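/- Let $k$ be a field and $A$ a finite dimensional Frobenius $k$-algebra, i.e. a finite dimensional associative unital $k$-algebra with an associative non-degenerate bilinear form $\langle\ ,\ \rangle$ ($\langle ab,c\rangle=\langle a,bc\rangle$). Let $(u_i),(v_i)$ be dual bases, $\langle v_i,u_j\rangle=\delta_{ij}$, and let $\nu$ be the Nakayama automorphism, $\langle a,b\rangle=\langle b,\nu(a)\rangle$. Put $\overline A=A/k1$, let $\overline a\in\overline A$ be the class of $a\in A$, and for $r,p\ge 0$ put $C^r=\mathrm{Hom}_k(\overline A^{\otimes r},A)$ and $C_p=A\otimes\overline A^{\otimes p}$. The complete complex $(\mathcal D^\bullet,\widehat d)$ has $\mathcal D^r=C^r$ for $r\ge 0$ and $\mathcal D^r=C_{-r-1}$ for $r\le -1$. Its differential $\widehat d^{\,r}:\mathcal D^r\to\mathcal D^{r+1}$ is, for $r\ge 0$, $$\delta(f)(\overline a_1\otimes\cdots\otimes\overline a_{r+1})=a_1f(\overline a_2\otimes\cdots)+\sum_{i=1}^{r}(-1)^if(\cdots\otimes\overline{a_ia_{i+1}}\otimes\cdots)+(-1)^{r+1}f(\overline a_1\otimes\cdots\otimes\overline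 a_r)a_{r+1},$$ for $r=-1$ the map $m\mapsto\sum_iu_imv_i$, and for $r=-p-2\le -2$ the map $C_{p+1}\to C_p$, $$\partial(m\otimes\overline a_1\otimes\cdots\otimes\overline a_{p+1})=m\,\nu^{-1}(a_1)\otimes\overline a_2\otimes\cdots+\sum_{i=1}^{p}(-1)^im\otimes\cdots\otimes\overline{a_ia_{i+1}}\otimes\cdots+(-1)^{p+1}a_{p+1}m\otimes\overline a_1\otimes\cdots\otimes\overline a_p .$$ Write $\widehat{\mathrm{HH}}^\bullet(A)$ for its cohomology. The product $\star:\mathcal D^r\otimes\mathcal D^s\to\mathcal D^{r+s}$ is given, for $f\in C^m$, $g\in C^n$, $\alpha=a_0\otimes\overline a_1\otimes\cdots\otimes\overline a_p\in C_p$ and $\beta=b_0\otimes\overline b_1\otimes\cdots\otimes\overline b_q\in C_q$ (with $\overline x_{i,j}=\overline x_i\otimes\cdots\otimes\overline x_j$), by * $(f\star g)(\overline b_{1,m+n})=f(\overline b_{1,m})\,g(\overline b_{m+1,m+n})$; * if $m\le p$: $\ \alpha\star f=a_0\,\nu^{-1}(f(\overline a_{1,m}))\otimes\overline a_{m+1,p}$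 and $f\star\alpha=f(\overline a_{p-m+1,p})\,a_0\otimes\overline a_{1,p-m}$; * if $m>p$ and $n=m-p-1$: $\ (f\star\alpha)(\overline b_{1,n})=\sum_if(\overline b_{1,n}\otimes\overline{u_i\nu(a_0)}\otimes\overline a_{1,p})\,v_i$ and $(\alpha\star f)(\overline b_{1,n})=\sum_iu_i\nu(a_0)\,f(\overline a_{1,p}\otimes\overline v_i\otimes\overline b_{1,n})$; * $\alpha\star\beta=\sum_iv_ib_0\otimes\overline b_{1,q}\otimes\overline{u_i\nu(a_0)}\otimes\overline a_{1,p}$. For $c\in k$ let $A_c=\mathrm{Ker}(\nu-c\,\mathrm{id})$, and let $\overline A_c$ be its image in $\overline A$. Let $\mathcal D^\bullet_{(1)}\subseteq\mathcal D^\bullet$ be the subcomplex with $$\mathcal D^r_{(1)}=\{f\in C^r: f(\overline A_{c_1}\otimes\cdots\otimes\overline A_{c_r})\subseteq A_{c_1\cdots c_r}\text{ for all }c_1,\dots,c_r\in k\}\quad(r\ge 0),$$ $$\mathcal D^{-p-1}_{(1)}=\sum_{c_0c_1\cdots c_p=1}A_{c_0}\otimes\overline A_{c_1}\otimes\cdots\otimes\overline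 A_{c_p}\quad(p\ge 0),$$ and let $\widehat{\mathrm{HH}}_{(1)}^\bullet(A)$ be its cohomology. 1. If $\star$ restricts to a product $\star_1:\mathcal D^\bullet_{(1)}\otimes\mathcal D^\bullet_{(1)}\to\mathcal D^\bullet_{(1)}$ (so that $\star_1$ is defined), then $\star_1$ induces a product on $\widehat{\mathrm{HH}}_{(1)}^\bullet(A)$ which makes it a $\mathbb Z$-graded, associative, graded commutative $k$-algebra ($xy=(-1)^{|x||y|}yx$) whose unit is the class of $1\in A=C^0$. 2. If $\nu$ is diagonalizable over $k$, then $\star$ does restrict to such a product $\star_1$; likewise $\star$ induces a product on $\widehat{\mathrm{HH}}^\bullet(A)$ which makes it a graded commutative algebra with unit the class of $1$, and $(\widehat{\mathrm{HH}}_{(1)}^\bullet(A),\star_1)\cong(\widehat{\mathrm{HH}}^\bullet(A),\star)$ as graded algebras. -/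

import Mathlib

open scoped TensorProduct

namespace FrobTate

/-- A Frobenius form on a `k`-algebra `A`: an associative non-degenerate bilinear form. -/
structure FrobeniusForm (k : Type*) (A : Type*) [Field k] [Ring A] [Algebra k A] where
  form : LinearMap.BilinForm k A
  assoc : ∀ a b c : A, form (a * b) c = form a (b * c)
  nondegenerate : form.Nondegenerate

section Nakayama

variable {k : Type*} {A : Type*} [Field k] [Ring A] [Algebra k A]

theorem FrobeniusForm.ext_right (F : FrobeniusForm k A) {x y : A} (h : ∀ b, F.form b x = F.form b y) : x = y := by
  rw [← sub_eq_zero]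
  exact F.nondegenerate.2 _ fun b => by rw [map_sub, h b, sub_self]

variable [FiniteDimensional k A] (F : FrobeniusForm k A)

/-- The linear map underlying the Nakayama automorphism. -/
noncomputable def FrobeniusForm.nakayamaLin : A ≃ₗ[k] A :=
  (F.form.toDual F.nondegenerate).trans
    (F.form.flip.toDual F.nondegenerate.flip).symm

theorem FrobeniusForm.form_nakayamaLin (a b : A) :
    F.form b (F.nakayamaLin a) = F.form a b :=
  LinearMap.BilinForm.apply_toDual_symm_apply (B := F.form.flip)
    (hB := F.nondegenerate.flip) (F.form.toDual F.nondegenerate a) b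

/-- The Nakayama automorphism `ν`, characterised by `⟨a, b⟩ = ⟨b, ν a⟩`. -/
noncomputable def FrobeniusForm.nakayama : A ≃ₐ[k] A :=
  AlgEquiv.ofLinearEquiv F.nakayamaLin
    (F.ext_right fun b => by
      rw [F.form_nakayamaLin, ← mul_one b, ← F.assoc, one_mul, mul_one])
    (fun x y => F.ext_right fun b => by
      rw [F.form_nakayamaLin, F.assoc, ← F.form_nakayamaLin x, F.assoc, ← F.form_nakayamaLin y,
        F.assoc])

theorem FrobeniusForm.form_nakayama (a b : A) : F.form a b = F.form b (F.nakayama a) :=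
  (F.form_nakayamaLin a b).symm

/-- The basis `u` of `A` in a pair of dual bases `u`, `v`. -/
noncomputable def FrobeniusForm.u (_ : FrobeniusForm k A) :
    Module.Basis (Fin (Module.finrank k A)) k A :=
  Module.finBasis k A

/-- The basis `v` of `A` in a pair of dual bases `u`, `v`: `⟨v i, u j⟩ = δ i j`. -/
noncomputable def FrobeniusForm.v : Module.Basis (Fin (Module.finrank k A)) k A :=
  F.form.dualBasis F.nondegenerate F.u

theorem FrobeniusForm.form_v_u (i j : Fin (Module.finrank k A)) :
    F.form (F.v i) (F.u j) = if j = i then 1 else 0 :=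
  LinearMap.BilinForm.apply_dualBasis_left F.nondegenerate F.u i j

/-- The Nakayama automorphism is diagonalizable over `k`: `A` is the sum of its eigenspaces. -/
def FrobeniusForm.NakayamaDiagonalizable : Prop :=
  ⨆ c : k, Module.End.eigenspace F.nakayama.toLinearMap c = ⊤

end Nakayama

/-! ### Tensor powers of `Ā = A / k·1` -/

section Bar

variable (k : Type*) (A : Type*) [Field k] [Ring A] [Algebra k A]

/-- `Ā`, the quotient of `A` by the subspace `k·1`. -/
abbrev Bar : Type _ := A ⧸ Submodule.span k {(1 : A)}

/-- The canonical epimorphism `A → Ā`, `a ↦ ā`. -/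
abbrev toBar : A →ₗ[k] Bar k A := (Submodule.span k {(1 : A)}).mkQ

/-- `Ā^{⊗ r}`. -/
abbrev BarPow (r : ℕ) : Type _ := ⨂[k] _ : Fin r, Bar k A

/-- `ā₁ ⊗ ⋯ ⊗ ā_r`. -/
abbrev barTensor {r : ℕ} (a : Fin r → A) : BarPow k A r :=
  PiTensorProduct.tprod k fun i => toBar k A (a i)

theorem exists_section : ∃ s : Bar k A →ₗ[k] A, (toBar k A).comp s = LinearMap.id :=
  LinearMap.exists_rightInverse_of_surjective _ (Submodule.range_mkQ _)

/-- A linear section of `A → Ā`. -/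
noncomputable def barSection : Bar k A →ₗ[k] A := (exists_section k A).choose

variable {k A}

theorem toBar_barSection (x : Bar k A) : toBar k A (barSection k A x) = x :=
  LinearMap.congr_fun (exists_section k A).choose_spec x

theorem exists_barSection_toBar (a : A) :
    ∃ c : k, barSection k A (toBar k A a) = a + c • 1 := by
  have h : barSection k A (toBar k A a) - a ∈ Submodule.span k {(1 : A)} := by
    have h0 : toBar k A (barSection k A (toBar k A a) - a) = 0 := by
      rw [map_sub, toBar_barSection, sub_self]
    exact (Submodule.Quotient.mk_eq_zero _).1 h0
  obtain ⟨c, hc⟩ := Submodule.mem_span_singleton.1 h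
  exact ⟨c, by rw [hc]; abel⟩

variable {M : Type*} [AddCommGroup M] [Module k M] {r : ℕ}

/-- A multilinear map on `A^r` that vanishes as soon as one of its arguments is `1`, as a linear
map on `Ā^{⊗ r}` (see `descend_barTensor`). -/
noncomputable def descend (G : MultilinearMap k (fun _ : Fin r => A) M) : BarPow k A r →ₗ[k] M :=
  PiTensorProduct.lift (G.compLinearMap fun _ => barSection k A)

theorem descend_barTensor (G : MultilinearMap k (fun _ : Fin r => A) M)
    (hG : ∀ a, (∃ j, a j = 1) → G a = 0) (a : Fin r → A) :
    descend G (barTensor k A a) = G a := by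
  rw [descend, PiTensorProduct.lift.tprod, MultilinearMap.compLinearMap_apply]
  choose c hc using fun i => exists_barSection_toBar (k := k) (a i)
  simp only [hc]
  suffices H : ∀ s : Finset (Fin r), G (fun i => if i ∈ s then a i + c i • 1 else a i) = G a by
    simpa using H Finset.univ
  intro s
  induction s using Finset.induction_on with
  | empty => simp
  | insert j s hj ih =>
    have e : (fun i => if i ∈ insert j s then a i + c i • (1 : A) else a i) =
        Function.update (fun i => if i ∈ s then a i + c i • (1 : A) else a i) j
          (a j + c j • 1) := by
      ext i
      by_cases h : i = j
      · subst h; simp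
      · simp [h]
    rw [e, MultilinearMap.map_update_add, MultilinearMap.map_update_smul,
      hG _ ⟨j, Function.update_self ..⟩, smul_zero, add_zero, ← ih]
    congr 1
    ext i
    by_cases h : i = j
    · subst h; simp [hj]
    · simp [h]

end Bar

/-! ### The alternating sums of the bar construction -/

section BarSum

variable {k : Type*} {A : Type*} [Field k] [Ring A] [Algebra k A]
variable {M : Type*} [AddCommGroup M] [Module k M] {M' : Type*} [AddCommMonoid M'] [Module k M']
  {r : ℕ}

theorem contractNth_update (i : Fin r) (a : Fin (r + 1) → A) (j : Fin (r + 1)) (x : A) :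
    Fin.contractNth i.castSucc (· * ·) (Function.update a j x) =
      Function.update (Fin.contractNth i.castSucc (· * ·) a) (i.predAbove j)
        (if j = i.castSucc then x * a i.succ else if j = i.succ then a i.castSucc * x else x) := by
  have hp : ((i.predAbove j : Fin r) : ℕ) = if (i : ℕ) < j then (j : ℕ) - 1 else j := by
    unfold Fin.predAbove
    split_ifs with h1 h2 h2
    · simp
    · exact absurd h1 h2
    · exact absurd h2 h1
    · simp
  ext l
  simp only [Fin.contractNth, Function.update_apply, Fin.ext_iff, hp, Fin.val_castSucc,
    Fin.val_succ]
  have hl : ∀ m : Fin r, (m : ℕ) = l → m = l := fun m h => Fin.ext h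
  have hi := hl i
  split_ifs <;> first | rfl | omega | (obtain rfl := hi (by omega); rfl)

/-- `(a₁, …, a_{r+1}) ↦ G(a₁, …, a_i a_{i+1}, …, a_{r+1})`. -/
noncomputable def contract (G : MultilinearMap k (fun _ : Fin r => A) M') (i : Fin r) :
    MultilinearMap k (fun _ : Fin (r + 1) => A) M' :=
  MultilinearMap.mk' (fun a => G (Fin.contractNth i.castSucc (· * ·) a))
    (fun a j x y => by
      simp only [contractNth_update]
      split_ifs <;> simp [add_mul, mul_add])
    (fun a j c x => by
      simp only [contractNth_update]
      split_ifs <;> simp)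

/-- `(a₁, …, a_{r+1}) ↦ L(a₁, G(a₂, …, a_{r+1}))`. -/
noncomputable def headTerm (L : A →ₗ[k] M' →ₗ[k] M) (G : MultilinearMap k (fun _ : Fin r => A) M') :
    MultilinearMap k (fun _ : Fin (r + 1) => A) M :=
  MultilinearMap.mk' (fun a => L (a 0) (G fun i => a i.succ))
    (fun a j x y => by
      refine Fin.cases ?_ (fun j => ?_) j
      · simp [Fin.succ_ne_zero]
      · have h : ∀ z : A, (fun i : Fin r => Function.update a j.succ z i.succ) =
            Function.update (fun i => a i.succ) j z := fun z => Fin.tail_update_succ (q := a) j z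
        simp [h, (Fin.succ_ne_zero j).symm])
    (fun a j c x => by
      refine Fin.cases ?_ (fun j => ?_) j
      · simp [Fin.succ_ne_zero]
      · have h : ∀ z : A, (fun i : Fin r => Function.update a j.succ z i.succ) =
            Function.update (fun i => a i.succ) j z := fun z => Fin.tail_update_succ (q := a) j z
        simp [h, (Fin.succ_ne_zero j).symm])

/-- `(a₁, …, a_{r+1}) ↦ R(a_{r+1}, G(a₁, …, a_r))`. -/
noncomputable def lastTerm (R : A →ₗ[k] M' →ₗ[k] M) (G : MultilinearMap k (fun _ : Fin r => A) M') :
    MultilinearMap k (fun _ : Fin (r + 1) => A) M :=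
  MultilinearMap.mk' (fun a => R (a (Fin.last r)) (G fun i => a i.castSucc))
    (fun a j x y => by
      refine Fin.lastCases ?_ (fun j => ?_) j
      · simp [Fin.castSucc_ne_last]
      · have h : ∀ z : A, (fun i : Fin r => Function.update a j.castSucc z i.castSucc) =
            Function.update (fun i => a i.castSucc) j z :=
          fun z => Fin.init_update_castSucc (q := a) j z
        simp [h, (Fin.castSucc_ne_last j).symm])
    (fun a j c x => by
      refine Fin.lastCases ?_ (fun j => ?_) j
      · simp [Fin.castSucc_ne_last]
      · have h : ∀ z : A, (fun i : Fin r => Function.update a j.castSucc z i.castSucc) =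
            Function.update (fun i => a i.castSucc) j z :=
          fun z => Fin.init_update_castSucc (q := a) j z
        simp [h, (Fin.castSucc_ne_last j).symm])

/-- The alternating sum
`L(a₁, G(a₂, …, a_{r+1})) + ∑ᵢ (-1)^i L(1, G(a₁, …, a_i a_{i+1}, …, a_{r+1}))
  + (-1)^{r+1} R(a_{r+1}, G(a₁, …, a_r))`, `1 ≤ i ≤ r` (in the code `i` is counted from `0`). -/
noncomputable def barSum (L R : A →ₗ[k] M' →ₗ[k] M)
    (G : MultilinearMap k (fun _ : Fin r => A) M') :
    MultilinearMap k (fun _ : Fin (r + 1) => A) M :=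
  headTerm L G
    + ∑ i : Fin r, (-1 : k) ^ ((i : ℕ) + 1) • (L 1).compMultilinearMap (contract G i)
    + (-1 : k) ^ (r + 1) • lastTerm R G

theorem barSum_apply (L R : A →ₗ[k] M' →ₗ[k] M)
    (G : MultilinearMap k (fun _ : Fin r => A) M') (a : Fin (r + 1) → A) :
    barSum L R G a = L (a 0) (G fun i => a i.succ)
      + ∑ i : Fin r, (-1 : k) ^ ((i : ℕ) + 1) • L 1 (G (Fin.contractNth i.castSucc (· * ·) a))
      + (-1 : k) ^ (r + 1) • R (a (Fin.last r)) (G fun i => a i.castSucc) := by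
  simp [barSum, headTerm, lastTerm, contract]

theorem barSum_eq_zero (L R : A →ₗ[k] M' →ₗ[k] M) (hLR : L 1 = R 1)
    (G : MultilinearMap k (fun _ : Fin r => A) M') (hG : ∀ a, (∃ j, a j = 1) → G a = 0)
    (a : Fin (r + 1) → A) (ha : ∃ j, a j = 1) : barSum L R G a = 0 := by
  obtain ⟨j, hj⟩ := ha
  rw [barSum_apply]
  set X : M := L 1 (G fun i => a (j.succAbove i)) with hX
  have h1 : L (a 0) (G fun i => a i.succ) = if (j : ℕ) = 0 then X else 0 := by
    split_ifs with h
    · have : j = 0 := Fin.ext h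
      subst this
      rw [hX, hj]
      simp
    · rw [hG _ ⟨j.pred (by rintro rfl; exact h rfl), by simpa using hj⟩, map_zero]
  have h2 : R (a (Fin.last r)) (G fun i => a i.castSucc) = if (j : ℕ) = r then X else 0 := by
    split_ifs with h
    · have : j = Fin.last r := Fin.ext h
      subst this
      rw [hX, hj, ← hLR]
      simp
    · rw [hG _ ⟨j.castPred (by rintro rfl; exact h rfl), by simpa using hj⟩, map_zero]
  have h3 : ∀ i : Fin r, L 1 (G (Fin.contractNth i.castSucc (· * ·) a)) =
      (if (i : ℕ) = j then X else 0) + (if (i : ℕ) + 1 = j then X else 0) := by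
    intro i
    by_cases c1 : (i : ℕ) = j
    · have : Fin.contractNth i.castSucc (· * ·) a = fun l => a (j.succAbove l) := by
        have : j = i.castSucc := Fin.ext c1.symm
        subst this
        ext l
        by_cases hl : (l : ℕ) = i
        · have : l = i := Fin.ext hl
          subst this
          rw [Fin.contractNth_apply_of_eq _ _ _ _ (by simp), hj, one_mul,
            Fin.succAbove_castSucc_self]
        · rw [Fin.contractNth_apply_of_ne _ _ _ _ (by simpa using Ne.symm hl)]
      rw [this, if_pos c1, if_neg (by omega), add_zero]
    · by_cases c2 : (i : ℕ) + 1 = j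
      · have : Fin.contractNth i.castSucc (· * ·) a = fun l => a (j.succAbove l) := by
          have : j = i.succ := Fin.ext c2.symm
          subst this
          ext l
          rcases lt_trichotomy (l : ℕ) i with hl | hl | hl
          · rw [Fin.contractNth_apply_of_lt _ _ _ _ (by simpa using hl),
              Fin.succAbove_of_castSucc_lt _ _ (by simp [Fin.lt_def]; omega)]
          · have : l = i := Fin.ext hl
            subst this
            rw [Fin.contractNth_apply_of_eq _ _ _ _ (by simp), hj, mul_one,
              Fin.succAbove_succ_self]
          · rw [Fin.contractNth_apply_of_gt _ _ _ _ (by simpa using hl),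
              Fin.succAbove_of_le_castSucc _ _ (by simp [Fin.le_def]; omega)]
        rw [this, if_neg c1, if_pos c2, zero_add]
      · rw [if_neg c1, if_neg c2, add_zero]
        have e := contractNth_update i a j 1
        rw [if_neg (fun h => c1 (by simp [h])), if_neg (fun h => c2 (by simp [h])),
          ← hj, Function.update_eq_self] at e
        rw [e, hG _ ⟨i.predAbove j, by rw [Function.update_self, hj]⟩, map_zero]
  simp only [h1, h2, h3, smul_add, Finset.sum_add_distrib, smul_ite, smul_zero]
  have hjr : (j : ℕ) < r + 1 := j.2
  have s1 : (∑ i : Fin r, if (i : ℕ) = j then (-1 : k) ^ ((i : ℕ) + 1) • X else 0) =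
      if (j : ℕ) = r then 0 else (-1 : k) ^ ((j : ℕ) + 1) • X := by
    split_ifs with h
    · exact Finset.sum_eq_zero fun i _ => if_neg (by have := i.2; omega)
    · rw [Finset.sum_eq_single (⟨j, by omega⟩ : Fin r)]
      · simp
      · intro b _ hb
        exact if_neg fun h => hb (Fin.ext h)
      · simp
  have s2 : (∑ i : Fin r, if (i : ℕ) + 1 = j then (-1 : k) ^ ((i : ℕ) + 1) • X else 0) =
      if (j : ℕ) = 0 then 0 else (-1 : k) ^ (j : ℕ) • X := by
    split_ifs with h
    · exact Finset.sum_eq_zero fun i _ => if_neg (by omega)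
    · rw [Finset.sum_eq_single (⟨(j : ℕ) - 1, by omega⟩ : Fin r)]
      · have : (j : ℕ) - 1 + 1 = j := by omega
        simp [this]
      · intro b _ hb
        exact if_neg fun h => hb (Fin.ext (by simp; omega))
      · simp
  rw [s1, s2]
  split_ifs with c1 c2 c2
  · simp [c1, ← c2]
  · simp [c1]
  · rw [c2, pow_succ]; simp
  · rw [pow_succ]; simp

end BarSum

/-! ### Hochschild cochains and chains -/

section Complex

variable (k : Type*) (A : Type*) [Field k] [Ring A] [Algebra k A]

/-- Normalized Hochschild cochains `C^r(A, A) = Hom_k(Ā^{⊗ r}, A)`. -/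
abbrev Cochain (r : ℕ) : Type _ := BarPow k A r →ₗ[k] A

/-- The space `C_p(A, A_σ) = A ⊗ Ā^{⊗ p}` of normalized Hochschild chains. -/
abbrev Chain (p : ℕ) : Type _ := A ⊗[k] BarPow k A p

variable {k A}

theorem barPow_hom_ext {M : Type*} [AddCommGroup M] [Module k M] {r : ℕ}
    {f g : BarPow k A r →ₗ[k] M} (h : ∀ a : Fin r → A, f (barTensor k A a) = g (barTensor k A a)) :
    f = g := by
  refine PiTensorProduct.ext (MultilinearMap.ext fun x => ?_)
  have := h fun i => barSection k A (x i)
  simp only [barTensor, toBar_barSection] at this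
  exact this

/-- `(a₁, …, a_r) ↦ ā₁ ⊗ ⋯ ⊗ ā_r` as a multilinear map on `A^r`. -/
noncomputable def barTensorMulti (r : ℕ) :
    MultilinearMap k (fun _ : Fin r => A) (BarPow k A r) :=
  (PiTensorProduct.tprod k).compLinearMap fun _ => toBar k A

theorem barTensorMulti_apply {r : ℕ} (a : Fin r → A) :
    barTensorMulti r a = barTensor k A a := rfl

theorem barTensorMulti_eq_zero {r : ℕ} (a : Fin r → A) (h : ∃ j, a j = 1) :
    barTensorMulti (k := k) r a = 0 := by
  obtain ⟨j, hj⟩ := h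
  refine (PiTensorProduct.tprod k).map_coord_zero j ?_
  change toBar k A (a j) = 0
  rw [hj]
  exact (Submodule.Quotient.mk_eq_zero _).2 (Submodule.mem_span_singleton_self _)

/-- The linear map on `Ā^{⊗ (r+1)}` given by the alternating sum
`L(a₁, a₂ ⊗ ⋯ ⊗ a_{r+1}) + ∑ᵢ (-1)^i L(1, a₁ ⊗ ⋯ ⊗ a_i a_{i+1} ⊗ ⋯ ⊗ a_{r+1})
  + (-1)^{r+1} R(a_{r+1}, a₁ ⊗ ⋯ ⊗ a_r)`; see `barMap_apply`. -/
noncomputable def barMap {M : Type*} [AddCommGroup M] [Module k M] (r : ℕ)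
    (L R : A →ₗ[k] BarPow k A r →ₗ[k] M) : BarPow k A (r + 1) →ₗ[k] M :=
  descend (barSum L R (barTensorMulti r))

theorem barMap_apply {M : Type*} [AddCommGroup M] [Module k M] {r : ℕ}
    {L R : A →ₗ[k] BarPow k A r →ₗ[k] M} (hLR : L 1 = R 1) (a : Fin (r + 1) → A) :
    barMap r L R (barTensor k A a) =
      L (a 0) (barTensor k A fun i => a i.succ)
      + ∑ i : Fin r, (-1 : k) ^ ((i : ℕ) + 1) •
          L 1 (barTensor k A (Fin.contractNth i.castSucc (· * ·) a))
      + (-1 : k) ^ (r + 1) • R (a (Fin.last r)) (barTensor k A fun i => a i.castSucc) := by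
  rw [barMap, descend_barTensor _
    (barSum_eq_zero L R hLR (barTensorMulti r) barTensorMulti_eq_zero), barSum_apply]
  rfl

/-- `δ^r : C^r(A, A) → C^{r+1}(A, A)`. -/
noncomputable def delta (r : ℕ) : Cochain k A r →ₗ[k] Cochain k A (r + 1) where
  toFun f := barMap r ((LinearMap.mul k A).compl₂ f) ((LinearMap.mul k A).flip.compl₂ f)
  map_add' f g := barPow_hom_ext fun a => by
    rw [LinearMap.add_apply, barMap_apply (by ext; simp), barMap_apply (by ext; simp),
      barMap_apply (by ext; simp)]
    simp only [LinearMap.compl₂_apply, LinearMap.add_apply, map_add, smul_add,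
      Finset.sum_add_distrib]
    abel
  map_smul' c f := barPow_hom_ext fun a => by
    rw [RingHom.id_apply, LinearMap.smul_apply, barMap_apply (by ext; simp),
      barMap_apply (by ext; simp)]
    simp only [LinearMap.compl₂_apply, LinearMap.smul_apply, map_smul, smul_add,
      Finset.smul_sum, smul_comm c]

/-- `δ(f)(ā₁ ⊗ ⋯ ⊗ ā_{r+1}) = a₁ f(ā₂ ⊗ ⋯) + ∑ᵢ (-1)^i f(⋯ ⊗ (a_i a_{i+1})¯ ⊗ ⋯)
  + (-1)^{r+1} f(ā₁ ⊗ ⋯ ⊗ ā_r) a_{r+1}`. -/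
theorem delta_apply {r : ℕ} (f : Cochain k A r) (a : Fin (r + 1) → A) :
    delta r f (barTensor k A a) =
      a 0 * f (barTensor k A fun i => a i.succ)
      + ∑ i : Fin r, (-1 : k) ^ ((i : ℕ) + 1) •
          f (barTensor k A (Fin.contractNth i.castSucc (· * ·) a))
      + (-1 : k) ^ (r + 1) • (f (barTensor k A fun i => a i.castSucc) * a (Fin.last r)) := by
  refine (barMap_apply (by ext; simp) a).trans ?_
  simp

/-- `∂_{p+1} : C_{p+1}(A, A_σ) → C_p(A, A_σ)`. -/
noncomputable def partialMap (σ : A ≃ₐ[k] A) (p : ℕ) : Chain k A (p + 1) →ₗ[k] Chain k A p :=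
  TensorProduct.lift
    { toFun := fun m => barMap p
        ((TensorProduct.mk k A (BarPow k A p)).comp
          ((LinearMap.mulLeft k m).comp σ.toLinearMap))
        ((TensorProduct.mk k A (BarPow k A p)).comp (LinearMap.mulRight k m))
      map_add' := fun m n => barPow_hom_ext fun a => by
        rw [LinearMap.add_apply, barMap_apply (by ext; simp), barMap_apply (by ext; simp),
          barMap_apply (by ext; simp)]
        simp only [LinearMap.comp_apply, LinearMap.mulLeft_apply, LinearMap.mulRight_apply,
          TensorProduct.mk_apply, add_mul, mul_add, TensorProduct.add_tmul, smul_add,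
          Finset.sum_add_distrib]
        abel
      map_smul' := fun c m => barPow_hom_ext fun a => by
        rw [RingHom.id_apply, LinearMap.smul_apply, barMap_apply (by ext; simp),
          barMap_apply (by ext; simp)]
        simp only [LinearMap.comp_apply, LinearMap.mulLeft_apply, LinearMap.mulRight_apply,
          TensorProduct.mk_apply, smul_mul_assoc, mul_smul_comm, TensorProduct.smul_tmul', smul_add,
          Finset.smul_sum, smul_comm c] }

/-- `∂(m ⊗ ā₁ ⊗ ⋯ ⊗ ā_{p+1}) = m σ(a₁) ⊗ ā₂ ⊗ ⋯ + ∑ᵢ (-1)^i m ⊗ ⋯ ⊗ (a_i a_{i+1})¯ ⊗ ⋯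
  + (-1)^{p+1} a_{p+1} m ⊗ ā₁ ⊗ ⋯ ⊗ ā_p`. -/
theorem partialMap_apply (σ : A ≃ₐ[k] A) {p : ℕ} (m : A) (a : Fin (p + 1) → A) :
    partialMap σ p (m ⊗ₜ barTensor k A a) =
      (m * σ (a 0)) ⊗ₜ barTensor k A (fun i => a i.succ)
      + ∑ i : Fin p, (-1 : k) ^ ((i : ℕ) + 1) •
          m ⊗ₜ[k] barTensor k A (Fin.contractNth i.castSucc (· * ·) a)
      + (-1 : k) ^ (p + 1) •
          (a (Fin.last p) * m) ⊗ₜ[k] barTensor k A (fun i => a i.castSucc) := by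
  have h := barMap_apply (k := k)
    (L := (TensorProduct.mk k A (BarPow k A p)).comp ((LinearMap.mulLeft k m).comp σ.toLinearMap))
    (R := (TensorProduct.mk k A (BarPow k A p)).comp (LinearMap.mulRight k m)) (by ext; simp) a
  refine h.trans ?_
  simp

variable (k A) in
/-- The identification `C_0(A, A_σ) = A`. -/
noncomputable def chainZero : Chain k A 0 ≃ₗ[k] A :=
  (TensorProduct.congr (LinearEquiv.refl k A) (PiTensorProduct.isEmptyEquiv (Fin 0))).trans
    (TensorProduct.rid k A)

variable (k A) in
/-- The identification `A = C^0(A, A)`. -/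
noncomputable def cochainZero : A →ₗ[k] Cochain k A 0 :=
  (LinearMap.lcomp k A (PiTensorProduct.isEmptyEquiv (Fin 0)).toLinearMap).comp
    (LinearMap.ringLmapEquivSelf k k A).symm.toLinearMap

theorem chainZero_apply (m : A) (a : Fin 0 → A) :
    chainZero k A (m ⊗ₜ barTensor k A a) = m := by
  simp [chainZero, barTensor]

theorem cochainZero_apply (x : A) (a : Fin 0 → A) :
    cochainZero k A x (barTensor k A a) = x := by
  simp [cochainZero, barTensor]

end Complex

section Frobenius

variable {k : Type*} {A : Type*} [Field k] [Ring A] [Algebra k A] [FiniteDimensional k A]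
  (F : FrobeniusForm k A)

/-- `μ : C_0(A, A_{ν⁻¹}) → C^0(A, A)`, `μ(m) = ∑ᵢ uᵢ m vᵢ`. -/
noncomputable def FrobeniusForm.normMap : Chain k A 0 →ₗ[k] Cochain k A 0 :=
  (cochainZero k A).comp
    ((∑ i, (LinearMap.mulLeft k (F.u i)).comp (LinearMap.mulRight k (F.v i))).comp
      (chainZero k A).toLinearMap)

theorem FrobeniusForm.normMap_apply (m : A) (a b : Fin 0 → A) :
    F.normMap (m ⊗ₜ barTensor k A a) (barTensor k A b) = ∑ i, F.u i * m * F.v i := by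
  simp only [FrobeniusForm.normMap, LinearMap.comp_apply, LinearEquiv.coe_coe, chainZero_apply,
    cochainZero_apply, LinearMap.sum_apply, LinearMap.mulLeft_apply, LinearMap.mulRight_apply,
    mul_assoc]

end Frobenius

/-! ### The `⋆`-product -/

section Star

variable (k : Type*) (A : Type*) [Field k] [Ring A] [Algebra k A]

/-- Concatenation `Ā^{⊗ m} ⊗ Ā^{⊗ n} ≃ Ā^{⊗ t}`, `m + n = t`. -/
noncomputable def concat {m n t : ℕ} (h : m + n = t) :
    BarPow k A m ⊗[k] BarPow k A n ≃ₗ[k] BarPow k A t :=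
  TensorPower.mulEquiv.trans (TensorPower.cast k (Bar k A) h)

theorem concat_tprod {m n t : ℕ} (h : m + n = t) (a : Fin m → A) (b : Fin n → A) :
    concat k A h (barTensor k A a ⊗ₜ barTensor k A b) =
      barTensor k A (fun i => Fin.append a b (Fin.cast h.symm i)) := by
  subst h
  have := TensorPower.tprod_mul_tprod k (fun i => toBar k A (a i)) (fun i => toBar k A (b i))
  rw [TensorPower.gMul_def] at this
  simp only [concat, LinearEquiv.trans_apply, this, TensorPower.cast_refl, LinearEquiv.refl_apply,
    barTensor, Fin.cast_eq_self]
  congr 1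
  ext i
  refine Fin.addCases (fun i => ?_) (fun i => ?_) i <;> simp

/-- Splitting `Ā^{⊗ t} → Ā^{⊗ m} ⊗ Ā^{⊗ n}`, `m + n = t`:
`a₁ ⊗ ⋯ ⊗ a_t ↦ (a₁ ⊗ ⋯ ⊗ a_m) ⊗ (a_{m+1} ⊗ ⋯ ⊗ a_t)`. -/
noncomputable def split {m n t : ℕ} (h : m + n = t) :
    BarPow k A t →ₗ[k] BarPow k A m ⊗[k] BarPow k A n :=
  (concat k A h).symm.toLinearMap

/-- `w, a₁ ⊗ ⋯ ⊗ a_p ↦ w ⊗ a₁ ⊗ ⋯ ⊗ a_p`. -/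
noncomputable def consBar (p : ℕ) : Bar k A →ₗ[k] BarPow k A p →ₗ[k] BarPow k A (p + 1) :=
  LinearMap.comp (TensorProduct.curry (concat k A (add_comm 1 p)).toLinearMap)
    (PiTensorProduct.subsingletonEquiv (R := k) (s := fun _ : Fin 1 => Bar k A) 0).symm.toLinearMap

theorem consBar_tprod {p : ℕ} (w : A) (a : Fin p → A) :
    consBar k A p (toBar k A w) (barTensor k A a) =
      barTensor k A (Fin.cons w a : Fin (p + 1) → A) := by
  have := concat_tprod k A (add_comm 1 p) (fun _ => w) a
  simp only [consBar, LinearMap.comp_apply, LinearEquiv.coe_coe,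
    PiTensorProduct.subsingletonEquiv_symm_apply', TensorProduct.curry_apply]
  refine this.trans ?_
  congr 1
  ext i
  rw [Fin.append_left_eq_cons]
  simp

variable {k A}

theorem split_tprod {m n t : ℕ} (h : m + n = t) (a : Fin m → A) (b : Fin n → A) :
    split k A h (barTensor k A (fun i => Fin.append a b (Fin.cast h.symm i))) =
      barTensor k A a ⊗ₜ barTensor k A b := by
  rw [← concat_tprod k A h]
  exact (concat k A h).symm_apply_apply _

/-- `f ⋆ g` for two cochains: the cup product
`(f ⌣ g)(b₁, …, b_{m+n}) = f(b₁, …, b_m) g(b_{m+1}, …, b_{m+n})`. -/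
noncomputable def cup {m n t : ℕ} (h : m + n = t) :
    Cochain k A m →ₗ[k] Cochain k A n →ₗ[k] Cochain k A t :=
  LinearMap.mk₂ k (fun f g => LinearMap.mul' k A ∘ₗ TensorProduct.map f g ∘ₗ split k A h)
    (fun f f' g => by simp [TensorProduct.map_add_left, LinearMap.comp_add, LinearMap.add_comp])
    (fun c f g => by simp [TensorProduct.map_smul_left, LinearMap.comp_smul, LinearMap.smul_comp])
    (fun f g g' => by simp [TensorProduct.map_add_right, LinearMap.comp_add, LinearMap.add_comp])
    (fun c f g => by simp [TensorProduct.map_smul_right, LinearMap.comp_smul, LinearMap.smul_comp])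

theorem cup_apply {m n t : ℕ} (h : m + n = t) (f : Cochain k A m) (g : Cochain k A n)
    (a : Fin m → A) (b : Fin n → A) :
    cup h f g (barTensor k A (fun i => Fin.append a b (Fin.cast h.symm i))) =
      f (barTensor k A a) * g (barTensor k A b) := by
  simp only [cup, LinearMap.mk₂_apply, LinearMap.comp_apply, split_tprod,
    TensorProduct.map_tmul, LinearMap.mul'_apply]

/-- `α ⋆ f`, `m ≤ p`, `q = p - m`: the cap product
`a₀ ⊗ a₁ ⊗ ⋯ ⊗ a_p ↦ a₀ ν⁻¹(f(a₁, …, a_m)) ⊗ a_{m+1} ⊗ ⋯ ⊗ a_p`. Here `σ = ν⁻¹`. -/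
noncomputable def capRight (σ : A ≃ₐ[k] A) {m q p : ℕ} (h : m + q = p) :
    Chain k A p →ₗ[k] Cochain k A m →ₗ[k] Chain k A q :=
  LinearMap.flip
    { toFun := fun f => TensorProduct.lift <| LinearMap.mk₂ k
        (fun a₀ x => TensorProduct.map (LinearMap.mul k A a₀ ∘ₗ σ.toLinearMap ∘ₗ f) LinearMap.id
          (split k A h x))
        (fun a₀ a₀' x => by
          simp [TensorProduct.map_add_left, LinearMap.add_comp])
        (fun c a₀ x => by
          simp [TensorProduct.map_smul_left, LinearMap.smul_comp])
        (fun a₀ x x' => by simp)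
        (fun c a₀ x => by simp)
      map_add' := fun f g => TensorProduct.ext' fun a₀ x => by
        simp [TensorProduct.map_add_left, LinearMap.comp_add]
      map_smul' := fun c f => TensorProduct.ext' fun a₀ x => by
        simp [TensorProduct.map_smul_left, LinearMap.comp_smul] }

theorem capRight_apply (σ : A ≃ₐ[k] A) {m q p : ℕ} (h : m + q = p) (f : Cochain k A m) (a₀ : A)
    (a : Fin m → A) (b : Fin q → A) :
    capRight σ h (a₀ ⊗ₜ barTensor k A (fun i => Fin.append a b (Fin.cast h.symm i))) f =
      (a₀ * σ (f (barTensor k A a))) ⊗ₜ barTensor k A b := by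
  simp only [capRight, LinearMap.flip_apply, LinearMap.coe_mk, AddHom.coe_mk,
    TensorProduct.lift.tmul, LinearMap.mk₂_apply, split_tprod, TensorProduct.map_tmul]
  rfl

/-- `f ⋆ α`, `m ≤ p`, `q = p - m`:
`a₀ ⊗ a₁ ⊗ ⋯ ⊗ a_p ↦ f(a_{p-m+1}, …, a_p) a₀ ⊗ a₁ ⊗ ⋯ ⊗ a_{p-m}`. -/
noncomputable def capLeft {m q p : ℕ} (h : q + m = p) :
    Cochain k A m →ₗ[k] Chain k A p →ₗ[k] Chain k A q where
  toFun f := TensorProduct.lift <| LinearMap.mk₂ k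
    (fun a₀ x => TensorProduct.comm k _ _
      (TensorProduct.map LinearMap.id ((LinearMap.mul k A).flip a₀ ∘ₗ f) (split k A h x)))
    (fun a₀ a₀' x => by simp [TensorProduct.map_add_right, LinearMap.add_comp])
    (fun c a₀ x => by simp [TensorProduct.map_smul_right, LinearMap.smul_comp])
    (fun a₀ x x' => by simp)
    (fun c a₀ x => by simp)
  map_add' f g := TensorProduct.ext' fun a₀ x => by
    simp [TensorProduct.map_add_right, LinearMap.comp_add]
  map_smul' c f := TensorProduct.ext' fun a₀ x => by
    simp [TensorProduct.map_smul_right, LinearMap.comp_smul]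

theorem capLeft_apply {m q p : ℕ} (h : q + m = p) (f : Cochain k A m) (a₀ : A)
    (b : Fin q → A) (a : Fin m → A) :
    capLeft h f (a₀ ⊗ₜ barTensor k A (fun i => Fin.append b a (Fin.cast h.symm i))) =
      (f (barTensor k A a) * a₀) ⊗ₜ barTensor k A b := by
  simp only [capLeft, LinearMap.coe_mk, AddHom.coe_mk,
    TensorProduct.lift.tmul, LinearMap.mk₂_apply, split_tprod, TensorProduct.map_tmul,
    TensorProduct.comm_tmul]
  rfl

end Star

section StarFrobenius

variable {k : Type*} {A : Type*} [Field k] [Ring A] [Algebra k A] [FiniteDimensional k A]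
  (F : FrobeniusForm k A)

/-- `f ⋆ α`, `p < m`, `n = m - p - 1`:
`(f ⋆ α)(b₁, …, b_n) = ∑ᵢ f(b₁, …, b_n, uᵢ ν(a₀), a₁, …, a_p) vᵢ`. -/
noncomputable def FrobeniusForm.evalLeft {n p m : ℕ} (h : n + (p + 1) = m) :
    Cochain k A m →ₗ[k] Chain k A p →ₗ[k] Cochain k A n where
  toFun f := TensorProduct.lift <| LinearMap.mk₂ k
    (fun a₀ x => ∑ i, (LinearMap.mul k A).flip (F.v i) ∘ₗ f ∘ₗ (concat k A h).toLinearMap ∘ₗ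
      (TensorProduct.mk k _ _).flip (consBar k A p (toBar k A (F.u i * F.nakayama a₀)) x))
    (fun a₀ a₀' x => by simp [mul_add, LinearMap.comp_add, Finset.sum_add_distrib])
    (fun c a₀ x => by simp [LinearMap.comp_smul, Finset.smul_sum])
    (fun a₀ x x' => by simp [LinearMap.comp_add, Finset.sum_add_distrib])
    (fun c a₀ x => by simp [LinearMap.comp_smul, Finset.smul_sum])
  map_add' f g := TensorProduct.ext' fun a₀ x => by
    simp [LinearMap.comp_add, LinearMap.add_comp, Finset.sum_add_distrib]
  map_smul' c f := TensorProduct.ext' fun a₀ x => by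
    simp [LinearMap.comp_smul, LinearMap.smul_comp, Finset.smul_sum]

theorem FrobeniusForm.evalLeft_apply {n p m : ℕ} (h : n + (p + 1) = m) (f : Cochain k A m)
    (a₀ : A) (a : Fin p → A) (b : Fin n → A) :
    F.evalLeft h f (a₀ ⊗ₜ barTensor k A a) (barTensor k A b) =
      ∑ i, f (barTensor k A fun j => Fin.append b
        (Fin.cons (F.u i * F.nakayama a₀) a : Fin (p + 1) → A) (Fin.cast h.symm j)) * F.v i := by
  change (∑ i, (LinearMap.mul k A).flip (F.v i) ∘ₗ f ∘ₗ (concat k A h).toLinearMap ∘ₗ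
      (TensorProduct.mk k _ _).flip
        (consBar k A p (toBar k A (F.u i * F.nakayama a₀)) (barTensor k A a)))
      (barTensor k A b) = _
  simp only [LinearMap.sum_apply, LinearMap.comp_apply, LinearMap.flip_apply,
    consBar_tprod, TensorProduct.mk_apply, LinearEquiv.coe_coe, concat_tprod, LinearMap.mul_apply']

/-- `α ⋆ f`, `p < m`, `n = m - p - 1`:
`(α ⋆ f)(b₁, …, b_n) = ∑ᵢ uᵢ ν(a₀) f(a₁, …, a_p, vᵢ, b₁, …, b_n)`. -/
noncomputable def FrobeniusForm.evalRight {n p m : ℕ} (h : p + (n + 1) = m) :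
    Chain k A p →ₗ[k] Cochain k A m →ₗ[k] Cochain k A n :=
  LinearMap.flip
    { toFun := fun f => TensorProduct.lift <| LinearMap.mk₂ k
        (fun a₀ x => ∑ i, LinearMap.mul k A (F.u i * F.nakayama a₀) ∘ₗ f ∘ₗ
          (concat k A h).toLinearMap ∘ₗ
            TensorProduct.mk k _ _ x ∘ₗ consBar k A n (toBar k A (F.v i)))
        (fun a₀ a₀' x => by simp [mul_add, LinearMap.add_comp, Finset.sum_add_distrib])
        (fun c a₀ x => by simp [LinearMap.smul_comp, Finset.smul_sum])
        (fun a₀ x x' => by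
          simp [LinearMap.comp_add, LinearMap.add_comp, Finset.sum_add_distrib])
        (fun c a₀ x => by simp [LinearMap.comp_smul, LinearMap.smul_comp, Finset.smul_sum])
      map_add' := fun f g => TensorProduct.ext' fun a₀ x => by
        simp [LinearMap.comp_add, LinearMap.add_comp, Finset.sum_add_distrib]
      map_smul' := fun c f => TensorProduct.ext' fun a₀ x => by
        simp [LinearMap.comp_smul, LinearMap.smul_comp, Finset.smul_sum] }

theorem FrobeniusForm.evalRight_apply {n p m : ℕ} (h : p + (n + 1) = m) (f : Cochain k A m)
    (a₀ : A) (a : Fin p → A) (b : Fin n → A) :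
    F.evalRight h (a₀ ⊗ₜ barTensor k A a) f (barTensor k A b) =
      ∑ i, F.u i * F.nakayama a₀ * f (barTensor k A fun j => Fin.append a
        (Fin.cons (F.v i) b : Fin (n + 1) → A) (Fin.cast h.symm j)) := by
  change (∑ i, LinearMap.mul k A (F.u i * F.nakayama a₀) ∘ₗ f ∘ₗ
      (concat k A h).toLinearMap ∘ₗ TensorProduct.mk k _ _ (barTensor k A a) ∘ₗ
        consBar k A n (toBar k A (F.v i))) (barTensor k A b) = _
  simp only [LinearMap.sum_apply, LinearMap.comp_apply,
    consBar_tprod, TensorProduct.mk_apply, LinearEquiv.coe_coe, concat_tprod, LinearMap.mul_apply']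

/-- `α ⋆ β` for two chains `α = a₀ ⊗ a₁ ⊗ ⋯ ⊗ a_p`, `β = b₀ ⊗ b₁ ⊗ ⋯ ⊗ b_q`:
`∑ᵢ vᵢ b₀ ⊗ b₁ ⊗ ⋯ ⊗ b_q ⊗ uᵢ ν(a₀) ⊗ a₁ ⊗ ⋯ ⊗ a_p`. -/
noncomputable def FrobeniusForm.chainMul {p q t : ℕ} (h : q + (p + 1) = t) :
    Chain k A p →ₗ[k] Chain k A q →ₗ[k] Chain k A t :=
  TensorProduct.lift <| LinearMap.mk₂ k
    (fun a₀ x => ∑ i, TensorProduct.map (LinearMap.mul k A (F.v i))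
      ((concat k A h).toLinearMap ∘ₗ
        (TensorProduct.mk k _ _).flip (consBar k A p (toBar k A (F.u i * F.nakayama a₀)) x)))
    (fun a₀ a₀' x => by
      simp [mul_add, LinearMap.comp_add, TensorProduct.map_add_right, Finset.sum_add_distrib])
    (fun c a₀ x => by
      simp [LinearMap.comp_smul, TensorProduct.map_smul_right, Finset.smul_sum])
    (fun a₀ x x' => by
      simp [LinearMap.comp_add, TensorProduct.map_add_right, Finset.sum_add_distrib])
    (fun c a₀ x => by
      simp [LinearMap.comp_smul, TensorProduct.map_smul_right, Finset.smul_sum])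

theorem FrobeniusForm.chainMul_apply {p q t : ℕ} (h : q + (p + 1) = t)
    (a₀ b₀ : A) (a : Fin p → A) (b : Fin q → A) :
    F.chainMul h (a₀ ⊗ₜ barTensor k A a) (b₀ ⊗ₜ barTensor k A b) =
      ∑ i, (F.v i * b₀) ⊗ₜ (barTensor k A fun j => Fin.append b
        (Fin.cons (F.u i * F.nakayama a₀) a : Fin (p + 1) → A) (Fin.cast h.symm j)) := by
  change (∑ i, TensorProduct.map (LinearMap.mul k A (F.v i))
      ((concat k A h).toLinearMap ∘ₗ (TensorProduct.mk k _ _).flip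
        (consBar k A p (toBar k A (F.u i * F.nakayama a₀)) (barTensor k A a))))
      (b₀ ⊗ₜ barTensor k A b) = _
  simp only [TensorProduct.map_tmul, LinearMap.sum_apply, LinearMap.comp_apply, LinearMap.flip_apply,
    consBar_tprod, TensorProduct.mk_apply, LinearEquiv.coe_coe, concat_tprod, LinearMap.mul_apply']

end StarFrobenius

/-! ### The complete complex and its cohomology -/

section Complete

universe u v

/-- The complete complex: `D^r = C^r(A, A)` for `r ≥ 0` and `D^r = C_{-r-1}(A, A_{ν⁻¹})` for
`r ≤ -1`. -/
def D (k : Type u) (A : Type v) [Field k] [Ring A] [Algebra k A] : ℤ → Type (max u v)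
  | .ofNat n => Cochain k A n
  | .negSucc p => Chain k A p

variable {k : Type u} {A : Type v} [Field k] [Ring A] [Algebra k A]

noncomputable instance instAddCommGroupD : (r : ℤ) → AddCommGroup (D k A r)
  | .ofNat n => inferInstanceAs (AddCommGroup (Cochain k A n))
  | .negSucc p => inferInstanceAs (AddCommGroup (Chain k A p))

noncomputable instance instModuleD : (r : ℤ) → Module k (D k A r)
  | .ofNat n => inferInstanceAs (Module k (Cochain k A n))
  | .negSucc p => inferInstanceAs (Module k (Chain k A p))

variable [FiniteDimensional k A] (F : FrobeniusForm k A)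

/-- The differential `D^r → D^{r+1}`: `δ^r` for `r ≥ 0`, `μ` for `r = -1`, and `∂_{-r-1}` for
`r ≤ -2`. -/
noncomputable def FrobeniusForm.d : (r : ℤ) → D k A r →ₗ[k] D k A (r + 1)
  | .ofNat n => (delta n : Cochain k A n →ₗ[k] Cochain k A (n + 1))
  | .negSucc 0 => F.normMap
  | .negSucc (p + 1) => partialMap F.nakayama.symm p

/-- The `⋆`-product `D^r ⊗ D^s → D^t`, `r + s = t`. -/
noncomputable def FrobeniusForm.star :
    (r s t : ℤ) → r + s = t → (D k A r →ₗ[k] D k A s →ₗ[k] D k A t)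
  | .ofNat m, .ofNat n, .ofNat l, h =>
    (cup (by simp only [Int.ofNat_eq_natCast] at h; omega) :
      Cochain k A m →ₗ[k] Cochain k A n →ₗ[k] Cochain k A l)
  | .ofNat m, .negSucc p, .negSucc q, h =>
    (capLeft (by simp only [Int.ofNat_eq_natCast] at h; omega) :
      Cochain k A m →ₗ[k] Chain k A p →ₗ[k] Chain k A q)
  | .ofNat m, .negSucc p, .ofNat n, h =>
    (F.evalLeft (by simp only [Int.ofNat_eq_natCast] at h; omega) :
      Cochain k A m →ₗ[k] Chain k A p →ₗ[k] Cochain k A n)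
  | .negSucc p, .ofNat m, .negSucc q, h =>
    (capRight F.nakayama.symm (by simp only [Int.ofNat_eq_natCast] at h; omega) :
      Chain k A p →ₗ[k] Cochain k A m →ₗ[k] Chain k A q)
  | .negSucc p, .ofNat m, .ofNat n, h =>
    (F.evalRight (by simp only [Int.ofNat_eq_natCast] at h; omega) :
      Chain k A p →ₗ[k] Cochain k A m →ₗ[k] Cochain k A n)
  | .negSucc p, .negSucc q, .negSucc l, h =>
    (F.chainMul (by omega) : Chain k A p →ₗ[k] Chain k A q →ₗ[k] Chain k A l)
  | .ofNat m, .ofNat n, .negSucc l, h =>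
    absurd h (by simp only [Int.ofNat_eq_natCast]; omega)
  | .negSucc p, .negSucc q, .ofNat l, h =>
    absurd h (by simp only [Int.ofNat_eq_natCast]; omega)

variable (k A) in
/-- The unit `1 ∈ A = D^0`. -/
noncomputable def unitD : D k A 0 := (cochainZero k A 1 : Cochain k A 0)

/-- The eigenspace `A_c = Ker(ν - c)` of the Nakayama automorphism; it is `0` if `c` is not an
eigenvalue. -/
noncomputable abbrev FrobeniusForm.eigen (c : k) : Submodule k A :=
  Module.End.eigenspace F.nakayama.toLinearMap c

/-- The subspace `D^r_{(c)}` of `D^r`. For `r ≥ 0` it consists of the cochains that map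
`Ā_{c₁} ⊗ ⋯ ⊗ Ā_{c_r}` into `A_{c c₁ ⋯ c_r}`; for `r = -p-1` it is the sum of the subspaces
`A_{c₀} ⊗ Ā_{c₁} ⊗ ⋯ ⊗ Ā_{c_p}` with `c₀ c₁ ⋯ c_p = c`. -/
noncomputable def FrobeniusForm.eigenD (c : k) : (r : ℤ) → Submodule k (D k A r)
  | .ofNat n =>
    ({ carrier := {f | ∀ (e : Fin n → k) (a : Fin n → A), (∀ i, a i ∈ F.eigen (e i)) →
          f (barTensor k A a) ∈ F.eigen (c * ∏ i, e i)}
       add_mem' := fun hf hg e a ha => by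
        rw [LinearMap.add_apply]
        exact Submodule.add_mem _ (hf e a ha) (hg e a ha)
       zero_mem' := fun e a _ => by
        rw [LinearMap.zero_apply]
        exact Submodule.zero_mem _
       smul_mem' := fun x f hf e a ha => by
        rw [LinearMap.smul_apply]
        exact Submodule.smul_mem _ _ (hf e a ha) } : Submodule k (Cochain k A n))
  | .negSucc p =>
    (Submodule.span k {x | ∃ (e₀ : k) (e : Fin p → k) (a₀ : A) (a : Fin p → A),
        e₀ * ∏ i, e i = c ∧ a₀ ∈ F.eigen e₀ ∧ (∀ i, a i ∈ F.eigen (e i)) ∧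
        x = a₀ ⊗ₜ barTensor k A a} : Submodule k (Chain k A p))

/-- The cocycles of a graded subspace `W` of the complete complex. -/
noncomputable def FrobeniusForm.cocycles (W : (r : ℤ) → Submodule k (D k A r)) (r : ℤ) :
    Submodule k (D k A r) :=
  LinearMap.ker (F.d r) ⊓ W r

/-- The image of the differential `W^{r-1} → D^r`. -/
noncomputable def FrobeniusForm.coboundaries (W : (r : ℤ) → Submodule k (D k A r)) :
    (r : ℤ) → Submodule k (D k A r)
  | .ofNat 0 => (W (.negSucc 0)).map (F.d (.negSucc 0))
  | .ofNat (n + 1) => (W (.ofNat n)).map (F.d (.ofNat n))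
  | .negSucc p => (W (.negSucc (p + 1))).map (F.d (.negSucc (p + 1)))

/-- The cohomology in degree `r` of the subcomplex `W` of the complete complex. -/
noncomputable abbrev FrobeniusForm.HH (W : (r : ℤ) → Submodule k (D k A r)) (r : ℤ) : Type (max u v) :=
  F.cocycles W r ⧸ (F.coboundaries W r).comap (F.cocycles W r).subtype

/-- The cohomology class of a cocycle. -/
noncomputable abbrev FrobeniusForm.cls (W : (r : ℤ) → Submodule k (D k A r)) {r : ℤ} (x : D k A r)
    (hx : x ∈ F.cocycles W r) : F.HH W r :=
  Submodule.Quotient.mk ⟨x, hx⟩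

/-- `⋆` restricts to a product on the graded subspace `W`. -/
def FrobeniusForm.StarRestricts (W : (r : ℤ) → Submodule k (D k A r)) : Prop :=
  ∀ (r s t : ℤ) (h : r + s = t), ∀ x ∈ W r, ∀ y ∈ W s, F.star r s t h x y ∈ W t

end Complete

/-! ### Graded commutative algebras -/

/-- The structure of a `ℤ`-graded, associative, unital, graded commutative `k`-algebra on a family
`H` of vector spaces. The product of degrees `r` and `s` is written with values in any degree `t`
that is equal to `r + s`. -/
structure GradedCommAlgebra (k : Type*) [Field k] (H : ℤ → Type*) [∀ r, AddCommGroup (H r)]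
    [∀ r, Module k (H r)] where
  mul : (r s t : ℤ) → r + s = t → (H r →ₗ[k] H s →ₗ[k] H t)
  one : H 0
  one_mul : ∀ (r : ℤ) (x : H r), mul 0 r r (zero_add r) one x = x
  mul_one : ∀ (r : ℤ) (x : H r), mul r 0 r (add_zero r) x one = x
  mul_assoc : ∀ (r s t rs st rst : ℤ) (h₁ : r + s = rs) (h₂ : s + t = st) (h₃ : rs + t = rst)
    (h₄ : r + st = rst) (x : H r) (y : H s) (z : H t),
    mul rs t rst h₃ (mul r s rs h₁ x y) z = mul r st rst h₄ x (mul s t st h₂ y z)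
  mul_comm : ∀ (r s t : ℤ) (h : r + s = t) (h' : s + r = t) (x : H r) (y : H s),
    mul r s t h x y = (r * s).negOnePow • mul s r t h' y x

/-- An isomorphism of graded algebras. -/
structure GradedCommAlgebra.Iso {k : Type*} [Field k] {H H' : ℤ → Type*}
    [∀ r, AddCommGroup (H r)] [∀ r, Module k (H r)] [∀ r, AddCommGroup (H' r)]
    [∀ r, Module k (H' r)] (S : GradedCommAlgebra k H) (S' : GradedCommAlgebra k H') where
  equiv : (r : ℤ) → H r ≃ₗ[k] H' r
  map_one : equiv 0 S.one = S'.one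
  map_mul : ∀ (r s t : ℤ) (h : r + s = t) (x : H r) (y : H s),
    equiv t (S.mul r s t h x y) = S'.mul r s t h (equiv r x) (equiv s y)

section Induced

variable {k : Type*} {A : Type*} [Field k] [Ring A] [Algebra k A] [FiniteDimensional k A]

/-- The product of the graded algebra `S` on the cohomology of `W` is induced by `⋆` (that is,
`⋆` maps cocycles to cocycles and `[x] [y] = [x ⋆ y]`), and its unit is the class of `1`. -/
def FrobeniusForm.IsStarAlgebra (F : FrobeniusForm k A) (W : (r : ℤ) → Submodule k (D k A r))
    (S : GradedCommAlgebra k (F.HH W)) : Prop :=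
  (∃ h1 : unitD k A ∈ F.cocycles W 0, S.one = F.cls W (unitD k A) h1) ∧
  ∀ (r s t : ℤ) (h : r + s = t) (x : D k A r) (hx : x ∈ F.cocycles W r) (y : D k A s)
    (hy : y ∈ F.cocycles W s),
    ∃ hxy : F.star r s t h x y ∈ F.cocycles W t,
      S.mul r s t h (F.cls W x hx) (F.cls W y hy) = F.cls W (F.star r s t h x y) hxy

end Induced

end FrobTate

/-! The hypothesis of part 1 already contains that of part 2. If `⋆` preserves the subcomplex, then
the square of the chain `1` of length `0`, which is `∑ vᵢ ⊗ ūᵢ`, lies in it. Contracting its first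
factor with any `y` gives `∑ ⟨vᵢ, y⟩ uᵢ = y`, so `y` is a sum of eigenvectors of `ν`
(`nakayamaDiagonalizable_of_starRestricts`). It remains to treat the full complex, and then a
diagonalizable `ν`.

On the full complex the product laws hold for every Frobenius algebra. They are proved by dimension
shifting instead of explicit homotopies. The complete complex is set up with coefficients in an
arbitrary bimodule `N` (`DN`, `dN`), and multiplication by a fixed cocycle becomes an operation
(`Op`), natural in `N`, that commutes with the differentials up to a sign. Every `N` embeds into the
coinduced bimodule `Hom_k(A, N)` and is a quotient of it, and the complete complex of the latter is
acyclic (`coind_acyclic`). Hence an operation that commutes with the differentials up to nonzero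
scalars vanishes on cohomology in all degrees once it does so in degree `0`. There a cocycle is a
central element `m` of `N`, the image of `1` under the bimodule map `a ↦ a m`, so by naturality the
value at `1 ∈ A` decides (`trivial`, `homologous_of_one`). Independence of the left representative,
associativity and graded commutativity all become comparisons of two operations at `1`
(`star_cohomologous_left`, `star_assoc`, `star_comm`).

One obstruction is that a chain multiplied from the left by the `⋆`-formula applies `ν⁻¹` to values
of a cochain, which makes no sense for values in `N`. The operation used instead differs from `⋆` by
the action of `ν` on all tensor factors. On cohomology this is harmless: Connes' operator `B`,
twisted by `ν`, satisfies `∂B + B∂ = 1 - ν` (`partA_connes`), so `ν` fixes every homology class of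
chains. The pairing `⟨f(x), a⟩` transports this to cochains (`tau_cohomologous`).

If `ν` is diagonalizable, let `τ` be the action of `ν` on the complete complex. It commutes with the
differential and with `⋆`. The subcomplex consists of the fixed points of `τ`
(`mem_eigenD_one_iff`), and the image of `τ - 1` is a complement of it in each degree. So the
subcomplex is closed under `⋆`, each of its elements that is a boundary is the boundary of one of
its elements (`isPure_eigenD`), and, since `τ` is the identity on cohomology, each class has a fixed
representative (`exists_cocycle_eigenD`). The inclusion is then an isomorphism on cohomology, and
the product laws restrict. -/

namespace FrobTate

/-! ### Bar words indexed by lists -/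

section Words

variable {k : Type*} {A : Type*} [Field k] [Ring A] [Algebra k A]
variable {M : Type*} [AddCommGroup M] [Module k M]

/-- The element `ā₁ ⊗ ⋯ ⊗ ā_r` of `Ā^{⊗ r}` given by the first `r` entries of a list. -/
noncomputable def bl (k : Type*) {A : Type*} [Field k] [Ring A] [Algebra k A] (r : ℕ)
    (l : List A) : BarPow k A r :=
  barTensor k A fun i : Fin r => l.getD i 0

theorem barTensor_eq_bl {r : ℕ} (a : Fin r → A) : barTensor k A a = bl k r (List.ofFn a) := by
  simp [bl, barTensor]

theorem bl_hom_ext {r : ℕ} {f g : BarPow k A r →ₗ[k] M}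
    (h : ∀ l : List A, l.length = r → f (bl k r l) = g (bl k r l)) : f = g :=
  barPow_hom_ext fun a => by
    rw [barTensor_eq_bl]
    exact h _ (by simp)

/-- Only the first list must have the right length: `bl` reads exactly `r` letters, truncating a
longer list and padding a shorter one with `0`. -/
theorem concat_bl {m n t : ℕ} (h : m + n = t) {l₁ l₂ : List A} (h₁ : l₁.length = m) :
    concat k A h (bl k m l₁ ⊗ₜ bl k n l₂) = bl k t (l₁ ++ l₂) := by
  rw [bl, bl, concat_tprod]
  subst h h₁
  unfold bl
  congr 1
  ext i
  refine Fin.addCases (fun i => ?_) (fun i => ?_) i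
  · simp [List.getD_eq_getElem?_getD, List.getElem?_append_left]
  · simp [List.getD_eq_getElem?_getD, List.getElem?_append_right]

theorem split_bl {m n t : ℕ} (h : m + n = t) {l₁ l₂ : List A} (h₁ : l₁.length = m) :
    split k A h (bl k t (l₁ ++ l₂)) = bl k m l₁ ⊗ₜ bl k n l₂ := by
  rw [← concat_bl h h₁]
  exact (concat k A h).symm_apply_apply _

theorem consBar_bl {p : ℕ} (w : A) (l : List A) :
    consBar k A p (toBar k A w) (bl k p l) = bl k (p + 1) (w :: l) := by
  rw [bl, consBar_tprod]
  unfold bl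
  congr 1
  ext i
  refine Fin.cases ?_ (fun i => ?_) i <;> simp

/-- The filler `y` is arbitrary, so all words `l₁ x l₂` are updates of one fixed tuple in one place.
Multilinearity then makes `slot` linear, as is needed to apply the Casimir identities inside a word.
-/
theorem bl_append_cons_eq_update {r : ℕ} (l₁ l₂ : List A) (h : l₁.length < r) (x y : A) :
    bl k r (l₁ ++ x :: l₂) = barTensorMulti r
      (Function.update (fun i : Fin r => (l₁ ++ y :: l₂).getD i 0) ⟨l₁.length, h⟩ x) := by
  rw [barTensorMulti_apply, bl]
  congr 1
  ext i
  by_cases hi : i = ⟨l₁.length, h⟩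
  · subst hi
    simp
  · have hi' : (i : ℕ) ≠ l₁.length := fun e => hi (Fin.ext e)
    rw [Function.update_of_ne hi]
    rcases lt_or_gt_of_ne hi' with h' | h'
    · simp [List.getD_eq_getElem?_getD, List.getElem?_append_left h']
    · obtain ⟨c, hc⟩ : ∃ c, (i : ℕ) = l₁.length + (c + 1) := ⟨i - l₁.length - 1, by omega⟩
      simp [List.getD_eq_getElem?_getD, hc, List.getElem?_append_right]

/-- The word `l₁ x l₂` as a linear map of `x`. -/
noncomputable def slot (k : Type*) {A : Type*} [Field k] [Ring A] [Algebra k A] {r : ℕ}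
    (l₁ l₂ : List A) (h : l₁.length < r) : A →ₗ[k] BarPow k A r where
  toFun x := bl k r (l₁ ++ x :: l₂)
  map_add' x y := by
    rw [bl_append_cons_eq_update l₁ l₂ h (x + y) 0, bl_append_cons_eq_update l₁ l₂ h x 0,
      bl_append_cons_eq_update l₁ l₂ h y 0, MultilinearMap.map_update_add]
  map_smul' c x := by
    rw [bl_append_cons_eq_update l₁ l₂ h (c • x) 0, bl_append_cons_eq_update l₁ l₂ h x 0,
      MultilinearMap.map_update_smul, RingHom.id_apply]

theorem slot_apply {r : ℕ} (l₁ l₂ : List A) (h : l₁.length < r) (x : A) :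
    slot k l₁ l₂ h x = bl k r (l₁ ++ x :: l₂) := rfl

/-- The alternating sum `∑ᵢ (-1)^i φ(a₁, …, a_i a_{i+1}, …)` (`i ≥ 1`). -/
def mid (φ : List A → M) : List A → M
  | [] => 0
  | [_] => 0
  | a :: b :: l => -φ (a * b :: l) - mid (fun w => φ (a :: w)) (b :: l)

@[simp] theorem mid_nil (φ : List A → M) : mid φ [] = 0 := rfl

@[simp] theorem mid_singleton (φ : List A → M) (a : A) : mid φ [a] = 0 := rfl

theorem mid_cons_cons (φ : List A → M) (a b : A) (l : List A) :
    mid φ (a :: b :: l) = -φ (a * b :: l) - mid (fun w => φ (a :: w)) (b :: l) := rfl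

/-- All words at which `mid φ l` evaluates `φ` are one letter shorter than `l`. Formulas that are
valid only for words of a given length can therefore be used under `mid`. -/
theorem mid_congr {φ ψ : List A → M} {l : List A}
    (h : ∀ w : List A, w.length + 1 = l.length → φ w = ψ w) : mid φ l = mid ψ l := by
  induction l generalizing φ ψ with
  | nil => rfl
  | cons a l ih =>
    cases l with
    | nil => rfl
    | cons b l =>
      rw [mid_cons_cons, mid_cons_cons, h _ (by simp), ih fun w hw => h _ (by simpa using hw)]

theorem map_mid {M' F : Type*} [AddCommGroup M'] [FunLike F M M'] [AddMonoidHomClass F M M']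
    (g : F) (φ : List A → M) (l : List A) : g (mid φ l) = mid (fun w => g (φ w)) l := by
  induction l generalizing φ with
  | nil => simp
  | cons a l ih =>
    cases l with
    | nil => simp
    | cons b l => simp only [mid_cons_cons, map_sub, map_neg, ih]

theorem mid_eq_map {M' F : Type*} [AddCommGroup M'] [FunLike F M M'] [AddMonoidHomClass F M M']
    (g : F) {φ : List A → M'} {ψ : List A → M} {l : List A}
    (h : ∀ w : List A, w.length + 1 = l.length → φ w = g (ψ w)) : mid φ l = g (mid ψ l) := by
  rw [map_mid, mid_congr h]

theorem mid_sum {ι : Type*} (s : Finset ι) (φ : ι → List A → M) (l : List A) :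
    mid (fun w => ∑ i ∈ s, φ i w) l = ∑ i ∈ s, mid (φ i) l := by
  classical
  induction l generalizing φ with
  | nil => simp
  | cons a l ih =>
    cases l with
    | nil => simp
    | cons b l => simp only [mid_cons_cons, ih, Finset.sum_sub_distrib, Finset.sum_neg_distrib]

theorem mid_map {B F : Type*} [Ring B] [FunLike F A B] [MulHomClass F A B] (σ : F)
    (φ : List B → M) (l : List A) : mid φ (l.map σ) = mid (fun w => φ (w.map σ)) l := by
  induction l generalizing φ with
  | nil => simp
  | cons a l ih =>
    cases l with
    | nil => simp
    | cons b l =>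
      have := ih (fun w => φ (σ a :: w))
      simp only [List.map_cons] at this
      simp only [List.map_cons, mid_cons_cons, map_mul, this]

/-- A contraction joins two neighbours inside `l₁ x` or inside `x l₂`, never across the shared
letter `x`. Positions in the second part are shifted by the length of `l₁`, which gives the sign.
This is the main tool for the Leibniz rules. -/
theorem mid_append_cons (φ : List A → M) (l₁ : List A) (x : A) (l₂ : List A) :
    mid φ (l₁ ++ x :: l₂) = mid (fun w => φ (w ++ l₂)) (l₁ ++ [x])
      + (-1 : k) ^ l₁.length • mid (fun w => φ (l₁ ++ w)) (x :: l₂) := by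
  induction l₁ generalizing φ with
  | nil => simp
  | cons a l ih =>
    cases l with
    | nil =>
      simp [mid_cons_cons]
      abel
    | cons b l =>
      have := ih (fun w => φ (a :: w))
      simp only [List.cons_append] at this
      simp only [List.cons_append, mid_cons_cons, this, List.length_cons, pow_succ,
        List.append_assoc, List.nil_append]
      simp only [mul_neg, mul_one, neg_smul, neg_neg]
      abel

-- The bridge from sums over `Fin` to recursion on lists. Through `barMap_bl` it removes index
-- arithmetic from all later computations with differentials.
omit [Algebra k A] in
theorem sum_contractNth_eq_mid (φ : List A → M) {r : ℕ} (l : List A) (hl : l.length = r + 1) :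
    ∑ i : Fin r, (-1 : k) ^ ((i : ℕ) + 1) •
      φ (List.ofFn (Fin.contractNth i.castSucc (· * ·) fun j : Fin (r + 1) => l.getD j 0))
      = mid φ l := by
  induction r generalizing l φ with
  | zero =>
    obtain ⟨a, rfl⟩ := List.length_eq_one_iff.1 hl
    simp
  | succ r ih =>
    match l, hl with
    | a :: b :: l, hl =>
      rw [Fin.sum_univ_succ, mid_cons_cons, ← ih _ (b :: l) (by simpa using hl), sub_eq_add_neg,
        ← Finset.sum_neg_distrib]
      congr 1
      · have : List.ofFn (Fin.contractNth (Fin.castSucc (0 : Fin (r + 1))) (· * ·)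
            fun j : Fin (r + 1 + 1) => (a :: b :: l).getD j 0) = a * b :: l := by
          rw [List.ofFn_succ]
          congr 1
          refine List.ext_getElem ?_ fun i h1 h2 => ?_
          · simp at hl ⊢; omega
          · simp [Fin.contractNth, h2]
        rw [this]
        simp
      · refine Finset.sum_congr rfl fun i _ => ?_
        rw [← neg_smul, List.ofFn_succ]
        have e : ∀ j : Fin (r), (Fin.contractNth i.succ.castSucc (· * ·)
            fun j : Fin (r + 1 + 1) => (a :: b :: l).getD j 0) j.succ =
            (Fin.contractNth i.castSucc (· * ·)
              fun j : Fin (r + 1) => (b :: l).getD j 0) j := by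
          intro j
          simp [Fin.contractNth]
        simp only [e]
        congr 2
        simp [pow_succ]

theorem ofFn_getD {r : ℕ} {l : List A} (h : l.length = r) :
    List.ofFn (fun i : Fin r => l.getD i 0) = l := by
  subst h
  refine List.ext_getElem (by simp) fun i h1 h2 => by simp

/-- The word is presented twice, as a first letter with its tail and as an initial part with its
last letter, so that both outer terms can be read off without casts. -/
theorem barMap_bl {r : ℕ} {L R : A →ₗ[k] BarPow k A r →ₗ[k] M} (hLR : L 1 = R 1) {a z : A}
    {l t i : List A} (ht : l = a :: t) (hi : l = i ++ [z]) (hl : t.length = r) :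
    barMap r L R (bl k (r + 1) l) = L a (bl k r t) + mid (fun w => L 1 (bl k r w)) l
      + (-1 : k) ^ (r + 1) • R z (bl k r i) := by
  have hl' : l.length = r + 1 := by simp [ht, hl]
  have hil : i.length = r := by simpa [hi] using hl'
  rw [bl, barMap_apply hLR, ← sum_contractNth_eq_mid (k := k) _ l hl']
  simp only [barTensor_eq_bl]
  congr 2
  · subst ht
    congr 2
    simp
    rw [← ofFn_getD hl]
    simp
  · congr 2
    · subst hi; simp [← hil]
    · rw [← ofFn_getD hil]
      congr 1
      have : (fun j : Fin r => l.getD j.castSucc 0) = fun j : Fin r => i.getD j 0 := by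
        ext j
        have : (j : ℕ) < i.length := by omega
        simp [hi, List.getD_eq_getElem?_getD, List.getElem?_append_left this]
      rw [this]

end Words

/-! ### Casimir identities -/

section Casimir

variable {k : Type*} {A : Type*} [Field k] [Ring A] [Algebra k A] [FiniteDimensional k A]
  (F : FrobeniusForm k A)

theorem FrobeniusForm.sum_form_v_smul_u (x : A) : ∑ i, F.form (F.v i) x • F.u i = x := by
  conv_rhs => rw [← F.u.sum_repr x]
  refine Finset.sum_congr rfl fun i _ => ?_
  congr 1
  calc F.form (F.v i) x = F.form (F.v i) (∑ j, F.u.repr x j • F.u j) := by rw [F.u.sum_repr]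
    _ = F.u.repr x i := by simp only [map_sum, map_smul, F.form_v_u]; simp

theorem FrobeniusForm.sum_form_u_smul_v (x : A) : ∑ i, F.form x (F.u i) • F.v i = x := by
  conv_rhs => rw [← F.v.sum_repr x]
  refine Finset.sum_congr rfl fun i _ => ?_
  congr 1
  calc F.form x (F.u i) = F.form (∑ j, F.v.repr x j • F.v j) (F.u i) := by rw [F.v.sum_repr]
    _ = F.v.repr x i := by
      simp only [map_sum, map_smul, LinearMap.sum_apply, LinearMap.smul_apply, F.form_v_u]; simp

variable {M : Type*} [AddCommGroup M] [Module k M]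

/-- After expansion in the dual bases both sides have the coefficients `⟨vⱼ, a uᵢ⟩ = ⟨vⱼ a, uᵢ⟩`.
The arbitrary bilinear `β` encodes an identity for the Casimir element `∑ uᵢ ⊗ vᵢ` in `A ⊗ A`, in a
form that applies inside any expression linear in the two factors. -/
theorem FrobeniusForm.casimir_mul (β : A →ₗ[k] A →ₗ[k] M) (a : A) :
    ∑ i, β (a * F.u i) (F.v i) = ∑ i, β (F.u i) (F.v i * a) := by
  have h1 : ∀ i, β (a * F.u i) (F.v i) =
      ∑ j, F.form (F.v j) (a * F.u i) • β (F.u j) (F.v i) := fun i => by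
    conv_lhs => rw [← F.sum_form_v_smul_u (a * F.u i)]
    simp
  have h2 : ∀ i, β (F.u i) (F.v i * a) =
      ∑ j, F.form (F.v i * a) (F.u j) • β (F.u i) (F.v j) := fun i => by
    conv_lhs => rw [← F.sum_form_u_smul_v (F.v i * a)]
    simp
  simp only [h1, h2, F.assoc]
  exact Finset.sum_comm

/-- The coefficients agree because `⟨vⱼ uᵢ, ν(a)⟩ = ⟨a, vⱼ uᵢ⟩`. This identity accounts for the
letters `uᵢ ν(a₀)` in the product and for the twist `ν⁻¹` in the boundary map. -/
theorem FrobeniusForm.casimir_mul_nakayama (β : A →ₗ[k] A →ₗ[k] M) (a : A) :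
    ∑ i, β (F.u i * F.nakayama a) (F.v i) = ∑ i, β (F.u i) (a * F.v i) := by
  have h1 : ∀ i, β (F.u i * F.nakayama a) (F.v i) =
      ∑ j, F.form (F.v j) (F.u i * F.nakayama a) • β (F.u j) (F.v i) := fun i => by
    conv_lhs => rw [← F.sum_form_v_smul_u (F.u i * F.nakayama a)]
    simp
  have h2 : ∀ i, β (F.u i) (a * F.v i) =
      ∑ j, F.form (a * F.v i) (F.u j) • β (F.u i) (F.v j) := fun i => by
    conv_lhs => rw [← F.sum_form_u_smul_v (a * F.v i)]
    simp
  simp only [h1, h2, F.assoc a, F.form_nakayama a]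
  rw [Finset.sum_comm]
  simp only [F.assoc]

/-- The Casimir element is symmetric up to `ν` in one factor: in the basis `u ⊗ u` the two sides
have transposed coefficient matrices, since `⟨vⱼ, ν(vᵢ)⟩ = ⟨vᵢ, vⱼ⟩`. -/
theorem FrobeniusForm.casimir_swap (β : A →ₗ[k] A →ₗ[k] M) :
    ∑ i, β (F.nakayama (F.v i)) (F.u i) = ∑ i, β (F.u i) (F.v i) := by
  have h1 : ∀ i, β (F.nakayama (F.v i)) (F.u i) =
      ∑ j, F.form (F.v j) (F.nakayama (F.v i)) • β (F.u j) (F.u i) := fun i => by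
    conv_lhs => rw [← F.sum_form_v_smul_u (F.nakayama (F.v i))]
    simp
  have h2 : ∀ i, β (F.u i) (F.v i) = ∑ j, F.form (F.v j) (F.v i) • β (F.u i) (F.u j) := fun i => by
    conv_lhs => rw [← F.sum_form_v_smul_u (F.v i)]
    simp
  simp only [h1, h2, ← F.form_nakayama]
  exact Finset.sum_comm

end Casimir

/-! ### Bimodules -/

universe u v

/-- A bimodule over a `k`-algebra `A` on which `k` acts centrally. -/
structure Bimod (k : Type u) (A : Type v) [Field k] [Ring A] [Algebra k A] where
  carrier : Type v
  [addCommGroup : AddCommGroup carrier]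
  [module : Module k carrier]
  l : A →ₗ[k] carrier →ₗ[k] carrier
  r : A →ₗ[k] carrier →ₗ[k] carrier
  one_l : ∀ n, l 1 n = n
  mul_l : ∀ a b n, l (a * b) n = l a (l b n)
  one_r : ∀ n, r 1 n = n
  mul_r : ∀ a b n, r (a * b) n = r b (r a n)
  l_r : ∀ a b n, l a (r b n) = r b (l a n)

attribute [instance] Bimod.addCommGroup Bimod.module
attribute [simp] Bimod.one_l Bimod.one_r

instance {k : Type u} {A : Type v} [Field k] [Ring A] [Algebra k A] :
    CoeSort (Bimod k A) (Type v) := ⟨Bimod.carrier⟩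

section Bimodules

variable {k : Type u} {A : Type v} [Field k] [Ring A] [Algebra k A]

variable (k A) in
/-- `A` as a bimodule over itself. -/
@[reducible] def Bimod.self : Bimod k A where
  carrier := A
  l := LinearMap.mul k A
  r := (LinearMap.mul k A).flip
  one_l := by simp
  mul_l := by simp [mul_assoc]
  one_r := by simp
  mul_r := by simp [mul_assoc]
  l_r := by simp [mul_assoc]

/-- Homomorphisms of bimodules. -/
structure Bimod.IsHom {N N' : Bimod k A} (φ : N →ₗ[k] N') : Prop where
  map_l : ∀ a n, φ (N.l a n) = N'.l a (φ n)
  map_r : ∀ a n, φ (N.r a n) = N'.r a (φ n)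

end Bimodules

/-! ### The complete complex with coefficients in a bimodule -/

section Coefficients

variable {k : Type u} {A : Type v} [Field k] [Ring A] [Algebra k A]

/-- Normalized Hochschild cochains with coefficients. -/
abbrev Coch (N : Bimod k A) (r : ℕ) : Type (max u v) := BarPow k A r →ₗ[k] N

/-- Normalized Hochschild chains with coefficients. -/
abbrev Chn (N : Bimod k A) (p : ℕ) : Type (max u v) := N ⊗[k] BarPow k A p

theorem chn_hom_ext {N : Bimod k A} {M : Type*} [AddCommGroup M] [Module k M] {p : ℕ}
    {f g : Chn N p →ₗ[k] M}
    (h : ∀ (n : N) (l : List A), l.length = p → f (n ⊗ₜ bl k p l) = g (n ⊗ₜ bl k p l)) : f = g :=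
  TensorProduct.ext <| LinearMap.ext fun n => bl_hom_ext fun l hl => h n l hl

/-- The Hochschild differential on cochains. -/
noncomputable def deltaN (N : Bimod k A) :
    {r r' : ℕ} → r + 1 = r' → (Coch N r →ₗ[k] Coch N r')
  | r, _, rfl =>
  { toFun := fun f => barMap r (N.l.compl₂ f) (N.r.compl₂ f)
    map_add' := fun f g => barPow_hom_ext fun a => by
      rw [LinearMap.add_apply, barMap_apply (by ext; simp), barMap_apply (by ext; simp),
        barMap_apply (by ext; simp)]
      simp only [LinearMap.compl₂_apply, LinearMap.add_apply, map_add, smul_add,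
        Finset.sum_add_distrib]
      abel
    map_smul' := fun c f => barPow_hom_ext fun a => by
      rw [RingHom.id_apply, LinearMap.smul_apply, barMap_apply (by ext; simp),
        barMap_apply (by ext; simp)]
      simp only [LinearMap.compl₂_apply, LinearMap.smul_apply, map_smul, smul_add,
        Finset.smul_sum, smul_comm c] }

/-- The target degree is a variable with a proof of `r + 1 = r'`. The same device is used for all
maps below, so that no cast between `m + n + 1` and `m + (n + 1)` is needed. -/
theorem deltaN_bl (N : Bimod k A) {r r' : ℕ} (h : r + 1 = r') (f : Coch N r) {a z : A}
    {l t i : List A} (ht : l = a :: t) (hi : l = i ++ [z]) (hl : t.length = r) :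
    deltaN N h f (bl k r' l) = N.l a (f (bl k r t)) + mid (fun w => f (bl k r w)) l
      + (-1 : k) ^ (r + 1) • N.r z (f (bl k r i)) := by
  subst h
  refine (barMap_bl (by ext; simp) ht hi hl).trans ?_
  simp

/-- The Hochschild differential on cochains with coefficients in `A`. -/
noncomputable def deltaA {r r' : ℕ} (h : r + 1 = r') : Cochain k A r →ₗ[k] Cochain k A r' :=
  deltaN (Bimod.self k A) h

theorem deltaA_bl {r r' : ℕ} (h : r + 1 = r') (f : Cochain k A r) {a z : A}
    {l t i : List A} (ht : l = a :: t) (hi : l = i ++ [z]) (hl : t.length = r) :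
    deltaA h f (bl k r' l) = a * f (bl k r t) + mid (fun w => f (bl k r w)) l
      + (-1 : k) ^ (r + 1) • (f (bl k r i) * z) :=
  deltaN_bl (Bimod.self k A) h f ht hi hl

/-- The Hochschild differential on chains, twisted by an automorphism. -/
noncomputable def partN (σ : A ≃ₐ[k] A) (N : Bimod k A) :
    {p p' : ℕ} → p + 1 = p' → (Chn N p' →ₗ[k] Chn N p)
  | p, _, rfl => TensorProduct.lift
    { toFun := fun n => barMap p
        ((TensorProduct.mk k N (BarPow k A p)).comp ((N.r.flip n).comp σ.toLinearMap))
        ((TensorProduct.mk k N (BarPow k A p)).comp (N.l.flip n))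
      map_add' := fun m n => barPow_hom_ext fun a => by
        rw [LinearMap.add_apply, barMap_apply (by ext; simp), barMap_apply (by ext; simp),
          barMap_apply (by ext; simp)]
        simp only [LinearMap.comp_apply, map_add, LinearMap.add_apply, LinearMap.flip_apply,
          TensorProduct.mk_apply, smul_add, TensorProduct.add_tmul,
          Finset.sum_add_distrib]
        abel
      map_smul' := fun c m => barPow_hom_ext fun a => by
        rw [RingHom.id_apply, LinearMap.smul_apply, barMap_apply (by ext; simp),
          barMap_apply (by ext; simp)]
        simp only [LinearMap.comp_apply, map_smul, LinearMap.smul_apply, LinearMap.flip_apply,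
          TensorProduct.mk_apply, TensorProduct.smul_tmul', smul_add,
          Finset.smul_sum, smul_comm c] }

theorem partN_bl (σ : A ≃ₐ[k] A) (N : Bimod k A) {p p' : ℕ} (h : p + 1 = p') (n : N) {a z : A}
    {l t i : List A} (ht : l = a :: t) (hi : l = i ++ [z]) (hl : t.length = p) :
    partN σ N h (n ⊗ₜ bl k p' l) = N.r (σ a) n ⊗ₜ bl k p t + mid (fun w => n ⊗ₜ[k] bl k p w) l
      + (-1 : k) ^ (p + 1) • N.l z n ⊗ₜ[k] bl k p i := by
  subst h
  have := barMap_bl (k := k)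
    (L := (TensorProduct.mk k N (BarPow k A p)).comp ((N.r.flip n).comp σ.toLinearMap))
    (R := (TensorProduct.mk k N (BarPow k A p)).comp (N.l.flip n)) (by ext; simp) ht hi hl
  refine this.trans ?_
  simp

/-- The cochains of degree `0` as elements of the coefficients. -/
theorem coch_zero_ext {N : Bimod k A} {f g : Coch N 0} (h : f (bl k 0 []) = g (bl k 0 [])) : f = g :=
  bl_hom_ext fun l hl => by rw [List.length_eq_zero_iff.1 hl, h]

/-- The Hochschild differential on chains with coefficients in `A`. -/
noncomputable def partA (σ : A ≃ₐ[k] A) {p p' : ℕ} (h : p + 1 = p') :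
    Chain k A p' →ₗ[k] Chain k A p :=
  partN σ (Bimod.self k A) h

theorem partA_bl (σ : A ≃ₐ[k] A) {p p' : ℕ} (h : p + 1 = p') (n : A) {a z : A}
    {l t i : List A} (ht : l = a :: t) (hi : l = i ++ [z]) (hl : t.length = p) :
    partA σ h (n ⊗ₜ bl k p' l) = (n * σ a) ⊗ₜ bl k p t + mid (fun w => n ⊗ₜ[k] bl k p w) l
      + (-1 : k) ^ (p + 1) • (z * n) ⊗ₜ[k] bl k p i :=
  partN_bl σ (Bimod.self k A) h n ht hi hl

/-- An element of the coefficients as a cochain of degree `0`. -/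
noncomputable def constN (N : Bimod k A) : N →ₗ[k] Coch N 0 :=
  (LinearMap.lcomp k N (PiTensorProduct.isEmptyEquiv (Fin 0)).toLinearMap).comp
    (LinearMap.ringLmapEquivSelf k k N).symm.toLinearMap

@[simp] theorem constN_bl (N : Bimod k A) (n : N) (l : List A) : constN N n (bl k 0 l) = n := by
  simp [constN, bl, barTensor]

/-- The map `Ā^{⊗ r} → Ā^{⊗ r}` induced by an automorphism of `A`. -/
noncomputable def powMap (σ : A ≃ₐ[k] A) (r : ℕ) : BarPow k A r →ₗ[k] BarPow k A r :=
  PiTensorProduct.map fun _ => Submodule.mapQ _ _ σ.toLinearMap <| by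
    rw [Submodule.span_singleton_le_iff_mem]
    exact Submodule.mem_span_singleton.2 ⟨1, by simp⟩

@[simp] theorem powMap_bl (σ : A ≃ₐ[k] A) (r : ℕ) (l : List A) :
    powMap σ r (bl k r l) = bl k r (l.map σ) := by
  unfold powMap bl
  rw [barTensor, PiTensorProduct.map_tprod]
  congr 1
  ext i
  simp [List.getD_eq_getElem?_getD]
  cases l[(i : ℕ)]? <;> simp

/-- `w, a₁ ⊗ ⋯ ⊗ a_p ↦ w ⊗ a₁ ⊗ ⋯ ⊗ a_p` for `w` in `A`. -/
noncomputable def consA (k : Type u) {A : Type v} [Field k] [Ring A] [Algebra k A] (p : ℕ) :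
    A →ₗ[k] BarPow k A p →ₗ[k] BarPow k A (p + 1) :=
  consBar k A p ∘ₗ toBar k A

@[simp] theorem consA_bl (p : ℕ) (w : A) (l : List A) :
    consA k p w (bl k p l) = bl k (p + 1) (w :: l) := consBar_bl w l

section Left

/-- The product `f ⋆ g` of a cochain and a cochain with coefficients. -/
noncomputable def cupL (N : Bimod k A) {m n t : ℕ} (h : m + n = t) (f : Cochain k A m) :
    Coch N n →ₗ[k] Coch N t where
  toFun g := TensorProduct.lift N.l ∘ₗ TensorProduct.map f g ∘ₗ split k A h
  map_add' g g' := by simp [TensorProduct.map_add_right, LinearMap.comp_add, LinearMap.add_comp]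
  map_smul' c g := by simp [TensorProduct.map_smul_right, LinearMap.comp_smul, LinearMap.smul_comp]

theorem cupL_bl (N : Bimod k A) {m n t : ℕ} (h : m + n = t) (f : Cochain k A m) (g : Coch N n)
    {l l₁ l₂ : List A} (hl : l = l₁ ++ l₂) (h₁ : l₁.length = m) :
    cupL N h f g (bl k t l) = N.l (f (bl k m l₁)) (g (bl k n l₂)) := by
  subst hl
  simp [cupL, split_bl h h₁]

/-- The product `g ⋆ f` of a cochain with coefficients and a cochain. -/
noncomputable def cupR (N : Bimod k A) {m n t : ℕ} (h : n + m = t) (f : Cochain k A m) :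
    Coch N n →ₗ[k] Coch N t where
  toFun g := TensorProduct.lift N.r.flip ∘ₗ TensorProduct.map g f ∘ₗ split k A h
  map_add' g g' := by simp [TensorProduct.map_add_left, LinearMap.comp_add, LinearMap.add_comp]
  map_smul' c g := by simp [TensorProduct.map_smul_left, LinearMap.comp_smul, LinearMap.smul_comp]

theorem cupR_bl (N : Bimod k A) {m n t : ℕ} (h : n + m = t) (f : Cochain k A m) (g : Coch N n)
    {l l₁ l₂ : List A} (hl : l = l₁ ++ l₂) (h₁ : l₁.length = n) :
    cupR N h f g (bl k t l) = N.r (f (bl k m l₂)) (g (bl k n l₁)) := by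
  subst hl
  simp [cupR, split_bl h h₁]

/-- The product `f ⋆ α` of a cochain and a chain with coefficients, in negative degree. -/
noncomputable def capL (N : Bimod k A) {m q p : ℕ} (h : q + m = p) (f : Cochain k A m) :
    Chn N p →ₗ[k] Chn N q :=
  TensorProduct.lift <| LinearMap.mk₂ k
    (fun n x => TensorProduct.comm k _ _
      (TensorProduct.map LinearMap.id (N.l.flip n ∘ₗ f) (split k A h x)))
    (fun n n' x => by simp [TensorProduct.map_add_right, LinearMap.add_comp])
    (fun c n x => by simp [TensorProduct.map_smul_right, LinearMap.smul_comp])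
    (fun n x x' => by simp)
    (fun c n x => by simp)

theorem capL_bl (N : Bimod k A) {m q p : ℕ} (h : q + m = p) (f : Cochain k A m) (n : N)
    {l l₁ l₂ : List A} (hl : l = l₁ ++ l₂) (h₁ : l₁.length = q) :
    capL N h f (n ⊗ₜ bl k p l) = N.l (f (bl k m l₂)) n ⊗ₜ bl k q l₁ := by
  subst hl
  simp [capL, split_bl h h₁]

variable [FiniteDimensional k A] (F : FrobeniusForm k A)

/-- The norm map `n ↦ ∑ uᵢ n vᵢ`. -/
noncomputable def FrobeniusForm.normN (N : Bimod k A) : Chn N 0 →ₗ[k] Coch N 0 :=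
  TensorProduct.lift <| LinearMap.mk₂ k
    (fun n x => ∑ i, PiTensorProduct.isEmptyEquiv (Fin 0) x • constN N (N.l (F.u i) (N.r (F.v i) n)))
    (fun n n' x => by simp [Finset.sum_add_distrib])
    (fun c n x => by simp [Finset.smul_sum, smul_comm c])
    (fun n x x' => by simp [Finset.sum_add_distrib, add_smul])
    (fun c n x => by simp [Finset.smul_sum, mul_smul])

theorem FrobeniusForm.normN_bl (N : Bimod k A) (n : N) (l l' : List A) :
    F.normN N (n ⊗ₜ bl k 0 l) (bl k 0 l') = ∑ i, N.l (F.u i) (N.r (F.v i) n) := by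
  have : PiTensorProduct.isEmptyEquiv (Fin 0) (bl k 0 l) = 1 := by simp [bl, barTensor]
  simp [FrobeniusForm.normN, this]

/-- The norm map with coefficients in `A`. -/
noncomputable def FrobeniusForm.normA : Chain k A 0 →ₗ[k] Cochain k A 0 :=
  F.normN (Bimod.self k A)

theorem FrobeniusForm.normA_bl (n : A) (l l' : List A) :
    F.normA (n ⊗ₜ bl k 0 l) (bl k 0 l') = ∑ i, F.u i * (n * F.v i) :=
  F.normN_bl (Bimod.self k A) n l l'

/-- The product `f ⋆ α` of a cochain and a chain with coefficients, in nonnegative degree. -/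
noncomputable def FrobeniusForm.evL (N : Bimod k A) {n p m : ℕ} (h : n + (p + 1) = m)
    (f : Cochain k A m) : Chn N p →ₗ[k] Coch N n :=
  TensorProduct.lift <| LinearMap.mk₂ k
    (fun a x => ∑ i, N.r (F.v i) ∘ₗ N.l.flip a ∘ₗ f ∘ₗ (concat k A h).toLinearMap ∘ₗ
      (TensorProduct.mk k _ _).flip (consA k p (F.u i) x))
    (fun a a' x => by simp [LinearMap.comp_add, LinearMap.add_comp, Finset.sum_add_distrib])
    (fun c a x => by simp [LinearMap.comp_smul, LinearMap.smul_comp, Finset.smul_sum])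
    (fun a x x' => by simp [LinearMap.comp_add, Finset.sum_add_distrib])
    (fun c a x => by simp [LinearMap.comp_smul, Finset.smul_sum])

/-- In the `⋆`-product the coefficient is buried in the letter `uᵢ ν(a₀)`, which is meaningless for
a coefficient in `N`. By `casimir_mul_nakayama` it can be moved out and placed between the value of
`f` and `vᵢ`; that form extends to `N`. -/
theorem FrobeniusForm.evL_bl (N : Bimod k A) {n p m : ℕ} (h : n + (p + 1) = m)
    (f : Cochain k A m) (a : N) (l b : List A) (hb : b.length = n) :
    F.evL N h f (a ⊗ₜ bl k p l) (bl k n b) =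
      ∑ i, N.r (F.v i) (N.l (f (bl k m (b ++ F.u i :: l))) a) := by
  simp only [FrobeniusForm.evL, TensorProduct.lift.tmul, LinearMap.flip_apply, LinearMap.coe_mk,
    AddHom.coe_mk,
    LinearMap.mk₂_apply, LinearMap.sum_apply, LinearMap.comp_apply, LinearMap.flip_apply, LinearEquiv.coe_coe,
    TensorProduct.mk_apply, TensorProduct.map_tmul, consA_bl, concat_bl h hb]

/-- The product `α ⋆ f` of a chain and a cochain with coefficients, in negative degree. -/
noncomputable def FrobeniusForm.capA (N : Bimod k A) {m q p : ℕ} (h : m + q = p) :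
    Chain k A p →ₗ[k] Coch N m →ₗ[k] Chn N q :=
  LinearMap.flip
    { toFun := fun f => TensorProduct.lift <| LinearMap.mk₂ k
        (fun a x => TensorProduct.map (N.l (F.nakayama a) ∘ₗ f) (powMap F.nakayama q)
          (split k A h x))
        (fun a a' x => by simp [TensorProduct.map_add_left, LinearMap.add_comp])
        (fun c a x => by simp [TensorProduct.map_smul_left, LinearMap.smul_comp])
        (fun a x x' => by simp)
        (fun c a x => by simp)
      map_add' := fun f g => TensorProduct.ext' fun a x => by
        simp [TensorProduct.map_add_left, LinearMap.comp_add]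
      map_smul' := fun c f => TensorProduct.ext' fun a x => by
        simp [TensorProduct.map_smul_left, LinearMap.comp_smul] }

/-- The `⋆`-product has the coefficient `a₀ ν⁻¹(f(…))`, and `ν⁻¹` does not act on `N`. Applying `ν`
to all tensor factors of that formula removes the obstacle, at the price of a twist that is undone
on cohomology by Connes' operator. -/
theorem FrobeniusForm.capA_bl (N : Bimod k A) {m q p : ℕ} (h : m + q = p) (f : Coch N m) (a : A)
    {l l₁ l₂ : List A} (hl : l = l₁ ++ l₂) (h₁ : l₁.length = m) :
    F.capA N h (a ⊗ₜ bl k p l) f =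
      N.l (F.nakayama a) (f (bl k m l₁)) ⊗ₜ bl k q (l₂.map F.nakayama) := by
  subst hl
  simp [FrobeniusForm.capA, split_bl h h₁]

/-- The product `α ⋆ f` of a chain and a cochain with coefficients, in nonnegative degree. -/
noncomputable def FrobeniusForm.evA (N : Bimod k A) {n p m : ℕ} (h : p + (n + 1) = m) :
    Chain k A p →ₗ[k] Coch N m →ₗ[k] Coch N n :=
  LinearMap.flip
    { toFun := fun f => TensorProduct.lift <| LinearMap.mk₂ k
        (fun a x => ∑ i, N.l (F.u i * F.nakayama a) ∘ₗ f ∘ₗ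
          (concat k A h).toLinearMap ∘ₗ
            TensorProduct.mk k _ _ x ∘ₗ consA k n (F.v i))
        (fun a a' x => by simp [mul_add, LinearMap.add_comp, Finset.sum_add_distrib])
        (fun c a x => by simp [LinearMap.smul_comp, Finset.smul_sum])
        (fun a x x' => by
          simp [LinearMap.comp_add, LinearMap.add_comp, Finset.sum_add_distrib])
        (fun c a x => by simp [LinearMap.comp_smul, LinearMap.smul_comp, Finset.smul_sum])
      map_add' := fun f g => TensorProduct.ext' fun a x => by
        simp [LinearMap.comp_add, LinearMap.add_comp, Finset.sum_add_distrib]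
      map_smul' := fun c f => TensorProduct.ext' fun a x => by
        simp [LinearMap.comp_smul, LinearMap.smul_comp, Finset.smul_sum] }

theorem FrobeniusForm.evA_bl (N : Bimod k A) {n p m : ℕ} (h : p + (n + 1) = m) (f : Coch N m)
    (a : A) (l b : List A) (hl : l.length = p) :
    F.evA N h (a ⊗ₜ bl k p l) f (bl k n b) =
      ∑ i, N.l (F.u i * F.nakayama a) (f (bl k m (l ++ F.v i :: b))) := by
  simp only [FrobeniusForm.evA, TensorProduct.lift.tmul, LinearMap.flip_apply, LinearMap.coe_mk,
    AddHom.coe_mk,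
    LinearMap.mk₂_apply, LinearMap.sum_apply, LinearMap.comp_apply, LinearMap.flip_apply, LinearEquiv.coe_coe,
    TensorProduct.mk_apply, TensorProduct.map_tmul, consA_bl, concat_bl h hl]

/-- The automorphism `ν^{⊗ (p+1)}` of `A ⊗ Ā^{⊗ p}`. -/
noncomputable def chainMap (σ : A ≃ₐ[k] A) (p : ℕ) : Chain k A p →ₗ[k] Chain k A p :=
  TensorProduct.map σ.toLinearMap (powMap σ p)

omit [FiniteDimensional k A] in
@[simp] theorem chainMap_bl (σ : A ≃ₐ[k] A) (p : ℕ) (a : A) (l : List A) :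
    chainMap σ p (a ⊗ₜ bl k p l) = σ a ⊗ₜ bl k p (l.map σ) := by
  simp [chainMap]

/-- The product `α ⋆ β` of a chain and a chain with coefficients. -/
noncomputable def FrobeniusForm.mulA (N : Bimod k A) {p q t : ℕ} (h : q + (p + 1) = t) :
    Chain k A p →ₗ[k] Chn N q →ₗ[k] Chn N t :=
  TensorProduct.lift <| LinearMap.mk₂ k
    (fun a x => ∑ i, TensorProduct.map (N.l (F.v i))
      ((concat k A h).toLinearMap ∘ₗ
        (TensorProduct.mk k _ _).flip (consA k p (F.u i * F.nakayama a) x)))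
    (fun a a' x => by
      simp [mul_add, LinearMap.comp_add, TensorProduct.map_add_right, Finset.sum_add_distrib])
    (fun c a x => by
      simp [LinearMap.comp_smul, TensorProduct.map_smul_right, Finset.smul_sum])
    (fun a x x' => by
      simp [LinearMap.comp_add, TensorProduct.map_add_right, Finset.sum_add_distrib])
    (fun c a x => by
      simp [LinearMap.comp_smul, TensorProduct.map_smul_right, Finset.smul_sum])

theorem FrobeniusForm.mulA_bl (N : Bimod k A) {p q t : ℕ} (h : q + (p + 1) = t)
    (a : A) (n : N) (l b : List A) (hb : b.length = q) :
    F.mulA N h (a ⊗ₜ bl k p l) (n ⊗ₜ bl k q b) =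
      ∑ i, N.l (F.v i) n ⊗ₜ bl k t (b ++ (F.u i * F.nakayama a) :: l) := by
  simp only [FrobeniusForm.mulA, TensorProduct.lift.tmul, LinearMap.flip_apply, LinearMap.coe_mk,
    AddHom.coe_mk,
    LinearMap.mk₂_apply, LinearMap.sum_apply, LinearMap.comp_apply, LinearMap.flip_apply, LinearEquiv.coe_coe,
    TensorProduct.mk_apply, TensorProduct.map_tmul, consA_bl, concat_bl h hb]

end Left

section Right

/-- The product `f ⋆ α` of a cochain with coefficients and a chain, in negative degree. -/
noncomputable def capR (N : Bimod k A) {m q p : ℕ} (h : q + m = p) :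
    Chain k A p →ₗ[k] Coch N m →ₗ[k] Chn N q :=
  LinearMap.flip
  { toFun := fun f => TensorProduct.lift <| LinearMap.mk₂ k
      (fun a x => TensorProduct.comm k _ _
        (TensorProduct.map LinearMap.id (N.r a ∘ₗ f) (split k A h x)))
      (fun a a' x => by simp [TensorProduct.map_add_right, LinearMap.add_comp])
      (fun c a x => by simp [TensorProduct.map_smul_right, LinearMap.smul_comp])
      (fun a x x' => by simp)
      (fun c a x => by simp)
    map_add' := fun f g => TensorProduct.ext' fun a x => by
      simp [TensorProduct.map_add_right, LinearMap.comp_add]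
    map_smul' := fun c f => TensorProduct.ext' fun a x => by
      simp [TensorProduct.map_smul_right, LinearMap.comp_smul] }

theorem capR_bl (N : Bimod k A) {m q p : ℕ} (h : q + m = p) (f : Coch N m) (a : A)
    {l l₁ l₂ : List A} (hl : l = l₁ ++ l₂) (h₁ : l₁.length = q) :
    capR N h (a ⊗ₜ bl k p l) f = N.r a (f (bl k m l₂)) ⊗ₜ bl k q l₁ := by
  subst hl
  simp [capR, split_bl h h₁]

variable [FiniteDimensional k A] (F : FrobeniusForm k A)

/-- The product `f ⋆ α` of a cochain with coefficients and a chain, in nonnegative degree. -/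
noncomputable def FrobeniusForm.evR (N : Bimod k A) {n p m : ℕ} (h : n + (p + 1) = m) :
    Chain k A p →ₗ[k] Coch N m →ₗ[k] Coch N n :=
  LinearMap.flip
  { toFun := fun f => TensorProduct.lift <| LinearMap.mk₂ k
      (fun a x => ∑ i, N.r (F.v i) ∘ₗ f ∘ₗ (concat k A h).toLinearMap ∘ₗ
        (TensorProduct.mk k _ _).flip (consA k p (F.u i * F.nakayama a) x))
      (fun a a' x => by simp [mul_add, LinearMap.comp_add, Finset.sum_add_distrib])
      (fun c a x => by simp [LinearMap.comp_smul, Finset.smul_sum])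
      (fun a x x' => by simp [LinearMap.comp_add, Finset.sum_add_distrib])
      (fun c a x => by simp [LinearMap.comp_smul, Finset.smul_sum])
    map_add' := fun f g => TensorProduct.ext' fun a x => by
      simp [LinearMap.comp_add, LinearMap.add_comp, Finset.sum_add_distrib]
    map_smul' := fun c f => TensorProduct.ext' fun a x => by
      simp [LinearMap.comp_smul, LinearMap.smul_comp, Finset.smul_sum] }

theorem FrobeniusForm.evR_bl (N : Bimod k A) {n p m : ℕ} (h : n + (p + 1) = m)
    (f : Coch N m) (a : A) (l b : List A) (hb : b.length = n) :
    F.evR N h (a ⊗ₜ bl k p l) f (bl k n b) =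
      ∑ i, N.r (F.v i) (f (bl k m (b ++ (F.u i * F.nakayama a) :: l))) := by
  simp only [FrobeniusForm.evR, TensorProduct.lift.tmul, LinearMap.flip_apply, LinearMap.coe_mk,
    AddHom.coe_mk,
    LinearMap.mk₂_apply, LinearMap.sum_apply, LinearMap.comp_apply, LinearMap.flip_apply, LinearEquiv.coe_coe,
    TensorProduct.mk_apply, TensorProduct.map_tmul, consA_bl, concat_bl h hb]

/-- The product `β ⋆ α` of a chain with coefficients and a chain. -/
noncomputable def FrobeniusForm.mulR (N : Bimod k A) {p q t : ℕ} (h : p + (q + 1) = t) :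
    Chain k A p →ₗ[k] Chn N q →ₗ[k] Chn N t :=
  TensorProduct.lift <| LinearMap.mk₂ k
    (fun a x => ∑ i, TensorProduct.map (N.r a ∘ₗ N.r (F.v i))
      ((concat k A h).toLinearMap ∘ₗ
        (TensorProduct.mk k _ _ x) ∘ₗ (consA k q (F.u i))))
    (fun a a' x => by
      simp [LinearMap.add_comp, TensorProduct.map_add_left, Finset.sum_add_distrib])
    (fun c a x => by
      simp [LinearMap.smul_comp, TensorProduct.map_smul_left, Finset.smul_sum])
    (fun a x x' => by
      simp [LinearMap.comp_add, LinearMap.add_comp, TensorProduct.map_add_right,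
        Finset.sum_add_distrib])
    (fun c a x => by
      simp [LinearMap.comp_smul, LinearMap.smul_comp, TensorProduct.map_smul_right,
        Finset.smul_sum])

/-- As with `evL`, the letter `uᵢ ν(n)` of the original formula is traded for `uᵢ` with `n` moved in
front of `vᵢ`. -/
theorem FrobeniusForm.mulR_bl (N : Bimod k A) {p q t : ℕ} (h : p + (q + 1) = t)
    (a : A) (n : N) (l b : List A) (hl : l.length = p) :
    F.mulR N h (a ⊗ₜ bl k p l) (n ⊗ₜ bl k q b) =
      ∑ i, N.r a (N.r (F.v i) n) ⊗ₜ bl k t (l ++ F.u i :: b) := by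
  simp only [FrobeniusForm.mulR, TensorProduct.lift.tmul, LinearMap.flip_apply, LinearMap.coe_mk,
    AddHom.coe_mk,
    LinearMap.mk₂_apply, LinearMap.sum_apply, LinearMap.comp_apply, LinearMap.flip_apply, LinearEquiv.coe_coe,
    TensorProduct.mk_apply, TensorProduct.map_tmul, consA_bl, concat_bl h hl]

end Right

end Coefficients

/-! ### Leibniz rules -/

section Lists

theorem exists_split {A : Type*} {l : List A} {m n : ℕ} (h : l.length = m + n) :
    ∃ l₁ l₂ : List A, l = l₁ ++ l₂ ∧ l₁.length = m ∧ l₂.length = n :=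
  ⟨l.take m, l.drop m, by simp, by simp; omega, by simp; omega⟩

theorem exists_split_cons {A : Type*} {l : List A} {m n : ℕ} (h : l.length = m + n + 1) :
    ∃ (l₁ : List A) (x : A) (l₂ : List A), l = l₁ ++ x :: l₂ ∧ l₁.length = m ∧ l₂.length = n := by
  obtain ⟨l₁, l₂, rfl, h₁, h₂⟩ := exists_split (l := l) (m := m) (n := n + 1) (by omega)
  obtain ⟨x, l₂, rfl⟩ := List.exists_cons_of_length_eq_add_one h₂
  exact ⟨l₁, x, l₂, rfl, h₁, by simpa using h₂⟩

theorem exists_head {A : Type*} (l : List A) (x : A) :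
    ∃ (a : A) (t : List A), l ++ [x] = a :: t ∧ t.length = l.length := by
  cases l with
  | nil => exact ⟨x, [], by simp⟩
  | cons a l => exact ⟨a, l ++ [x], by simp⟩

theorem exists_last {A : Type*} (x : A) (l : List A) :
    ∃ (i : List A) (z : A), x :: l = i ++ [z] ∧ i.length = l.length := by
  rcases List.eq_nil_or_concat l with rfl | ⟨i, z, rfl⟩
  · exact ⟨[], x, by simp⟩
  · exact ⟨x :: i, z, by simp⟩

end Lists

variable {k : Type u} {A : Type v} [Field k] [Ring A] [Algebra k A]

section Cup

variable (N : Bimod k A)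

/-- With the word cut as `l₁ x l₂`, the inner sum splits at `x`. The term `f(l₁) x g(l₂)` occurs
once in `δf` and once in `δg`, with opposite signs. -/
theorem deltaN_cupL {m n t m' n' t' : ℕ} (h : m + n = t) (ht : t + 1 = t') (hm : m + 1 = m')
    (hn : n + 1 = n') (h₁ : m' + n = t') (h₂ : m + n' = t') (f : Cochain k A m) (g : Coch N n) :
    deltaN N ht (cupL N h f g) = cupL N h₁ (deltaA hm f) g
      + (-1 : k) ^ m • cupL N h₂ f (deltaN N hn g) := by
  subst hm hn
  refine bl_hom_ext fun l hl => ?_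
  obtain ⟨l₁, x, l₂, rfl, hl₁, hl₂⟩ := exists_split_cons (l := l) (m := m) (n := n) (by omega)
  obtain ⟨a, t₁, e₁, ht₁⟩ := exists_head l₁ x
  obtain ⟨i₂, z, e₂, hi₂⟩ := exists_last x l₂
  have d₁ : l₁ ++ x :: l₂ = a :: (t₁ ++ l₂) := by rw [← List.cons_append, ← e₁]; simp
  have d₂ : l₁ ++ x :: l₂ = (l₁ ++ i₂) ++ [z] := by rw [e₂]; simp
  have d₃ : l₁ ++ x :: l₂ = (l₁ ++ [x]) ++ l₂ := by simp
  rw [deltaN_bl N ht _ d₁ d₂ (by simp; omega), mid_append_cons (k := k), LinearMap.add_apply,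
    LinearMap.smul_apply, cupL_bl N h₁ _ _ d₃ (by simp; omega), cupL_bl N h₂ _ _ rfl hl₁,
    cupL_bl N h _ _ rfl (by omega), cupL_bl N h _ _ rfl hl₁,
    deltaA_bl rfl f e₁ rfl (by omega), deltaN_bl N rfl g rfl e₂ (by omega)]
  rw [mid_eq_map (N.l.flip (g (bl k n l₂))) (ψ := fun w => f (bl k m w))
      (fun w hw => cupL_bl N h _ _ rfl (by simp at hw; omega)),
    mid_eq_map (N.l (f (bl k m l₁))) (ψ := fun w => g (bl k n w))
      (fun w hw => cupL_bl N h _ _ rfl hl₁)]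
  have e : (-1 : k) ^ (t + 1) = (-1) ^ m * (-1) ^ (n + 1) := by rw [← h, ← pow_add, add_assoc]
  simp only [LinearMap.mul_apply', LinearMap.flip_apply, map_add, map_smul, LinearMap.add_apply,
    LinearMap.smul_apply, N.mul_l, N.l_r, hl₁, e]
  -- Only the parities of the exponents matter; in each of the four cases a linear identity with
  -- coefficients `±1` remains.
  rcases neg_one_pow_eq_or k m with h | h <;> rcases neg_one_pow_eq_or k n with h' | h' <;>
    simp only [pow_succ, h, h'] <;> module

/-- The cocycle condition solved for its inner sum. This is how it enters the Leibniz rules: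
contractions inside the arguments of `f` are exchanged for outer terms. -/
theorem mid_of_cocycle {m : ℕ} {f : Cochain k A m} (hf : deltaA rfl f = 0) {a z : A}
    {l t i : List A} (ht : l = a :: t) (hi : l = i ++ [z]) (hl : t.length = m) :
    mid (fun w => f (bl k m w)) l =
      -(a * f (bl k m t)) - (-1 : k) ^ (m + 1) • (f (bl k m i) * z) := by
  have := deltaA_bl rfl f ht hi hl
  rw [hf, LinearMap.zero_apply] at this
  rw [eq_sub_iff_add_eq, eq_neg_iff_add_eq_zero, this]
  abel

/-- Contractions among the letters `x l₂` fed to `f` become two outer terms by the cocycle relation.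
One of them, `x f(l₂)`, is the last term of the boundary after capping; the other cancels the last
term of the boundary before capping. -/
theorem partN_capL (σ : A ≃ₐ[k] A) {m p q p' q' : ℕ} (hp : p + 1 = p') (hq : q + 1 = q')
    (h : q + m = p) (h' : q' + m = p') {f : Cochain k A m} (hf : deltaA rfl f = 0) :
    partN σ N hq ∘ₗ capL N h' f = capL N h f ∘ₗ partN σ N hp := by
  subst hp hq
  refine chn_hom_ext fun n l hl => ?_
  obtain ⟨l₁, x, l₂, rfl, hl₁, hl₂⟩ := exists_split_cons (l := l) (m := q) (n := m) (by omega)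
  obtain ⟨a, t₁, e₁, ht₁⟩ := exists_head l₁ x
  obtain ⟨i₂, z, e₂, hi₂⟩ := exists_last x l₂
  have d₁ : l₁ ++ x :: l₂ = a :: (t₁ ++ l₂) := by rw [← List.cons_append, ← e₁]; simp
  have d₂ : l₁ ++ x :: l₂ = (l₁ ++ i₂) ++ [z] := by rw [e₂]; simp
  have d₃ : l₁ ++ x :: l₂ = (l₁ ++ [x]) ++ l₂ := by simp
  rw [LinearMap.comp_apply, LinearMap.comp_apply, capL_bl N h' f n d₃ (by simp; omega),
    partN_bl σ N rfl _ e₁ rfl (by omega), partN_bl σ N rfl n d₁ d₂ (by simp; omega), map_add,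
    map_add, map_mid, map_smul, mid_append_cons (k := k) (fun w => capL N h f (n ⊗ₜ bl k p w)),
    capL_bl N h f _ rfl (by omega), capL_bl N h f _ rfl (by omega),
    mid_eq_map ((TensorProduct.mk k N _).flip (bl k q l₁) ∘ₗ N.l.flip n)
      (ψ := fun w => f (bl k m w)) (fun w hw => capL_bl N h f n rfl hl₁),
    mid_congr (φ := fun w => capL N h f (n ⊗ₜ bl k p (w ++ l₂)))
      (fun w hw => capL_bl N h f n rfl (by simp at hw; omega)),
    mid_of_cocycle hf rfl e₂ hl₂]
  simp only [LinearMap.comp_apply, map_sub, map_neg, map_smul, LinearMap.flip_apply,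
    TensorProduct.mk_apply, N.mul_l, N.l_r, ← h, hl₁]
  rcases neg_one_pow_eq_or k m with h | h <;> rcases neg_one_pow_eq_or k q with h' | h' <;>
    simp only [pow_succ, pow_add, h, h'] <;> module

variable [FiniteDimensional k A] (F : FrobeniusForm k A)

/-- The first term of `∂` carries `x ν⁻¹(a)`. Moved through the Casimir element, the factor becomes
the letter `uⱼ a`, so the term is the first contraction of the word `uⱼ l`. This is what the twist
by `ν⁻¹` is for. -/
theorem FrobeniusForm.evL_partN_bl {n p m p' : ℕ} (h : n + (p + 1) = m) (hp : p + 1 = p')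
    (f : Cochain k A m) (x : N) {l i b : List A} {z : A} (hi : l = i ++ [z]) (hb : b.length = n)
    (hl : l.length = p') :
    F.evL N h f (partN F.nakayama.symm N hp (x ⊗ₜ bl k p' l)) (bl k n b) =
      ∑ j, N.r (F.v j) (N.l (-mid (fun w => f (bl k m (b ++ w))) (F.u j :: l)
        + (-1 : k) ^ (p + 1) • (f (bl k m (b ++ F.u j :: i)) * z)) x) := by
  subst hp
  obtain ⟨a, t, rfl⟩ := List.exists_cons_of_length_eq_add_one hl
  have hbm : b.length < m := by omega
  have c := F.casimir_mul_nakayama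
    (N.r.flip ∘ₗ N.l.flip x ∘ₗ f ∘ₗ slot k b t hbm) (F.nakayama.symm a)
  simp only [LinearMap.comp_apply, LinearMap.flip_apply, slot_apply, AlgEquiv.apply_symm_apply,
    N.mul_r] at c
  rw [partN_bl _ N rfl x rfl hi (by simpa using hl), map_add, map_add, map_smul, map_mid,
    LinearMap.add_apply, LinearMap.add_apply, LinearMap.smul_apply,
    F.evL_bl N h f _ _ _ hb, F.evL_bl N h f _ _ _ hb,
    ← LinearMap.applyₗ_apply_apply (bl k n b) (mid _ _), map_mid]
  simp only [LinearMap.applyₗ_apply_apply, F.evL_bl N h f _ _ _ hb, mid_sum, N.l_r, ← c]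
  rw [Finset.smul_sum, ← Finset.sum_add_distrib, ← Finset.sum_add_distrib]
  refine Finset.sum_congr rfl fun j _ => ?_
  rw [mid_eq_map (N.r (F.v j) ∘ₗ N.l.flip x)
    (φ := fun w => N.r (F.v j) (N.l (f (bl k m (b ++ F.u j :: w))) x))
    (ψ := fun w => f (bl k m (b ++ F.u j :: w)))
    (fun w hw => rfl), mid_cons_cons]
  simp only [LinearMap.comp_apply, map_sub, map_neg, map_smul, map_add, LinearMap.add_apply,
    LinearMap.neg_apply, LinearMap.sub_apply, LinearMap.smul_apply, LinearMap.flip_apply, N.mul_l]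
  abel

/-- The last term of `δ` carries `vⱼ z`, which `casimir_mul` turns into the letter `z uⱼ`: the last
contraction of the word `b uⱼ`. -/
theorem FrobeniusForm.deltaN_evL_bl {n p m n' : ℕ} (h : n + (p + 1) = m) (hn : n + 1 = n')
    (f : Cochain k A m) (x : N) {b₀ : A} {l b b' : List A} (hb : b = b₀ :: b')
    (hb' : b'.length = n) :
    deltaN N hn (F.evL N h f (x ⊗ₜ bl k p l)) (bl k n' b) =
      ∑ j, N.r (F.v j) (N.l (b₀ * f (bl k m (b' ++ F.u j :: l))
        + mid (fun w => f (bl k m (w ++ l))) (b ++ [F.u j])) x) := by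
  obtain ⟨i, z, e, hi⟩ := exists_last b₀ b'
  have him : i.length < m := by omega
  have c := F.casimir_mul
    (N.r.flip ∘ₗ N.l.flip x ∘ₗ f ∘ₗ slot k i l him) z
  simp only [LinearMap.comp_apply, LinearMap.flip_apply, slot_apply, N.mul_r] at c
  rw [deltaN_bl N hn _ hb (hb.trans e) hb', F.evL_bl N h f _ _ _ hb',
    F.evL_bl N h f _ _ _ (hi.trans hb'), mid_congr fun w hw => F.evL_bl N h f _ _ _
      (by simp [hb] at hw; omega)]
  simp only [mid_sum, map_sum]
  rw [← c, Finset.smul_sum, ← Finset.sum_add_distrib, ← Finset.sum_add_distrib]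
  refine Finset.sum_congr rfl fun j _ => ?_
  rw [mid_eq_map (N.r (F.v j) ∘ₗ N.l.flip x)
    (φ := fun w => N.r (F.v j) (N.l (f (bl k m (w ++ F.u j :: l))) x))
    (ψ := fun w => f (bl k m (w ++ F.u j :: l)))
    (fun w hw => rfl), hb, e, List.append_assoc, List.singleton_append,
    mid_append_cons (k := k) (fun w => f (bl k m (w ++ l)))]
  simp only [mid_cons_cons, mid_singleton, LinearMap.comp_apply, map_sub, map_neg, map_smul,
    map_add, map_zero, LinearMap.add_apply, LinearMap.neg_apply, LinearMap.sub_apply,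
    LinearMap.zero_apply, LinearMap.smul_apply, LinearMap.flip_apply, N.mul_l, N.l_r,
    List.append_assoc, List.singleton_append, List.cons_append, List.nil_append, hi, hb', pow_succ]
  module

/-- The place where products cross from chains to cochains. In the cocycle relation of `f` on the
word `uⱼ l`, the outer term `uⱼ f(l)` produces the norm of the capped chain. -/
theorem FrobeniusForm.normN_capL {p m : ℕ} (hp : p + 1 = m) (h : 0 + m = m)
    (h' : 0 + (p + 1) = m) {f : Cochain k A m} (hf : deltaA rfl f = 0) :
    F.normN N ∘ₗ capL N h f = F.evL N h' f ∘ₗ partN F.nakayama.symm N hp := by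
  refine chn_hom_ext fun x l hl => coch_zero_ext ?_
  obtain ⟨a, t, rfl⟩ := List.exists_cons_of_length_eq_add_one (hl.trans hp.symm)
  obtain ⟨i, z, e, hi⟩ := exists_last a t
  rw [LinearMap.comp_apply, LinearMap.comp_apply, F.evL_partN_bl N h' hp f x e rfl hl,
    capL_bl N h f x (List.nil_append _).symm rfl, F.normN_bl]
  refine Finset.sum_congr rfl fun j _ => ?_
  simp only [List.nil_append]
  rw [mid_of_cocycle hf rfl (i := F.u j :: i) (z := z) (by rw [e]; simp) hl]
  subst hp
  simp only [map_sub, map_neg, map_smul, map_add, LinearMap.add_apply, LinearMap.neg_apply,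
    LinearMap.sub_apply, LinearMap.smul_apply, N.mul_l, N.l_r, pow_succ]
  module

theorem FrobeniusForm.normN_capL_zero (h : 0 + 0 = 0) {f : Cochain k A 0}
    (hf : deltaA rfl f = 0) :
    F.normN N ∘ₗ capL N h f = cupL N h f ∘ₗ F.normN N := by
  refine chn_hom_ext fun x l hl => coch_zero_ext ?_
  rw [List.length_eq_zero_iff.1 hl, LinearMap.comp_apply, LinearMap.comp_apply,
    capL_bl N h f x (List.nil_append _).symm rfl, F.normN_bl,
    cupL_bl N h _ _ (List.nil_append _).symm rfl, F.normN_bl, map_sum]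
  refine Finset.sum_congr rfl fun j _ => ?_
  have := mid_of_cocycle hf (a := F.u j) (l := [F.u j]) rfl (List.nil_append _).symm rfl
  simp only [mid_singleton, zero_add, pow_one, neg_smul, one_smul, sub_neg_eq_add] at this
  simp only [N.l_r, ← N.mul_l, neg_add_eq_zero.1 this.symm]

/-- Both sides are pieces of the cocycle relation of `f` on the one word `b uⱼ l`: contractions to
the left of `uⱼ` belong to `δ`, those to the right belong to `∂`. -/
theorem FrobeniusForm.deltaN_evL {n p m n' p' : ℕ} (h : n + (p' + 1) = m) (hn : n + 1 = n')
    (hp : p + 1 = p') (h' : n' + (p + 1) = m) {f : Cochain k A m} (hf : deltaA rfl f = 0) :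
    deltaN N hn ∘ₗ F.evL N h f = (-1 : k) ^ n' • (F.evL N h' f ∘ₗ partN F.nakayama.symm N hp) := by
  refine chn_hom_ext fun x l hl => bl_hom_ext fun b hb => ?_
  obtain ⟨b₀, b', rfl⟩ := List.exists_cons_of_length_eq_add_one (hb.trans hn.symm)
  obtain ⟨a, t, rfl⟩ := List.exists_cons_of_length_eq_add_one (hl.trans hp.symm)
  obtain ⟨i, z, e, hi⟩ := exists_last a t
  rw [LinearMap.comp_apply, LinearMap.smul_apply, LinearMap.comp_apply, LinearMap.smul_apply,
    F.evL_partN_bl N h' hp f x e hb hl,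
    F.deltaN_evL_bl N h hn f x rfl (by simp at hb; omega), Finset.smul_sum]
  refine Finset.sum_congr rfl fun j _ => ?_
  have c := mid_of_cocycle hf (a := b₀) (l := b₀ :: b' ++ F.u j :: a :: t)
    (t := b' ++ F.u j :: a :: t) (i := b₀ :: b' ++ F.u j :: i) (z := z) rfl (by rw [e]; simp)
    (by simp at hb hl ⊢; omega)
  rw [mid_append_cons (k := k), hb] at c
  rw [eq_sub_of_add_eq c]
  have e' : (-1 : k) ^ (m + 1) = (-1) ^ n' * (-1) ^ p := by
    rw [← h', ← pow_add, pow_succ, ← add_assoc, pow_succ]; simp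
  simp only [map_sub, map_neg, map_smul, map_add, LinearMap.add_apply, LinearMap.neg_apply,
    LinearMap.sub_apply, LinearMap.smul_apply, N.mul_l, N.l_r, e']
  rcases neg_one_pow_eq_or k n' with h | h <;> rcases neg_one_pow_eq_or k p with h' | h' <;>
    simp only [pow_succ, h, h'] <;> module

theorem FrobeniusForm.deltaN_evL_zero {m n : ℕ} (h : n + (0 + 1) = m) (h' : m + 0 = m)
    {f : Cochain k A m} (hf : deltaA rfl f = 0) :
    deltaN N h ∘ₗ F.evL N h f = (-1 : k) ^ m • (cupL N h' f ∘ₗ F.normN N) := by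
  refine chn_hom_ext fun x l hl => bl_hom_ext fun b hb => ?_
  obtain ⟨b₀, b', rfl⟩ := List.exists_cons_of_length_eq_add_one (hb.trans h.symm)
  obtain rfl := List.length_eq_zero_iff.1 hl
  rw [LinearMap.comp_apply, LinearMap.smul_apply, LinearMap.comp_apply, LinearMap.smul_apply,
    F.deltaN_evL_bl N h h f x rfl (by simp at hb; omega),
    cupL_bl N h' _ _ (List.append_nil _).symm hb, F.normN_bl, map_sum, Finset.smul_sum]
  refine Finset.sum_congr rfl fun j _ => ?_
  have c := mid_of_cocycle hf (a := b₀) (l := b₀ :: b' ++ [F.u j])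
    (t := b' ++ [F.u j]) (i := b₀ :: b') (z := F.u j) rfl rfl (by simp at hb ⊢; omega)
  simp only [List.append_nil]
  rw [c]
  simp only [map_sub, map_neg, map_smul, map_add, LinearMap.add_apply, LinearMap.neg_apply,
    LinearMap.sub_apply, LinearMap.smul_apply, N.mul_l, N.l_r, pow_succ]
  module

end Cup

/-! ### Right cup products, and chains multiplying cochains from the left. -/

section ChainProducts

variable {k : Type u} {A : Type v} [Field k] [Ring A] [Algebra k A] (N : Bimod k A)

theorem chain_hom_ext {M : Type*} [AddCommGroup M] [Module k M] {p : ℕ}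
    {f g : Chain k A p →ₗ[k] M}
    (h : ∀ (a : A) (l : List A), l.length = p → f (a ⊗ₜ bl k p l) = g (a ⊗ₜ bl k p l)) : f = g :=
  chn_hom_ext (N := Bimod.self k A) h

theorem deltaN_cupR {m n t n' t' : ℕ} (h : n + m = t) (ht : t + 1 = t')
    (hn : n + 1 = n') (h' : n' + m = t') {f : Cochain k A m} (hf : deltaA rfl f = 0)
    (g : Coch N n) :
    deltaN N ht (cupR N h f g) = cupR N h' f (deltaN N hn g) := by
  subst hn
  refine bl_hom_ext fun l hl => ?_
  obtain ⟨l₁, x, l₂, rfl, hl₁, hl₂⟩ := exists_split_cons (l := l) (m := n) (n := m) (by omega)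
  obtain ⟨a, t₁, e₁, ht₁⟩ := exists_head l₁ x
  obtain ⟨i₂, z, e₂, hi₂⟩ := exists_last x l₂
  have d₁ : l₁ ++ x :: l₂ = a :: (t₁ ++ l₂) := by rw [← List.cons_append, ← e₁]; simp
  have d₂ : l₁ ++ x :: l₂ = (l₁ ++ i₂) ++ [z] := by rw [e₂]; simp
  have d₃ : l₁ ++ x :: l₂ = (l₁ ++ [x]) ++ l₂ := by simp
  rw [deltaN_bl N ht _ d₁ d₂ (by simp; omega), mid_append_cons (k := k),
    cupR_bl N h' _ _ d₃ (by simp; omega),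
    cupR_bl N h _ _ rfl (by omega), cupR_bl N h _ _ rfl hl₁,
    deltaN_bl N rfl g e₁ rfl (by omega)]
  rw [mid_eq_map (N.r (f (bl k m l₂))) (ψ := fun w => g (bl k n w))
      (fun w hw => cupR_bl N h _ _ rfl (by simp at hw; omega)),
    mid_eq_map (N.r.flip (g (bl k n l₁))) (ψ := fun w => f (bl k m w))
      (fun w hw => cupR_bl N h _ _ rfl hl₁), mid_of_cocycle hf rfl e₂ hl₂]
  have e : (-1 : k) ^ (t + 1) = (-1) ^ n * (-1) ^ (m + 1) := by rw [← h, ← pow_add, add_assoc]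
  simp only [LinearMap.flip_apply, map_add, map_smul, map_sub, map_neg, LinearMap.add_apply,
    LinearMap.smul_apply, N.mul_r, N.l_r, hl₁, e]
  rcases neg_one_pow_eq_or k m with h | h <;> rcases neg_one_pow_eq_or k n with h' | h' <;>
    simp only [pow_succ, h, h'] <;> module

variable [FiniteDimensional k A] (F : FrobeniusForm k A)

/-- The letters left over by the cap product have been moved by `ν`, so the `ν⁻¹` of the boundary
map cancels and the first of them, `x`, acts on the value of `f` as itself. This gives the right
outer term of `δf`. -/
theorem FrobeniusForm.partN_capA {m p q m' p' q' : ℕ} (hm : m + 1 = m') (hp : p + 1 = p')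
    (hq : q + 1 = q') (h : m + q = p) (h₁ : m + q' = p') (h₂ : m' + q = p') (α : Chain k A p')
    (f : Coch N m) :
    (-1 : k) ^ m • partN F.nakayama.symm N hq (F.capA N h₁ α f) =
      F.capA N h (partA F.nakayama.symm hp α) f - F.capA N h₂ α (deltaN N hm f) := by
  subst hm hp hq
  suffices H : (-1 : k) ^ m • partN F.nakayama.symm N rfl ∘ₗ (F.capA N h₁).flip f =
      (F.capA N h).flip f ∘ₗ partA F.nakayama.symm rfl - (F.capA N h₂).flip (deltaN N rfl f) from
    LinearMap.congr_fun H α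
  refine chain_hom_ext fun a l hl => ?_
  obtain ⟨l₁, x, l₂, rfl, hl₁, hl₂⟩ := exists_split_cons (l := l) (m := m) (n := q) (by omega)
  obtain ⟨y, t₁, e₁, ht₁⟩ := exists_head l₁ x
  obtain ⟨i₂, z, e₂, hi₂⟩ := exists_last x l₂
  have d₁ : l₁ ++ x :: l₂ = y :: (t₁ ++ l₂) := by rw [← List.cons_append, ← e₁]; simp
  have d₂ : l₁ ++ x :: l₂ = (l₁ ++ i₂) ++ [z] := by rw [e₂]; simp
  have d₃ : l₁ ++ x :: l₂ = (l₁ ++ [x]) ++ l₂ := by simp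
  have e₃ : (x :: l₂).map F.nakayama = i₂.map F.nakayama ++ [F.nakayama z] := by rw [e₂]; simp
  simp only [LinearMap.smul_apply, LinearMap.comp_apply, LinearMap.sub_apply, LinearMap.flip_apply]
  rw [F.capA_bl N h₁ f a rfl hl₁, F.capA_bl N h₂ _ a d₃ (by simp; omega),
    partN_bl _ N rfl _ (List.map_cons ..) e₃ (by simp; omega), partA_bl _ rfl a d₁ d₂ (by simp; omega),
    deltaN_bl N rfl f e₁ rfl (by omega), map_add, map_add, map_smul, LinearMap.add_apply,
    LinearMap.add_apply, LinearMap.smul_apply, F.capA_bl N h f _ rfl (by omega),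
    F.capA_bl N h f _ rfl (by omega), ← LinearMap.flip_apply (F.capA N h), map_mid,
    mid_append_cons (k := k) (fun w => (F.capA N h).flip f (a ⊗ₜ bl k p w)), mid_map,
    mid_eq_map ((TensorProduct.mk k N _).flip (bl k q (l₂.map F.nakayama)) ∘ₗ N.l (F.nakayama a))
      (φ := fun w => (F.capA N h).flip f (a ⊗ₜ bl k p (w ++ l₂)))
      (ψ := fun w => f (bl k m w)) (fun w hw => F.capA_bl N h f a rfl (by simp at hw; omega)),
    mid_congr (φ := fun w => (F.capA N h).flip f (a ⊗ₜ bl k p (l₁ ++ w)))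
      (fun w hw => F.capA_bl N h f a rfl hl₁)]
  simp only [LinearMap.comp_apply, map_mul, AlgEquiv.symm_apply_apply, AlgEquiv.apply_symm_apply,
    LinearMap.flip_apply, TensorProduct.mk_apply, N.mul_l, N.l_r, ← h, hl₁, map_add, map_smul,
    TensorProduct.add_tmul, ← TensorProduct.smul_tmul']
  rcases neg_one_pow_eq_or k m with h | h <;> rcases neg_one_pow_eq_or k q with h' | h' <;>
    simp only [pow_succ, pow_add, h, h'] <;> module

/-- Under `ν` the first outer term of `∂` contributes `ν(a) y` and the last one `ν(z) ν(a)`. The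
Casimir identity turns the factor `ν(z)` into the letter `z vⱼ`, which completes the inner sum of `l
vⱼ`. -/
theorem FrobeniusForm.evA_partA_bl {n p m p' : ℕ} (h : p + (n + 1) = m) (hp : p + 1 = p')
    (f : Coch N m) (a : A) {l t b : List A} {y : A} (hy : l = y :: t) (hl : l.length = p') :
    b.length = n →
    F.evA N h (partA F.nakayama.symm hp (a ⊗ₜ bl k p' l)) f (bl k n b) =
      ∑ j, N.l (F.u j * F.nakayama a) (N.l y (f (bl k m (t ++ F.v j :: b)))
        + mid (fun w => f (bl k m (w ++ b))) (l ++ [F.v j])) := by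
  intro hb
  subst hp hy
  obtain ⟨i, z, e, hi⟩ := exists_last y t
  have hit : i.length = p := hi.trans (by simpa using hl)
  have him : i.length < m := by omega
  have c := F.casimir_mul_nakayama
    ((N.l ∘ₗ LinearMap.mulRight k (F.nakayama a)).compl₂ (f ∘ₗ slot k i b him)) z
  simp only [LinearMap.compl₂_apply, LinearMap.comp_apply, slot_apply, LinearMap.mulRight_apply]
    at c
  have hmid : F.evA N h (mid (fun w => a ⊗ₜ[k] bl k p w) (y :: t)) f (bl k n b) =
      mid (fun w => ∑ j, N.l (F.u j * F.nakayama a) (f (bl k m (w ++ F.v j :: b)))) (y :: t) :=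
    (map_mid (LinearMap.applyₗ (bl k n b) ∘ₗ (F.evA N h).flip f) _ _).trans
      (mid_congr fun w hw => F.evA_bl N h f a _ b (by simp at hw hl; omega))
  rw [partA_bl _ rfl a rfl e (by simpa using hl), map_add, map_add, map_smul,
    LinearMap.add_apply, LinearMap.add_apply, LinearMap.smul_apply, LinearMap.add_apply,
    LinearMap.add_apply, LinearMap.smul_apply,
    F.evA_bl N h f _ _ _ (by simpa using hl), F.evA_bl N h f _ _ _ hit,
    hmid]
  simp only [mid_sum, map_mul, AlgEquiv.apply_symm_apply]
  simp only [← mul_assoc] at c ⊢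
  rw [c, Finset.smul_sum, ← Finset.sum_add_distrib, ← Finset.sum_add_distrib]
  refine Finset.sum_congr rfl fun j _ => ?_
  rw [mid_eq_map (N.l (F.u j * F.nakayama a))
    (ψ := fun w => f (bl k m (w ++ F.v j :: b))) (fun w hw => rfl), e, List.append_assoc,
    List.singleton_append, mid_append_cons (k := k) (fun w => f (bl k m (w ++ b)))]
  simp only [mid_cons_cons, mid_singleton, map_sub, map_neg, map_smul, map_add, map_zero, N.mul_l,
    List.append_assoc, List.cons_append, List.nil_append, hit, pow_succ]
  module

theorem FrobeniusForm.deltaN_evA_bl {n p m n' : ℕ} (h : p + (n + 1) = m) (hn : n + 1 = n')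
    (f : Coch N m) (a : A) {l b i : List A} {z : A} (hi : b = i ++ [z]) (hl : l.length = p)
    (hb : b.length = n') :
    deltaN N hn (F.evA N h (a ⊗ₜ bl k p l) f) (bl k n' b) =
      ∑ j, N.l (F.u j * F.nakayama a) (-mid (fun w => f (bl k m (l ++ w))) (F.v j :: b)
        + (-1 : k) ^ n' • N.r z (f (bl k m (l ++ F.v j :: i)))) := by
  subst hn
  obtain ⟨b₀, b', rfl⟩ := List.exists_cons_of_length_eq_add_one hb
  have him : l.length < m := by omega
  have c := F.casimir_mul
    ((N.l ∘ₗ LinearMap.mulRight k (F.nakayama a)).compl₂ (f ∘ₗ slot k l b' him)) b₀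
  simp only [LinearMap.compl₂_apply, LinearMap.comp_apply, slot_apply, LinearMap.mulRight_apply]
    at c
  rw [deltaN_bl N rfl _ rfl hi (by simpa using hb), F.evA_bl N h f _ _ _ hl,
    F.evA_bl N h f _ _ _ hl,
    mid_congr (φ := fun w => F.evA N h (a ⊗ₜ bl k p l) f (bl k n w))
      fun w hw => F.evA_bl N h f _ _ _ hl]
  simp only [mid_sum, map_sum, ← N.mul_l]
  simp only [mul_assoc] at c ⊢
  rw [c, Finset.smul_sum, ← Finset.sum_add_distrib, ← Finset.sum_add_distrib]
  refine Finset.sum_congr rfl fun j _ => ?_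
  rw [mid_eq_map (N.l (F.u j * F.nakayama a))
    (ψ := fun w => f (bl k m (l ++ F.v j :: w))) (fun w hw => rfl), mid_cons_cons]
  simp only [map_sub, map_neg, map_smul, map_add, N.l_r]
  module

theorem FrobeniusForm.normN_capA {p m m' : ℕ} (hp : p + 1 = m) (hm : m + 1 = m') (h : m + 0 = m)
    (h₁ : p + (0 + 1) = m) (h₂ : m + (0 + 1) = m') (α : Chain k A m) (f : Coch N m) :
    (-1 : k) ^ m • F.normN N (F.capA N h α f) =
      F.evA N h₁ (partA F.nakayama.symm hp α) f - F.evA N h₂ α (deltaN N hm f) := by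
  suffices H : (-1 : k) ^ m • F.normN N ∘ₗ (F.capA N h).flip f =
      (F.evA N h₁).flip f ∘ₗ partA F.nakayama.symm hp - (F.evA N h₂).flip (deltaN N hm f) from
    LinearMap.congr_fun H α
  refine chain_hom_ext fun a l hl => coch_zero_ext ?_
  obtain ⟨y, t, rfl⟩ := List.exists_cons_of_length_eq_add_one (hl.trans hp.symm)
  simp only [LinearMap.smul_apply, LinearMap.comp_apply, LinearMap.sub_apply, LinearMap.flip_apply]
  rw [F.capA_bl N h f a (List.append_nil _).symm hl, List.map_nil, F.normN_bl,
    F.evA_partA_bl N h₁ hp f a rfl hl rfl, F.evA_bl N h₂ _ a _ _ hl, Finset.smul_sum,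
    ← Finset.sum_sub_distrib]
  refine Finset.sum_congr rfl fun j _ => ?_
  rw [deltaN_bl N hm f (l := y :: t ++ [F.v j]) (t := t ++ [F.v j]) rfl rfl (by simp at hl ⊢; omega)]
  simp only [List.append_nil, map_add, map_smul, pow_succ, N.mul_l, N.l_r]
  module

theorem FrobeniusForm.deltaN_evA {n p m n' p' m' : ℕ} (h : p' + (n + 1) = m) (hn : n + 1 = n')
    (hp : p + 1 = p') (hm : m + 1 = m') (h₁ : p + (n' + 1) = m) (h₂ : p' + (n' + 1) = m')
    (α : Chain k A p') (f : Coch N m) :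
    (-1 : k) ^ p' • deltaN N hn (F.evA N h α f) =
      F.evA N h₁ (partA F.nakayama.symm hp α) f - F.evA N h₂ α (deltaN N hm f) := by
  suffices H : (-1 : k) ^ p' • deltaN N hn ∘ₗ (F.evA N h).flip f =
      (F.evA N h₁).flip f ∘ₗ partA F.nakayama.symm hp - (F.evA N h₂).flip (deltaN N hm f) from
    LinearMap.congr_fun H α
  refine chain_hom_ext fun a l hl => bl_hom_ext fun b hb => ?_
  obtain ⟨y, t, rfl⟩ := List.exists_cons_of_length_eq_add_one (hl.trans hp.symm)
  obtain ⟨b₀, b', rfl⟩ := List.exists_cons_of_length_eq_add_one (hb.trans hn.symm)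
  obtain ⟨i, z, e, hi⟩ := exists_last b₀ b'
  simp only [LinearMap.smul_apply, LinearMap.comp_apply, LinearMap.sub_apply, LinearMap.flip_apply]
  rw [F.deltaN_evA_bl N h hn f a e hl hb,
    F.evA_partA_bl N h₁ hp f a rfl hl hb, F.evA_bl N h₂ _ a _ _ hl, Finset.smul_sum,
    ← Finset.sum_sub_distrib]
  refine Finset.sum_congr rfl fun j _ => ?_
  rw [deltaN_bl N hm f (l := y :: t ++ F.v j :: b₀ :: b') (a := y) (t := t ++ F.v j :: b₀ :: b') (i := y :: t ++ F.v j :: i) (z := z) rfl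
    (by rw [e]; simp) (by simp at hl hb ⊢; omega), mid_append_cons (k := k) (fun w => f (bl k m w))]
  have e' : (-1 : k) ^ (m + 1) = -((-1) ^ n' * (-1) ^ p') := by
    rw [← h, ← hn, ← pow_add, pow_succ, add_comm p']; simp
  simp only [map_add, map_smul, map_neg, hl, e']
  rcases neg_one_pow_eq_or k p' with h | h <;> rcases neg_one_pow_eq_or k n' with h' | h' <;>
    simp only [pow_succ, h, h'] <;> module

omit [FiniteDimensional k A] in
theorem chn_zero_exists {N : Bimod k A} (α : Chn N 0) : ∃ n : N, α = n ⊗ₜ bl k 0 [] := by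
  induction α using TensorProduct.induction_on with
  | zero => exact ⟨0, by simp⟩
  | tmul n x =>
    have : x = PiTensorProduct.isEmptyEquiv (Fin 0) x • bl k 0 ([] : List A) := by
      apply (PiTensorProduct.isEmptyEquiv (Fin 0)).injective
      simp [bl, barTensor]
    exact ⟨PiTensorProduct.isEmptyEquiv (Fin 0) x • n, by
      conv_lhs => rw [this]
      rw [TensorProduct.tmul_smul, TensorProduct.smul_tmul']⟩
  | add α β hα hβ =>
    obtain ⟨n, rfl⟩ := hα
    obtain ⟨n', rfl⟩ := hβ
    exact ⟨n + n', by rw [TensorProduct.add_tmul]⟩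

omit [FiniteDimensional k A] in
theorem chain_zero_exists (α : Chain k A 0) : ∃ a : A, α = a ⊗ₜ bl k 0 [] :=
  chn_zero_exists (N := Bimod.self k A) α

theorem FrobeniusForm.sum_u_mul_nakayama_mul_v (a : A) :
    ∑ j, F.u j * F.nakayama a * F.v j = ∑ j, F.u j * (a * F.v j) :=
  F.casimir_mul_nakayama (LinearMap.mul k A) a

/-- A chain of length `0` has no boundary within the chains; the norm takes its place, since `∑ uⱼ
ν(a) vⱼ = ∑ uⱼ a vⱼ`. -/
theorem FrobeniusForm.deltaN_evA_zero {m n m' : ℕ} (h : 0 + (n + 1) = m) (hn : n + 1 = m)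
    (hm : m + 1 = m') (h₁ : 0 + m = m) (h₂ : 0 + (m + 1) = m') (α : Chain k A 0) (f : Coch N m) :
    deltaN N hn (F.evA N h α f) = cupL N h₁ (F.normA α) f - F.evA N h₂ α (deltaN N hm f) := by
  obtain ⟨a, rfl⟩ := chain_zero_exists α
  refine bl_hom_ext fun b hb => ?_
  obtain ⟨b₀, b', rfl⟩ := List.exists_cons_of_length_eq_add_one (hb.trans hn.symm)
  obtain ⟨i, z, e, hi⟩ := exists_last b₀ b'
  rw [F.deltaN_evA_bl N h hn f a e rfl hb, LinearMap.sub_apply, F.evA_bl N h₂ _ a _ _ rfl,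
    cupL_bl N h₁ _ _ (List.nil_append _).symm rfl, F.normA_bl, ← F.sum_u_mul_nakayama_mul_v,
    map_sum, LinearMap.sum_apply, ← Finset.sum_sub_distrib]
  refine Finset.sum_congr rfl fun j _ => ?_
  rw [deltaN_bl N hm f (l := [] ++ F.v j :: b₀ :: b') (i := F.v j :: i) (z := z) rfl
    (by rw [e]; simp) hb]
  simp only [map_add, map_smul, map_neg, pow_succ, N.mul_l, List.nil_append]
  module

theorem FrobeniusForm.normN_capA_zero (h : 0 + 0 = 0) (h₂ : 0 + (0 + 1) = 1) (α : Chain k A 0)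
    (f : Coch N 0) :
    F.normN N (F.capA N h α f) = cupL N h (F.normA α) f - F.evA N h₂ α (deltaN N rfl f) := by
  obtain ⟨a, rfl⟩ := chain_zero_exists α
  refine coch_zero_ext ?_
  rw [F.capA_bl N h f a (List.nil_append _).symm rfl, F.normN_bl, LinearMap.sub_apply,
    F.evA_bl N h₂ _ a _ _ rfl, cupL_bl N h _ _ (List.nil_append _).symm rfl, F.normA_bl,
    ← F.sum_u_mul_nakayama_mul_v, map_sum, LinearMap.sum_apply, ← Finset.sum_sub_distrib]
  refine Finset.sum_congr rfl fun j _ => ?_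
  rw [deltaN_bl N rfl f (l := [] ++ [F.v j]) (i := []) rfl rfl rfl]
  simp only [map_add, map_smul, pow_succ, N.mul_l, N.l_r, List.nil_append, mid_singleton, map_zero]
  module

end ChainProducts

/-! ### Products of two chains of positive length. -/

section ChainChainProducts

variable {k : Type u} {A : Type v} [Field k] [Ring A] [Algebra k A] (N : Bimod k A)
variable [FiniteDimensional k A] (F : FrobeniusForm k A)

theorem FrobeniusForm.casimir_word_left {t : ℕ} (n : N) (a z : A) (b l : List A)
    (h : b.length < t) :
    ∑ j, N.l (F.v j) n ⊗ₜ[k] bl k t (b ++ (z * (F.u j * F.nakayama a)) :: l) =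
      ∑ j, N.l (F.v j) (N.l z n) ⊗ₜ[k] bl k t (b ++ (F.u j * F.nakayama a) :: l) := by
  have c := F.casimir_mul (((TensorProduct.mk k N _).flip ∘ₗ slot k b l h ∘ₗ
    LinearMap.mulRight k (F.nakayama a)).compl₂ (N.l.flip n)) z
  simpa [slot_apply, mul_assoc, N.mul_l] using c

theorem FrobeniusForm.casimir_word_right {t : ℕ} (n : N) (a z : A) (b l : List A)
    (h : b.length < t) :
    ∑ j, N.l (F.v j) n ⊗ₜ[k] bl k t (b ++ (F.u j * F.nakayama (z * a)) :: l) =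
      ∑ j, N.l z (N.l (F.v j) n) ⊗ₜ[k] bl k t (b ++ (F.u j * F.nakayama a) :: l) := by
  have c := F.casimir_mul_nakayama (((TensorProduct.mk k N _).flip ∘ₗ slot k b l h ∘ₗ
    LinearMap.mulRight k (F.nakayama a)).compl₂ (N.l.flip n)) z
  simpa [slot_apply, mul_assoc, N.mul_l] using c

/-- The product word is `b (uⱼ ν(a)) l`. Contracting the inserted letter with its left neighbour
gives the last term of `∂β`, and with its right neighbour the first term of `∂α`. The outer action
of the last letter of `l` gives the last term of `∂α`. The Casimir identities carry out these
exchanges. -/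
theorem FrobeniusForm.partN_mulA {p q p' q' t t' : ℕ} (hp : p + 1 = p') (hq : q + 1 = q')
    (ht : t + 1 = t') (h : q' + (p' + 1) = t') (h₁ : q + (p' + 1) = t) (h₂ : q' + (p + 1) = t)
    (α : Chain k A p') (β : Chn N q') :
    partN F.nakayama.symm N ht (F.mulA N h α β) = F.mulA N h₁ α (partN F.nakayama.symm N hq β)
      - (-1 : k) ^ q' • F.mulA N h₂ (partA F.nakayama.symm hp α) β := by
  suffices H : (F.mulA N h).compr₂ (partN F.nakayama.symm N ht) =
      (F.mulA N h₁).compl₂ (partN F.nakayama.symm N hq)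
      - (-1 : k) ^ q' • F.mulA N h₂ ∘ₗ (partA F.nakayama.symm hp) from
    LinearMap.congr_fun (LinearMap.congr_fun H α) β
  refine chain_hom_ext fun a l hl => chn_hom_ext fun n b hb => ?_
  obtain ⟨y, s, rfl⟩ := List.exists_cons_of_length_eq_add_one (hl.trans hp.symm)
  obtain ⟨b₀, b', rfl⟩ := List.exists_cons_of_length_eq_add_one (hb.trans hq.symm)
  obtain ⟨ib, zb, eb, hib⟩ := exists_last b₀ b'
  obtain ⟨il, zl, el, hil⟩ := exists_last y s
  have hib' : ib.length = q := by simp at hb; omega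
  have hil' : il.length = p := by simp at hl; omega
  have c₁ := F.casimir_word_left N n a zb ib (y :: s) (t := t) (by omega)
  have c₂ := F.casimir_word_right N n a zl (b₀ :: b') il (t := t) (by omega)
  have m₁ : F.mulA N h₁ (a ⊗ₜ bl k p' (y :: s)) (mid (fun w => n ⊗ₜ[k] bl k q w) (b₀ :: b')) =
      mid (fun w => ∑ j, N.l (F.v j) n ⊗ₜ[k] bl k t (w ++ (F.u j * F.nakayama a) :: y :: s))
        (b₀ :: b') :=
    (map_mid _ _ _).trans (mid_congr fun w hw => F.mulA_bl N h₁ a n _ w (by omega))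
  have m₂ : F.mulA N h₂ (mid (fun w => a ⊗ₜ[k] bl k p w) (y :: s)) (n ⊗ₜ bl k q' (b₀ :: b')) =
      mid (fun w => ∑ j, N.l (F.v j) n ⊗ₜ[k] bl k t (b₀ :: b' ++ (F.u j * F.nakayama a) :: w))
        (y :: s) :=
    (map_mid ((F.mulA N h₂).flip (n ⊗ₜ bl k q' (b₀ :: b'))) _ _).trans
      (mid_congr fun w hw => F.mulA_bl N h₂ a n w _ hb)
  have e₁ : ∀ j, partN F.nakayama.symm N ht (N.l (F.v j) n ⊗ₜ[k]
      bl k t' (b₀ :: b' ++ (F.u j * F.nakayama a) :: y :: s)) = _ := fun j =>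
    partN_bl F.nakayama.symm N ht _ (a := b₀) (z := zl)
      (t := b' ++ (F.u j * F.nakayama a) :: y :: s)
      (i := b₀ :: b' ++ (F.u j * F.nakayama a) :: il) rfl (by rw [el]; simp)
      (by simp at hl hb ⊢; omega)
  simp only [LinearMap.compr₂_apply, LinearMap.compl₂_apply, LinearMap.sub_apply,
    LinearMap.smul_apply, LinearMap.comp_apply]
  rw [F.mulA_bl N h a n _ _ hb, map_sum, partN_bl _ N hq n rfl eb (by simpa [← hq] using hb),
    partA_bl _ hp a rfl el (by simpa [← hp] using hl)]
  simp only [e₁, map_add, map_smul, LinearMap.add_apply, LinearMap.smul_apply, m₁, m₂, mid_sum]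
  rw [F.mulA_bl N h₁ a _ _ _ (by simp at hb; omega), F.mulA_bl N h₁ a _ _ _ hib',
    F.mulA_bl N h₂ _ n _ _ hb, F.mulA_bl N h₂ _ n _ _ hb, c₂, ← c₁]
  simp only [Finset.smul_sum, ← Finset.sum_add_distrib, ← Finset.sum_sub_distrib]
  refine Finset.sum_congr rfl fun j _ => ?_
  rw [mid_append_cons (k := k) _ (b₀ :: b'), mid_cons_cons, eb, List.append_assoc,
    List.singleton_append, mid_append_cons (k := k) _ ib, mid_cons_cons, ← eb]
  have et : (-1 : k) ^ (t + 1) = (-1) ^ q' * (-1) ^ (p + 1) * (-1) := by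
    rw [← h₂, pow_succ, pow_add]
  simp only [mid_singleton, map_mul, AlgEquiv.apply_symm_apply, N.l_r, List.append_assoc,
    List.singleton_append, List.cons_append, List.nil_append, hb, hib', et, ← hq, ← hp, mul_assoc]
  simp only [pow_succ]
  module

end ChainChainProducts

/-! ### Products of chains in which a factor has length `0`. -/

section ChainChainProducts

variable {k : Type u} {A : Type v} [Field k] [Ring A] [Algebra k A] (N : Bimod k A)

theorem partA_chainMap (σ τ : A ≃ₐ[k] A) (h : ∀ a, σ (τ a) = τ (σ a)) {p p' : ℕ} (hp : p + 1 = p')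
    (α : Chain k A p') :
    partA τ hp (chainMap σ p' α) = chainMap σ p (partA τ hp α) := by
  suffices H : partA τ hp ∘ₗ chainMap σ p' = chainMap σ p ∘ₗ partA τ hp from
    LinearMap.congr_fun H α
  refine chain_hom_ext fun a l hl => ?_
  obtain ⟨y, s, rfl⟩ := List.exists_cons_of_length_eq_add_one (hl.trans hp.symm)
  obtain ⟨i, z, e, hi⟩ := exists_last y s
  have e' : (y :: s).map σ = i.map σ ++ [σ z] := by rw [e]; simp
  rw [LinearMap.comp_apply, LinearMap.comp_apply, chainMap_bl,
    partA_bl τ hp _ (List.map_cons ..) e' (by simp at hl ⊢; omega),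
    partA_bl τ hp _ rfl e (by simp at hl ⊢; omega), map_add, map_add, map_smul, map_mid, mid_map]
  simp only [chainMap_bl, map_mul, h]

variable [FiniteDimensional k A] (F : FrobeniusForm k A)

theorem FrobeniusForm.sum_u_l_v_r_comm (n : N) (a : A) :
    N.l a (∑ j, N.l (F.u j) (N.r (F.v j) n)) = N.r a (∑ j, N.l (F.u j) (N.r (F.v j) n)) := by
  have c := F.casimir_mul (N.l.compl₂ (N.r.flip n)) a
  simpa [N.mul_l, N.mul_r, N.l_r] using c

theorem FrobeniusForm.sum_v_l_u_r (n : N) :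
    ∑ j, N.l (F.v j) (N.r (F.nakayama.symm (F.u j)) n) = ∑ j, N.l (F.u j) (N.r (F.v j) n) := by
  have c := F.casimir_swap (N.l.compl₂ (N.r.flip n ∘ₗ F.nakayama.symm.toLinearMap)).flip
  simpa using c.symm

theorem FrobeniusForm.normA_chainMap (α : Chain k A 0) :
    F.normA (chainMap F.nakayama 0 α) = F.normA α := by
  obtain ⟨a, rfl⟩ := chain_zero_exists α
  rw [chainMap_bl, List.map_nil]
  refine coch_zero_ext (N := Bimod.self k A) ?_
  rw [F.normA_bl, F.normA_bl, ← F.sum_u_mul_nakayama_mul_v a]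
  simp only [mul_assoc]

theorem FrobeniusForm.partN_mulA_zero_left {q q' t t' : ℕ} (hq : q + 1 = q')
    (ht : t + 1 = t') (h : q' + (0 + 1) = t') (h₁ : q + (0 + 1) = t)
    {α : Chain k A 0} (hα : F.normA α = 0) (β : Chn N q') :
    partN F.nakayama.symm N ht (F.mulA N h α β) =
      F.mulA N h₁ α (partN F.nakayama.symm N hq β) := by
  obtain ⟨a, rfl⟩ := chain_zero_exists α
  have ha := LinearMap.congr_fun hα (bl k 0 [])
  rw [F.normA_bl, ← F.sum_u_mul_nakayama_mul_v, LinearMap.zero_apply] at ha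
  suffices H : partN F.nakayama.symm N ht ∘ₗ F.mulA N h (a ⊗ₜ bl k 0 []) =
      F.mulA N h₁ (a ⊗ₜ bl k 0 []) ∘ₗ partN F.nakayama.symm N hq from LinearMap.congr_fun H β
  refine chn_hom_ext fun n b hb => ?_
  obtain ⟨b₀, b', rfl⟩ := List.exists_cons_of_length_eq_add_one (hb.trans hq.symm)
  obtain ⟨ib, zb, eb, hib⟩ := exists_last b₀ b'
  have hib' : ib.length = q := by simp at hb; omega
  have c₁ := F.casimir_word_left N n a zb ib [] (t := t) (by omega)
  have m₁ : F.mulA N h₁ (a ⊗ₜ bl k 0 []) (mid (fun w => n ⊗ₜ[k] bl k q w) (b₀ :: b')) =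
      mid (fun w => ∑ j, N.l (F.v j) n ⊗ₜ[k] bl k t (w ++ [F.u j * F.nakayama a])) (b₀ :: b') :=
    (map_mid _ _ _).trans (mid_congr fun w hw => F.mulA_bl N h₁ a n _ w (by omega))
  have e₁ : ∀ j, partN F.nakayama.symm N ht (N.l (F.v j) n ⊗ₜ[k]
      bl k t' (b₀ :: b' ++ [F.u j * F.nakayama a])) = _ := fun j =>
    partN_bl F.nakayama.symm N ht _ (a := b₀) rfl rfl (by simp at hb ⊢; omega)
  -- The inserted letter is now the last one, and its action from the left assembles to `(∑ uⱼ ν(a)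
  -- vⱼ) n`, which vanishes because `α` has norm zero.
  have last : ∑ j, N.l (F.u j * F.nakayama a) (N.l (F.v j) n) ⊗ₜ[k] bl k t (b₀ :: b') = 0 := by
    simp only [← N.mul_l, ← TensorProduct.sum_tmul, ← LinearMap.sum_apply, ← map_sum, ha]
    simp
  simp only [LinearMap.comp_apply]
  rw [F.mulA_bl N h a n _ _ hb, map_sum, partN_bl _ N hq n rfl eb (by simpa [← hq] using hb)]
  simp only [e₁, map_add, map_smul, m₁, mid_sum]
  rw [F.mulA_bl N h₁ a _ _ _ (by simp at hb; omega), F.mulA_bl N h₁ a _ _ _ hib', ← c₁,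
    Finset.sum_add_distrib, ← Finset.smul_sum, last, smul_zero, add_zero]
  simp only [Finset.smul_sum, ← Finset.sum_add_distrib]
  refine Finset.sum_congr rfl fun j _ => ?_
  rw [eb, List.append_assoc,
    List.singleton_append, mid_append_cons (k := k) _ ib, mid_cons_cons, ← eb]
  simp only [mid_singleton, N.l_r, hib', pow_succ]
  module

/-- The inserted letter is now the first one, and its action from the right gives `∑ vⱼ n ν⁻¹(uⱼ)
a`. By `casimir_swap` this is the norm of `β` times `a`. Norms are central, so `a` may stand on the
left, as in `capA`. The twist of `α` by `ν` is the one built into `capA`. -/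
theorem FrobeniusForm.partN_mulA_zero_right {p p' : ℕ} (hp : p + 1 = p')
    (ht : p' + 1 = p' + 1) (h : 0 + (p' + 1) = p' + 1) (h₁ : 0 + p' = p') (h₂ : 0 + (p + 1) = p')
    (α : Chain k A p') (β : Chn N 0) :
    partN F.nakayama.symm N ht (F.mulA N h (chainMap F.nakayama p' α) β) =
      F.capA N h₁ α (F.normN N β)
      - F.mulA N h₂ (chainMap F.nakayama p (partA F.nakayama.symm hp α)) β := by
  obtain ⟨n, rfl⟩ := chn_zero_exists β
  rw [← partA_chainMap _ _ (by simp)]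
  suffices H : partN F.nakayama.symm N ht ∘ₗ (F.mulA N h).flip (n ⊗ₜ bl k 0 []) ∘ₗ
        chainMap F.nakayama p' =
      (F.capA N h₁).flip (F.normN N (n ⊗ₜ bl k 0 []))
      - (F.mulA N h₂).flip (n ⊗ₜ bl k 0 []) ∘ₗ partA F.nakayama.symm hp ∘ₗ
        chainMap F.nakayama p' from LinearMap.congr_fun H α
  refine chain_hom_ext fun a l hl => ?_
  have hl' : (l.map F.nakayama).length = p' := by simpa using hl
  simp only [LinearMap.comp_apply, LinearMap.sub_apply, LinearMap.flip_apply, chainMap_bl]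
  rw [F.capA_bl N h₁ _ a (List.nil_append _).symm rfl, F.normN_bl, F.sum_u_l_v_r_comm]
  -- Both sides now depend on `a` and `l` only through their images under `ν`, which become the new
  -- variables.
  generalize F.nakayama a = a
  generalize l.map F.nakayama = l at *
  obtain ⟨y, s, rfl⟩ := List.exists_cons_of_length_eq_add_one (hl'.trans hp.symm)
  obtain ⟨il, zl, el, hil⟩ := exists_last y s
  have c₂ := F.casimir_word_right N n a zl [] il (t := p') (by simp; omega)
  have m₂ : F.mulA N h₂ (mid (fun w => a ⊗ₜ[k] bl k p w) (y :: s)) (n ⊗ₜ bl k 0 []) =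
      mid (fun w => ∑ j, N.l (F.v j) n ⊗ₜ[k] bl k p' ((F.u j * F.nakayama a) :: w))
        (y :: s) :=
    (map_mid ((F.mulA N h₂).flip (n ⊗ₜ bl k 0 [])) _ _).trans
      (mid_congr fun w hw => F.mulA_bl N h₂ a n w _ rfl)
  have e₁ : ∀ j, partN F.nakayama.symm N ht (N.l (F.v j) n ⊗ₜ[k]
      bl k (p' + 1) ([] ++ (F.u j * F.nakayama a) :: y :: s)) = _ := fun j =>
    partN_bl F.nakayama.symm N ht _ (z := zl) (i := (F.u j * F.nakayama a) :: il) rfl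
      (by rw [el]; simp) (by simp at hl' ⊢; omega)
  have c₃ : ∑ j, N.r (F.nakayama.symm (F.u j * F.nakayama a)) (N.l (F.v j) n) ⊗ₜ[k]
      bl k p' (y :: s) = N.r a (∑ j, N.l (F.u j) (N.r (F.v j) n)) ⊗ₜ[k] bl k p' (y :: s) := by
    rw [← F.sum_v_l_u_r]
    simp only [map_mul, AlgEquiv.symm_apply_apply, N.mul_r, ← N.l_r, TensorProduct.sum_tmul, map_sum]
  rw [F.mulA_bl N h a n _ _ rfl, map_sum,
    partA_bl _ hp a rfl el (by simp at hl' ⊢; omega), ← c₃]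
  simp only [e₁, map_add, map_smul, LinearMap.add_apply, LinearMap.smul_apply, m₂, mid_sum]
  rw [F.mulA_bl N h₂ _ n _ _ rfl, F.mulA_bl N h₂ _ n _ _ rfl, c₂]
  simp only [Finset.smul_sum, ← Finset.sum_add_distrib, ← Finset.sum_sub_distrib]
  refine Finset.sum_congr rfl fun j _ => ?_
  simp only [mid_cons_cons, map_mul, AlgEquiv.apply_symm_apply, AlgEquiv.symm_apply_apply,
    List.nil_append, ← hp, mul_assoc, pow_succ]
  module

theorem FrobeniusForm.partN_mulA_zero_zero (ht : 0 + 1 = 1) (h : 0 + (0 + 1) = 1) (h₁ : 0 + 0 = 0)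
    {α : Chain k A 0} (hα : F.normA α = 0) (β : Chn N 0) :
    partN F.nakayama.symm N ht (F.mulA N h (chainMap F.nakayama 0 α) β) =
      F.capA N h₁ α (F.normN N β) := by
  obtain ⟨a, rfl⟩ := chain_zero_exists α
  obtain ⟨n, rfl⟩ := chn_zero_exists β
  rw [← F.normA_chainMap] at hα
  have ha := LinearMap.congr_fun hα (bl k 0 [])
  rw [chainMap_bl, List.map_nil, F.normA_bl, ← F.sum_u_mul_nakayama_mul_v,
    LinearMap.zero_apply] at ha
  rw [chainMap_bl, F.capA_bl N h₁ _ a (List.nil_append _).symm rfl, F.normN_bl,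
    F.sum_u_l_v_r_comm, List.map_nil]
  generalize F.nakayama a = a at *
  have last : ∑ j, N.l (F.u j * F.nakayama a) (N.l (F.v j) n) ⊗ₜ[k] bl k 0 ([] : List A) = 0 := by
    simp only [← N.mul_l, ← TensorProduct.sum_tmul, ← LinearMap.sum_apply, ← map_sum, ha]
    simp
  have c₃ : ∑ j, N.r (F.nakayama.symm (F.u j * F.nakayama a)) (N.l (F.v j) n) ⊗ₜ[k]
      bl k 0 ([] : List A) = N.r a (∑ j, N.l (F.u j) (N.r (F.v j) n)) ⊗ₜ[k] bl k 0 [] := by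
    rw [← F.sum_v_l_u_r]
    simp only [map_mul, AlgEquiv.symm_apply_apply, N.mul_r, ← N.l_r, TensorProduct.sum_tmul, map_sum]
  have e₁ : ∀ j, partN F.nakayama.symm N ht (N.l (F.v j) n ⊗ₜ[k]
      bl k 1 ([] ++ [F.u j * F.nakayama a])) = _ := fun j =>
    partN_bl F.nakayama.symm N ht _ (a := F.u j * F.nakayama a) (i := []) rfl rfl rfl
  rw [F.mulA_bl N h a n _ _ rfl, map_sum, Finset.sum_congr rfl fun j _ => e₁ j]
  simp only [List.nil_append, mid_singleton, add_zero]
  rw [Finset.sum_add_distrib, ← Finset.smul_sum, last, c₃, smul_zero, add_zero]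

end ChainChainProducts

/-! ### Chains multiplying from the right. -/

section RightProducts

variable {k : Type u} {A : Type v} [Field k] [Ring A] [Algebra k A] (N : Bimod k A)

theorem partN_capR (σ : A ≃ₐ[k] A) {m p q m' p' q' : ℕ} (hm : m + 1 = m') (hp : p + 1 = p')
    (hq : q + 1 = q') (h : q + m = p) (h₁ : q' + m = p') (h₂ : q + m' = p') (α : Chain k A p')
    (f : Coch N m) :
    partN σ N hq (capR N h₁ α f) =
      capR N h (partA σ hp α) f - (-1 : k) ^ q • capR N h₂ α (deltaN N hm f) := by
  subst hm hp hq
  suffices H : partN σ N rfl ∘ₗ (capR N h₁).flip f =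
      (capR N h).flip f ∘ₗ partA σ rfl - (-1 : k) ^ q • (capR N h₂).flip (deltaN N rfl f) from
    LinearMap.congr_fun H α
  refine chain_hom_ext fun a l hl => ?_
  obtain ⟨l₁, x, l₂, rfl, hl₁, hl₂⟩ := exists_split_cons (l := l) (m := q) (n := m) (by omega)
  obtain ⟨y, t₁, e₁, ht₁⟩ := exists_head l₁ x
  obtain ⟨i₂, z, e₂, hi₂⟩ := exists_last x l₂
  have d₁ : l₁ ++ x :: l₂ = y :: (t₁ ++ l₂) := by rw [← List.cons_append, ← e₁]; simp
  have d₂ : l₁ ++ x :: l₂ = (l₁ ++ i₂) ++ [z] := by rw [e₂]; simp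
  have d₃ : l₁ ++ x :: l₂ = (l₁ ++ [x]) ++ l₂ := by simp
  simp only [LinearMap.smul_apply, LinearMap.comp_apply, LinearMap.sub_apply, LinearMap.flip_apply]
  rw [capR_bl N h₁ f a d₃ (by simp; omega), capR_bl N h₂ _ a rfl hl₁,
    partN_bl _ N rfl _ e₁ rfl (by omega), partA_bl _ rfl a d₁ d₂ (by simp; omega),
    deltaN_bl N rfl f rfl e₂ hl₂, map_add, map_add, map_smul, LinearMap.add_apply,
    LinearMap.add_apply, LinearMap.smul_apply, capR_bl N h f _ rfl (by omega),
    capR_bl N h f _ rfl hl₁, ← LinearMap.flip_apply (capR N h), map_mid,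
    mid_append_cons (k := k) (fun w => (capR N h).flip f (a ⊗ₜ bl k p w)),
    mid_congr (φ := fun w => (capR N h).flip f (a ⊗ₜ bl k p (w ++ l₂)))
      (fun w hw => capR_bl N h f a rfl (by simp at hw; omega)),
    mid_eq_map ((TensorProduct.mk k N _).flip (bl k q l₁) ∘ₗ N.r a)
      (φ := fun w => (capR N h).flip f (a ⊗ₜ bl k p (l₁ ++ w)))
      (ψ := fun w => f (bl k m w)) (fun w hw => capR_bl N h f a rfl hl₁)]
  simp only [LinearMap.comp_apply,
    LinearMap.flip_apply, TensorProduct.mk_apply, N.mul_r, N.l_r, ← h, hl₁, map_add, map_smul,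
    TensorProduct.add_tmul, ← TensorProduct.smul_tmul']
  rcases neg_one_pow_eq_or k m with h | h <;> rcases neg_one_pow_eq_or k q with h' | h' <;>
    simp only [pow_succ, pow_add, h, h'] <;> module

variable [FiniteDimensional k A] (F : FrobeniusForm k A)

theorem FrobeniusForm.evR_partA_bl {n p m p' : ℕ} (h : n + (p + 1) = m) (hp : p + 1 = p')
    (f : Coch N m) (a : A) {l b i : List A} {z : A} (hz : l = i ++ [z]) (hl : l.length = p')
    (hb : b.length = n) :
    F.evR N h (partA F.nakayama.symm hp (a ⊗ₜ bl k p' l)) f (bl k n b) =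
      ∑ j, N.r (F.v j) (-mid (fun w => f (bl k m (b ++ w))) ((F.u j * F.nakayama a) :: l)
        + (-1 : k) ^ p' • N.r z (f (bl k m (b ++ (F.u j * F.nakayama a) :: i)))) := by
  subst hp
  obtain ⟨y, t, rfl⟩ := List.exists_cons_of_length_eq_add_one hl
  have him : b.length < m := by omega
  have c := F.casimir_mul_nakayama ((N.r.flip ∘ₗ f ∘ₗ slot k b i him ∘ₗ
    LinearMap.mulRight k (F.nakayama a))) z
  simp only [LinearMap.comp_apply, slot_apply, LinearMap.mulRight_apply, LinearMap.flip_apply]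
    at c
  have hmid : F.evR N h (mid (fun w => a ⊗ₜ[k] bl k p w) (y :: t)) f (bl k n b) =
      mid (fun w => ∑ j, N.r (F.v j) (f (bl k m (b ++ (F.u j * F.nakayama a) :: w)))) (y :: t) :=
    (map_mid (LinearMap.applyₗ (bl k n b) ∘ₗ (F.evR N h).flip f) _ _).trans
      (mid_congr fun w hw => F.evR_bl N h f a _ b hb)
  rw [partA_bl _ rfl a rfl hz (by simpa using hl), map_add, map_add, map_smul,
    LinearMap.add_apply, LinearMap.add_apply, LinearMap.smul_apply, LinearMap.add_apply,
    LinearMap.add_apply, LinearMap.smul_apply,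
    F.evR_bl N h f _ _ _ hb, F.evR_bl N h f _ _ _ hb, hmid]
  simp only [mid_sum, map_mul, AlgEquiv.apply_symm_apply]
  simp only [← mul_assoc] at c ⊢
  rw [c, Finset.smul_sum, ← Finset.sum_add_distrib, ← Finset.sum_add_distrib]
  refine Finset.sum_congr rfl fun j _ => ?_
  rw [mid_eq_map (N.r (F.v j))
    (ψ := fun w => f (bl k m (b ++ (F.u j * F.nakayama a) :: w))) (fun w hw => rfl)]
  simp only [mid_cons_cons, map_sub, map_neg, map_smul, map_add, N.mul_r]
  module

theorem FrobeniusForm.deltaN_evR_bl {n p m n' : ℕ} (h : n + (p + 1) = m) (hn : n + 1 = n')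
    (f : Coch N m) (a : A) {l b t : List A} {y : A} (hy : b = y :: t)
    (hb : b.length = n') :
    deltaN N hn (F.evR N h (a ⊗ₜ bl k p l) f) (bl k n' b) =
      ∑ j, N.r (F.v j) (N.l y (f (bl k m (t ++ (F.u j * F.nakayama a) :: l)))
        + mid (fun w => f (bl k m (w ++ l))) (b ++ [F.u j * F.nakayama a])) := by
  subst hn hy
  obtain ⟨i, z, e, hi⟩ := exists_last y t
  have hin : i.length = n := hi.trans (by simpa using hb)
  have him : i.length < m := by omega
  have c := F.casimir_mul (N.r.flip ∘ₗ f ∘ₗ slot k i l him ∘ₗ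
    LinearMap.mulRight k (F.nakayama a)) z
  simp only [LinearMap.comp_apply, slot_apply, LinearMap.mulRight_apply, LinearMap.flip_apply,
    N.mul_r] at c
  rw [deltaN_bl N rfl _ rfl e (by simpa using hb), F.evR_bl N h f _ _ _ (by simpa using hb),
    F.evR_bl N h f _ _ _ hin,
    mid_congr (φ := fun w => F.evR N h (a ⊗ₜ bl k p l) f (bl k n w))
      fun w hw => F.evR_bl N h f _ _ _ (by simp at hw hb; omega)]
  simp only [mid_sum, map_sum]
  rw [← c, Finset.smul_sum, ← Finset.sum_add_distrib, ← Finset.sum_add_distrib]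
  refine Finset.sum_congr rfl fun j _ => ?_
  rw [mid_eq_map (N.r (F.v j))
    (ψ := fun w => f (bl k m (w ++ (F.u j * F.nakayama a) :: l))) (fun w hw => rfl), e,
    List.append_assoc, List.singleton_append,
    mid_append_cons (k := k) (fun w => f (bl k m (w ++ l)))]
  simp only [mid_cons_cons, mid_singleton, map_sub, map_neg, map_smul, map_add, map_zero, N.l_r,
    List.append_assoc, List.cons_append, List.nil_append, hin, pow_succ, mul_assoc]
  module

theorem FrobeniusForm.normN_capR {p m m' : ℕ} (hp : p + 1 = m) (hm : m + 1 = m') (h : 0 + m = m)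
    (h₁ : 0 + (p + 1) = m) (h₂ : 0 + (m + 1) = m') (α : Chain k A m) (f : Coch N m) :
    F.normN N (capR N h α f) =
      F.evR N h₁ (partA F.nakayama.symm hp α) f + F.evR N h₂ α (deltaN N hm f) := by
  suffices H : F.normN N ∘ₗ (capR N h).flip f =
      (F.evR N h₁).flip f ∘ₗ partA F.nakayama.symm hp + (F.evR N h₂).flip (deltaN N hm f) from
    LinearMap.congr_fun H α
  refine chain_hom_ext fun a l hl => coch_zero_ext ?_
  obtain ⟨y, t, rfl⟩ := List.exists_cons_of_length_eq_add_one (hl.trans hp.symm)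
  obtain ⟨i, z, e, hi⟩ := exists_last y t
  have c := F.casimir_mul_nakayama (((N.r.flip ∘ₗ N.l.flip (f (bl k m (y :: t)))))) a
  simp only [LinearMap.comp_apply, LinearMap.flip_apply] at c
  simp only [LinearMap.comp_apply, LinearMap.add_apply, LinearMap.flip_apply]
  rw [capR_bl N h f a (List.nil_append _).symm rfl, F.normN_bl,
    F.evR_partA_bl N h₁ hp f a e hl rfl, F.evR_bl N h₂ _ a _ _ rfl, ← Finset.sum_add_distrib]
  simp only [← N.mul_r, N.l_r]
  rw [← c]
  refine Finset.sum_congr rfl fun j _ => ?_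
  rw [deltaN_bl N hm f (l := [] ++ (F.u j * F.nakayama a) :: y :: t)
    (i := (F.u j * F.nakayama a) :: i) (z := z) rfl (by rw [e]; simp) hl, ← map_add]
  simp only [List.nil_append, map_add, map_neg, map_smul, pow_succ]
  module

theorem FrobeniusForm.deltaN_evR {n p m n' p' m' : ℕ} (h : n + (p' + 1) = m) (hn : n + 1 = n')
    (hp : p + 1 = p') (hm : m + 1 = m') (h₁ : n' + (p + 1) = m) (h₂ : n' + (p' + 1) = m')
    (α : Chain k A p') (f : Coch N m) :
    deltaN N hn (F.evR N h α f) =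
      (-1 : k) ^ n' • F.evR N h₁ (partA F.nakayama.symm hp α) f
        + F.evR N h₂ α (deltaN N hm f) := by
  suffices H : deltaN N hn ∘ₗ (F.evR N h).flip f =
      (-1 : k) ^ n' • (F.evR N h₁).flip f ∘ₗ partA F.nakayama.symm hp
        + (F.evR N h₂).flip (deltaN N hm f) from
    LinearMap.congr_fun H α
  refine chain_hom_ext fun a l hl => bl_hom_ext fun b hb => ?_
  obtain ⟨y, t, rfl⟩ := List.exists_cons_of_length_eq_add_one (hl.trans hp.symm)
  obtain ⟨b₀, b', rfl⟩ := List.exists_cons_of_length_eq_add_one (hb.trans hn.symm)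
  obtain ⟨i, z, e, hi⟩ := exists_last y t
  simp only [LinearMap.smul_apply, LinearMap.comp_apply, LinearMap.add_apply, LinearMap.flip_apply]
  rw [F.deltaN_evR_bl N h hn f a rfl hb,
    F.evR_partA_bl N h₁ hp f a e hl hb, F.evR_bl N h₂ _ a _ _ hb, Finset.smul_sum,
    ← Finset.sum_add_distrib]
  refine Finset.sum_congr rfl fun j _ => ?_
  rw [deltaN_bl N hm f (l := b₀ :: b' ++ (F.u j * F.nakayama a) :: y :: t) (a := b₀)
    (t := b' ++ (F.u j * F.nakayama a) :: y :: t) (i := b₀ :: b' ++ (F.u j * F.nakayama a) :: i)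
    (z := z) rfl (by rw [e]; simp) (by simp at hl hb ⊢; omega),
    mid_append_cons (k := k) (fun w => f (bl k m w))]
  have e' : (-1 : k) ^ (m + 1) = -((-1) ^ n' * (-1) ^ p') := by
    rw [← h₁, ← hp, ← pow_add, pow_succ]; simp
  simp only [map_add, map_smul, map_neg, hb, e']
  module

theorem FrobeniusForm.deltaN_evR_zero {m n m' : ℕ} (h : n + (0 + 1) = m) (hn : n + 1 = m)
    (hm : m + 1 = m') (h₂ : m + (0 + 1) = m') {α : Chain k A 0} (hα : F.normA α = 0)
    (f : Coch N m) :
    deltaN N hn (F.evR N h α f) = F.evR N h₂ α (deltaN N hm f) := by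
  obtain ⟨a, rfl⟩ := chain_zero_exists α
  have ha := LinearMap.congr_fun hα (bl k 0 [])
  rw [F.normA_bl, ← F.sum_u_mul_nakayama_mul_v, LinearMap.zero_apply] at ha
  refine bl_hom_ext fun b hb => ?_
  obtain ⟨b₀, b', rfl⟩ := List.exists_cons_of_length_eq_add_one (hb.trans hn.symm)
  have last : ∑ j, N.r (F.v j) (N.r (F.u j * F.nakayama a) (f (bl k m (b₀ :: b')))) = 0 := by
    simp only [← N.mul_r, ← LinearMap.sum_apply, ← map_sum, ha]
    simp
  rw [F.deltaN_evR_bl N h hn f a rfl hb, F.evR_bl N h₂ _ a _ _ hb, ← add_zero (∑ j, _),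
    ← smul_zero ((-1 : k) ^ (m + 1)), ← last, Finset.smul_sum, ← Finset.sum_add_distrib]
  refine Finset.sum_congr rfl fun j _ => ?_
  rw [deltaN_bl N hm f (l := b₀ :: b' ++ [F.u j * F.nakayama a])
    (t := b' ++ [F.u j * F.nakayama a]) (i := b₀ :: b') rfl rfl (by simpa using hb)]
  simp only [map_add, map_smul, List.append_nil]

theorem FrobeniusForm.normN_capR_zero (h : 0 + 0 = 0) (h₂ : 0 + (0 + 1) = 1) {α : Chain k A 0}
    (hα : F.normA α = 0) (f : Coch N 0) :
    F.normN N (capR N h α f) = F.evR N h₂ α (deltaN N rfl f) := by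
  obtain ⟨a, rfl⟩ := chain_zero_exists α
  have ha := LinearMap.congr_fun hα (bl k 0 [])
  rw [F.normA_bl, ← F.sum_u_mul_nakayama_mul_v, LinearMap.zero_apply] at ha
  refine coch_zero_ext ?_
  have last : ∑ j, N.r (F.v j) (N.r (F.u j * F.nakayama a) (f (bl k 0 []))) = 0 := by
    simp only [← N.mul_r, ← LinearMap.sum_apply, ← map_sum, ha]
    simp
  have c := F.casimir_mul_nakayama (((N.r.flip ∘ₗ N.l.flip (f (bl k 0 []))))) a
  simp only [LinearMap.comp_apply, LinearMap.flip_apply] at c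
  rw [capR_bl N h f a (List.nil_append _).symm rfl, F.normN_bl,
    F.evR_bl N h₂ _ a _ _ rfl]
  simp only [← N.mul_r, N.l_r]
  rw [← c]
  refine Eq.symm ((Finset.sum_congr rfl fun j _ => congrArg (N.r (F.v j)) (deltaN_bl N rfl f
    (l := [] ++ [F.u j * F.nakayama a]) (i := []) rfl rfl rfl)).trans ?_)
  simp only [map_add, map_smul, List.nil_append, mid_singleton, add_zero, Finset.sum_add_distrib,
    ← Finset.smul_sum, last, smul_zero]

/-- Mirror image of `partN_mulA`: the Casimir letter `uⱼ` now stands between the word of `α` and the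
word of `β`, and its contractions with the two neighbours become the last term of `∂α` and the first
term of `∂β`. -/
theorem FrobeniusForm.partN_mulR {p q p' q' t t' : ℕ} (hp : p + 1 = p') (hq : q + 1 = q')
    (ht : t + 1 = t') (h : p' + (q' + 1) = t') (h₁ : p + (q' + 1) = t) (h₂ : p' + (q + 1) = t)
    (α : Chain k A p') (β : Chn N q') :
    partN F.nakayama.symm N ht (F.mulR N h α β) = F.mulR N h₁ (partA F.nakayama.symm hp α) β
      - (-1 : k) ^ p' • F.mulR N h₂ α (partN F.nakayama.symm N hq β) := by
  suffices H : (F.mulR N h).compr₂ (partN F.nakayama.symm N ht) =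
      F.mulR N h₁ ∘ₗ (partA F.nakayama.symm hp)
      - (-1 : k) ^ p' • (F.mulR N h₂).compl₂ (partN F.nakayama.symm N hq) from
    LinearMap.congr_fun (LinearMap.congr_fun H α) β
  refine chain_hom_ext fun a l hl => chn_hom_ext fun n b hb => ?_
  obtain ⟨y, s, rfl⟩ := List.exists_cons_of_length_eq_add_one (hl.trans hp.symm)
  obtain ⟨b₀, b', rfl⟩ := List.exists_cons_of_length_eq_add_one (hb.trans hq.symm)
  obtain ⟨ib, zb, eb, hib⟩ := exists_last b₀ b'
  obtain ⟨il, zl, el, hil⟩ := exists_last y s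
  have hil' : il.length = p := by simp at hl; omega
  have c₁ := F.casimir_mul (((TensorProduct.mk k N _).flip ∘ₗ
    slot k il (b₀ :: b') (r := t) (by omega)).compl₂ (N.r a ∘ₗ N.r.flip n)) zl
  have c₂ := F.casimir_mul_nakayama (((TensorProduct.mk k N _).flip ∘ₗ
    slot k (y :: s) b' (r := t) (by omega)).compl₂ (N.r a ∘ₗ N.r.flip n)) (F.nakayama.symm b₀)
  simp only [LinearMap.compl₂_apply, LinearMap.comp_apply, slot_apply, LinearMap.flip_apply,
    TensorProduct.mk_apply, N.mul_r, AlgEquiv.apply_symm_apply] at c₁ c₂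
  have m₁ : F.mulR N h₁ (mid (fun w => a ⊗ₜ[k] bl k p w) (y :: s)) (n ⊗ₜ bl k q' (b₀ :: b')) =
      mid (fun w => ∑ j, N.r a (N.r (F.v j) n) ⊗ₜ[k] bl k t (w ++ F.u j :: b₀ :: b')) (y :: s) :=
    (map_mid ((F.mulR N h₁).flip (n ⊗ₜ bl k q' (b₀ :: b'))) _ _).trans
      (mid_congr fun w hw => F.mulR_bl N h₁ a n w _ (by omega))
  have m₂ : F.mulR N h₂ (a ⊗ₜ bl k p' (y :: s)) (mid (fun w => n ⊗ₜ[k] bl k q w) (b₀ :: b')) =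
      mid (fun w => ∑ j, N.r a (N.r (F.v j) n) ⊗ₜ[k] bl k t (y :: s ++ F.u j :: w)) (b₀ :: b') :=
    (map_mid _ _ _).trans (mid_congr fun w hw => F.mulR_bl N h₂ a n _ w hl)
  have e₁ : ∀ j, partN F.nakayama.symm N ht (N.r a (N.r (F.v j) n) ⊗ₜ[k]
      bl k t' (y :: s ++ F.u j :: b₀ :: b')) = _ := fun j =>
    partN_bl F.nakayama.symm N ht _ (a := y) (z := zb)
      (t := s ++ F.u j :: b₀ :: b')
      (i := y :: s ++ F.u j :: ib) rfl (by rw [eb]; simp)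
      (by simp at hl hb ⊢; omega)
  simp only [LinearMap.compr₂_apply, LinearMap.compl₂_apply, LinearMap.sub_apply,
    LinearMap.smul_apply, LinearMap.comp_apply]
  rw [F.mulR_bl N h a n _ _ hl, map_sum, partN_bl _ N hq n rfl eb (by simpa [← hq] using hb),
    partA_bl _ hp a rfl el (by simpa [← hp] using hl)]
  simp only [e₁, map_add, map_smul, LinearMap.add_apply, LinearMap.smul_apply, m₁, m₂, mid_sum]
  rw [F.mulR_bl N h₁ _ n _ _ (by simp at hl; omega), F.mulR_bl N h₁ _ n _ _ hil',
    F.mulR_bl N h₂ a _ _ _ hl, F.mulR_bl N h₂ a _ _ _ hl, ← c₂]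
  simp only [N.mul_r]
  rw [← c₁]
  simp only [Finset.smul_sum, ← Finset.sum_add_distrib, ← Finset.sum_sub_distrib]
  refine Finset.sum_congr rfl fun j _ => ?_
  rw [mid_append_cons (k := k) _ (y :: s), mid_cons_cons, el, List.append_assoc,
    List.singleton_append, mid_append_cons (k := k) _ il, mid_cons_cons, ← el]
  have et : (-1 : k) ^ (t + 1) = (-1) ^ p' * (-1) ^ (q + 1) * (-1) := by
    rw [← h₂, pow_succ, pow_add]
  simp only [mid_singleton, N.l_r, List.append_assoc,
    List.cons_append, List.nil_append, hl, hil', et, ← hp]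
  simp only [pow_succ]
  module

theorem FrobeniusForm.sum_v_mul_nakayama_symm_u (a : A) :
    ∑ j, F.v j * (a * F.nakayama.symm (F.u j)) = ∑ j, F.u j * (a * F.v j) := by
  have c := F.casimir_swap ((LinearMap.mul k A).compl₂ (LinearMap.mulLeft k a ∘ₗ
    F.nakayama.symm.toLinearMap)).flip
  simpa using c.symm

theorem FrobeniusForm.partN_mulR_zero_left {q q' t t' : ℕ} (hq : q + 1 = q')
    (ht : t + 1 = t') (h : 0 + (q' + 1) = t') (h₂ : 0 + (q + 1) = t)
    {α : Chain k A 0} (hα : F.normA α = 0) (β : Chn N q') :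
    partN F.nakayama.symm N ht (F.mulR N h α β) =
      - F.mulR N h₂ α (partN F.nakayama.symm N hq β) := by
  obtain ⟨a, rfl⟩ := chain_zero_exists α
  have ha := LinearMap.congr_fun hα (bl k 0 [])
  rw [F.normA_bl, ← F.sum_v_mul_nakayama_symm_u, LinearMap.zero_apply] at ha
  suffices H : partN F.nakayama.symm N ht ∘ₗ F.mulR N h (a ⊗ₜ bl k 0 []) =
      - F.mulR N h₂ (a ⊗ₜ bl k 0 []) ∘ₗ partN F.nakayama.symm N hq from LinearMap.congr_fun H β
  refine chn_hom_ext fun n b hb => ?_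
  obtain ⟨b₀, b', rfl⟩ := List.exists_cons_of_length_eq_add_one (hb.trans hq.symm)
  obtain ⟨ib, zb, eb, hib⟩ := exists_last b₀ b'
  have c₂ := F.casimir_mul_nakayama (((TensorProduct.mk k N _).flip ∘ₗ
    slot k [] b' (r := t) (by simp; omega)).compl₂ (N.r a ∘ₗ N.r.flip n)) (F.nakayama.symm b₀)
  simp only [LinearMap.compl₂_apply, LinearMap.comp_apply, slot_apply, LinearMap.flip_apply,
    TensorProduct.mk_apply, N.mul_r, AlgEquiv.apply_symm_apply] at c₂
  have m₂ : F.mulR N h₂ (a ⊗ₜ bl k 0 []) (mid (fun w => n ⊗ₜ[k] bl k q w) (b₀ :: b')) =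
      mid (fun w => ∑ j, N.r a (N.r (F.v j) n) ⊗ₜ[k] bl k t ([] ++ F.u j :: w)) (b₀ :: b') :=
    (map_mid _ _ _).trans (mid_congr fun w hw => F.mulR_bl N h₂ a n _ w rfl)
  have e₁ : ∀ j, partN F.nakayama.symm N ht (N.r a (N.r (F.v j) n) ⊗ₜ[k]
      bl k t' ([] ++ F.u j :: b₀ :: b')) = _ := fun j =>
    partN_bl F.nakayama.symm N ht _ (z := zb) (i := F.u j :: ib) rfl (by rw [eb]; simp)
      (by simp at hb ⊢; omega)
  -- The inserted letter comes first; its action from the right assembles to `n` times `∑ vⱼ a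
  -- ν⁻¹(uⱼ)`, which is the norm of `α` and so vanishes.
  have first : ∑ j, N.r (F.nakayama.symm (F.u j)) (N.r a (N.r (F.v j) n)) ⊗ₜ[k]
      bl k t (b₀ :: b') = 0 := by
    simp only [← N.mul_r, ← TensorProduct.sum_tmul, ← LinearMap.sum_apply, ← map_sum, mul_assoc, ha]
    simp
  simp only [LinearMap.comp_apply, LinearMap.neg_apply]
  rw [F.mulR_bl N h a n _ _ rfl, map_sum, Finset.sum_congr rfl fun j _ => e₁ j,
    partN_bl _ N hq n rfl eb (by simpa [← hq] using hb)]
  simp only [map_add, map_smul, m₂, mid_sum]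
  rw [F.mulR_bl N h₂ a _ _ _ rfl, F.mulR_bl N h₂ a _ _ _ rfl, ← c₂, Finset.sum_add_distrib,
    Finset.sum_add_distrib, first, zero_add]
  simp only [Finset.smul_sum, ← Finset.sum_add_distrib, ← Finset.sum_neg_distrib]
  refine Finset.sum_congr rfl fun j _ => ?_
  have et : (-1 : k) ^ (t + 1) = (-1) ^ (q + 1) * (-1) := by rw [← h₂, zero_add, pow_succ]
  simp only [mid_cons_cons, List.nil_append, et, N.l_r]
  module

theorem FrobeniusForm.partN_mulR_zero_right {p p' : ℕ} (hp : p + 1 = p')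
    (ht : p' + 1 = p' + 1) (h : p' + (0 + 1) = p' + 1) (h₁ : p + (0 + 1) = p') (h₂ : p' + 0 = p')
    (α : Chain k A p') (β : Chn N 0) :
    partN F.nakayama.symm N ht (F.mulR N h α β) =
      F.mulR N h₁ (partA F.nakayama.symm hp α) β
      - (-1 : k) ^ p' • capR N h₂ α (F.normN N β) := by
  obtain ⟨n, rfl⟩ := chn_zero_exists β
  suffices H : partN F.nakayama.symm N ht ∘ₗ (F.mulR N h).flip (n ⊗ₜ bl k 0 []) =
      (F.mulR N h₁).flip (n ⊗ₜ bl k 0 []) ∘ₗ partA F.nakayama.symm hp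
      - (-1 : k) ^ p' • (capR N h₂).flip (F.normN N (n ⊗ₜ bl k 0 [])) from
    LinearMap.congr_fun H α
  refine chain_hom_ext fun a l hl => ?_
  obtain ⟨y, s, rfl⟩ := List.exists_cons_of_length_eq_add_one (hl.trans hp.symm)
  obtain ⟨il, zl, el, hil⟩ := exists_last y s
  have hil' : il.length = p := by simp at hl; omega
  have c₁ := F.casimir_mul (((TensorProduct.mk k N _).flip ∘ₗ
    slot k il [] (r := p') (by omega)).compl₂ (N.r a ∘ₗ N.r.flip n)) zl
  simp only [LinearMap.compl₂_apply, LinearMap.comp_apply, slot_apply, LinearMap.flip_apply,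
    TensorProduct.mk_apply, N.mul_r] at c₁
  have m₁ : F.mulR N h₁ (mid (fun w => a ⊗ₜ[k] bl k p w) (y :: s)) (n ⊗ₜ bl k 0 []) =
      mid (fun w => ∑ j, N.r a (N.r (F.v j) n) ⊗ₜ[k] bl k p' (w ++ [F.u j])) (y :: s) :=
    (map_mid ((F.mulR N h₁).flip (n ⊗ₜ bl k 0 [])) _ _).trans
      (mid_congr fun w hw => F.mulR_bl N h₁ a n w _ (by omega))
  have e₁ : ∀ j, partN F.nakayama.symm N ht (N.r a (N.r (F.v j) n) ⊗ₜ[k]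
      bl k (p' + 1) (y :: s ++ [F.u j])) = _ := fun j =>
    partN_bl F.nakayama.symm N ht _ (a := y) (t := s ++ [F.u j]) (i := y :: s) rfl rfl
      (by simp at hl ⊢; omega)
  simp only [LinearMap.comp_apply, LinearMap.sub_apply, LinearMap.smul_apply, LinearMap.flip_apply]
  rw [F.mulR_bl N h a n _ _ hl, map_sum, Finset.sum_congr rfl fun j _ => e₁ j,
    partA_bl _ hp a rfl el (by simpa [← hp] using hl),
    capR_bl N h₂ _ a (List.append_nil _).symm hl, F.normN_bl]
  simp only [map_add, map_smul, LinearMap.add_apply, LinearMap.smul_apply, m₁, mid_sum]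
  rw [F.mulR_bl N h₁ _ n _ _ (by simp at hl; omega), F.mulR_bl N h₁ _ n _ _ hil']
  simp only [N.mul_r]
  rw [← c₁]
  simp only [map_sum, TensorProduct.sum_tmul, Finset.smul_sum, ← Finset.sum_add_distrib,
    ← Finset.sum_sub_distrib]
  refine Finset.sum_congr rfl fun j _ => ?_
  rw [el, List.append_assoc,
    List.singleton_append, mid_append_cons (k := k) _ il, mid_cons_cons, ← el]
  simp only [mid_singleton, N.l_r, hil', ← hp, pow_succ]
  module

theorem FrobeniusForm.partN_mulR_zero_zero (ht : 0 + 1 = 1) (h : 0 + (0 + 1) = 1) (h₂ : 0 + 0 = 0)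
    {α : Chain k A 0} (hα : F.normA α = 0) (β : Chn N 0) :
    partN F.nakayama.symm N ht (F.mulR N h α β) = - capR N h₂ α (F.normN N β) := by
  obtain ⟨a, rfl⟩ := chain_zero_exists α
  obtain ⟨n, rfl⟩ := chn_zero_exists β
  have ha := LinearMap.congr_fun hα (bl k 0 [])
  rw [F.normA_bl, ← F.sum_v_mul_nakayama_symm_u, LinearMap.zero_apply] at ha
  have first : ∑ j, N.r (F.nakayama.symm (F.u j)) (N.r a (N.r (F.v j) n)) ⊗ₜ[k]
      bl k 0 ([] : List A) = 0 := by
    simp only [← N.mul_r, ← TensorProduct.sum_tmul, ← LinearMap.sum_apply, ← map_sum, mul_assoc, ha]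
    simp
  have e₁ : ∀ j, partN F.nakayama.symm N ht (N.r a (N.r (F.v j) n) ⊗ₜ[k]
      bl k 1 ([] ++ [F.u j])) = _ := fun j =>
    partN_bl F.nakayama.symm N ht _ (a := F.u j) (i := []) rfl rfl rfl
  rw [F.mulR_bl N h a n _ _ rfl, map_sum, Finset.sum_congr rfl fun j _ => e₁ j,
    capR_bl N h₂ _ a (List.append_nil _).symm rfl, F.normN_bl]
  simp only [List.nil_append, mid_singleton, add_zero]
  rw [Finset.sum_add_distrib, first]
  simp only [map_sum, TensorProduct.sum_tmul, N.l_r]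
  simp

end RightProducts

/-! ### The complete complex of a bimodule. -/

section CompleteComplex

variable {k : Type u} {A : Type v} [Field k] [Ring A] [Algebra k A]

/-- The complete complex with coefficients in a bimodule. -/
def DN (N : Bimod k A) : ℤ → Type (max u v)
  | .ofNat n => Coch N n
  | .negSucc p => Chn N p

noncomputable instance instAddCommGroupDN (N : Bimod k A) : (r : ℤ) → AddCommGroup (DN N r)
  | .ofNat n => inferInstanceAs (AddCommGroup (Coch N n))
  | .negSucc p => inferInstanceAs (AddCommGroup (Chn N p))

noncomputable instance instModuleDN (N : Bimod k A) : (r : ℤ) → Module k (DN N r)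
  | .ofNat n => inferInstanceAs (Module k (Coch N n))
  | .negSucc p => inferInstanceAs (Module k (Chn N p))

/-- The map between complete complexes induced by a linear map of the coefficients. -/
noncomputable def mapDN {N N' : Bimod k A} (φ : N →ₗ[k] N') : (r : ℤ) → DN N r →ₗ[k] DN N' r
  | .ofNat n => (φ.compRight k : Coch N n →ₗ[k] Coch N' n)
  | .negSucc p => (φ.rTensor (BarPow k A p) : Chn N p →ₗ[k] Chn N' p)

/-- The induced maps exist for all linear maps of coefficients, not only for bimodule maps. Thus
linear splittings of an exact sequence of bimodules act on the complexes, and exactness in each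
degree is immediate. -/
theorem mapDN_comp {N N' N'' : Bimod k A} (φ : N →ₗ[k] N') (ψ : N' →ₗ[k] N'') (r : ℤ)
    (x : DN N r) : mapDN ψ r (mapDN φ r x) = mapDN (ψ ∘ₗ φ) r x := by
  cases r with
  | ofNat n => rfl
  | negSucc p => exact (LinearMap.congr_fun (LinearMap.rTensor_comp (BarPow k A p) ψ φ) x).symm

theorem mapDN_id (N : Bimod k A) (r : ℤ) (x : DN N r) : mapDN LinearMap.id r x = x := by
  cases r with
  | ofNat n => rfl
  | negSucc p => exact LinearMap.congr_fun (LinearMap.rTensor_id (BarPow k A p) N) x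

theorem mapDN_add {N N' : Bimod k A} (φ ψ : N →ₗ[k] N') (r : ℤ) (x : DN N r) :
    mapDN (φ + ψ) r x = mapDN φ r x + mapDN ψ r x := by
  cases r with
  | ofNat n => rfl
  | negSucc p => exact LinearMap.congr_fun (LinearMap.rTensor_add (BarPow k A p) φ ψ) x

variable [FiniteDimensional k A] (F : FrobeniusForm k A)

/-- The differential of the complete complex with coefficients in a bimodule, with the signs that
make it compatible with products. -/
noncomputable def FrobeniusForm.dN (N : Bimod k A) :
    (s t : ℤ) → s + 1 = t → (DN N s →ₗ[k] DN N t)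
  | .ofNat n, .ofNat n', h =>
    (deltaN N (by simp only [Int.ofNat_eq_natCast] at h; omega) : Coch N n →ₗ[k] Coch N n')
  | .negSucc 0, .ofNat 0, _ => (F.normN N : Chn N 0 →ₗ[k] Coch N 0)
  | .negSucc (p' + 1), .negSucc p, h =>
    ((-1 : k) ^ (p' + 1) • partN F.nakayama.symm N (by omega) : Chn N (p' + 1) →ₗ[k] Chn N p)
  | .negSucc 0, .negSucc p, h => absurd h (by omega)
  | .negSucc (p + 1), .ofNat n, h => absurd h (by simp only [Int.ofNat_eq_natCast]; omega)
  | .negSucc 0, .ofNat (n + 1), h => absurd h (by simp only [Int.ofNat_eq_natCast]; omega)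
  | .ofNat n, .negSucc p, h => absurd h (by simp only [Int.ofNat_eq_natCast]; omega)

/-- With the sign `(-1)^p` on chains, left multiplication by a cocycle commutes with the
differential up to a sign that depends only on the degree of the cocycle, not on the degree of the
argument. Kernels and images are unaffected. -/
theorem FrobeniusForm.dN_negSucc (N : Bimod k A) {p' p : ℕ}
    (h : Int.negSucc p' + 1 = Int.negSucc p) (h' : p + 1 = p') (x : Chn N p') :
    F.dN N (.negSucc p') (.negSucc p) h x =
      ((-1 : k) ^ p' • partN F.nakayama.symm N h' x : Chn N p) := by
  subst h'
  rfl

theorem FrobeniusForm.dN_mapDN {N N' : Bimod k A} {φ : N →ₗ[k] N'} (hφ : Bimod.IsHom φ)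
    (s t : ℤ) (h : s + 1 = t) (x : DN N s) :
    F.dN N' s t h (mapDN φ s x) = mapDN φ t (F.dN N s t h x) := by
  match s, t, h, x with
  | .ofNat n, .ofNat n', h, f =>
    have h' : n + 1 = n' := by simp only [Int.ofNat_eq_natCast] at h; omega
    refine bl_hom_ext (M := N') fun l hl => ?_
    subst h'
    obtain ⟨a, t, rfl⟩ := List.exists_cons_of_length_eq_add_one hl
    obtain ⟨i, z, e, hi⟩ := exists_last a t
    refine (deltaN_bl N' rfl _ rfl e (by simpa using hl)).trans (Eq.symm ?_)
    refine (congrArg φ (deltaN_bl N rfl f rfl e (by simpa using hl))).trans ?_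
    rw [map_add, map_add, map_smul, map_mid, hφ.map_l, hφ.map_r]
    rfl
  | .negSucc 0, .ofNat 0, _, x =>
    obtain ⟨n, rfl⟩ := chn_zero_exists x
    refine coch_zero_ext (N := N') ?_
    refine (F.normN_bl N' (φ n) [] []).trans (Eq.symm ?_)
    refine (congrArg φ (F.normN_bl N n [] [])).trans ?_
    simp only [map_sum, hφ.map_l, hφ.map_r]
  | .negSucc p', .negSucc p, h, x =>
    have hp : p + 1 = p' := by omega
    refine (F.dN_negSucc N' h hp _).trans
      (Eq.trans ?_ (congrArg (mapDN φ _) (F.dN_negSucc N h hp x)).symm)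
    suffices H : ((-1 : k) ^ p' • partN F.nakayama.symm N' hp) ∘ₗ φ.rTensor (BarPow k A p') =
        φ.rTensor (BarPow k A p) ∘ₗ ((-1 : k) ^ p' • partN F.nakayama.symm N hp) from
      LinearMap.congr_fun H x
    refine chn_hom_ext fun n l hl => ?_
    obtain ⟨a, t, rfl⟩ := List.exists_cons_of_length_eq_add_one (hl.trans hp.symm)
    obtain ⟨i, z, e, hi⟩ := exists_last a t
    simp only [LinearMap.comp_apply, LinearMap.smul_apply, LinearMap.rTensor_tmul, map_smul]
    rw [partN_bl _ N' hp _ rfl e (by simp at hl; omega),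
      partN_bl _ N hp _ rfl e (by simp at hl; omega), map_add, map_add, map_smul, map_mid]
    simp only [LinearMap.rTensor_tmul, hφ.map_l, hφ.map_r]
  | .negSucc (p + 1), .ofNat n, h, _ => exact absurd h (by simp only [Int.ofNat_eq_natCast]; omega)
  | .negSucc 0, .ofNat (n + 1), h, _ => exact absurd h (by simp only [Int.ofNat_eq_natCast]; omega)
  | .ofNat n, .negSucc p, h, _ => exact absurd h (by simp only [Int.ofNat_eq_natCast]; omega)

/-! ### Exact sequences of bimodules -/

/-- A sub-bimodule. -/
@[reducible] def Bimod.sub {N : Bimod k A} (S : Submodule k N) (hl : ∀ a, ∀ n ∈ S, N.l a n ∈ S)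
    (hr : ∀ a, ∀ n ∈ S, N.r a n ∈ S) : Bimod k A where
  carrier := S
  l := LinearMap.mk₂ k (fun a n => ⟨N.l a n, hl a n n.2⟩) (fun a b n => by ext; simp)
    (fun c a n => by ext; simp) (fun a b n => by ext; simp) (fun c a n => by ext; simp)
  r := LinearMap.mk₂ k (fun a n => ⟨N.r a n, hr a n n.2⟩) (fun a b n => by ext; simp)
    (fun c a n => by ext; simp) (fun a b n => by ext; simp) (fun c a n => by ext; simp)
  one_l n := by ext; simp
  mul_l a b n := by ext; simp [N.mul_l]
  one_r n := by ext; simp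
  mul_r a b n := by ext; simp [N.mul_r]
  l_r a b n := by ext; simp [N.l_r]

/-- A quotient bimodule. -/
@[reducible] noncomputable def Bimod.quot {N : Bimod k A} (S : Submodule k N)
    (hl : ∀ a, ∀ n ∈ S, N.l a n ∈ S) (hr : ∀ a, ∀ n ∈ S, N.r a n ∈ S) : Bimod k A where
  carrier := N ⧸ S
  l := 
    { toFun := fun a => S.mapQ S (N.l a) (hl a)
      map_add' := fun a b => by ext; simp
      map_smul' := fun c a => by ext; simp }
  r := 
    { toFun := fun a => S.mapQ S (N.r a) (hr a)
      map_add' := fun a b => by ext; simp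
      map_smul' := fun c a => by ext; simp }
  one_l n := by
    obtain ⟨n, rfl⟩ := S.mkQ_surjective n
    simp
  mul_l a b n := by
    obtain ⟨n, rfl⟩ := S.mkQ_surjective n
    simp [N.mul_l]
  one_r n := by
    obtain ⟨n, rfl⟩ := S.mkQ_surjective n
    simp
  mul_r a b n := by
    obtain ⟨n, rfl⟩ := S.mkQ_surjective n
    simp [N.mul_r]
  l_r a b n := by
    obtain ⟨n, rfl⟩ := S.mkQ_surjective n
    simp [N.l_r]

/-- Short exact sequences of bimodules, with a splitting by linear maps. -/
structure SplitExact (N E Q : Bimod k A) where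
  i : N →ₗ[k] E
  p : E →ₗ[k] Q
  ρ : E →ₗ[k] N
  σ : Q →ₗ[k] E
  i_hom : Bimod.IsHom i
  p_hom : Bimod.IsHom p
  ρ_i : ρ ∘ₗ i = LinearMap.id
  p_σ : p ∘ₗ σ = LinearMap.id
  p_i : p ∘ₗ i = 0
  add_eq : i ∘ₗ ρ + σ ∘ₗ p = LinearMap.id

-- Over a field `i` has a linear retraction `ρ`, and `id - i ρ` kills the image of `i`, hence
-- descends to a section of the quotient map.
omit [FiniteDimensional k A] in
theorem exists_splitExact_of_injective {N E : Bimod k A} (i : N →ₗ[k] E) (hi : Bimod.IsHom i)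
    (hinj : Function.Injective i) :
    ∃ (Q : Bimod k A) (S : SplitExact N E Q), S.i = i := by
  obtain ⟨ρ, hρ⟩ := i.exists_leftInverse_of_injective (LinearMap.ker_eq_bot.2 hinj)
  refine ⟨Bimod.quot (LinearMap.range i) ?_ ?_,
    { i := i
      p := (LinearMap.range i).mkQ
      ρ := ρ
      σ := (LinearMap.range i).liftQ (LinearMap.id - i ∘ₗ ρ) ?_
      i_hom := hi
      p_hom := ⟨fun a n => rfl, fun a n => rfl⟩
      ρ_i := hρ
      p_σ := ?_
      p_i := ?_
      add_eq := ?_ }, rfl⟩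
  · rintro a _ ⟨n, rfl⟩
    exact ⟨N.l a n, hi.map_l a n⟩
  · rintro a _ ⟨n, rfl⟩
    exact ⟨N.r a n, hi.map_r a n⟩
  · rintro _ ⟨n, rfl⟩
    have := LinearMap.congr_fun hρ n
    simp at this ⊢
    rw [this, sub_self]
  · refine LinearMap.ext fun x => ?_
    obtain ⟨x, rfl⟩ := (LinearMap.range i).mkQ_surjective x
    simp
  · exact LinearMap.ext fun x => by simp
  · exact LinearMap.ext fun x => by simp

omit [FiniteDimensional k A] in
theorem exists_splitExact_of_surjective {E Q : Bimod k A} (p : E →ₗ[k] Q) (hp : Bimod.IsHom p)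
    (hsurj : Function.Surjective p) :
    ∃ (K : Bimod k A) (S : SplitExact K E Q), S.p = p := by
  obtain ⟨σ, hσ⟩ := p.exists_rightInverse_of_surjective (LinearMap.range_eq_top.2 hsurj)
  have hσ' : ∀ x, p (σ x) = x := fun x => LinearMap.congr_fun hσ x
  have hm : ∀ x, (LinearMap.id - σ ∘ₗ p : E →ₗ[k] E) x ∈ LinearMap.ker p := fun x => by simp [hσ']
  have hl : ∀ a, ∀ n ∈ LinearMap.ker p, E.l a n ∈ LinearMap.ker p := fun a n hn => by
    rw [LinearMap.mem_ker] at hn ⊢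
    rw [hp.map_l, hn, map_zero]
  have hr : ∀ a, ∀ n ∈ LinearMap.ker p, E.r a n ∈ LinearMap.ker p := fun a n hn => by
    rw [LinearMap.mem_ker] at hn ⊢
    rw [hp.map_r, hn, map_zero]
  exact ⟨Bimod.sub (LinearMap.ker p) hl hr,
    { i := (LinearMap.ker p).subtype
      p := p
      ρ := (LinearMap.id - σ ∘ₗ p).codRestrict (LinearMap.ker p) hm
      σ := σ
      i_hom := ⟨fun a n => rfl, fun a n => rfl⟩
      p_hom := hp
      ρ_i := LinearMap.ext fun x => Subtype.ext <| by
        have : p x.1 = 0 := x.2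
        simp [this]
      p_σ := hσ
      p_i := LinearMap.ext fun x : LinearMap.ker p => x.2
      add_eq := LinearMap.ext fun x => by simp }, rfl⟩

variable {F}

omit [FiniteDimensional k A] in
theorem SplitExact.map_injective {N E Q : Bimod k A} (S : SplitExact N E Q) {r : ℤ} {x : DN N r}
    (h : mapDN S.i r x = 0) : x = 0 := by
  have := mapDN_comp S.i S.ρ r x
  rwa [h, map_zero, S.ρ_i, mapDN_id, eq_comm] at this

omit [FiniteDimensional k A] in
theorem SplitExact.map_surjective {N E Q : Bimod k A} (S : SplitExact N E Q) {r : ℤ} (x : DN Q r) :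
    ∃ y, mapDN S.p r y = x :=
  ⟨mapDN S.σ r x, by rw [mapDN_comp, S.p_σ, mapDN_id]⟩

omit [FiniteDimensional k A] in
theorem SplitExact.map_exact {N E Q : Bimod k A} (S : SplitExact N E Q) {r : ℤ} {y : DN E r}
    (h : mapDN S.p r y = 0) : ∃ x, mapDN S.i r x = y := by
  refine ⟨mapDN S.ρ r y, ?_⟩
  have := mapDN_id E r y
  rwa [← S.add_eq, mapDN_add, ← mapDN_comp, ← mapDN_comp, h, map_zero, add_zero] at this

omit [FiniteDimensional k A] in
theorem mapDN_zero {N N' : Bimod k A} (r : ℤ) (x : DN N r) : mapDN (0 : N →ₗ[k] N') r x = 0 := by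
  simpa using mapDN_add (0 : N →ₗ[k] N') 0 r x

omit [FiniteDimensional k A] in
theorem SplitExact.map_comp_eq_zero {N E Q : Bimod k A} (S : SplitExact N E Q) {r : ℤ}
    (x : DN N r) : mapDN S.p r (mapDN S.i r x) = 0 := by
  rw [mapDN_comp, S.p_i, mapDN_zero]

end CompleteComplex

/-! ### The differential squares to zero. -/

section Square

theorem mid_sub {A : Type*} [Ring A] {M : Type*} [AddCommGroup M] (φ ψ : List A → M) (l : List A) :
    mid (fun w => φ w - ψ w) l = mid φ l - mid ψ l := by
  induction l generalizing φ ψ with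
  | nil => simp
  | cons a l ih =>
    cases l with
    | nil => simp
    | cons b l =>
      simp only [mid_cons_cons, ih]
      abel

theorem mid_add {A : Type*} [Ring A] {M : Type*} [AddCommGroup M] (φ ψ : List A → M) (l : List A) :
    mid (fun w => φ w + ψ w) l = mid φ l + mid ψ l := by
  induction l generalizing φ ψ with
  | nil => simp
  | cons a l ih =>
    cases l with
    | nil => simp
    | cons b l =>
      simp only [mid_cons_cons, ih]
      abel

theorem mid_neg {A : Type*} [Ring A] {M : Type*} [AddCommGroup M] (φ : List A → M) (l : List A) :
    mid (fun w => -φ w) l = -mid φ l :=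
  (map_mid (-AddMonoidHom.id M) φ l).symm

/-- Two contractions at distant places can be done in either order and cancel by sign; two that
involve three consecutive letters cancel by associativity. -/
theorem mid_mid {A : Type*} [Ring A] {M : Type*} [AddCommGroup M] (φ : List A → M) (l : List A) :
    mid (mid φ) l = 0 := by
  induction l generalizing φ with
  | nil => rfl
  | cons a l ih =>
    match l with
    | [] => rfl
    | [b] => simp [mid_cons_cons]
    | b :: c :: l =>
      have e : mid (fun w => mid φ (a :: w)) (b :: c :: l) =
          mid (fun w => -φ (a * w.headD 0 :: w.tail) - mid (fun w => φ (a :: w)) w) (b :: c :: l) :=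
        mid_congr fun w hw => by
          obtain ⟨x, w, rfl⟩ : ∃ x w', w = x :: w' :=
            List.exists_cons_of_ne_nil fun h => by simp [h] at hw
          rfl
      rw [mid_cons_cons, e, mid_sub, ih, mid_cons_cons, mid_cons_cons]
      simp only [List.headD_cons, List.tail_cons, mul_assoc, mid_neg]
      abel

/-- Outer terms of a differential depend on the first letter and the rest. Written with `headD` and
`tail` they become functions of a list, to which `mid` applies; the words that occur are nonempty,
so the default `0` is never reached. -/
theorem mid_headD {A : Type*} [Ring A] {M : Type*} [AddCommGroup M] (ψ : A → List A → M) (a b : A)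
    (l : List A) :
    mid (fun w => ψ (w.headD 0) w.tail) (a :: b :: l) = -ψ (a * b) l - mid (ψ a) (b :: l) := rfl

variable {k : Type u} {A : Type v} [Field k] [Ring A] [Algebra k A]

omit [Algebra k A] in
theorem mid_smul {M : Type*} [AddCommGroup M] [Module k M] (c : k) (φ : List A → M) (l : List A) :
    mid (fun w => c • φ w) l = c • mid φ l :=
  (map_mid (c • LinearMap.id : M →ₗ[k] M) φ l).symm

theorem mid_getLastD {M : Type*} [AddCommGroup M] [Module k M] (χ : A → List A → M) (l : List A)
    (y z : A) : mid (fun w => χ (w.getLastD 0) w.dropLast) (l ++ [y, z]) =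
      mid (χ z) (l ++ [y]) - (-1 : k) ^ l.length • χ (y * z) l := by
  rw [mid_append_cons (k := k)]
  simp [mid_cons_cons, sub_eq_add_neg]

theorem deltaN_deltaN (N : Bimod k A) {r r' r'' : ℕ} (h : r + 1 = r') (h' : r' + 1 = r'')
    (f : Coch N r) : deltaN N h' (deltaN N h f) = 0 := by
  subst h
  refine bl_hom_ext fun l hl => ?_
  obtain ⟨a, s, rfl⟩ := List.exists_cons_of_length_eq_add_one (hl.trans h'.symm)
  obtain ⟨b, t, rfl⟩ := List.exists_cons_of_length_eq_add_one (n := r) (by simpa [← h'] using hl)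
  obtain ⟨m, z, e, hm⟩ := exists_last b t
  obtain ⟨i, y, e', hi⟩ := exists_last a m
  have ht : t.length = r := by simp at hl; omega
  have e₁ : a :: b :: t = (a :: m) ++ [z] := by rw [e]; rfl
  have e₂ : a :: b :: t = i ++ [y, z] := by rw [e₁, e']; simp
  have hd : mid (fun w => deltaN N rfl f (bl k (r + 1) w)) (a :: b :: t) =
      mid (fun w => N.l (w.headD 0) (f (bl k r w.tail)) + mid (fun w => f (bl k r w)) w
        + (-1 : k) ^ (r + 1) • N.r (w.getLastD 0) (f (bl k r w.dropLast))) (a :: b :: t) :=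
    mid_congr fun w hw => by
      obtain ⟨x, w, rfl⟩ : ∃ x w', w = x :: w' :=
        List.exists_cons_of_ne_nil fun h => by simp [h] at hw
      obtain ⟨j, x', ex, hj⟩ := exists_last x w
      have e₃ : (x :: w).getLastD 0 = x' := by rw [ex]; simp
      have e₄ : (x :: w).dropLast = j := by rw [ex]; simp
      rw [deltaN_bl N rfl f rfl ex (by simp at hw; omega), e₃, e₄]
      rfl
  rw [deltaN_bl N h' _ rfl e₁ (by simp; omega), hd, mid_add, mid_add, mid_mid, mid_smul,
    mid_headD (fun x w => N.l x (f (bl k r w))), deltaN_bl N rfl f rfl e ht,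
    deltaN_bl N rfl f rfl e' (by omega), e₂, mid_getLastD (k := k) (fun x w => N.r x (f (bl k r w))),
    ← e', ← map_mid (N.l a), ← map_mid (N.r z)]
  have hi' : i.length = r := by omega
  simp only [map_add, map_smul, N.mul_l, N.mul_r, N.l_r, hi', LinearMap.zero_apply]
  rcases neg_one_pow_eq_or k r with h | h <;> simp only [pow_succ, h] <;> module

theorem partN_partN (σ : A ≃ₐ[k] A) (N : Bimod k A) {r r' r'' : ℕ} (h : r + 1 = r')
    (h' : r' + 1 = r'') (x : Chn N r'') : partN σ N h (partN σ N h' x) = 0 := by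
  subst h
  suffices H : partN σ N rfl ∘ₗ partN σ N h' = 0 from LinearMap.congr_fun H x
  refine chn_hom_ext fun n l hl => ?_
  obtain ⟨a, s, rfl⟩ := List.exists_cons_of_length_eq_add_one (hl.trans h'.symm)
  obtain ⟨b, t, rfl⟩ := List.exists_cons_of_length_eq_add_one (n := r) (by simpa [← h'] using hl)
  obtain ⟨m, z, e, hm⟩ := exists_last b t
  obtain ⟨i, y, e', hi⟩ := exists_last a m
  have ht : t.length = r := by simp at hl; omega
  have e₁ : a :: b :: t = (a :: m) ++ [z] := by rw [e]; rfl
  have e₂ : a :: b :: t = i ++ [y, z] := by rw [e₁, e']; simp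
  have hd : mid (fun w => partN σ N rfl (n ⊗ₜ bl k (r + 1) w)) (a :: b :: t) =
      mid (fun w => N.r (σ (w.headD 0)) n ⊗ₜ[k] (bl k r w.tail) + mid (fun w => n ⊗ₜ[k] bl k r w) w
        + (-1 : k) ^ (r + 1) • N.l (w.getLastD 0) n ⊗ₜ[k] (bl k r w.dropLast)) (a :: b :: t) :=
    mid_congr fun w hw => by
      obtain ⟨x, w, rfl⟩ : ∃ x w', w = x :: w' :=
        List.exists_cons_of_ne_nil fun h => by simp [h] at hw
      obtain ⟨j, x', ex, hj⟩ := exists_last x w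
      have e₃ : (x :: w).getLastD 0 = x' := by rw [ex]; simp
      have e₄ : (x :: w).dropLast = j := by rw [ex]; simp
      rw [partN_bl σ N rfl n rfl ex (by simp at hw; omega), e₃, e₄]
      rfl
  rw [LinearMap.comp_apply, partN_bl σ N h' _ rfl e₁ (by simp; omega), map_add, map_add, map_smul,
    map_mid, hd, mid_add, mid_add, mid_mid, mid_smul,
    mid_headD (fun x w => N.r (σ x) n ⊗ₜ[k] bl k r w), partN_bl σ N rfl _ rfl e ht,
    partN_bl σ N rfl _ rfl e' (by omega), e₂,
    mid_getLastD (k := k) (fun x w => N.l x n ⊗ₜ[k] bl k r w), ← e']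
  have hi' : i.length = r := by omega
  simp only [N.mul_l, N.mul_r, N.l_r, hi', LinearMap.zero_apply, map_mul]
  rcases neg_one_pow_eq_or k r with h | h <;> simp only [pow_succ, h] <;> module

variable [FiniteDimensional k A] (F : FrobeniusForm k A)

/-- The two terms of the boundary are `n ν⁻¹(y)` and `y n`. They have the same norm by the Casimir
identity, and they enter with opposite signs. -/
theorem FrobeniusForm.normN_partN (N : Bimod k A) (x : Chn N 1) :
    F.normN N (partN F.nakayama.symm N (zero_add 1) x) = 0 := by
  suffices H : F.normN N ∘ₗ partN F.nakayama.symm N (zero_add 1) = 0 from LinearMap.congr_fun H x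
  refine chn_hom_ext fun n l hl => coch_zero_ext ?_
  obtain ⟨y, rfl⟩ := List.length_eq_one_iff.1 hl
  have c := F.casimir_mul_nakayama (N.l.compl₂ (N.r.flip n)) (F.nakayama.symm y)
  simp only [LinearMap.compl₂_apply, LinearMap.flip_apply, AlgEquiv.apply_symm_apply, N.mul_l,
    N.mul_r] at c
  rw [LinearMap.comp_apply, partN_bl (p := 0) (t := []) _ N _ n (i := []) rfl rfl rfl, mid_singleton, add_zero, map_add,
    map_smul, LinearMap.add_apply, LinearMap.smul_apply, F.normN_bl, F.normN_bl, ← c]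
  simp [N.l_r]

theorem FrobeniusForm.deltaN_normN (N : Bimod k A) (x : Chn N 0) :
    deltaN N (zero_add 1) (F.normN N x) = 0 := by
  obtain ⟨n, rfl⟩ := chn_zero_exists x
  refine bl_hom_ext fun l hl => ?_
  obtain ⟨y, rfl⟩ := List.length_eq_one_iff.1 hl
  rw [deltaN_bl (r := 0) (t := []) N _ _ (i := []) rfl rfl rfl, F.normN_bl, F.sum_u_l_v_r_comm]
  simp

theorem FrobeniusForm.dN_dN (N : Bimod k A) {r s t : ℤ} (h : r + 1 = s) (h' : s + 1 = t)
    (x : DN N r) : F.dN N s t h' (F.dN N r s h x) = 0 := by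
  match r, s, t, h, h', x with
  | .ofNat n, .ofNat n', .ofNat n'', h, h', x => exact deltaN_deltaN N _ _ x
  | .negSucc 0, .ofNat 0, .ofNat 1, _, _, x => exact F.deltaN_normN N x
  | .negSucc 1, .negSucc 0, .ofNat 0, h, h', x =>
    obtain ⟨x, rfl⟩ : ∃ z : Chn N 1, z = x := ⟨x, rfl⟩
    refine (congrArg (F.dN N _ _ h') (F.dN_negSucc N h (zero_add 1) x)).trans ?_
    refine (map_smul (F.normN N) _ _).trans ?_
    rw [F.normN_partN]
    exact smul_zero _
  | .negSucc p'', .negSucc p', .negSucc p, h, h', x =>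
    have e : p + 1 = p' := by omega
    have e' : p' + 1 = p'' := by omega
    obtain ⟨x, rfl⟩ : ∃ z : Chn N p'', z = x := ⟨x, rfl⟩
    refine (congrArg (F.dN N _ _ h') (F.dN_negSucc N h e' x)).trans ?_
    refine (F.dN_negSucc N h' e _).trans ?_
    rw [map_smul, partN_partN, smul_zero, smul_zero]
    rfl
  | .negSucc p, .ofNat (n + 1), _, h, _, _ =>
    exact absurd h (by simp only [Int.ofNat_eq_natCast]; omega)
  | .negSucc (p + 1), .ofNat n, _, h, _, _ =>
    exact absurd h (by simp only [Int.ofNat_eq_natCast]; omega)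
  | _, .ofNat n, .negSucc p, _, h, _ =>
    exact absurd h (by simp only [Int.ofNat_eq_natCast]; omega)
  | .ofNat n, .negSucc p, _, h, _, _ =>
    exact absurd h (by simp only [Int.ofNat_eq_natCast]; omega)
  | _, .ofNat 0, .ofNat (n + 2), _, h, _ =>
    exact absurd h (by simp only [Int.ofNat_eq_natCast]; omega)
  | _, .ofNat 0, .ofNat 0, _, h, _ =>
    exact absurd h (by simp only [Int.ofNat_eq_natCast]; omega)
  | _, .negSucc 0, .ofNat (n + 1), _, h, _ =>
    exact absurd h (by simp only [Int.ofNat_eq_natCast]; omega)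
  | _, .negSucc (p + 1), .ofNat n, _, h, _ =>
    exact absurd h (by simp only [Int.ofNat_eq_natCast]; omega)
  | .negSucc 0, .negSucc p, _, h, _, _ => exact absurd h (by omega)
  | .negSucc (p + 2), .negSucc 0, _, h, _, _ => exact absurd h (by omega)

end Square

/-! ### Acyclicity of coinduced bimodules. -/

section Coinduced

variable {k : Type u} {A : Type v} [Field k] [Ring A] [Algebra k A]

/-- The left action `(a φ)(y) = φ(y a)` on `Hom_k(A, N)`. -/
noncomputable def coindL (N : Bimod k A) : A →ₗ[k] (A →ₗ[k] N) →ₗ[k] (A →ₗ[k] N) :=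
  LinearMap.mk₂ k (fun a φ => φ ∘ₗ LinearMap.mulRight k a)
    (fun a b φ => by ext; simp [mul_add]) (fun c a φ => by ext; simp)
    (fun a φ ψ => by ext; simp) (fun c a φ => by ext; simp)

@[simp] theorem coindL_apply (N : Bimod k A) (a : A) (φ : A →ₗ[k] N) (y : A) :
    coindL N a φ y = φ (y * a) := rfl

/-- The right action `(φ a)(y) = φ(y) a` on `Hom_k(A, N)`. -/
noncomputable def coindR (N : Bimod k A) : A →ₗ[k] (A →ₗ[k] N) →ₗ[k] (A →ₗ[k] N) :=
  LinearMap.mk₂ k (fun a φ => N.r a ∘ₗ φ)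
    (fun a b φ => by ext; simp) (fun c a φ => by ext; simp)
    (fun a φ ψ => by ext; simp) (fun c a φ => by ext; simp)

@[simp] theorem coindR_apply (N : Bimod k A) (a : A) (φ : A →ₗ[k] N) (y : A) :
    coindR N a φ y = N.r a (φ y) := rfl

/-- The bimodule `Hom_k(A, N)`, with `(a φ b)(y) = φ(y a) b`. -/
@[reducible] noncomputable def Bimod.coind (N : Bimod k A) : Bimod k A where
  carrier := A →ₗ[k] N
  l := coindL N
  r := coindR N
  one_l φ := by ext; simp
  mul_l a b φ := by ext; simp [mul_assoc]
  one_r φ := by ext; simp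
  mul_r a b φ := by ext; simp [N.mul_r]
  l_r a b φ := by ext; simp

/-- The embedding sends `n` to `y ↦ y n`; evaluation at `1` recovers `n`. -/
theorem Bimod.exists_mono_coind (N : Bimod k A) :
    ∃ i : N →ₗ[k] Bimod.coind N, Bimod.IsHom i ∧ Function.Injective i := by
  refine ⟨N.l.flip, ⟨fun a n => ?_, fun a n => ?_⟩, fun m n h => ?_⟩
  · exact LinearMap.ext fun y => (N.mul_l y a n).symm
  · exact LinearMap.ext fun y => N.l_r y a n
  · simpa using LinearMap.congr_fun h 1

variable [FiniteDimensional k A] (F : FrobeniusForm k A)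

/-- The Frobenius form makes the same bimodule serve as a cover: `φ ↦ ∑ uᵢ φ(vᵢ)` is left linear by
`casimir_mul`, and it sends `⟨·, 1⟩ n` to `n`. -/
theorem FrobeniusForm.exists_epi_coind (F : FrobeniusForm k A) (N : Bimod k A) :
    ∃ p : Bimod.coind N →ₗ[k] N, Bimod.IsHom p ∧ Function.Surjective p := by
  let p : (A →ₗ[k] N) →ₗ[k] N := ∑ i, N.l (F.u i) ∘ₗ LinearMap.applyₗ (F.v i)
  have hp : ∀ φ, p φ = ∑ i, N.l (F.u i) (φ (F.v i)) := fun φ => by simp [p]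
  refine ⟨p, ⟨fun a φ => ?_, fun a φ => ?_⟩, fun n => ?_⟩
  · have c := F.casimir_mul (N.l.compl₂ φ) a
    simp only [LinearMap.compl₂_apply, N.mul_l] at c
    rw [hp, hp, map_sum, c]
    rfl
  · rw [hp, hp, map_sum]
    simp only [coindR_apply, N.l_r]
  · refine ⟨(F.form.flip 1).smulRight n, ?_⟩
    have h := F.sum_form_v_smul_u 1
    rw [hp]
    simpa using congrArg (fun z => N.l z n) h

omit [FiniteDimensional k A] in
theorem mid_linearMap_apply {M : Type*} [AddCommGroup M] [Module k M] (φ : List A → (A →ₗ[k] M))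
    (l : List A) (y : A) : mid φ l y = mid (fun w => φ w y) l :=
  map_mid (LinearMap.applyₗ y : (A →ₗ[k] M) →ₗ[k] M) φ l

-- The contraction turns the first letter into the variable of `Hom_k(A, N)`: `g(w)(y) = f(y w)(1)`.
-- The cocycle relation of `f` on the word `y l`, evaluated at `1`, is then `δg = f`.
omit [FiniteDimensional k A] in
theorem deltaN_coind_exact (N : Bimod k A) {r r' r'' : ℕ} (h : r + 1 = r') (h' : r' + 1 = r'')
    (f : Coch (Bimod.coind N) r') (hf : deltaN (Bimod.coind N) h' f = 0) :
    ∃ g, deltaN (Bimod.coind N) h g = f := by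
  subst h
  let g : BarPow k A r →ₗ[k] (A →ₗ[k] N) :=
    ((consA k r).compr₂ (LinearMap.applyₗ (1 : A) ∘ₗ f)).flip
  have hg : ∀ w y, g (bl k r w) y = (f (bl k (r + 1) (y :: w)) : A →ₗ[k] N) 1 := fun w y => by
    simp [g]
  refine ⟨g, bl_hom_ext (M := A →ₗ[k] N) fun l hl => LinearMap.ext fun y => ?_⟩
  obtain ⟨a, t, rfl⟩ := List.exists_cons_of_length_eq_add_one hl
  obtain ⟨i, z, e, hi⟩ := exists_last a t
  have e₁ := LinearMap.congr_fun hf (bl k r'' (y :: a :: t))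
  rw [deltaN_bl _ h' f (i := y :: i) (z := z) rfl (by rw [e]; simp) hl, LinearMap.zero_apply] at e₁
  have e₂ : (_ : A →ₗ[k] N) 1 = (0 : A →ₗ[k] N) 1 := congrArg (fun φ : A →ₗ[k] N => φ 1) e₁
  have e₃ := deltaN_bl (Bimod.coind N) rfl g (l := a :: t) rfl e (by simpa using hl)
  refine (congrArg (fun φ : A →ₗ[k] N => φ y) e₃).trans ?_
  have m₁ : (mid (fun w => f (bl k (r + 1) w)) (y :: a :: t) : A →ₗ[k] N) 1 =
      mid (fun w => (f (bl k (r + 1) w) : A →ₗ[k] N) 1) (y :: a :: t) :=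
    mid_linearMap_apply (fun w => (f (bl k (r + 1) w) : A →ₗ[k] N)) _ _
  have m₂ : (mid (fun w => g (bl k r w)) (a :: t) : A →ₗ[k] N) y =
      mid (fun w => (f (bl k (r + 1) (y :: w)) : A →ₗ[k] N) 1) (a :: t) :=
    (mid_linearMap_apply _ _ _).trans (mid_congr fun w _ => hg w y)
  simp only [LinearMap.add_apply, LinearMap.smul_apply, coindL_apply, coindR_apply, hg, m₁, m₂,
    one_mul, LinearMap.zero_apply] at e₂ ⊢
  rw [mid_cons_cons] at e₂
  rw [eq_comm, ← sub_eq_zero, ← e₂]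
  simp only [pow_succ]
  module

/-- The cocycle condition evaluated at `1` reads `φ(y) = φ(1) y`. The norm of `⟨·, 1⟩ φ(1)` sends
`y` to `∑ ⟨y, uᵢ⟩ φ(1) vᵢ`, which is the same. -/
theorem FrobeniusForm.normN_coind_exact_right (N : Bimod k A) (f : Coch (Bimod.coind N) 0)
    (hf : deltaN (Bimod.coind N) (rfl : 0 + 1 = 1) f = 0) :
    ∃ x, F.normN (Bimod.coind N) x = f := by
  obtain ⟨φ, hφ⟩ : ∃ φ : A →ₗ[k] N, f (bl k 0 []) = φ := ⟨_, rfl⟩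
  have e : ∀ y, φ y = N.r y (φ 1) := fun y => by
    have e₁ := LinearMap.congr_fun hf (bl k 1 [y])
    rw [deltaN_bl _ rfl f (i := []) rfl rfl rfl, hφ, LinearMap.zero_apply] at e₁
    have e₂ : (_ : A →ₗ[k] N) 1 = (0 : A →ₗ[k] N) 1 := congrArg (fun φ : A →ₗ[k] N => φ 1) e₁
    simp only [LinearMap.add_apply, LinearMap.smul_apply, coindL_apply, coindR_apply,
      mid_singleton, one_mul, LinearMap.zero_apply] at e₂
    rw [← sub_eq_zero, ← e₂]
    module
  refine ⟨((F.form.flip 1).smulRight (φ 1) : A →ₗ[k] N) ⊗ₜ bl k 0 [],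
    coch_zero_ext (N := Bimod.coind N) ?_⟩
  rw [F.normN_bl, hφ]
  refine LinearMap.ext fun y => ?_
  rw [e y]
  conv_rhs => rw [← F.sum_form_u_smul_v y]
  refine (LinearMap.sum_apply _ _ _).trans ?_
  simp [F.assoc]

/-- The map `n ↦ ⟨·, 1⟩ n`. -/
noncomputable def FrobeniusForm.formTensor (N : Bimod k A) : N →ₗ[k] (A →ₗ[k] N) :=
  LinearMap.smulRightₗ (F.form.flip 1)

omit [FiniteDimensional k A] in
@[simp] theorem FrobeniusForm.formTensor_apply (N : Bimod k A) (n : N) (y : A) :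
    F.formTensor N n y = F.form y 1 • n := rfl

/-- The contraction of the complex of chains with coefficients in `Hom_k(A, N)`. -/
noncomputable def FrobeniusForm.contrN (N : Bimod k A) (p : ℕ) :
    Chn (Bimod.coind N) p →ₗ[k] Chn (Bimod.coind N) (p + 1) :=
  ∑ i, TensorProduct.map
    (F.formTensor N ∘ₗ LinearMap.applyₗ (F.v i) :
      (A →ₗ[k] N) →ₗ[k] (A →ₗ[k] N))
    ((concat k A rfl).toLinearMap ∘ₗ (TensorProduct.mk k _ _).flip (bl k 1 [F.u i]))

theorem FrobeniusForm.contrN_bl (N : Bimod k A) {p : ℕ} (φ : A →ₗ[k] N) (l : List A)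
    (hl : l.length = p) : F.contrN N p (φ ⊗ₜ bl k p l) =
      ∑ i, (F.formTensor N (φ (F.v i))) ⊗ₜ bl k (p + 1) (l ++ [F.u i]) := by
  simp only [FrobeniusForm.contrN, LinearMap.sum_apply]
  refine Finset.sum_congr rfl fun i _ => ?_
  refine (TensorProduct.map_tmul _ _ _ _).trans ?_
  simp [concat_bl rfl hl]

theorem FrobeniusForm.sum_l_u_contr (N : Bimod k A) (φ : A →ₗ[k] N) :
    ∑ i, (Bimod.coind N).l (F.u i) (F.formTensor N (φ (F.v i))) = φ := by
  refine LinearMap.ext fun y => ?_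
  refine (LinearMap.sum_apply _ _ _).trans ?_
  conv_rhs => rw [← F.sum_form_u_smul_v y]
  simp [F.assoc]

/-- The appended letter `uⱼ`, acting as the last outer term, contributes `∑ uⱼ · ⟨·, 1⟩ φ(vⱼ) = φ`,
the identity term of the homotopy. Contracted with its neighbour, it yields the last outer term of
`∂x` by the Casimir identity. -/
theorem FrobeniusForm.partN_contrN (N : Bimod k A) {p : ℕ}
    (x : Chn (Bimod.coind N) (p + 1)) :
    partN F.nakayama.symm (Bimod.coind N) rfl (F.contrN N (p + 1) x) =
      F.contrN N p (partN F.nakayama.symm (Bimod.coind N) rfl x) + (-1 : k) ^ (p + 1 + 1) • x := by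
  suffices H : partN F.nakayama.symm (Bimod.coind N) rfl ∘ₗ F.contrN N (p + 1) =
      F.contrN N p ∘ₗ partN F.nakayama.symm (Bimod.coind N) rfl
        + (-1 : k) ^ (p + 1 + 1) • LinearMap.id from LinearMap.congr_fun H x
  refine chn_hom_ext fun φ l hl => ?_
  obtain ⟨a, t, rfl⟩ := List.exists_cons_of_length_eq_add_one hl
  obtain ⟨i, z, e, hi⟩ := exists_last a t
  have hi' : i.length = p := by simp at hl; omega
  set ψ := F.formTensor N with hψ
  have hr : ∀ b n, coindR N b (ψ n) = ψ (N.r b n) := fun b n => LinearMap.ext fun y => by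
    simp [hψ]
  have c := F.casimir_mul (((TensorProduct.mk k (A →ₗ[k] N) _).flip ∘ₗ
    slot k i [] (r := p + 1) (by omega)).compl₂ (ψ ∘ₗ φ)) z
  simp only [LinearMap.compl₂_apply, LinearMap.comp_apply, slot_apply, LinearMap.flip_apply,
    TensorProduct.mk_apply] at c
  have m₁ : F.contrN N p (mid (fun w => φ ⊗ₜ[k] bl k p w) (a :: t)) =
      mid (fun w => ∑ j, ψ (φ (F.v j)) ⊗ₜ[k] bl k (p + 1) (w ++ [F.u j])) (a :: t) :=
    (map_mid _ _ _).trans (mid_congr fun w hw => F.contrN_bl N φ w (by omega))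
  have e₁ : ∀ j, partN F.nakayama.symm (Bimod.coind N) rfl (ψ (φ (F.v j)) ⊗ₜ[k]
      bl k (p + 1 + 1) (a :: t ++ [F.u j])) = _ := fun j =>
    partN_bl F.nakayama.symm (Bimod.coind N) rfl _ (a := a) (t := t ++ [F.u j]) rfl rfl
      (by simp at hl ⊢; omega)
  have last := F.sum_l_u_contr N φ
  simp only [← hψ] at last
  simp only [LinearMap.comp_apply, LinearMap.add_apply, LinearMap.smul_apply, LinearMap.id_apply]
  rw [F.contrN_bl N φ _ hl, map_sum, Finset.sum_congr rfl fun j _ => e₁ j,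
    partN_bl _ _ rfl φ rfl e (by simpa using hl), Finset.sum_add_distrib, ← Finset.smul_sum,
    ← TensorProduct.sum_tmul, last]
  simp only [map_add, map_smul, m₁, mid_sum]
  refine congrArg (· + _) ?_
  erw [F.contrN_bl N _ _ (by simpa using hl), F.contrN_bl N _ _ hi']
  simp only [coindL_apply]
  rw [← c]
  simp only [Finset.smul_sum, ← Finset.sum_add_distrib]
  refine Finset.sum_congr rfl fun j _ => ?_
  rw [e, List.append_assoc, List.singleton_append, mid_append_cons (k := k) _ i, mid_cons_cons]
  simp only [mid_singleton, hi', pow_succ, ← hψ, hr, coindR_apply]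
  module

/-- In length `0` the appended letter is also the first one. Its action from the right gives `∑
φ(vⱼ) ν⁻¹(uⱼ) = ∑ φ(uⱼ) vⱼ`, the norm evaluated at `1`, so it vanishes by hypothesis. -/
theorem FrobeniusForm.partN_contrN_zero (N : Bimod k A) (x : Chn (Bimod.coind N) 0)
    (hx : F.normN (Bimod.coind N) x = 0) :
    partN F.nakayama.symm (Bimod.coind N) (zero_add 1) (F.contrN N 0 x) = -x := by
  obtain ⟨φ, rfl⟩ := chn_zero_exists x
  set ψ := F.formTensor N with hψ
  have h₁ : (_ : A →ₗ[k] N) = 0 := (F.normN_bl (Bimod.coind N) φ [] []).symm.trans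
    (LinearMap.congr_fun hx (bl k 0 []))
  have h₂ : ∑ j, N.r (F.v j) (φ (F.u j)) = 0 := by
    have := LinearMap.congr_fun h₁ 1
    rw [LinearMap.sum_apply] at this
    simpa using this
  have c := F.casimir_swap ((N.r ∘ₗ F.nakayama.symm.toLinearMap).compl₂ φ)
  simp only [LinearMap.compl₂_apply, LinearMap.comp_apply, AlgEquiv.toLinearMap_apply,
    AlgEquiv.symm_apply_apply] at c
  rw [h₂] at c
  have e₁ : ∀ j, partN F.nakayama.symm (Bimod.coind N) (zero_add 1) (ψ (φ (F.v j)) ⊗ₜ[k]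
      bl k 1 ([] ++ [F.u j])) = _ := fun j =>
    partN_bl F.nakayama.symm (Bimod.coind N) (zero_add 1) _ (a := F.u j) (i := []) rfl rfl rfl
  have last := F.sum_l_u_contr N φ
  simp only [← hψ] at last
  have first : ∑ j, coindR N (F.nakayama.symm (F.u j)) (ψ (φ (F.v j))) = 0 := by
    refine LinearMap.ext fun y => ?_
    simp only [LinearMap.sum_apply, coindR_apply, hψ, F.formTensor_apply, map_smul, ← Finset.smul_sum, ← c, smul_zero, LinearMap.zero_apply]
  rw [F.contrN_bl (p := 0) N φ [] rfl, map_sum, Finset.sum_congr rfl fun j _ => e₁ j,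
    Finset.sum_add_distrib, Finset.sum_add_distrib, ← Finset.smul_sum,
    ← TensorProduct.sum_tmul, ← TensorProduct.sum_tmul, last]
  simp only [first]
  simp

theorem FrobeniusForm.coind_acyclic (N : Bimod k A) (r s t : ℤ) (h : r + 1 = s) (h' : s + 1 = t)
    (x : DN (Bimod.coind N) s) (hx : F.dN _ s t h' x = 0) :
    ∃ y, F.dN _ r s h y = x := by
  match r, s, t, h, h', x with
  | .ofNat n, .ofNat n', .ofNat n'', h, h', x =>
    exact deltaN_coind_exact N _ _ x hx
  | .negSucc 0, .ofNat 0, .ofNat 1, _, _, x =>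
    exact F.normN_coind_exact_right N x hx
  | .negSucc 1, .negSucc 0, .ofNat 0, _, _, x =>
    refine ⟨(F.contrN N 0 x : Chn _ 1), (F.dN_negSucc _ _ (zero_add 1) _).trans ?_⟩
    rw [F.partN_contrN_zero N x hx]
    have : ∀ z : Chn (Bimod.coind N) 0, (-1 : k) ^ 1 • -z = z := by simp
    exact this x
  | .negSucc p'', .negSucc p', .negSucc p, h, h', x =>
    have e : p + 1 = p' := by omega
    have e' : p' + 1 = p'' := by omega
    subst e' e
    have hx' : partN F.nakayama.symm (Bimod.coind N) rfl x = 0 := by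
      have := (F.dN_negSucc _ h' rfl x).symm.trans hx
      exact (smul_eq_zero.1 this).resolve_left (pow_ne_zero _ (by simp))
    refine ⟨(F.contrN N (p + 1) x : Chn _ (p + 1 + 1)), (F.dN_negSucc _ _ rfl _).trans ?_⟩
    rw [F.partN_contrN N x, hx', map_zero, zero_add]
    have : ∀ z : Chn (Bimod.coind N) (p + 1),
        (-1 : k) ^ (p + 1 + 1) • (-1 : k) ^ (p + 1 + 1) • z = z := fun z => by
      rw [smul_smul, ← pow_add, Even.neg_one_pow ⟨_, rfl⟩, one_smul]
    exact this x
  | .negSucc p, .ofNat (n + 1), _, h, _, _ =>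
    exact absurd h (by simp only [Int.ofNat_eq_natCast]; omega)
  | .negSucc (p + 1), .ofNat n, _, h, _, _ =>
    exact absurd h (by simp only [Int.ofNat_eq_natCast]; omega)
  | _, .ofNat n, .negSucc p, _, h, _ =>
    exact absurd h (by simp only [Int.ofNat_eq_natCast]; omega)
  | .ofNat n, .negSucc p, _, h, _, _ =>
    exact absurd h (by simp only [Int.ofNat_eq_natCast]; omega)
  | _, .ofNat 0, .ofNat (n + 2), _, h, _ =>
    exact absurd h (by simp only [Int.ofNat_eq_natCast]; omega)
  | _, .ofNat 0, .ofNat 0, _, h, _ =>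
    exact absurd h (by simp only [Int.ofNat_eq_natCast]; omega)
  | _, .negSucc 0, .ofNat (n + 1), _, h, _ =>
    exact absurd h (by simp only [Int.ofNat_eq_natCast]; omega)
  | _, .negSucc (p + 1), .ofNat n, _, h, _ =>
    exact absurd h (by simp only [Int.ofNat_eq_natCast]; omega)
  | .negSucc 0, .negSucc p, _, h, _, _ => exact absurd h (by omega)
  | .negSucc (p + 2), .negSucc 0, _, h, _, _ => exact absurd h (by omega)

end Coinduced

/-- The sign `(-1)^r`. -/
def sgn (k : Type*) [Field k] (r : ℤ) : k := ((r.negOnePow : ℤ) : k)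

section Sign

variable (k : Type*) [Field k]

theorem sgn_add (r s : ℤ) : sgn k (r + s) = sgn k r * sgn k s := by
  simp [sgn, Int.negOnePow_add]

theorem sgn_ofNat (n : ℕ) : sgn k (.ofNat n) = (-1) ^ n := by
  simp [sgn, Int.negOnePow_def]

theorem sgn_mul_self (r : ℤ) : sgn k r * sgn k r = 1 := by
  rw [← sgn_add]
  simp [sgn, Int.negOnePow_even _ (Even.add_self r)]

theorem sgn_ne_zero (r : ℤ) : sgn k r ≠ 0 := left_ne_zero_of_mul_eq_one (sgn_mul_self k r)

theorem sgn_negSucc (p : ℕ) : sgn k (.negSucc p) = (-1) ^ (p + 1) := by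
  rw [← sgn_ofNat, ← mul_one (sgn k (.ofNat _)), ← sgn_mul_self k (.negSucc p), ← mul_assoc,
    ← sgn_add, Int.ofNat_eq_natCast, Int.negSucc_eq]
  simp [sgn]

theorem negOnePow_smul {M : Type*} [AddCommGroup M] [Module k M] (r : ℤ) (x : M) :
    r.negOnePow • x = sgn k r • x := by
  rw [sgn, Int.cast_smul_eq_zsmul]
  rfl

end Sign

/-! ### Natural operations and dimension shifting. -/

section Yoneda

variable {k : Type u} {A : Type v} [Field k] [Ring A] [Algebra k A]

/-- Natural operations of degree `r` on the complete complexes of bimodules. -/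
structure Op (k : Type u) (A : Type v) [Field k] [Ring A] [Algebra k A] (r : ℤ) where
  app : (N : Bimod k A) → (s t : ℤ) → s + r = t → DN N s →ₗ[k] DN N t
  naturality : ∀ {N N' : Bimod k A} (φ : N →ₗ[k] N'), Bimod.IsHom φ → ∀ s t h y,
    app N' s t h (mapDN φ s y) = mapDN φ t (app N s t h y)

/-- The difference of two operations. -/
noncomputable def Op.sub {r : ℤ} (Φ Ψ : Op k A r) : Op k A r where
  app N s t h := Φ.app N s t h - Ψ.app N s t h
  naturality φ hφ s t h y := by
    rw [LinearMap.sub_apply, LinearMap.sub_apply, Φ.naturality φ hφ, Ψ.naturality φ hφ, map_sub]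

/-- The composition of two operations. -/
noncomputable def Op.comp {r r' r'' : ℤ} (h₀ : r' + r = r'') (Φ : Op k A r) (Ψ : Op k A r') : Op k A r'' where
  app N s t h := Φ.app N (s + r') t (by omega) ∘ₗ Ψ.app N s (s + r') rfl
  naturality φ hφ s t h y := by
    rw [LinearMap.comp_apply, LinearMap.comp_apply, Ψ.naturality φ hφ, Φ.naturality φ hφ]

/-- An operation multiplied by a sign depending on the degree. -/
noncomputable def Op.smul {r : ℤ} (ε : ℤ → k) (Φ : Op k A r) : Op k A r where
  app N s t h := ε s • Φ.app N s t h
  naturality φ hφ s t h y := by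
    rw [LinearMap.smul_apply, LinearMap.smul_apply, Φ.naturality φ hφ, map_smul]

theorem Op.comp_app {r r' r'' : ℤ} (h₀ : r' + r = r'') (Φ : Op k A r) (Ψ : Op k A r')
    (N : Bimod k A) {s t t' : ℤ} (h : s + r'' = t) (h₁ : s + r' = t') (h₂ : t' + r = t)
    (y : DN N s) :
    (Op.comp h₀ Φ Ψ).app N s t h y = Φ.app N t' t h₂ (Ψ.app N s t' h₁ y) := by
  subst h₁
  rfl

/-- The unit of the complete complex with coefficients in `A`. -/
noncomputable def oneDN (k : Type u) (A : Type v) [Field k] [Ring A] [Algebra k A] :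
    DN (Bimod.self k A) 0 :=
  constN (Bimod.self k A) (1 : A)

variable [FiniteDimensional k A] (F : FrobeniusForm k A)

/-- The operation commutes with the differentials in degree `s`, up to the sign `ε`. -/
def FrobeniusForm.CommutesAt {r : ℤ} (Φ : Op k A r) (ε : k) (s : ℤ) : Prop :=
  ∀ (N : Bimod k A) (s' t t' : ℤ) (hs : s + 1 = s') (ht : t + 1 = t') (h : s + r = t)
    (h' : s' + r = t') (y : DN N s),
    Φ.app N s' t' h' (F.dN N s s' hs y) = ε • F.dN N t t' ht (Φ.app N s t h y)

theorem FrobeniusForm.CommutesAt.sub {F : FrobeniusForm k A} {r : ℤ} {Φ Ψ : Op k A r} {ε : k}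
    {s : ℤ} (hΦ : F.CommutesAt Φ ε s) (hΨ : F.CommutesAt Ψ ε s) :
    F.CommutesAt (Φ.sub Ψ) ε s := by
  intro N s' t t' hs ht h h' y
  simp only [Op.sub, LinearMap.sub_apply, hΦ N s' t t' hs ht h h' y, hΨ N s' t t' hs ht h h' y,
    map_sub, smul_sub]

/-- The boundaries of the complete complex with coefficients in a bimodule. -/
noncomputable def FrobeniusForm.bd (N : Bimod k A) (t : ℤ) : Submodule k (DN N t) :=
  LinearMap.range (F.dN N (t - 1) t (by omega))

theorem FrobeniusForm.mem_bd {N : Bimod k A} {s t : ℤ} (h : s + 1 = t) {x : DN N t} :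
    x ∈ F.bd N t ↔ ∃ y, F.dN N s t h y = x := by
  obtain rfl : s = t - 1 := by omega
  rfl

theorem FrobeniusForm.dN_mem_bd {N : Bimod k A} {s t : ℤ} (h : s + 1 = t) (y : DN N s) :
    F.dN N s t h y ∈ F.bd N t :=
  (F.mem_bd h).2 ⟨y, rfl⟩

theorem FrobeniusForm.mapDN_mem_bd {N N' : Bimod k A} {φ : N →ₗ[k] N'} (hφ : Bimod.IsHom φ)
    {t : ℤ} {x : DN N t} (hx : x ∈ F.bd N t) : mapDN φ t x ∈ F.bd N' t := by
  obtain ⟨y, rfl⟩ := hx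
  rw [← F.dN_mapDN hφ]
  exact F.dN_mem_bd _ _

/-- The operation maps the cocycles of degree `s` to coboundaries. -/
def FrobeniusForm.Trivial {r : ℤ} (Φ : Op k A r) (s : ℤ) : Prop :=
  ∀ (N : Bimod k A) (t : ℤ) (h : s + r = t) (y : DN N s),
    F.dN N s (s + 1) rfl y = 0 → Φ.app N s t h y ∈ F.bd N t

variable {F}

/-- Shift upwards along `N → Hom_k(A, N) → Q`. By acyclicity the cocycle `y` becomes a boundary `d
e` in the middle term. The image of `e` in `Q` is a cocycle one degree lower, where triviality is
known, and naturality brings the conclusion back to `N`. -/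
theorem FrobeniusForm.CommutesAt.trivial_succ {r : ℤ} {Φ : Op k A r} {ε : k} {s : ℤ}
    (hΦ : F.CommutesAt Φ ε s) (h : F.Trivial Φ s) : F.Trivial Φ (s + 1) := by
  intro N t' h' y hy
  obtain ⟨i, hi, hinj⟩ := N.exists_mono_coind
  obtain ⟨Q, S, rfl⟩ := exists_splitExact_of_injective i hi hinj
  obtain ⟨e, he⟩ := F.coind_acyclic N s (s + 1) (s + 1 + 1) rfl rfl (mapDN S.i _ y)
    (by rw [F.dN_mapDN S.i_hom, hy, map_zero])
  have hz : F.dN Q s (s + 1) rfl (mapDN S.p s e) = 0 := by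
    rw [F.dN_mapDN S.p_hom, he, S.map_comp_eq_zero]
  have ht : s + r + 1 = t' := by omega
  obtain ⟨w, hw⟩ := (F.mem_bd (s := s + r - 1) (by omega)).1 (h Q (s + r) rfl _ hz)
  obtain ⟨w, rfl⟩ := S.map_surjective w
  rw [F.dN_mapDN S.p_hom, Φ.naturality _ S.p_hom, ← sub_eq_zero, ← map_sub] at hw
  obtain ⟨z, hz'⟩ := S.map_exact hw
  have key := hΦ _ _ _ _ rfl ht rfl h' e
  rw [he, Φ.naturality _ S.i_hom] at key
  -- By construction `z` maps to `d w - Φ(e)`, while `Φ(y)` maps to `Φ(d e) = ε d Φ(e)`; the term `d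
  -- w` dies under `d`, whence the factor `-ε`.
  refine (F.mem_bd ht).2 ⟨-ε • z, ?_⟩
  rw [← sub_eq_zero]
  refine S.map_injective ?_
  have dd : F.dN (Bimod.coind N) _ t' ht (F.dN (Bimod.coind N) (s + r - 1) (s + r) (by omega) w) = 0 :=
    F.dN_dN _ _ _ _
  rw [map_sub, map_smul, map_smul, ← F.dN_mapDN S.i_hom, hz', map_sub, dd, key]
  simp

/-- Shift downwards along `K → Hom_k(A, N) → N`. The differential of a lift of `y` comes from a
cocycle of `K` one degree higher, where triviality is known. To solve for `Φ(y)` the scalar `ε` must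
be invertible. -/
theorem FrobeniusForm.CommutesAt.trivial_pred {r : ℤ} {Φ : Op k A r} {ε : k} {s s' : ℤ}
    (hΦ : F.CommutesAt Φ ε s) (hε : ε ≠ 0) (hs : s + 1 = s') (h : F.Trivial Φ s') :
    F.Trivial Φ s := by
  subst hs
  intro N t ht y hy
  obtain ⟨p, hp, hsurj⟩ := F.exists_epi_coind N
  obtain ⟨K, S, rfl⟩ := exists_splitExact_of_surjective p hp hsurj
  obtain ⟨y, rfl⟩ := S.map_surjective y
  rw [F.dN_mapDN S.p_hom] at hy
  obtain ⟨z, hz⟩ := S.map_exact hy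
  have hz' : F.dN K (s + 1) (s + 1 + 1) rfl z = 0 := by
    refine S.map_injective ?_
    rw [← F.dN_mapDN S.i_hom, hz, F.dN_dN]
  obtain ⟨w, hw⟩ := (F.mem_bd rfl).1 (h K (t + 1) (by omega) z hz')
  have key := hΦ _ (s + 1) t (t + 1) rfl rfl ht (by omega) y
  rw [← hz, Φ.naturality _ S.i_hom, ← hw, ← F.dN_mapDN S.i_hom] at key
  -- The correction by `ε⁻¹ w`, which dies in `N`, makes the value of `Φ` at the lift a cocycle of
  -- the acyclic complex.
  obtain ⟨c, hc⟩ := F.coind_acyclic N (t - 1) t (t + 1) (by omega) rfl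
    (Φ.app _ s t ht y - ε⁻¹ • mapDN S.i t w)
    (by rw [map_sub, map_smul, key, smul_smul, inv_mul_cancel₀ hε, one_smul, sub_self])
  rw [Φ.naturality _ S.p_hom]
  refine (F.mem_bd (s := t - 1) (by omega)).2 ⟨mapDN S.p _ c, ?_⟩
  rw [F.dN_mapDN S.p_hom, hc, map_sub, map_smul, S.map_comp_eq_zero, smul_zero, sub_zero]

/-- A cocycle of degree `0` is an element `m` with `a m = m a`. So `a ↦ a m` is a bimodule map `A →
N` that carries `1` to the cocycle, and naturality transports the boundary found over `A`. -/
theorem FrobeniusForm.trivial_zero {r : ℤ} {Φ : Op k A r}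
    (h : Φ.app _ 0 r (zero_add r) (oneDN k A) ∈ F.bd _ r) : F.Trivial Φ 0 := by
  intro N t ht y hy
  obtain rfl : r = t := by omega
  obtain ⟨y, rfl⟩ : ∃ z : Coch N 0, z = y := ⟨y, rfl⟩
  obtain ⟨m, hm⟩ : ∃ m, y (bl k 0 []) = m := ⟨_, rfl⟩
  have hc : ∀ a, N.l a m = N.r a m := fun a => by
    have hy' : deltaN N (zero_add 1) y = 0 := hy
    have e₁ := LinearMap.congr_fun hy' (bl k 1 [a])
    have e₂ := (deltaN_bl N (zero_add 1) y (i := []) rfl rfl rfl).symm.trans e₁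
    rw [mid_singleton, hm, LinearMap.zero_apply] at e₂
    rw [← sub_eq_zero, ← e₂]
    module
  have hφ : Bimod.IsHom (N := Bimod.self k A) (N.l.flip m) :=
    ⟨fun a b => N.mul_l a b m, fun a b => by
      change N.l (b * a) m = N.r a (N.l b m)
      rw [N.mul_l, hc, N.l_r]⟩
  have hy' : mapDN (N := Bimod.self k A) (N.l.flip m) 0 (oneDN k A) = y := by
    refine coch_zero_ext (N := N) (Eq.trans ?_ hm.symm)
    refine (congrArg (N.l.flip m) (constN_bl (Bimod.self k A) (1 : A) [])).trans ?_
    simp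
  rw [← hy', Φ.naturality _ hφ]
  exact F.mapDN_mem_bd hφ h

/-- The upward shift alone reaches all nonnegative degrees. This variant serves right multiplication
by a cochain, for which no sensible operation on chains is at hand. -/
theorem FrobeniusForm.trivial_nonneg {r : ℤ} {Φ : Op k A r} {ε : ℤ → k}
    (hΦ : ∀ n : ℕ, F.CommutesAt Φ (ε n) n)
    (h : Φ.app _ 0 r (zero_add r) (oneDN k A) ∈ F.bd _ r) (n : ℕ) : F.Trivial Φ n := by
  induction n with
  | zero => exact F.trivial_zero h
  | succ n ih => exact (hΦ n).trivial_succ ih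

theorem FrobeniusForm.trivial {r : ℤ} {Φ : Op k A r} {ε : ℤ → k}
    (hΦ : ∀ s, F.CommutesAt Φ (ε s) s) (hε : ∀ s, ε s ≠ 0)
    (h : Φ.app _ 0 r (zero_add r) (oneDN k A) ∈ F.bd _ r) (s : ℤ) : F.Trivial Φ s := by
  induction s using Int.induction_on with
  | zero => exact F.trivial_zero h
  | succ n ih => exact (hΦ n).trivial_succ ih
  | pred n ih => exact (hΦ _).trivial_pred (hε _) (by omega) ih

end Yoneda

/-! ### Multiplications as natural operations. -/

section Operations

variable {k : Type u} {A : Type v} [Field k] [Ring A] [Algebra k A]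

section Naturality

variable {N N' : Bimod k A} {φ : N →ₗ[k] N'} (hφ : Bimod.IsHom φ)
include hφ

theorem cupL_natural {m n t : ℕ} (h : m + n = t) (f : Cochain k A m) (y : Coch N n) :
    cupL N' h f (φ ∘ₗ y) = φ ∘ₗ cupL N h f y := by
  refine bl_hom_ext fun l hl => ?_
  obtain ⟨l₁, l₂, rfl, h₁, h₂⟩ := exists_split (hl.trans h.symm)
  rw [LinearMap.comp_apply, cupL_bl N' h _ _ rfl h₁, cupL_bl N h _ _ rfl h₁, hφ.map_l]
  rfl

theorem cupR_natural {m n t : ℕ} (h : n + m = t) (f : Cochain k A m) (y : Coch N n) :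
    cupR N' h f (φ ∘ₗ y) = φ ∘ₗ cupR N h f y := by
  refine bl_hom_ext fun l hl => ?_
  obtain ⟨l₁, l₂, rfl, h₁, h₂⟩ := exists_split (hl.trans h.symm)
  rw [LinearMap.comp_apply, cupR_bl N' h _ _ rfl h₁, cupR_bl N h _ _ rfl h₁, hφ.map_r]
  rfl

theorem capL_natural {m p q : ℕ} (h : q + m = p) (f : Cochain k A m) (y : Chn N p) :
    capL N' h f (φ.rTensor _ y) = φ.rTensor _ (capL N h f y) := by
  suffices H : capL N' h f ∘ₗ φ.rTensor _ = φ.rTensor _ ∘ₗ capL N h f from LinearMap.congr_fun H y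
  refine chn_hom_ext fun n l hl => ?_
  obtain ⟨l₁, l₂, rfl, h₁, h₂⟩ := exists_split (hl.trans h.symm)
  simp only [LinearMap.comp_apply, LinearMap.rTensor_tmul]
  rw [capL_bl N' h _ _ rfl h₁, capL_bl N h _ _ rfl h₁, LinearMap.rTensor_tmul, hφ.map_l]

theorem capR_natural {m p q : ℕ} (h : q + m = p) (α : Chain k A p) (y : Coch N m) :
    capR N' h α (φ ∘ₗ y) = φ.rTensor _ (capR N h α y) := by
  suffices H : (capR N' h).flip (φ ∘ₗ y) = φ.rTensor _ ∘ₗ (capR N h).flip y from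
    LinearMap.congr_fun H α
  refine chain_hom_ext fun n l hl => ?_
  obtain ⟨l₁, l₂, rfl, h₁, h₂⟩ := exists_split (hl.trans h.symm)
  simp only [LinearMap.comp_apply, LinearMap.flip_apply]
  rw [capR_bl N' h _ _ rfl h₁, capR_bl N h _ _ rfl h₁, LinearMap.rTensor_tmul, hφ.map_r]
  rfl

variable [FiniteDimensional k A] (F : FrobeniusForm k A)

theorem FrobeniusForm.evL_natural {m n p : ℕ} (h : n + (p + 1) = m) (f : Cochain k A m)
    (y : Chn N p) : F.evL N' h f (φ.rTensor _ y) = φ ∘ₗ (F.evL N h f y) := by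
  suffices H : F.evL N' h f ∘ₗ φ.rTensor _ = φ.compRight k ∘ₗ F.evL N h f from
    LinearMap.congr_fun H y
  refine chn_hom_ext fun n l hl => bl_hom_ext fun b hb => ?_
  simp only [LinearMap.comp_apply, LinearMap.rTensor_tmul, LinearMap.compRight_apply]
  rw [F.evL_bl N' h _ _ _ _ hb, F.evL_bl N h _ _ _ _ hb, map_sum]
  simp only [hφ.map_l, hφ.map_r]

theorem FrobeniusForm.capA_natural {m p q : ℕ} (h : m + q = p) (α : Chain k A p) (y : Coch N m) :
    F.capA N' h α (φ ∘ₗ y) = φ.rTensor _ (F.capA N h α y) := by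
  suffices H : (F.capA N' h).flip (φ ∘ₗ y) = φ.rTensor _ ∘ₗ (F.capA N h).flip y from
    LinearMap.congr_fun H α
  refine chain_hom_ext fun n l hl => ?_
  obtain ⟨l₁, l₂, rfl, h₁, h₂⟩ := exists_split (hl.trans h.symm)
  simp only [LinearMap.comp_apply, LinearMap.flip_apply]
  rw [F.capA_bl N' h _ _ rfl h₁, F.capA_bl N h _ _ rfl h₁, LinearMap.rTensor_tmul, hφ.map_l]
  rfl

theorem FrobeniusForm.evA_natural {m n p : ℕ} (h : p + (n + 1) = m) (α : Chain k A p)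
    (y : Coch N m) : F.evA N' h α (φ ∘ₗ y) = φ ∘ₗ (F.evA N h α y) := by
  suffices H : (F.evA N' h).flip (φ ∘ₗ y) = φ.compRight k ∘ₗ (F.evA N h).flip y from
    LinearMap.congr_fun H α
  refine chain_hom_ext fun n l hl => bl_hom_ext fun b hb => ?_
  simp only [LinearMap.comp_apply, LinearMap.flip_apply, LinearMap.compRight_apply]
  rw [F.evA_bl N' h _ _ _ _ hl, F.evA_bl N h _ _ _ _ hl, map_sum]
  simp only [hφ.map_l, LinearMap.comp_apply]

theorem FrobeniusForm.evR_natural {m n p : ℕ} (h : n + (p + 1) = m) (α : Chain k A p)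
    (y : Coch N m) : F.evR N' h α (φ ∘ₗ y) = φ ∘ₗ (F.evR N h α y) := by
  suffices H : (F.evR N' h).flip (φ ∘ₗ y) = φ.compRight k ∘ₗ (F.evR N h).flip y from
    LinearMap.congr_fun H α
  refine chain_hom_ext fun n l hl => bl_hom_ext fun b hb => ?_
  simp only [LinearMap.comp_apply, LinearMap.flip_apply, LinearMap.compRight_apply]
  rw [F.evR_bl N' h _ _ _ _ hb, F.evR_bl N h _ _ _ _ hb, map_sum]
  simp only [hφ.map_r, LinearMap.comp_apply]

theorem FrobeniusForm.mulA_natural {p q t : ℕ} (h : q + (p + 1) = t) (α : Chain k A p)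
    (y : Chn N q) : F.mulA N' h α (φ.rTensor _ y) = φ.rTensor _ (F.mulA N h α y) := by
  suffices H : (F.mulA N' h).compl₂ (φ.rTensor _) = (F.mulA N h).compr₂ (φ.rTensor _) from
    LinearMap.congr_fun (LinearMap.congr_fun H α) y
  refine chain_hom_ext fun n l hl => chn_hom_ext fun x b hb => ?_
  simp only [LinearMap.compl₂_apply, LinearMap.compr₂_apply, LinearMap.rTensor_tmul]
  rw [F.mulA_bl N' h _ _ _ _ hb, F.mulA_bl N h _ _ _ _ hb, map_sum]
  simp only [hφ.map_l, LinearMap.rTensor_tmul]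

theorem FrobeniusForm.mulR_natural {p q t : ℕ} (h : p + (q + 1) = t) (α : Chain k A p)
    (y : Chn N q) : F.mulR N' h α (φ.rTensor _ y) = φ.rTensor _ (F.mulR N h α y) := by
  suffices H : (F.mulR N' h).compl₂ (φ.rTensor _) = (F.mulR N h).compr₂ (φ.rTensor _) from
    LinearMap.congr_fun (LinearMap.congr_fun H α) y
  refine chain_hom_ext fun n l hl => chn_hom_ext fun x b hb => ?_
  simp only [LinearMap.compl₂_apply, LinearMap.compr₂_apply, LinearMap.rTensor_tmul]
  rw [F.mulR_bl N' h _ _ _ _ hl, F.mulR_bl N h _ _ _ _ hl, map_sum]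
  simp only [hφ.map_r, LinearMap.rTensor_tmul]

end Naturality

/-- The operation `y ↦ y ⋆ f` on cochains. -/
noncomputable def opRCochain {m : ℕ} (f : Cochain k A m) : Op k A (.ofNat m) where
  app N
    | .ofNat n, .ofNat t, h =>
      (cupR N (by simp only [Int.ofNat_eq_natCast] at h; omega) f : Coch N n →ₗ[k] Coch N t)
    | .ofNat _, .negSucc _, _ => 0
    | .negSucc _, _, _ => 0
  naturality φ hφ s t h y := by
    match s, t, h, y with
    | .ofNat n, .ofNat t, h, y => exact cupR_natural hφ _ f y
    | .ofNat _, .negSucc _, _, _ => exact (map_zero _).symm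
    | .negSucc _, _, _, _ => exact (map_zero _).symm

variable [FiniteDimensional k A] (F : FrobeniusForm k A)

/-- The operation `y ↦ f ⋆ y`. -/
noncomputable def FrobeniusForm.opLCochain {m : ℕ} (f : Cochain k A m) : Op k A (.ofNat m) where
  app N
    | .ofNat n, .ofNat t, h =>
      (cupL N (by simp only [Int.ofNat_eq_natCast] at h; omega) f : Coch N n →ₗ[k] Coch N t)
    | .negSucc p, .negSucc q, h =>
      (capL N (by simp only [Int.ofNat_eq_natCast] at h; omega) f : Chn N p →ₗ[k] Chn N q)
    | .negSucc p, .ofNat n, h =>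
      (F.evL N (by simp only [Int.ofNat_eq_natCast] at h; omega) f : Chn N p →ₗ[k] Coch N n)
    | .ofNat _, .negSucc _, _ => 0
  naturality φ hφ s t h y := by
    match s, t, h, y with
    | .ofNat n, .ofNat t, h, y => exact cupL_natural hφ _ f y
    | .negSucc p, .negSucc q, h, y => exact capL_natural hφ _ f y
    | .negSucc p, .ofNat n, h, y => exact F.evL_natural hφ _ f y
    | .ofNat _, .negSucc _, _, _ => exact (map_zero _).symm

/-- The operation `y ↦ α ⋆ y`, up to the Nakayama automorphism. -/
noncomputable def FrobeniusForm.opLChain {p : ℕ} (α : Chain k A p) : Op k A (.negSucc p) where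
  app N
    | .ofNat m, .negSucc q, h =>
      (F.capA N (by simp only [Int.ofNat_eq_natCast] at h; omega) α : Coch N m →ₗ[k] Chn N q)
    | .ofNat m, .ofNat n, h =>
      (F.evA N (by simp only [Int.ofNat_eq_natCast] at h; omega) α : Coch N m →ₗ[k] Coch N n)
    | .negSucc q, .negSucc t, h =>
      (F.mulA N (by omega) (chainMap F.nakayama p α) : Chn N q →ₗ[k] Chn N t)
    | .negSucc _, .ofNat _, _ => 0
  naturality φ hφ s t h y := by
    match s, t, h, y with
    | .ofNat m, .negSucc q, h, y => exact F.capA_natural hφ _ α y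
    | .ofNat m, .ofNat n, h, y => exact F.evA_natural hφ _ α y
    | .negSucc q, .negSucc t, h, y => exact F.mulA_natural hφ _ _ y
    | .negSucc _, .ofNat _, _, _ => exact (map_zero _).symm

/-- The operation `y ↦ y ⋆ α`. -/
noncomputable def FrobeniusForm.opRChain {p : ℕ} (α : Chain k A p) : Op k A (.negSucc p) where
  app N
    | .ofNat m, .negSucc q, h =>
      (capR N (by simp only [Int.ofNat_eq_natCast] at h; omega) α : Coch N m →ₗ[k] Chn N q)
    | .ofNat m, .ofNat n, h =>
      (F.evR N (by simp only [Int.ofNat_eq_natCast] at h; omega) α : Coch N m →ₗ[k] Coch N n)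
    | .negSucc q, .negSucc t, h =>
      (F.mulR N (by omega) α : Chn N q →ₗ[k] Chn N t)
    | .negSucc _, .ofNat _, _ => 0
  naturality φ hφ s t h y := by
    match s, t, h, y with
    | .ofNat m, .negSucc q, h, y => exact capR_natural hφ _ α y
    | .ofNat m, .ofNat n, h, y => exact F.evR_natural hφ _ α y
    | .negSucc q, .negSucc t, h, y => exact F.mulR_natural hφ _ _ y
    | .negSucc _, .ofNat _, _, _ => exact (map_zero _).symm

/-- Restricted to nonnegative degrees, because the operation has been set to `0` on chains and need
not be compatible with the norm map. -/
theorem FrobeniusForm.commutesAt_opRCochain {m : ℕ} {f : Cochain k A m}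
    (hf : deltaA rfl f = 0) (n : ℕ) : F.CommutesAt (opRCochain f) 1 n := by
  intro N s' t t' hs ht h h' y
  rcases s' with n' | p' <;> rcases t with t | q <;> rcases t' with t' | q' <;>
    simp only [Int.ofNat_eq_natCast] at hs ht h h' <;> try (exfalso; omega)
  exact (deltaN_cupR N (by omega) (by omega) (by omega) (by omega) hf y).symm.trans
    (one_smul k _).symm

end Operations

/-! ### Multiplication by a cocycle commutes with the differentials up to sign. -/

section Commutes

variable {k : Type u} {A : Type v} [Field k] [Ring A] [Algebra k A]
variable [FiniteDimensional k A] (F : FrobeniusForm k A)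

theorem sign_smul_eq {M : Type*} [AddCommGroup M] [Module k M] {a b : ℕ} {x y : M}
    (h : (-1 : k) ^ a • x = y) (hb : (a + b) % 2 = 0) : x = (-1 : k) ^ b • y := by
  rw [← h, smul_smul, ← pow_add, Even.neg_one_pow, one_smul]
  rw [Nat.even_iff]
  omega

theorem smul_eq_smul_smul {M : Type*} [AddCommGroup M] [Module k M] {a b c : ℕ} (x : M)
    (h : (a + b + c) % 2 = 0) : (-1 : k) ^ a • x = (-1 : k) ^ b • (-1 : k) ^ c • x := by
  rw [smul_smul, ← pow_add]
  refine sign_smul_eq (a := a) (smul_smul _ _ _ |>.trans ?_) (by omega)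
  rw [← pow_add, Even.neg_one_pow (Even.add_self a), one_smul]

theorem neg_sign_smul_eq {M : Type*} [AddCommGroup M] [Module k M] {a b : ℕ} {x y : M}
    (h : (-1 : k) ^ a • x = 0 - y) (hb : (a + b) % 2 = 1) : y = (-1 : k) ^ b • x := by
  rw [eq_sub_iff_add_eq, add_comm, ← eq_neg_iff_add_eq_zero, ← neg_smul] at h
  rw [h]
  congr 1
  rcases Nat.even_or_odd a with ha | ha
  · rw [ha.neg_one_pow, Odd.neg_one_pow]
    rw [Nat.odd_iff]
    rw [Nat.even_iff] at ha
    omega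
  · rw [ha.neg_one_pow, Even.neg_one_pow, neg_neg]
    rw [Nat.even_iff]
    rw [Nat.odd_iff] at ha
    omega

theorem neg_smul_eq {M : Type*} [AddCommGroup M] [Module k M] {a b : ℕ} {x y : M}
    (h : x = 0 - (-1 : k) ^ a • y) (hb : (a + b) % 2 = 1) : y = (-1 : k) ^ b • x := by
  have h' : (-1 : k) ^ a • y = 0 - x := by rw [h]; simp
  exact sign_smul_eq (neg_sign_smul_eq h' hb).symm (by omega)

theorem FrobeniusForm.commutesAt_opLCochain {m : ℕ} {f : Cochain k A m}
    (hf : deltaA rfl f = 0) (s : ℤ) : F.CommutesAt (F.opLCochain f) ((-1) ^ m) s := by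
  intro N s' t t' hs ht h h' y
  rcases s with n | p <;> rcases s' with n' | p' <;> rcases t with t | q <;>
    rcases t' with t' | q' <;>
    (try simp only [Int.ofNat_eq_natCast] at hs ht h h') <;> try (exfalso; omega)
  · obtain ⟨y, rfl⟩ : ∃ z : Coch N n, z = y := ⟨y, rfl⟩
    have := deltaN_cupL N (m := m) (n := n) (t := t) (m' := m + 1) (n' := n') (t' := t') (by omega)
      (by omega) rfl (by omega) (by omega) (by omega) f y
    have h0 : ∀ {t : ℕ} (h : m + 1 + n = t), cupL N h (0 : Cochain k A (m + 1)) = 0 := fun h => by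
      ext; simp [cupL]
    rw [hf, h0, LinearMap.zero_apply, zero_add] at this
    exact sign_smul_eq this.symm (by omega)
  · obtain ⟨y, rfl⟩ : ∃ z : Chn N p, z = y := ⟨y, rfl⟩
    obtain rfl : p = 0 := by omega
    obtain rfl : n' = 0 := by omega
    have := LinearMap.congr_fun (F.deltaN_evL_zero N (m := m) (n := t) (by omega) rfl hf) y
    obtain rfl : m = t' := by omega
    exact sign_smul_eq this.symm (by omega)
  · obtain ⟨y, rfl⟩ : ∃ z : Chn N p, z = y := ⟨y, rfl⟩
    obtain rfl : p = 0 := by omega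
    obtain rfl : n' = 0 := by omega
    obtain rfl : q = 0 := by omega
    obtain rfl : t' = 0 := by omega
    obtain rfl : m = 0 := by omega
    have := LinearMap.congr_fun (F.normN_capL_zero N rfl hf) y
    refine sign_smul_eq (a := 0) ?_ (by omega)
    rw [pow_zero]
    exact (one_smul k _).trans this.symm
  · obtain ⟨y, rfl⟩ : ∃ z : Chn N p, z = y := ⟨y, rfl⟩
    have := LinearMap.congr_fun (F.deltaN_evL N (m := m) (n := t) (p := p') (n' := t') (p' := p)
      (by omega) (by omega) (by omega) (by omega) hf) y
    refine (congrArg _ (F.dN_negSucc N hs (by omega) y)).trans ?_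
    refine (map_smul (F.evL N (by omega) f) _ _).trans ?_
    refine sign_smul_eq (a := m) (Eq.trans ?_ this.symm) (by omega)
    rw [smul_smul, ← pow_add]
    congr 1
    -- The signs agree because here `m = t' + p`.
    rw [show m + p = t' + 2 * p by omega, pow_add, pow_mul]
    simp
  · obtain ⟨y, rfl⟩ : ∃ z : Chn N p, z = y := ⟨y, rfl⟩
    obtain rfl : q = 0 := by omega
    obtain rfl : t' = 0 := by omega
    obtain rfl : m = p := by omega
    have := LinearMap.congr_fun (F.normN_capL N (p := p') (by omega) (by omega) (by omega) hf) y
    refine (congrArg _ (F.dN_negSucc N hs (by omega) y)).trans ?_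
    refine (map_smul (F.evL N (by omega) f) _ _).trans ?_
    exact congrArg _ this.symm
  · obtain ⟨y, rfl⟩ : ∃ z : Chn N p, z = y := ⟨y, rfl⟩
    have := LinearMap.congr_fun (partN_capL N F.nakayama.symm (p := p') (q := q') (p' := p)
      (q' := q) (by omega) (by omega) (by omega) (by omega) hf) y
    refine (congrArg _ (F.dN_negSucc N hs (by omega) y)).trans ?_
    refine Eq.trans ?_ (congrArg _ (F.dN_negSucc N ht (by omega) _)).symm
    refine (map_smul (capL N (by omega) f) _ _).trans ?_
    refine (congrArg _ this.symm).trans ?_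
    exact smul_eq_smul_smul (M := Chn N q') _ (by omega)

/-- The cycles among the chains with coefficients in the algebra. -/
def FrobeniusForm.IsCycle : {p : ℕ} → Chain k A p → Prop
  | 0, α => F.normA α = 0
  | p + 1, α => partA F.nakayama.symm rfl α = 0

variable {F}

/-- Each case is a Leibniz rule with one term removed by the cycle condition: the product with `∂α`,
or, for a chain of length `0`, the product with its norm. Where two chains are multiplied the twist
by `ν` is present, so that the formulas match `capA` across the norm map. -/
theorem FrobeniusForm.commutesAt_opLChain {p : ℕ} {α : Chain k A p}
    (hα : F.IsCycle α) (s : ℤ) : F.CommutesAt (F.opLChain α) ((-1) ^ (p + 1)) s := by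
  intro N s' t t' hs ht h h' y
  rcases p with _ | p
  · change F.normA α = 0 at hα
    have h0 : ∀ {m : ℕ} (h : 0 + m = m), cupL N h (F.normA α) = 0 := fun h => by
      rw [hα]; ext; simp [cupL]
    rcases s with n | r <;> rcases s' with n' | r' <;> rcases t with t | q <;>
      rcases t' with t' | q' <;>
      (try simp only [Int.ofNat_eq_natCast] at hs ht h h') <;> try (exfalso; omega)
    · obtain ⟨y, rfl⟩ : ∃ z : Coch N n, z = y := ⟨y, rfl⟩
      obtain rfl : t' = n := by omega
      have := F.deltaN_evA_zero N (n := t) (m := t') (m' := n') (by omega) (by omega) (by omega)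
        (by omega) (by omega) α y
      rw [h0, LinearMap.zero_apply] at this
      exact neg_sign_smul_eq (a := 0) (by rw [pow_zero, one_smul]; exact this) rfl
    · obtain ⟨y, rfl⟩ : ∃ z : Coch N n, z = y := ⟨y, rfl⟩
      obtain rfl : n = 0 := by omega
      obtain rfl : n' = 1 := by omega
      obtain rfl : q = 0 := by omega
      obtain rfl : t' = 0 := by omega
      have := F.normN_capA_zero N (by omega) (by omega) α y
      rw [h0, LinearMap.zero_apply] at this
      exact neg_sign_smul_eq (a := 0) (by rw [pow_zero, one_smul]; exact this) rfl
    · obtain ⟨y, rfl⟩ : ∃ z : Chn N r, z = y := ⟨y, rfl⟩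
      obtain rfl : n' = 0 := by omega
      obtain rfl : r = 0 := by omega
      obtain rfl : q = 1 := by omega
      obtain rfl : q' = 0 := by omega
      have := F.partN_mulA_zero_zero N (by omega) (by omega) (by omega) hα y
      refine Eq.trans ?_ (congrArg _ (F.dN_negSucc N ht (by omega) _)).symm
      refine Eq.trans ?_ (smul_eq_smul_smul (a := 0) (M := Chn N 0) _ (by omega))
      rw [pow_zero]
      exact this.symm.trans (one_smul k _).symm
    · obtain ⟨y, rfl⟩ : ∃ z : Chn N r, z = y := ⟨y, rfl⟩
      have := F.partN_mulA_zero_left N (q := r') (q' := r) (t := q') (t' := q) (by omega)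
        (by omega) (by omega) (by omega) ((F.normA_chainMap α).trans hα) y
      refine (congrArg _ (F.dN_negSucc N hs (by omega) y)).trans ?_
      refine Eq.trans ?_ (congrArg _ (F.dN_negSucc N ht (by omega) _)).symm
      refine (map_smul (F.mulA N (by omega) (chainMap F.nakayama 0 α)) _ _).trans ?_
      exact (congrArg _ this.symm).trans (smul_eq_smul_smul (M := Chn N q') _ (by omega))
  · change partA _ _ α = 0 at hα
    rcases s with n | r <;> rcases s' with n' | r' <;> rcases t with t | q <;>
      rcases t' with t' | q' <;>
      (try simp only [Int.ofNat_eq_natCast] at hs ht h h') <;> try (exfalso; omega)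
    · obtain ⟨y, rfl⟩ : ∃ z : Coch N n, z = y := ⟨y, rfl⟩
      have := F.deltaN_evA N (n := t) (n' := t') (m := n) (m' := n') (p := p) (by omega) (by omega)
        rfl (by omega) (by omega) (by omega) α y
      rw [hα, map_zero, LinearMap.zero_apply] at this
      exact neg_sign_smul_eq this (by omega)
    · obtain ⟨y, rfl⟩ : ∃ z : Coch N n, z = y := ⟨y, rfl⟩
      obtain rfl : n = p + 1 := by omega
      obtain rfl : q = 0 := by omega
      obtain rfl : t' = 0 := by omega
      have := F.normN_capA N (m' := n') (p := p) rfl (by omega) (by omega) (by omega) (by omega) α y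
      rw [hα, map_zero, LinearMap.zero_apply] at this
      exact neg_sign_smul_eq this (by omega)
    · obtain ⟨y, rfl⟩ : ∃ z : Coch N n, z = y := ⟨y, rfl⟩
      have := F.partN_capA N (m := n) (m' := n') (q := q') (q' := q) (p := p) (by omega) rfl
        (by omega) (by omega) (by omega) (by omega) α y
      rw [hα, map_zero, LinearMap.zero_apply] at this
      refine Eq.trans ?_ (congrArg _ (F.dN_negSucc N ht (by omega) _)).symm
      exact (neg_sign_smul_eq (b := n + 1) this (by omega)).trans
        (smul_eq_smul_smul (M := Chn N q') _ (by omega))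
    · obtain ⟨y, rfl⟩ : ∃ z : Chn N r, z = y := ⟨y, rfl⟩
      obtain rfl : r = 0 := by omega
      obtain rfl : n' = 0 := by omega
      obtain rfl : q = p + 1 + 1 := by omega
      obtain rfl : q' = p + 1 := by omega
      have := F.partN_mulA_zero_right N (p := p) rfl rfl (by omega) (by omega) (by omega) α y
      rw [hα, map_zero, map_zero, LinearMap.zero_apply, sub_zero] at this
      refine Eq.trans ?_ (congrArg _ (F.dN_negSucc N ht (by omega) _)).symm
      refine Eq.trans ?_ (smul_eq_smul_smul (a := 0) (M := Chn N (p + 1)) _ (by omega))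
      rw [pow_zero]
      exact this.symm.trans (one_smul k _).symm
    · obtain ⟨y, rfl⟩ : ∃ z : Chn N r, z = y := ⟨y, rfl⟩
      have := F.partN_mulA N (p := p) (q := r') (q' := r) (t := q') (t' := q) rfl (by omega)
        (by omega) (by omega) (by omega) (by omega) (chainMap F.nakayama _ α) y
      rw [partA_chainMap _ _ (by simp), hα, map_zero, map_zero, LinearMap.zero_apply, smul_zero,
        sub_zero] at this
      refine (congrArg _ (F.dN_negSucc N hs (by omega) y)).trans ?_
      refine Eq.trans ?_ (congrArg _ (F.dN_negSucc N ht (by omega) _)).symm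
      refine (map_smul (F.mulA N (by omega) (chainMap F.nakayama _ α)) _ _).trans ?_
      exact (congrArg _ this.symm).trans (smul_eq_smul_smul (M := Chn N q') _ (by omega))

theorem FrobeniusForm.commutesAt_opRChain {p : ℕ} {α : Chain k A p}
    (hα : F.IsCycle α) (s : ℤ) : F.CommutesAt (F.opRChain α) 1 s := by
  intro N s' t t' hs ht h h' y
  refine Eq.trans ?_ (one_smul k _).symm
  rcases p with _ | p
  · change F.normA α = 0 at hα
    rcases s with n | r <;> rcases s' with n' | r' <;> rcases t with t | q <;>
      rcases t' with t' | q' <;>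
      (try simp only [Int.ofNat_eq_natCast] at hs ht h h') <;> try (exfalso; omega)
    · obtain ⟨y, rfl⟩ : ∃ z : Coch N n, z = y := ⟨y, rfl⟩
      obtain rfl : t' = n := by omega
      exact (F.deltaN_evR_zero N (n := t) (m := t') (m' := n') (by omega) (by omega) (by omega)
        (by omega) hα y).symm
    · obtain ⟨y, rfl⟩ : ∃ z : Coch N n, z = y := ⟨y, rfl⟩
      obtain rfl : n = 0 := by omega
      obtain rfl : n' = 1 := by omega
      obtain rfl : q = 0 := by omega
      obtain rfl : t' = 0 := by omega
      exact (F.normN_capR_zero N (by omega) (by omega) hα y).symm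
    · obtain ⟨y, rfl⟩ : ∃ z : Chn N r, z = y := ⟨y, rfl⟩
      obtain rfl : n' = 0 := by omega
      obtain rfl : r = 0 := by omega
      obtain rfl : q = 1 := by omega
      obtain rfl : q' = 0 := by omega
      have := F.partN_mulR_zero_zero N (by omega) (by omega) (by omega) hα y
      refine Eq.trans ?_ (F.dN_negSucc N ht (by omega) _).symm
      exact neg_smul_eq (a := 0) (by rw [pow_zero, one_smul, zero_sub]; exact this) rfl
    · obtain ⟨y, rfl⟩ : ∃ z : Chn N r, z = y := ⟨y, rfl⟩
      have := F.partN_mulR_zero_left N (q := r') (q' := r) (t := q') (t' := q) (by omega)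
        (by omega) (by omega) (by omega) hα y
      refine (congrArg _ (F.dN_negSucc N hs (by omega) y)).trans ?_
      refine Eq.trans ?_ (F.dN_negSucc N ht (by omega) _).symm
      refine (map_smul (F.mulR N (by omega) α) _ _).trans ?_
      refine (congrArg ((-1 : k) ^ r • ·) (neg_eq_iff_eq_neg.2 this).symm).trans ?_
      obtain rfl : q = r + 1 := by omega
      rw [smul_neg, ← neg_smul, pow_succ, mul_neg, mul_one]
      rfl
  · change partA _ _ α = 0 at hα
    rcases s with n | r <;> rcases s' with n' | r' <;> rcases t with t | q <;>
      rcases t' with t' | q' <;>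
      (try simp only [Int.ofNat_eq_natCast] at hs ht h h') <;> try (exfalso; omega)
    · obtain ⟨y, rfl⟩ : ∃ z : Coch N n, z = y := ⟨y, rfl⟩
      have := F.deltaN_evR N (n := t) (n' := t') (m := n) (m' := n') (p := p) (by omega) (by omega)
        rfl (by omega) (by omega) (by omega) α y
      rw [hα, map_zero, LinearMap.zero_apply, smul_zero, zero_add] at this
      exact this.symm
    · obtain ⟨y, rfl⟩ : ∃ z : Coch N n, z = y := ⟨y, rfl⟩
      obtain rfl : n = p + 1 := by omega
      obtain rfl : q = 0 := by omega
      obtain rfl : t' = 0 := by omega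
      have := F.normN_capR N (m' := n') (p := p) rfl (by omega) (by omega) (by omega) (by omega) α y
      rw [hα, map_zero, LinearMap.zero_apply] at this
      exact (this.trans (zero_add _)).symm
    · obtain ⟨y, rfl⟩ : ∃ z : Coch N n, z = y := ⟨y, rfl⟩
      have := partN_capR N F.nakayama.symm (m := n) (m' := n') (q := q') (q' := q) (p := p)
        (by omega) rfl (by omega) (by omega) (by omega) (by omega) α y
      rw [hα, map_zero, LinearMap.zero_apply] at this
      refine Eq.trans ?_ (F.dN_negSucc N ht (by omega) _).symm
      exact neg_smul_eq this (by omega)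
    · obtain ⟨y, rfl⟩ : ∃ z : Chn N r, z = y := ⟨y, rfl⟩
      obtain rfl : r = 0 := by omega
      obtain rfl : n' = 0 := by omega
      obtain rfl : q = p + 1 + 1 := by omega
      obtain rfl : q' = p + 1 := by omega
      have := F.partN_mulR_zero_right N (p := p) rfl rfl (by omega) (by omega) (by omega) α y
      rw [hα, map_zero, LinearMap.zero_apply] at this
      refine Eq.trans ?_ (F.dN_negSucc N ht (by omega) _).symm
      exact neg_smul_eq this (by omega)
    · obtain ⟨y, rfl⟩ : ∃ z : Chn N r, z = y := ⟨y, rfl⟩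
      have := F.partN_mulR N (p := p) (q := r') (q' := r) (t := q') (t' := q) rfl (by omega)
        (by omega) (by omega) (by omega) (by omega) α y
      rw [hα, map_zero, LinearMap.zero_apply] at this
      refine (congrArg _ (F.dN_negSucc N hs (by omega) y)).trans ?_
      refine Eq.trans ?_ (F.dN_negSucc N ht (by omega) _).symm
      refine (map_smul (F.mulR N (by omega) α) _ _).trans ?_
      refine (congrArg _ (neg_smul_eq (b := p) (M := Chn N q') this (by omega))).trans ?_
      exact (smul_eq_smul_smul (a := q) (M := Chn N q') _ (by omega)).symm

end Commutes

/-! ### Connes' operator -/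

section Rotation

variable {k : Type u} {A : Type v} [Field k] [Ring A] [Algebra k A]
variable {M : Type*} [AddCommGroup M] [Module k M]

/-- The word with its last `j` letters moved to the front, twisted by an automorphism. -/
def rot (s : A ≃ₐ[k] A) (j : ℕ) (w : List A) : List A :=
  (w.drop (w.length - j)).map s ++ w.take (w.length - j)

theorem rot_append (s : A ≃ₐ[k] A) {j : ℕ} {l₁ l₂ : List A} (h : l₂.length = j) :
    rot s j (l₁ ++ l₂) = l₂.map s ++ l₁ := by
  subst h
  simp [rot]

theorem rot_zero (s : A ≃ₐ[k] A) (w : List A) : rot s 0 w = w := by simp [rot]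

theorem mid_append_append (φ : List A → M) (l₁ : List A) (x y : A) (l₂ : List A) :
    mid φ (l₁ ++ x :: y :: l₂) = mid (fun w => φ (w ++ y :: l₂)) (l₁ ++ [x])
      - (-1 : k) ^ l₁.length • φ (l₁ ++ x * y :: l₂)
      - (-1 : k) ^ l₁.length • mid (fun w => φ (l₁ ++ x :: w)) (y :: l₂) := by
  rw [mid_append_cons (k := k), mid_cons_cons, smul_sub, smul_neg]
  abel

/-- This gives the inner part of `∂B + B∂`. Contractions of all rotations of `w` are regrouped as
rotations of contracted words; the contraction at the seam, where the last letter has come to stand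
before the first, yields the words beginning with `s z * a`. -/
theorem sum_mid_rot (s : A ≃ₐ[k] A) (φ : List A → M) {q : ℕ} {a z : A} {t : List A}
    (ht : t.length = q) :
    ∑ j ∈ Finset.range (q + 2), (-1 : k) ^ ((q + 1) * j) • mid φ (rot s j (a :: t ++ [z])) =
      ∑ j ∈ Finset.range (q + 1), (-1 : k) ^ (q * j) •
        (mid (fun w => φ (rot s j w)) (a :: t ++ [z])
          + (-1 : k) ^ q • φ (rot s j (s z * a :: t))) := by
  set w := a :: t ++ [z] with hw
  have hwl : w.length = q + 2 := by simp [hw, ht]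
  -- `G j` collects, in the rotation by `j`, the contractions among letters that were not moved. `H
  -- j` collects, in the rotation by `j + 1`, those among moved letters and the one at the seam. The
  -- index shift makes `G j + H j` belong to the rotation by `j` of words with one letter less.
  set G : ℕ → M := fun j => (-1 : k) ^ (q * j) •
    mid (fun u => φ ((w.drop (q + 2 - j)).map s ++ u)) (w.take (q + 2 - j)) with hG
  set H : ℕ → M := fun j => (-1 : k) ^ ((q + 1) * (j + 1)) •
    (mid (fun u => φ (u.map s ++ w.take (q + 1 - j))) (w.drop (q + 1 - j))
      - (-1 : k) ^ j • φ (rot s j (s z * a :: t))) with hH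
  have e₀ : (-1 : k) ^ ((q + 1) * 0) • mid φ (rot s 0 w) = G 0 := by
    have : List.drop (q + 2) w = [] := List.drop_of_length_le hwl.le
    simp only [hG, rot_zero, Nat.sub_zero, List.take_of_length_le hwl.le, this]
    simp
  have e₁ : ∀ j ∈ Finset.range (q + 1),
      (-1 : k) ^ ((q + 1) * (j + 1)) • mid φ (rot s (j + 1) w) = G (j + 1) + H j := by
    intro j hj
    rw [Finset.mem_range] at hj
    obtain ⟨t₁, t₂, h, h₁⟩ : ∃ t₁ t₂, t = t₁ ++ t₂ ∧ t₁.length = q - j :=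
      ⟨t.take (q - j), t.drop (q - j), (List.take_append_drop _ _).symm, by simp; omega⟩
    have h₂ : t₂.length = j := by rw [h, List.length_append] at ht; omega
    have d : w = (a :: t₁) ++ (t₂ ++ [z]) := by rw [hw, h]; simp
    have d' : s z * a :: t = (s z * a :: t₁) ++ t₂ := by rw [h]; simp
    have n₁ : q + 2 - (j + 1) = (a :: t₁).length := by simp [h₁]; omega
    have n₂ : q + 1 - j = (a :: t₁).length := by simp [h₁]; omega
    have := mid_append_append (k := k) φ (t₂.map s) (s z) a t₁
    have m := mid_map s (fun u => φ (u ++ a :: t₁)) (t₂ ++ [z])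
    simp only [hG, hH, n₁, n₂, d']
    rw [d, rot_append s (j := j + 1) (l₂ := t₂ ++ [z]) (by simp [h₂]), rot_append s (j := j) h₂, List.map_append, List.append_assoc,
      List.take_left, List.drop_left]
    simp only [List.map_append, List.map_cons, List.map_nil, List.append_assoc, List.cons_append,
      List.nil_append] at this m ⊢
    rw [this, m, List.length_map, h₂]
    rcases neg_one_pow_eq_or k j with h | h <;> rcases neg_one_pow_eq_or k q with h' | h' <;>
      simp only [pow_succ, pow_add, pow_mul, mul_add, add_mul, one_mul, mul_one, h, h', one_pow, smul_sub, smul_smul] <;>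
      module
  have e₂ : ∀ j ∈ Finset.range (q + 1), G j + H j = (-1 : k) ^ (q * j) •
        (mid (fun w => φ (rot s j w)) w + (-1 : k) ^ q • φ (rot s j (s z * a :: t))) := by
    intro j hj
    rw [Finset.mem_range] at hj
    obtain ⟨l₁, x, l₂, d, h₁, h₂⟩ := exists_split_cons (l := w) (m := q + 1 - j) (n := j) (by omega)
    have n₁ : q + 2 - j = (l₁ ++ [x]).length := by simp [h₁]; omega
    have n₂ : q + 1 - j = l₁.length := h₁.symm
    have d₂ : w = (l₁ ++ [x]) ++ l₂ := by simp [d]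
    have D : w.drop (q + 2 - j) = l₂ := by rw [n₁, d₂, List.drop_left]
    have T : w.take (q + 2 - j) = l₁ ++ [x] := by rw [n₁, d₂, List.take_left]
    have D' : w.drop (q + 1 - j) = x :: l₂ := by rw [n₂, d, List.drop_left]
    have T' : w.take (q + 1 - j) = l₁ := by rw [n₂, d, List.take_left]
    simp only [hG, hH, D, T, D', T']
    rw [d, mid_append_cons (k := k) (fun w => φ (rot s j w)), h₁, mid_congr (l := l₁ ++ [x])
      (fun u _ => congrArg φ (rot_append s (l₁ := u) h₂)), mid_congr (l := x :: l₂)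
      (fun u hu => congrArg φ (rot_append s (l₁ := l₁) (l₂ := u) (by simp at hu; omega)))]
    have hsgn : (-1 : k) ^ (q + 1 - j) = (-1) ^ (q + 1) * (-1) ^ j := by
      rw [← pow_add, show q + 1 + j = (q + 1 - j) + 2 * j by omega, pow_add, pow_mul]
      simp
    rw [hsgn]
    rcases neg_one_pow_eq_or k j with h | h <;> rcases neg_one_pow_eq_or k q with h' | h' <;>
      simp only [pow_succ, pow_add, pow_mul, mul_add, add_mul, one_mul, mul_one, h, h', one_pow, smul_sub, smul_add, smul_smul] <;>
      module
  rw [Finset.sum_range_succ', e₀, Finset.sum_congr rfl e₁, Finset.sum_add_distrib, add_right_comm,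
    ← Finset.sum_range_succ' G, Finset.sum_range_succ, ← Finset.sum_congr rfl e₂,
    Finset.sum_add_distrib]
  -- In the last rotation a single letter stays in place, so it has nothing to be contracted with.
  have : G (q + 1) = 0 := by simp [hG, hw]
  rw [this, add_zero]

/-- The sum telescopes. A rotation through all `p + 1` letters applies `s` to each of them, and its
sign `(-1)^(p(p+1))` is `1`. -/
theorem sum_sub_rot (s : A ≃ₐ[k] A) (φ : List A → M) {p : ℕ} {w : List A} (hw : w.length = p + 1) :
    ∑ j ∈ Finset.range (p + 1), (-1 : k) ^ (p * j) •
      (φ (rot s j w) - (-1 : k) ^ p • φ (rot s 1 (rot s j w))) = φ w - φ (w.map s) := by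
  have : ∀ j ∈ Finset.range (p + 1), (-1 : k) ^ (p * j) •
      (φ (rot s j w) - (-1 : k) ^ p • φ (rot s 1 (rot s j w))) =
      (-1 : k) ^ (p * j) • φ (rot s j w) - (-1 : k) ^ (p * (j + 1)) • φ (rot s (j + 1) w) := by
    intro j hj
    rw [Finset.mem_range] at hj
    obtain ⟨l₁, x, l₂, rfl, h₁, h₂⟩ := exists_split_cons (l := w) (m := p - j) (n := j) (by omega)
    have d : l₁ ++ x :: l₂ = (l₁ ++ [x]) ++ l₂ := by simp
    rw [rot_append s (j := j + 1) (l₂ := x :: l₂) (by simp [h₂]), d, rot_append s h₂,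
      ← List.append_assoc, rot_append s (j := 1) (l₂ := [x]) rfl, smul_sub, smul_smul, mul_add,
      mul_one, pow_add]
    simp
  rw [Finset.sum_congr rfl this, Finset.sum_range_sub', rot_zero]
  have h : rot s (p + 1) w = w.map s := by
    simpa using rot_append s (l₁ := []) hw
  rw [h, Even.neg_one_pow (Nat.even_mul_succ_self p)]
  simp

/-- The twisted cyclic rotation of `Ā^{⊗ (p+1)}`. -/
noncomputable def rotMap (s : A ≃ₐ[k] A) (p : ℕ) : BarPow k A (p + 1) →ₗ[k] BarPow k A (p + 1) :=
  (concat k A (add_comm 1 p)).toLinearMap ∘ₗ TensorProduct.map (powMap s 1) LinearMap.id ∘ₗ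
    (TensorProduct.comm k _ _).toLinearMap ∘ₗ split k A rfl

theorem rotMap_bl (s : A ≃ₐ[k] A) {p : ℕ} {l : List A} {x : A} (hl : l.length = p) :
    rotMap s p (bl k (p + 1) (l ++ [x])) = bl k (p + 1) (s x :: l) := by
  simp only [rotMap, LinearMap.comp_apply]
  rw [split_bl rfl hl]
  simp only [LinearEquiv.coe_coe, TensorProduct.comm_tmul, TensorProduct.map_tmul, powMap_bl,
    LinearMap.id_apply]
  exact concat_bl (k := k) (add_comm 1 p) (l₁ := [s x]) rfl

theorem rotMap_pow_bl (s : A ≃ₐ[k] A) {p j : ℕ} {w : List A} (hw : w.length = p + 1)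
    (hj : j ≤ p + 1) : (rotMap s p ^ j) (bl k (p + 1) w) = bl k (p + 1) (rot s j w) := by
  induction j with
  | zero => rw [rot_zero]; rfl
  | succ j ih =>
    obtain ⟨l₁, x, l₂, rfl, h₁, h₂⟩ := exists_split_cons (l := w) (m := p - j) (n := j) (by omega)
    have d : l₁ ++ x :: l₂ = (l₁ ++ [x]) ++ l₂ := by simp
    rw [pow_succ', Module.End.mul_apply, ih (by omega), 
      rot_append s (j := j + 1) (l₂ := x :: l₂) (by simp [h₂]), d, rot_append s h₂, ← List.append_assoc, rotMap_bl s (by simp; omega)]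
    rfl

/-- Connes' operator. -/
noncomputable def connes (s : A ≃ₐ[k] A) (p : ℕ) : Chain k A p →ₗ[k] Chain k A (p + 1) :=
  TensorProduct.mk k A (BarPow k A (p + 1)) 1 ∘ₗ
    (∑ j ∈ Finset.range (p + 1), (-1 : k) ^ (p * j) • rotMap s p ^ j) ∘ₗ
      TensorProduct.lift (consA k p ∘ₗ s.toLinearMap)

theorem connes_bl (s : A ≃ₐ[k] A) {p : ℕ} (m : A) {l : List A} (hl : l.length = p) :
    connes s p (m ⊗ₜ bl k p l) = ∑ j ∈ Finset.range (p + 1), (-1 : k) ^ (p * j) •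
      (1 : A) ⊗ₜ[k] bl k (p + 1) (rot s j (s m :: l)) := by
  simp only [connes, LinearMap.comp_apply, TensorProduct.lift.tmul, AlgEquiv.toLinearMap_apply,
    consA_bl, LinearMap.sum_apply, LinearMap.smul_apply, map_sum, map_smul, TensorProduct.mk_apply]
  refine Finset.sum_congr rfl fun j hj => ?_
  rw [rotMap_pow_bl s (by simp [hl]) (Finset.mem_range.1 hj).le]

theorem length_rot (s : A ≃ₐ[k] A) (j : ℕ) (w : List A) : (rot s j w).length = w.length := by
  simp [rot]

/-- The word `a :: l` as the chain `σ(a) ⊗ l`. -/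
noncomputable def wordChain (σ : A ≃ₐ[k] A) (p : ℕ) (w : List A) : Chain k A p :=
  σ (w.headD 0) ⊗ₜ bl k p w.tail

/-- With coefficient `1`, the last outer term of the boundary is the first outer term for the word
rotated by one letter. Hence the outer terms of the boundary of Connes' sum telescope. -/
theorem partA_one (s : A ≃ₐ[k] A) {p : ℕ} {w : List A} (hw : w.length = p + 1) :
    partA s.symm rfl ((1 : A) ⊗ₜ bl k (p + 1) w) =
      wordChain s.symm p w - (-1 : k) ^ p • wordChain s.symm p (rot s 1 w)
        + mid (fun u => (1 : A) ⊗ₜ[k] bl k p u) w := by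
  obtain ⟨a, t, rfl⟩ := List.exists_cons_of_length_eq_add_one hw
  obtain ⟨i, z, e, hi⟩ := exists_last a t
  rw [partA_bl s.symm rfl 1 rfl e (by simpa using hw), e, rot_append s (j := 1) (l₂ := [z]) rfl, ← e, wordChain,
    wordChain, pow_succ]
  simp
  module

theorem partA_connes_bl (s : A ≃ₐ[k] A) {p : ℕ} (m : A) {l : List A} (hl : l.length = p) :
    partA s.symm rfl (connes s p (m ⊗ₜ bl k p l)) =
      m ⊗ₜ bl k p l - chainMap s p (m ⊗ₜ bl k p l) + ∑ j ∈ Finset.range (p + 1),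
        (-1 : k) ^ (p * j) • mid (fun u => (1 : A) ⊗ₜ[k] bl k p u) (rot s j (s m :: l)) := by
  have hl' : (s m :: l).length = p + 1 := by simp [hl]
  have h := sum_sub_rot s (wordChain s.symm p) hl'
  rw [connes_bl s m hl, map_sum]
  rw [Finset.sum_congr rfl fun j _ => (map_smul (partA s.symm rfl) ((-1 : k) ^ (p * j)) _).trans
    (congrArg _ (partA_one s ((length_rot s j _).trans hl')))]
  simp only [smul_add]
  rw [Finset.sum_add_distrib]
  rw [h, chainMap_bl]
  simp [wordChain]

theorem partA_connes_zero (s : A ≃ₐ[k] A) (x : Chain k A 0) :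
    partA s.symm rfl (connes s 0 x) = x - chainMap s 0 x := by
  suffices H : partA s.symm rfl ∘ₗ connes s 0 = LinearMap.id - chainMap s 0 from
    LinearMap.congr_fun H x
  refine chain_hom_ext fun m l hl => ?_
  rw [LinearMap.comp_apply, partA_connes_bl s m hl]
  obtain rfl := List.length_eq_zero_iff.1 hl
  simp [rot_zero]

/-- The outer terms of `∂B` telescope to the identity minus the action of `s` by `sum_sub_rot`; its
inner terms cancel against `B∂` by `sum_mid_rot`. -/
theorem partA_connes (s : A ≃ₐ[k] A) {p : ℕ} (x : Chain k A (p + 1)) :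
    partA s.symm rfl (connes s (p + 1) x) + connes s p (partA s.symm rfl x) =
      x - chainMap s (p + 1) x := by
  suffices H : partA s.symm rfl ∘ₗ connes s (p + 1) + connes s p ∘ₗ partA s.symm rfl =
      LinearMap.id - chainMap s (p + 1) from LinearMap.congr_fun H x
  refine chain_hom_ext fun m l hl => ?_
  obtain ⟨y, t', rfl⟩ := List.exists_cons_of_length_eq_add_one hl
  obtain ⟨t, z, e, ht⟩ := exists_last y t'
  have ht' : t.length = p := by simpa [ht] using hl
  have key := sum_mid_rot (k := k) s (fun u => (1 : A) ⊗ₜ[k] bl k (p + 1) u) (a := s m) (z := z) ht'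
  have hc : connes s p (partA s.symm rfl (m ⊗ₜ bl k (p + 1) (y :: t'))) =
      - ∑ j ∈ Finset.range (p + 1), (-1 : k) ^ (p * j) •
        (mid (fun w => (1 : A) ⊗ₜ[k] bl k (p + 1) (rot s j w)) (s m :: y :: t')
          + (-1 : k) ^ p • (1 : A) ⊗ₜ[k] bl k (p + 1) (rot s j (s z * s m :: t))) := by
    have hm : ∀ w : List A, w.length + 1 = (y :: t').length →
        connes s p (m ⊗ₜ[k] bl k p w) = ∑ j ∈ Finset.range (p + 1), (-1 : k) ^ (p * j) •
          (1 : A) ⊗ₜ[k] bl k (p + 1) (rot s j (s m :: w)) := fun w hw =>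
      connes_bl s m (by simp at hw hl; omega)
    rw [partA_bl s.symm rfl m rfl e (by simpa using hl), map_add, map_add, map_smul,
      connes_bl s _ (by simpa using hl), connes_bl s _ ht', map_mid, mid_congr hm, mid_sum]
    simp only [mid_cons_cons, map_mul, AlgEquiv.apply_symm_apply, Finset.smul_sum,
      ← Finset.sum_add_distrib, ← Finset.sum_neg_distrib]
    refine Finset.sum_congr rfl fun j _ => ?_
    rw [mid_smul, pow_succ]
    module
  rw [LinearMap.add_apply, LinearMap.comp_apply, LinearMap.comp_apply, hc, partA_connes_bl s m hl,
    e, ← List.cons_append, key]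
  simp

end Rotation

/-! ### The star product in terms of the operations -/

section StarOperations

variable {k : Type u} {A : Type v} [Field k] [Ring A] [Algebra k A]

theorem cup_eq_cupL {m n t : ℕ} (h : m + n = t) (f : Cochain k A m) (g : Cochain k A n) :
    cup h f g = cupL (Bimod.self k A) h f g := rfl

theorem cup_eq_cupR {m n t : ℕ} (h : m + n = t) (f : Cochain k A m) (g : Cochain k A n) :
    cup h f g = cupR (Bimod.self k A) h g f := by
  refine bl_hom_ext fun l hl => ?_
  obtain ⟨l₁, l₂, rfl, h₁, h₂⟩ := exists_split (hl.trans h.symm)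
  rw [cup_eq_cupL, cupL_bl _ h _ _ rfl h₁]
  exact (cupR_bl (Bimod.self k A) h g f rfl h₁).symm

theorem capLeft_eq_capL {m p q : ℕ} (h : q + m = p) (f : Cochain k A m) (α : Chain k A p) :
    capLeft h f α = capL (Bimod.self k A) h f α := rfl

theorem capLeft_eq_capR {m p q : ℕ} (h : q + m = p) (f : Cochain k A m) (α : Chain k A p) :
    capLeft h f α = capR (Bimod.self k A) h α f := by
  suffices H : capLeft h f = (capR (Bimod.self k A) h).flip f from LinearMap.congr_fun H α
  refine chain_hom_ext fun a l hl => ?_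
  obtain ⟨l₁, l₂, rfl, h₁, h₂⟩ := exists_split (hl.trans h.symm)
  refine (capL_bl (Bimod.self k A) h f a rfl h₁).trans ?_
  exact (capR_bl (Bimod.self k A) h f a rfl h₁).symm

variable [FiniteDimensional k A] (F : FrobeniusForm k A)

theorem FrobeniusForm.evalLeft_eq_evR {n p m : ℕ} (h : n + (p + 1) = m) (f : Cochain k A m)
    (α : Chain k A p) : F.evalLeft h f α = F.evR (Bimod.self k A) h α f := by
  suffices H : F.evalLeft h f = (F.evR (Bimod.self k A) h).flip f from LinearMap.congr_fun H α
  exact chain_hom_ext fun a l hl => rfl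

theorem FrobeniusForm.evalLeft_eq_evL {n p m : ℕ} (h : n + (p + 1) = m) (f : Cochain k A m)
    (α : Chain k A p) : F.evalLeft h f α = F.evL (Bimod.self k A) h f α := by
  rw [F.evalLeft_eq_evR]
  suffices H : (F.evR (Bimod.self k A) h).flip f = F.evL (Bimod.self k A) h f from
    LinearMap.congr_fun H α
  refine chain_hom_ext fun a l hl => bl_hom_ext fun b hb => ?_
  refine (F.evR_bl (Bimod.self k A) h f a l b hb).trans ?_
  refine Eq.trans ?_ (F.evL_bl (Bimod.self k A) h f a l b hb).symm
  refine (F.casimir_mul_nakayama ((LinearMap.mul k A) ∘ₗ f ∘ₗ slot k b l (by omega)) a).trans ?_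
  exact Finset.sum_congr rfl fun j _ => (mul_assoc _ _ _).symm

theorem FrobeniusForm.evalRight_eq_evA {n p m : ℕ} (h : p + (n + 1) = m) (f : Cochain k A m)
    (α : Chain k A p) : F.evalRight h α f = F.evA (Bimod.self k A) h α f := rfl

theorem FrobeniusForm.capA_eq_chainMap {m p q : ℕ} (h : m + q = p) (f : Cochain k A m)
    (α : Chain k A p) : F.capA (Bimod.self k A) h α f =
      chainMap F.nakayama q (capRight F.nakayama.symm h α f) := by
  suffices H : (F.capA (Bimod.self k A) h).flip f =
    chainMap F.nakayama q ∘ₗ (capRight F.nakayama.symm h).flip f from LinearMap.congr_fun H α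
  refine chain_hom_ext fun a l hl => ?_
  obtain ⟨l₁, l₂, rfl, h₁, h₂⟩ := exists_split (hl.trans h.symm)
  refine (F.capA_bl (Bimod.self k A) h f a rfl h₁).trans ?_
  simp [capRight, split_bl h h₁]

theorem FrobeniusForm.chainMul_eq_mulA {p q t : ℕ} (h : q + (p + 1) = t) (α : Chain k A p)
    (β : Chain k A q) : F.chainMul h α β = F.mulA (Bimod.self k A) h α β := rfl

theorem FrobeniusForm.chainMul_eq_mulR {p q t : ℕ} (h : q + (p + 1) = t) (α : Chain k A p)
    (β : Chain k A q) : F.chainMul h α β = F.mulR (Bimod.self k A) h β α := by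
  suffices H : F.chainMul h = (F.mulR (Bimod.self k A) h).flip from
    LinearMap.congr_fun (LinearMap.congr_fun H α) β
  refine chain_hom_ext fun a l hl => chain_hom_ext fun b w hw => ?_
  refine (F.mulA_bl (Bimod.self k A) h a b l w hw).trans ?_
  refine Eq.trans ?_ (F.mulR_bl (Bimod.self k A) h b a w l hw).symm
  exact F.casimir_mul_nakayama (((TensorProduct.mk k A (BarPow k A t)) ∘ₗ
    LinearMap.mulRight k b).flip ∘ₗ slot k w l (by omega)) a

/-- The twist of the complete complex by the Nakayama automorphism on chains. -/
noncomputable def FrobeniusForm.tw : (r : ℤ) → D k A r →ₗ[k] D k A r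
  | .ofNat n => (LinearMap.id : Cochain k A n →ₗ[k] Cochain k A n)
  | .negSucc p => (chainMap F.nakayama p : Chain k A p →ₗ[k] Chain k A p)

/-- The complete complex as the complete complex with coefficients in `A`. -/
noncomputable def toDN : (r : ℤ) → D k A r ≃ₗ[k] DN (Bimod.self k A) r
  | .ofNat n => LinearEquiv.refl k (Cochain k A n)
  | .negSucc p => LinearEquiv.refl k (Chain k A p)

/-- The operation `x ⋆ -`. -/
noncomputable def FrobeniusForm.opL : (r : ℤ) → D k A r → Op k A r
  | .ofNat _, f => F.opLCochain f
  | .negSucc _, α => F.opLChain α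

end StarOperations

/-! ### Passage to cohomology and the comparison principle. -/

section Cohomology

variable {k : Type u} {A : Type v} [Field k] [Ring A] [Algebra k A]

theorem partialMap_eq_partA (σ : A ≃ₐ[k] A) (p : ℕ) (α : Chain k A (p + 1)) :
    partialMap σ p α = partA σ rfl α := by
  suffices H : partialMap σ p = partA σ rfl from LinearMap.congr_fun H α
  exact chain_hom_ext fun a l hl => rfl

variable [FiniteDimensional k A] (F : FrobeniusForm k A)

theorem FrobeniusForm.normMap_eq_normA (α : Chain k A 0) : F.normMap α = F.normA α := by
  obtain ⟨a, rfl⟩ := chain_zero_exists α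
  refine coch_zero_ext (N := Bimod.self k A) ?_
  refine (F.normMap_apply a _ _).trans (Eq.trans ?_ (F.normA_bl a [] []).symm)
  simp only [mul_assoc]

theorem FrobeniusForm.d_eq_zero_iff (r : ℤ) (x : D k A r) :
    F.d r x = 0 ↔ F.dN _ r (r + 1) rfl (toDN r x) = 0 := by
  match r, x with
  | .ofNat n, x => rfl
  | .negSucc 0, (x : Chain k A 0) =>
    change F.normMap x = 0 ↔ F.normA x = 0
    rw [F.normMap_eq_normA]
  | .negSucc (p + 1), (x : Chain k A (p + 1)) =>
    change partialMap _ p x = 0 ↔ ((-1 : k) ^ (p + 1)) • partA F.nakayama.symm rfl x = 0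
    rw [partialMap_eq_partA, smul_eq_zero_iff_right (pow_ne_zero _ (by simp))]

theorem FrobeniusForm.isCycle_of_d_eq_zero {p : ℕ} {α : Chain k A p}
    (h : F.d (.negSucc p) α = 0) : F.IsCycle α := by
  match p, α, h with
  | 0, α, h => exact (F.normMap_eq_normA α).symm.trans h
  | p + 1, α, h => exact (partialMap_eq_partA _ p α).symm.trans h

theorem FrobeniusForm.mem_coboundaries_iff (r : ℤ) (x : D k A r) :
    x ∈ F.coboundaries (fun _ => ⊤) r ↔ toDN r x ∈ F.bd _ r := by
  match r, x with
  | .ofNat 0, x =>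
    refine Iff.trans ?_ (F.mem_bd (s := .negSucc 0) (t := .ofNat 0) rfl).symm
    constructor
    · rintro ⟨y, -, rfl⟩
      exact ⟨y, (F.normMap_eq_normA y).symm⟩
    · rintro ⟨y, rfl⟩
      exact ⟨y, Submodule.mem_top, F.normMap_eq_normA y⟩
  | .ofNat (n + 1), x =>
    refine Iff.trans ?_ (F.mem_bd (s := .ofNat n) (t := .ofNat (n + 1)) rfl).symm
    constructor
    · rintro ⟨y, -, rfl⟩
      exact ⟨y, rfl⟩
    · rintro ⟨y, rfl⟩
      exact ⟨y, Submodule.mem_top, rfl⟩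
  | .negSucc p, x =>
    refine Iff.trans ?_ (F.mem_bd (s := .negSucc (p + 1)) (t := .negSucc p) (by omega)).symm
    constructor
    · rintro ⟨y, -, rfl⟩
      obtain ⟨y, rfl⟩ : ∃ z : Chain k A (p + 1), z = y := ⟨y, rfl⟩
      refine ⟨(-1 : k) ^ (p + 1) • y, ?_⟩
      change ((-1 : k) ^ (p + 1)) • partA F.nakayama.symm rfl ((-1 : k) ^ (p + 1) • y) = _
      rw [map_smul, smul_smul, ← mul_pow, ← partialMap_eq_partA]
      simp
      rfl
    · rintro ⟨y, h⟩
      obtain ⟨y, rfl⟩ : ∃ z : Chain k A (p + 1), z = y := ⟨y, rfl⟩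
      refine ⟨(-1 : k) ^ (p + 1) • y, Submodule.mem_top, ?_⟩
      refine Eq.trans ?_ h
      change partialMap _ p ((-1 : k) ^ (p + 1) • y) =
        ((-1 : k) ^ (p + 1)) • partA F.nakayama.symm rfl y
      rw [map_smul, partialMap_eq_partA]

/-- Congruence modulo the boundaries. -/
def FrobeniusForm.Homologous {N : Bimod k A} {t : ℤ} (x y : DN N t) : Prop := x - y ∈ F.bd N t

variable {F} in
theorem FrobeniusForm.Homologous.trans {N : Bimod k A} {t : ℤ} {x y z : DN N t}
    (h : F.Homologous x y) (h' : F.Homologous y z) : F.Homologous x z := by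
  have := add_mem h h'
  rwa [sub_add_sub_cancel] at this

variable {F} in
theorem FrobeniusForm.Homologous.symm {N : Bimod k A} {t : ℤ} {x y : DN N t}
    (h : F.Homologous x y) : F.Homologous y x := by
  have := neg_mem h
  rwa [neg_sub] at this

theorem FrobeniusForm.Homologous.rfl {F : FrobeniusForm k A} {N : Bimod k A} {t : ℤ} {x : DN N t} :
    F.Homologous x x := by
  rw [FrobeniusForm.Homologous, sub_self]
  exact zero_mem _

theorem FrobeniusForm.dN_eq_zero_of_homologous {F : FrobeniusForm k A} {N : Bimod k A} {s t : ℤ}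
    (ht : s + 1 = t) {x y : DN N s} (h : F.Homologous x y) (hx : F.dN N s t ht x = 0) :
    F.dN N s t ht y = 0 := by
  obtain ⟨z, hz⟩ := h
  have := F.dN_dN N (by omega) ht z
  rwa [hz, map_sub, hx, zero_sub, neg_eq_zero] at this

variable {F}

theorem Op.map_homologous {r : ℤ} {Φ : Op k A r} {ε : ℤ → k} (hΦ : ∀ s, F.CommutesAt Φ (ε s) s)
    {N : Bimod k A} {s t : ℤ} (h : s + r = t) {x y : DN N s} (hxy : F.Homologous x y) :
    F.Homologous (Φ.app N s t h x) (Φ.app N s t h y) := by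
  rw [FrobeniusForm.Homologous, ← map_sub]
  obtain ⟨z, hz⟩ := (F.mem_bd (s := s - 1) (by omega)).1 hxy
  rw [← hz, hΦ _ N s (t - 1) t (by omega) (by omega) (by omega) (by omega)]
  exact Submodule.smul_mem _ _ (F.dN_mem_bd _ _)

theorem Op.map_cocycle {r : ℤ} {Φ : Op k A r} {ε : ℤ → k} (hΦ : ∀ s, F.CommutesAt Φ (ε s) s)
    (hε : ∀ s, ε s ≠ 0) {N : Bimod k A} {s t : ℤ} (h : s + r = t) {x : DN N s}
    (hx : F.dN N s (s + 1) rfl x = 0) : F.dN N t (t + 1) rfl (Φ.app N s t h x) = 0 := by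
  have := hΦ s N (s + 1) t (t + 1) rfl rfl h (by omega) x
  rw [hx, map_zero] at this
  exact (smul_eq_zero_iff_right (hε s)).1 this.symm

/-- The difference of the two operations is trivial at `1`, hence everywhere by dimension shifting.
The laws of the product below are applications of this principle. -/
theorem FrobeniusForm.homologous_of_one {r : ℤ} {Φ Ψ : Op k A r} {ε : ℤ → k}
    (hΦ : ∀ s, F.CommutesAt Φ (ε s) s) (hΨ : ∀ s, F.CommutesAt Ψ (ε s) s) (hε : ∀ s, ε s ≠ 0)
    (h : F.Homologous (Φ.app _ 0 r (zero_add r) (oneDN k A)) (Ψ.app _ 0 r (zero_add r) (oneDN k A)))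
    {N : Bimod k A} {s t : ℤ} (ht : s + r = t) {y : DN N s} (hy : F.dN N s (s + 1) rfl y = 0) :
    F.Homologous (Φ.app N s t ht y) (Ψ.app N s t ht y) :=
  FrobeniusForm.trivial (Φ := Φ.sub Ψ) (fun s => (hΦ s).sub (hΨ s)) hε h s N t ht y hy

theorem FrobeniusForm.homologous_of_one_nonneg {r : ℤ} {Φ Ψ : Op k A r} {ε : ℤ → k}
    (hΦ : ∀ n : ℕ, F.CommutesAt Φ (ε n) n) (hΨ : ∀ n : ℕ, F.CommutesAt Ψ (ε n) n)
    (h : F.Homologous (Φ.app _ 0 r (zero_add r) (oneDN k A)) (Ψ.app _ 0 r (zero_add r) (oneDN k A)))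
    {N : Bimod k A} {n : ℕ} {t : ℤ} (ht : n + r = t) {y : DN N n}
    (hy : F.dN N n (n + 1) rfl y = 0) :
    F.Homologous (Φ.app N n t ht y) (Ψ.app N n t ht y) :=
  FrobeniusForm.trivial_nonneg (Φ := Φ.sub Ψ) (fun n => (hΦ n).sub (hΨ n)) h n N t ht y hy

/-! ### Multiplication by a class -/

theorem FrobeniusForm.commutesAt_opL {r : ℤ} {x : D k A r} (hx : F.d r x = 0) (s : ℤ) :
    F.CommutesAt (F.opL r x) (sgn k r) s := by
  match r, x, hx with
  | .ofNat m, f, hf =>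
    rw [sgn_ofNat]
    exact F.commutesAt_opLCochain hf s
  | .negSucc p, α, hα =>
    rw [sgn_negSucc]
    exact F.commutesAt_opLChain (F.isCycle_of_d_eq_zero hα) s

theorem FrobeniusForm.opL_one (r : ℤ) (x : D k A r) :
    (F.opL r x).app _ 0 r (zero_add r) (oneDN k A) = toDN r (F.tw r x) := by
  match r, x with
  | .ofNat m, (f : Cochain k A m) =>
    refine bl_hom_ext (M := A) fun l hl => ?_
    refine (cupL_bl (Bimod.self k A) _ f _ (List.append_nil l).symm hl).trans ?_
    refine (congrArg (f (bl k m l) * ·) (constN_bl (Bimod.self k A) (1 : A) [])).trans ?_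
    exact mul_one _
  | .negSucc p, (α : Chain k A p) =>
    change (F.capA (Bimod.self k A) _).flip (constN (Bimod.self k A) (1 : A)) α = chainMap F.nakayama p α
    refine LinearMap.congr_fun (chain_hom_ext fun a l hl => ?_) α
    refine (F.capA_bl (Bimod.self k A) (m := 0) _ _ a (List.nil_append l).symm rfl).trans ?_
    rw [constN_bl, chainMap_bl]
    simp

/-- For a cycle the identity of Connes' operator reduces to `∂Bα = α - ν(α)`. The sign in the
witness undoes the sign of `dN`. -/
theorem FrobeniusForm.homologous_tw (r : ℤ) (x : D k A r) (hx : F.d r x = 0) :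
    F.Homologous (toDN r (F.tw r x)) (toDN r x) := by
  match r, x, hx with
  | .ofNat m, f, _ => exact FrobeniusForm.Homologous.rfl
  | .negSucc p, (α : Chain k A p), h =>
    refine FrobeniusForm.Homologous.symm ((F.mem_bd (s := .negSucc (p + 1)) (by omega)).2
      ⟨(-1 : k) ^ (p + 1) • connes F.nakayama p α, ?_⟩)
    have key : partA F.nakayama.symm rfl (connes F.nakayama p α) = α - chainMap F.nakayama p α := by
      have h := F.isCycle_of_d_eq_zero h
      match p, α, h with
      | 0, α, _ => exact partA_connes_zero _ α
      | p + 1, α, h =>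
        have h' : partA F.nakayama.symm rfl α = 0 := h
        have := partA_connes F.nakayama α
        rwa [h', map_zero, add_zero] at this
    change ((-1 : k) ^ (p + 1)) • partA F.nakayama.symm rfl ((-1 : k) ^ (p + 1) • connes F.nakayama p α) =
      α - chainMap F.nakayama p α
    rw [map_smul, smul_smul, ← mul_pow, key]
    simp

theorem FrobeniusForm.opL_one_homologous {r : ℤ} {x : D k A r} (hx : F.d r x = 0) :
    F.Homologous ((F.opL r x).app _ 0 r (zero_add r) (oneDN k A)) (toDN r x) := by
  rw [F.opL_one]
  exact F.homologous_tw r x hx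

end Cohomology

/-! ### Associativity and graded commutativity up to boundaries. -/

section ProductLaws

variable {k : Type u} {A : Type v} [Field k] [Ring A] [Algebra k A]

theorem chainMap_chainMap_symm (σ : A ≃ₐ[k] A) (p : ℕ) (α : Chain k A p) :
    chainMap σ p (chainMap σ.symm p α) = α := by
  suffices H : chainMap σ p ∘ₗ chainMap σ.symm p = LinearMap.id from LinearMap.congr_fun H α
  refine chain_hom_ext fun a l hl => ?_
  simp [Function.comp_def]

theorem chainMap_injective (σ : A ≃ₐ[k] A) (p : ℕ) : Function.Injective (chainMap σ p) := by
  refine Function.LeftInverse.injective (g := chainMap σ.symm p) fun α => ?_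
  simpa using chainMap_chainMap_symm σ.symm p α

variable [FiniteDimensional k A] {F : FrobeniusForm k A}

theorem FrobeniusForm.d_tw_eq_zero_iff (r : ℤ) (x : D k A r) :
    F.d r (F.tw r x) = 0 ↔ F.d r x = 0 := by
  match r, x with
  | .ofNat n, x => rfl
  | .negSucc 0, (x : Chain k A 0) =>
    change F.normMap (chainMap _ 0 x) = 0 ↔ F.normMap x = 0
    rw [F.normMap_eq_normA, F.normMap_eq_normA, F.normA_chainMap]
  | .negSucc (p + 1), (x : Chain k A (p + 1)) =>
    change partialMap _ p (chainMap _ _ x) = 0 ↔ partialMap _ p x = 0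
    rw [partialMap_eq_partA, partialMap_eq_partA, partA_chainMap _ _ (by simp),
      map_eq_zero_iff _ (chainMap_injective _ _)]

/-- The operation and the `⋆`-product differ at most by the action of `ν`, either on the result or
on the left factor, and `ν` does not change homology classes. -/
theorem FrobeniusForm.opL_homologous_star {r s t : ℤ} (h : r + s = t) (h' : s + r = t)
    {x : D k A r} {y : D k A s} (hx : F.d r x = 0) (hy : F.d s y = 0) :
    F.Homologous ((F.opL r x).app _ s t h' (toDN s y)) (toDN t (F.star r s t h x y)) := by
  have hL : F.dN _ t (t + 1) rfl ((F.opL r x).app _ s t h' (toDN s y)) = 0 :=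
    Op.map_cocycle (F.commutesAt_opL hx) (fun _ => sgn_ne_zero k r) h' ((F.d_eq_zero_iff s y).1 hy)
  match r, s, t, h, x, y with
  | .ofNat m, .ofNat n, .ofNat l, h, f, g => exact FrobeniusForm.Homologous.rfl
  | .ofNat m, .negSucc p, .negSucc q, h, f, α => exact FrobeniusForm.Homologous.rfl
  | .ofNat m, .negSucc p, .ofNat n, h, f, α =>
    have := F.evalLeft_eq_evL (n := n) (p := p) (m := m)
      (by simp only [Int.ofNat_eq_natCast] at h; omega) f α
    exact (congrArg (F.Homologous _) this).mpr FrobeniusForm.Homologous.rfl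
  | .negSucc p, .ofNat m, .negSucc q, h, α, f =>
    have := F.capA_eq_chainMap (m := m) (p := p) (q := q)
      (by simp only [Int.ofNat_eq_natCast] at h; omega) f α
    have e : (F.opL (.negSucc p) α).app _ (.ofNat m) (.negSucc q) h' (toDN (.ofNat m) f) =
      toDN (.negSucc q) (F.tw (.negSucc q) (F.star (.negSucc p) (.ofNat m) (.negSucc q) h α f)) := this
    -- The result is twisted by `ν`. It is a cocycle, since the operation preserves cocycles, so
    -- `homologous_tw` applies to it.
    rw [e] at hL ⊢
    exact F.homologous_tw _ _ ((F.d_tw_eq_zero_iff _ _).1 ((F.d_eq_zero_iff _ _).2 hL))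
  | .negSucc p, .ofNat m, .ofNat n, h, α, f => exact FrobeniusForm.Homologous.rfl
  | .negSucc p, .negSucc q, .negSucc l, h, α, β =>
    -- For two chains the operation twists its left factor. Starting from `ν⁻¹(α)` gives exactly
    -- `⋆`, and the operations of `α` and `ν⁻¹(α)` are compared at `1`.
    obtain ⟨α', hα⟩ : ∃ α' : D k A (.negSucc p), F.tw (.negSucc p) α' = α :=
      ⟨chainMap F.nakayama.symm p α, chainMap_chainMap_symm F.nakayama p α⟩
    have hα' : F.d _ α' = 0 := (F.d_tw_eq_zero_iff _ _).1 (hα ▸ hx)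
    have e : (F.opL (.negSucc p) α').app _ (.negSucc q) (.negSucc l) h' (toDN (.negSucc q) β) =
      toDN (.negSucc l) (F.star (.negSucc p) (.negSucc q) (.negSucc l) h α β) := by
      rw [← hα]
      rfl
    rw [← e]
    refine FrobeniusForm.homologous_of_one (F.commutesAt_opL hx) (F.commutesAt_opL hα')
      (fun _ => sgn_ne_zero k _) ?_ h' ((F.d_eq_zero_iff _ β).1 hy)
    rw [F.opL_one, F.opL_one, hα]
    exact F.homologous_tw _ α hx
  | .ofNat m, .ofNat n, .negSucc l, h, _, _ =>
    exact absurd h (by simp only [Int.ofNat_eq_natCast]; omega)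
  | .negSucc p, .negSucc q, .ofNat l, h, _, _ =>
    exact absurd h (by simp only [Int.ofNat_eq_natCast]; omega)

theorem FrobeniusForm.d_star {r s t : ℤ} (h : r + s = t) {x : D k A r} {y : D k A s}
    (hx : F.d r x = 0) (hy : F.d s y = 0) : F.d t (F.star r s t h x y) = 0 := by
  have h' : s + r = t := by omega
  rw [F.d_eq_zero_iff]
  exact F.dN_eq_zero_of_homologous _ (F.opL_homologous_star h h' hx hy)
    (Op.map_cocycle (F.commutesAt_opL hx) (fun _ => sgn_ne_zero k r) h' ((F.d_eq_zero_iff s y).1 hy))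

/-- Cohomologous cocycles of the complete complex. -/
def FrobeniusForm.Cohomologous (F : FrobeniusForm k A) {r : ℤ} (x y : D k A r) : Prop :=
  F.Homologous (toDN r x) (toDN r y)

/-- A change of the left factor changes the operation, but its value at `1` only by a boundary. For
the right factor it suffices that a single operation preserves boundaries. -/
theorem FrobeniusForm.star_cohomologous_left {r s t : ℤ} (h : r + s = t) {x x' : D k A r}
    {y : D k A s} (hx : F.d r x = 0) (hx' : F.d r x' = 0) (hy : F.d s y = 0)
    (hxx' : F.Cohomologous x x') :
    F.Cohomologous (F.star r s t h x y) (F.star r s t h x' y) := by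
  have h' : s + r = t := by omega
  refine (F.opL_homologous_star h h' hx hy).symm.trans
    (FrobeniusForm.Homologous.trans ?_ (F.opL_homologous_star h h' hx' hy))
  exact FrobeniusForm.homologous_of_one (F.commutesAt_opL hx) (F.commutesAt_opL hx')
    (fun _ => sgn_ne_zero k _)
    ((F.opL_one_homologous hx).trans (hxx'.trans (F.opL_one_homologous hx').symm))
    h' ((F.d_eq_zero_iff _ y).1 hy)

theorem FrobeniusForm.star_cohomologous_right {r s t : ℤ} (h : r + s = t) {x : D k A r}
    {y y' : D k A s} (hx : F.d r x = 0) (hy : F.d s y = 0) (hy' : F.d s y' = 0)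
    (hyy' : F.Cohomologous y y') :
    F.Cohomologous (F.star r s t h x y) (F.star r s t h x y') := by
  have h' : s + r = t := by omega
  exact (F.opL_homologous_star h h' hx hy).symm.trans
    ((Op.map_homologous (F.commutesAt_opL hx) h' hyy').trans (F.opL_homologous_star h h' hx hy'))

theorem FrobeniusForm.CommutesAt.comp {r r' r'' : ℤ} (h₀ : r' + r = r'') {Φ : Op k A r}
    {Ψ : Op k A r'} {ε ε' : k} (hΦ : ∀ s, F.CommutesAt Φ ε s) (hΨ : ∀ s, F.CommutesAt Ψ ε' s)
    (s : ℤ) : F.CommutesAt (Op.comp h₀ Φ Ψ) (ε' * ε) s := by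
  intro N s' t t' hs ht h h' y
  rw [Op.comp_app h₀ Φ Ψ N h' (t' := s' + r') rfl (by omega),
    Op.comp_app h₀ Φ Ψ N h (t' := s + r') rfl (by omega),
    hΨ _ _ _ _ _ hs (by omega) rfl rfl, map_smul, hΦ _ _ _ _ _ _ ht (by omega) (by omega), smul_smul]

/-- Multiplication by `x ⋆ y` and the composite of the multiplications by `y` and by `x` carry the
same sign and agree at `1` up to boundaries. -/
theorem FrobeniusForm.star_assoc {r s t rs st rst : ℤ} (h₁ : r + s = rs) (h₂ : s + t = st)
    (h₃ : rs + t = rst) (h₄ : r + st = rst) {x : D k A r} {y : D k A s} {z : D k A t}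
    (hx : F.d r x = 0) (hy : F.d s y = 0) (hz : F.d t z = 0) :
    F.Cohomologous (F.star rs t rst h₃ (F.star r s rs h₁ x y) z)
      (F.star r st rst h₄ x (F.star s t st h₂ y z)) := by
  have hxy := F.d_star h₁ hx hy
  have hyz := F.d_star h₂ hy hz
  have c : ∀ n, F.CommutesAt (Op.comp (r'' := rs) (by omega) (F.opL r x) (F.opL s y)) (sgn k rs) n := by
    intro n
    have e : sgn k rs = sgn k s * sgn k r := by rw [← h₁, add_comm, sgn_add]
    rw [e]
    exact FrobeniusForm.CommutesAt.comp _ (F.commutesAt_opL hx) (F.commutesAt_opL hy) n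
  refine (F.opL_homologous_star h₃ (by omega) hxy hz).symm.trans ?_
  refine (FrobeniusForm.homologous_of_one (F.commutesAt_opL hxy) c (fun _ => sgn_ne_zero k _) ?_
    (by omega) ((F.d_eq_zero_iff _ z).1 hz)).trans ?_
  · rw [Op.comp_app _ _ _ _ _ (t' := s) (zero_add s) (by omega)]
    exact (F.opL_one_homologous hxy).trans ((F.opL_homologous_star h₁ (by omega) hx hy).symm.trans
      (Op.map_homologous (F.commutesAt_opL hx) _ (F.opL_one_homologous hy).symm))
  · rw [Op.comp_app _ _ _ _ _ (t' := st) (by omega) (by omega)]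
    exact (Op.map_homologous (F.commutesAt_opL hx) _
      (F.opL_homologous_star h₂ (by omega) hy hz)).trans
      (F.opL_homologous_star h₄ (by omega) hx hyz)

theorem FrobeniusForm.opRChain_app {p : ℕ} (α : Chain k A p) (s t : ℤ)
    (h : s + .negSucc p = t) (y : D k A s) :
    (F.opRChain α).app _ s t h (toDN s y) = toDN t (F.star s (.negSucc p) t h y α) := by
  match s, t, h, y with
  | .ofNat m, .negSucc q, h, f => exact (capLeft_eq_capR _ f α).symm
  | .ofNat m, .ofNat n, h, f => exact (F.evalLeft_eq_evR _ f α).symm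
  | .negSucc q, .negSucc l, h, β => exact (F.chainMul_eq_mulR _ β α).symm
  | .negSucc q, .ofNat l, h, _ => exact absurd h (by simp only [Int.ofNat_eq_natCast]; omega)

theorem FrobeniusForm.star_unit (r : ℤ) (x : D k A r) :
    F.star 0 r r (zero_add r) (unitD k A) x = x := by
  match r, x with
  | .ofNat n, (f : Cochain k A n) =>
    refine bl_hom_ext (M := A) fun l hl => ?_
    refine (cupL_bl (Bimod.self k A) (m := 0) _ _ f (List.nil_append l).symm rfl).trans ?_
    refine (congrArg (· * f (bl k n l)) (constN_bl (Bimod.self k A) (1 : A) [])).trans ?_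
    exact one_mul _
  | .negSucc p, (α : Chain k A p) =>
    change capLeft _ (constN (Bimod.self k A) (1 : A)) α = (LinearMap.id : Chain k A p →ₗ[k] Chain k A p) α
    refine LinearMap.congr_fun (chain_hom_ext fun a l hl => ?_) α
    refine (capL_bl (Bimod.self k A) (m := 0) _ _ a (List.append_nil l).symm hl).trans ?_
    rw [constN_bl]
    simp

theorem FrobeniusForm.d_unitD : F.d 0 (unitD k A) = 0 := by
  refine bl_hom_ext (M := A) fun l hl => ?_
  obtain ⟨a, rfl⟩ := List.length_eq_one_iff.1 hl
  refine (deltaN_bl (Bimod.self k A) rfl (constN _ (1 : A)) (i := []) rfl rfl rfl).trans ?_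
  rw [constN_bl]
  simp
  rfl

theorem FrobeniusForm.star_comm_chain {p : ℕ} {s t : ℤ} (h : .negSucc p + s = t)
    (h' : s + .negSucc p = t) {α : Chain k A p} {y : D k A s}
    (hα : F.d (.negSucc p) α = 0) (hy : F.d s y = 0) :
    F.Cohomologous (F.star (.negSucc p) s t h α y)
      (sgn k (.negSucc p * s) • F.star s (.negSucc p) t h' y α) := by
  -- Right multiplication commutes strictly with the differentials. The factor `(-1)^(r n)` in
  -- degree `n`, where `r` is the degree of `α`, gives it the sign `(-1)^r` of left multiplication,
  -- so the two can be compared at `1`.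
  have c : ∀ n, F.CommutesAt (Op.smul (fun n => sgn k (.negSucc p * n)) (F.opRChain α))
      (sgn k (.negSucc p)) n := by
    intro n N s' t t' hs ht h h' y
    simp only [Op.smul, LinearMap.smul_apply]
    rw [F.commutesAt_opRChain (F.isCycle_of_d_eq_zero hα) n N s' t t' hs ht h h' y, one_smul,
      map_smul, smul_smul, ← hs, mul_add, mul_one, add_comm, sgn_add]
  refine (F.opL_homologous_star h h' hα hy).symm.trans ?_
  have key := FrobeniusForm.homologous_of_one (F.commutesAt_opL hα) c (fun _ => sgn_ne_zero k _) ?_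
    h' ((F.d_eq_zero_iff _ y).1 hy)
  · simp only [Op.smul, LinearMap.smul_apply, F.opRChain_app] at key
    rw [map_smul]
    exact key
  · simp only [Op.smul, LinearMap.smul_apply]
    have e : (F.opRChain α).app (Bimod.self k A) 0 (.negSucc p) (zero_add _) (oneDN k A) =
        toDN (.negSucc p) α :=
      (F.opRChain_app α 0 _ (zero_add _) (unitD k A)).trans
        (congrArg (toDN (.negSucc p)) (F.star_unit (.negSucc p) α))
    rw [mul_zero, show sgn k 0 = 1 by simp [sgn], one_smul, e]
    exact F.opL_one_homologous hα

theorem FrobeniusForm.star_comm {r s t : ℤ} (h : r + s = t)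
    (h' : s + r = t) {x : D k A r} {y : D k A s} (hx : F.d r x = 0) (hy : F.d s y = 0) :
    F.Cohomologous (F.star r s t h x y) (sgn k (r * s) • F.star s r t h' y x) := by
  match r, s, h, h', x, y, hx, hy with
  | .negSucc p, s, h, h', α, y, hα, hy => exact F.star_comm_chain h h' hα hy
  -- The previous case with the factors exchanged, multiplied by the sign, whose square is `1`.
  | .ofNat m, .negSucc p, h, h', y, α, hy, hα =>
    have := F.star_comm_chain h' h hα hy
    have := Submodule.smul_mem (F.bd _ t) (sgn k (.ofNat m * .negSucc p)) this
    rw [mul_comm (Int.negSucc p), map_smul, smul_sub, smul_smul, sgn_mul_self, one_smul,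
      ← map_smul] at this
    exact FrobeniusForm.Homologous.symm this
  | .ofNat m, .ofNat n, h, h', f, g, hf, hg =>
    -- Between cochains, right multiplication is an operation in nonnegative degrees only; that is
    -- enough because `g` has degree `n ≥ 0`.
    have c : ∀ i : ℕ, F.CommutesAt (Op.smul (fun i => sgn k (m * i)) (opRCochain f))
        ((-1 : k) ^ m) i := by
      intro i N s' t t' hs ht h h' y
      simp only [Op.smul, LinearMap.smul_apply]
      rw [F.commutesAt_opRCochain hf i N s' t t' hs ht h h' y, one_smul,
        map_smul, smul_smul, ← hs, mul_add, mul_one, add_comm, sgn_add]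
      congr 2
      exact sgn_ofNat k m
    refine (F.opL_homologous_star h h' hf hg).symm.trans ?_
    have key := FrobeniusForm.homologous_of_one_nonneg (n := n) (ε := fun _ => (-1) ^ m)
      (fun n => F.commutesAt_opLCochain hf n) c ?_ h' ((F.d_eq_zero_iff _ g).1 hg)
    · simp only [Op.smul, LinearMap.smul_apply] at key
      rw [map_smul]
      rcases t with l | l
      · have e := cup_eq_cupR (by simp only [Int.ofNat_eq_natCast] at h'; omega : n + m = l) g f
        exact (congrArg (fun z => F.Homologous _ (sgn k (m * n) • z)) e).mpr key
      · exact absurd h (by simp only [Int.ofNat_eq_natCast]; omega)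
    · simp only [Op.smul, LinearMap.smul_apply]
      rw [mul_zero, show sgn k 0 = 1 by simp [sgn], one_smul]
      have e : (opRCochain f).app (Bimod.self k A) 0 (.ofNat m) (zero_add _) (oneDN k A) =
          toDN (.ofNat m) f := by
        obtain ⟨f, rfl⟩ : ∃ f' : Cochain k A m, f' = f := ⟨f, rfl⟩
        refine bl_hom_ext (M := A) fun l hl => ?_
        refine (cupR_bl (Bimod.self k A) (n := 0) _ f _ (List.nil_append l).symm rfl).trans ?_
        refine (congrArg (· * f (bl k m l)) (constN_bl (Bimod.self k A) (1 : A) [])).trans ?_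
        exact one_mul _
      rw [e]
      exact F.opL_one_homologous hf

end ProductLaws

/-! ### The algebra structure on cohomology -/

section AlgebraStructure

variable {k : Type u} {A : Type v} [Field k] [Ring A] [Algebra k A]
variable [FiniteDimensional k A] {F : FrobeniusForm k A}

theorem FrobeniusForm.cohomologous_iff {r : ℤ} {x y : D k A r} :
    F.Cohomologous x y ↔ x - y ∈ F.coboundaries (fun _ => ⊤) r := by
  rw [F.mem_coboundaries_iff, map_sub]
  rfl

theorem FrobeniusForm.coboundaries_mono {W W' : (r : ℤ) → Submodule k (D k A r)}
    (h : ∀ r, W r ≤ W' r) (r : ℤ) : F.coboundaries W r ≤ F.coboundaries W' r := by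
  match r with
  | .ofNat 0 => exact Submodule.map_mono (h _)
  | .ofNat (n + 1) => exact Submodule.map_mono (h _)
  | .negSucc p => exact Submodule.map_mono (h _)

/-- Every element of `W` that is a boundary of the complete complex is a boundary of `W`. -/
def FrobeniusForm.IsPure (F : FrobeniusForm k A) (W : (r : ℤ) → Submodule k (D k A r)) : Prop :=
  ∀ r, ∀ x ∈ W r, x ∈ F.coboundaries (fun _ => ⊤) r → x ∈ F.coboundaries W r

variable {W : (r : ℤ) → Submodule k (D k A r)}

/-- For a pure subcomplex the map to the full cohomology is injective, so every identity between
classes can be checked in the full complex, where the product laws are known. -/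
theorem FrobeniusForm.cls_eq_cls_iff (hW : F.IsPure W) {r : ℤ} {x y : D k A r}
    {hx : x ∈ F.cocycles W r} {hy : y ∈ F.cocycles W r} :
    F.cls W x hx = F.cls W y hy ↔ F.Cohomologous x y := by
  rw [FrobeniusForm.cls, FrobeniusForm.cls, Submodule.Quotient.eq, cohomologous_iff]
  exact ⟨fun h => F.coboundaries_mono (fun _ => le_top) r h,
    fun h => hW r _ (sub_mem hx.2 hy.2) h⟩

theorem FrobeniusForm.star_mem_cocycles (hs : F.StarRestricts W) {r s t : ℤ} (h : r + s = t)
    {x : D k A r} {y : D k A s} (hx : x ∈ F.cocycles W r) (hy : y ∈ F.cocycles W s) :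
    F.star r s t h x y ∈ F.cocycles W t :=
  ⟨F.d_star h hx.1 hy.1, hs r s t h x hx.2 y hy.2⟩

/-- The product of cocycles. -/
noncomputable def FrobeniusForm.starCocycles (hs : F.StarRestricts W) (r s t : ℤ) (h : r + s = t) :
    F.cocycles W r →ₗ[k] F.cocycles W s →ₗ[k] F.cocycles W t :=
  LinearMap.mk₂ k (fun x y => ⟨F.star r s t h x y, F.star_mem_cocycles hs h x.2 y.2⟩)
    (fun x x' y => by ext1; simp) (fun c x y => by ext1; simp)
    (fun x y y' => by ext1; simp) (fun c x y => by ext1; simp)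

theorem FrobeniusForm.cohomologous_zero_of_mem {r : ℤ} {x : D k A r}
    (h : x ∈ F.coboundaries W r) : F.Cohomologous x 0 := by
  rw [cohomologous_iff, sub_zero]
  exact F.coboundaries_mono (fun _ => le_top) r h

/-- The product of cohomology classes. -/
noncomputable def FrobeniusForm.starClasses (hW : F.IsPure W) (hs : F.StarRestricts W)
    (r s t : ℤ) (h : r + s = t) : F.HH W r →ₗ[k] F.HH W s →ₗ[k] F.HH W t :=
  Submodule.liftQ _ (Submodule.liftQ _
    ((F.starCocycles hs r s t h).compr₂ (Submodule.mkQ _)).flip (by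
      intro y hy
      ext x
      refine (F.cls_eq_cls_iff hW (hy := zero_mem _)).2 ?_
      have := F.star_cohomologous_right h x.2.1 y.2.1 (map_zero _) (F.cohomologous_zero_of_mem hy)
      rwa [map_zero] at this)).flip (by
    intro x hx
    ext y
    refine (F.cls_eq_cls_iff hW (hy := zero_mem _)).2 ?_
    have := F.star_cohomologous_left h x.2.1 (map_zero _) y.2.1 (F.cohomologous_zero_of_mem hx)
    rwa [map_zero, LinearMap.zero_apply] at this)

theorem FrobeniusForm.starClasses_cls (hW : F.IsPure W) (hs : F.StarRestricts W)
    (r s t : ℤ) (h : r + s = t) {x : D k A r} {y : D k A s} (hx : x ∈ F.cocycles W r)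
    (hy : y ∈ F.cocycles W s) :
    F.starClasses hW hs r s t h (F.cls W x hx) (F.cls W y hy) =
      F.cls W (F.star r s t h x y) (F.star_mem_cocycles hs h hx hy) := rfl

theorem FrobeniusForm.exists_cls {r : ℤ} (z : F.HH W r) :
    ∃ (x : D k A r) (hx : x ∈ F.cocycles W r), F.cls W x hx = z := by
  obtain ⟨⟨x, hx⟩, rfl⟩ := Submodule.Quotient.mk_surjective _ z
  exact ⟨x, hx, rfl⟩

theorem FrobeniusForm.unitD_mem_cocycles (h1 : unitD k A ∈ W 0) : unitD k A ∈ F.cocycles W 0 :=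
  ⟨F.d_unitD, h1⟩

/-- The algebra structure on the cohomology of `W`. -/
noncomputable def FrobeniusForm.starAlgebra (hW : F.IsPure W) (hs : F.StarRestricts W)
    (h1 : unitD k A ∈ W 0) : GradedCommAlgebra k (F.HH W) where
  mul := F.starClasses hW hs
  one := F.cls W (unitD k A) (F.unitD_mem_cocycles h1)
  one_mul r z := by
    obtain ⟨x, hx, rfl⟩ := F.exists_cls z
    rw [F.starClasses_cls, F.cls_eq_cls_iff hW, F.star_unit]
    exact FrobeniusForm.Homologous.rfl
  mul_one r z := by
    obtain ⟨x, hx, rfl⟩ := F.exists_cls z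
    rw [F.starClasses_cls, F.cls_eq_cls_iff hW]
    have := F.star_comm (add_zero r) (zero_add r) hx.1 F.d_unitD
    rwa [F.star_unit, mul_zero, show sgn k 0 = 1 by simp [sgn], one_smul] at this
  mul_assoc r s t rs st rst h₁ h₂ h₃ h₄ x y z := by
    obtain ⟨x, hx, rfl⟩ := F.exists_cls x
    obtain ⟨y, hy, rfl⟩ := F.exists_cls y
    obtain ⟨z, hz, rfl⟩ := F.exists_cls z
    rw [F.starClasses_cls, F.starClasses_cls, F.starClasses_cls, F.starClasses_cls,
      F.cls_eq_cls_iff hW]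
    exact F.star_assoc h₁ h₂ h₃ h₄ hx.1 hy.1 hz.1
  mul_comm r s t h h' x y := by
    obtain ⟨x, hx, rfl⟩ := F.exists_cls x
    obtain ⟨y, hy, rfl⟩ := F.exists_cls y
    rw [F.starClasses_cls, F.starClasses_cls, negOnePow_smul (k := k)]
    exact (F.cls_eq_cls_iff hW (hy := Submodule.smul_mem _ _ (F.star_mem_cocycles hs h' hy hx))).2
      (F.star_comm h h' hx.1 hy.1)

theorem FrobeniusForm.isStarAlgebra_starAlgebra (hW : F.IsPure W) (hs : F.StarRestricts W)
    (h1 : unitD k A ∈ W 0) : F.IsStarAlgebra W (F.starAlgebra hW hs h1) :=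
  ⟨⟨F.unitD_mem_cocycles h1, rfl⟩, fun _ _ _ h _ hx _ hy => ⟨F.star_mem_cocycles hs h hx hy, rfl⟩⟩

/-- The map on cohomology induced by the inclusion of `W` into the complete complex. -/
noncomputable def FrobeniusForm.inclusionHH (F : FrobeniusForm k A)
    (W : (r : ℤ) → Submodule k (D k A r)) (r : ℤ) :
    F.HH W r →ₗ[k] F.HH (fun _ => ⊤) r :=
  Submodule.mapQ _ _ (Submodule.inclusion (inf_le_inf_left _ le_top))
    fun _ hx => F.coboundaries_mono (fun _ => le_top) r hx

theorem FrobeniusForm.isPure_top : F.IsPure (fun _ => ⊤) := fun _ _ _ h => h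

theorem FrobeniusForm.bijective_inclusionHH (hW : F.IsPure W)
    (hsurj : ∀ r x, F.d r x = 0 → ∃ y ∈ F.cocycles W r, F.Cohomologous y x) (r : ℤ) :
    Function.Bijective (F.inclusionHH W r) := by
  constructor
  · intro x y hxy
    obtain ⟨x, hx, rfl⟩ := F.exists_cls x
    obtain ⟨y, hy, rfl⟩ := F.exists_cls y
    exact (F.cls_eq_cls_iff hW).2 ((F.cls_eq_cls_iff F.isPure_top (hx := ⟨hx.1, Submodule.mem_top⟩)
      (hy := ⟨hy.1, Submodule.mem_top⟩)).1 hxy)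
  · intro z
    obtain ⟨x, hx, rfl⟩ := F.exists_cls z
    obtain ⟨y, hy, h⟩ := hsurj r x hx.1
    exact ⟨F.cls W y hy, (F.cls_eq_cls_iff F.isPure_top (hx := ⟨hy.1, Submodule.mem_top⟩)).2 h⟩

theorem FrobeniusForm.nonempty_iso (hW : F.IsPure W)
    (hsurj : ∀ r x, F.d r x = 0 → ∃ y ∈ F.cocycles W r, F.Cohomologous y x)
    {S₁ : GradedCommAlgebra k (F.HH W)} {S : GradedCommAlgebra k (F.HH fun _ => ⊤)}
    (h₁ : F.IsStarAlgebra W S₁) (h : F.IsStarAlgebra (fun _ => ⊤) S) : Nonempty (S₁.Iso S) := by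
  refine ⟨⟨fun r => LinearEquiv.ofBijective _ (F.bijective_inclusionHH hW hsurj r), ?_, ?_⟩⟩
  · obtain ⟨⟨e₁, h₁⟩, -⟩ := h₁
    obtain ⟨⟨e, h⟩, -⟩ := h
    rw [h₁, h]
    rfl
  · intro r s t e x y
    obtain ⟨x, hx, rfl⟩ := F.exists_cls x
    obtain ⟨y, hy, rfl⟩ := F.exists_cls y
    obtain ⟨e₁, h₁⟩ := h₁.2 r s t e x hx y hy
    obtain ⟨e₂, h₂⟩ := h.2 r s t e x ⟨hx.1, Submodule.mem_top⟩ y ⟨hy.1, Submodule.mem_top⟩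
    rw [h₁]
    exact h₂.symm

end AlgebraStructure

/-! ### The action of the Nakayama automorphism -/

section Pairing

variable {k : Type u} {A : Type v} [Field k] [Ring A] [Algebra k A]

/-- The action of an automorphism on cochains. -/
noncomputable def cochainMap (σ : A ≃ₐ[k] A) (n : ℕ) : Cochain k A n →ₗ[k] Cochain k A n :=
  LinearMap.llcomp k _ _ _ σ.toLinearMap ∘ₗ LinearMap.lcomp k A (powMap σ.symm n)

@[simp] theorem cochainMap_bl (σ : A ≃ₐ[k] A) (n : ℕ) (f : Cochain k A n) (l : List A) :
    cochainMap σ n f (bl k n l) = σ (f (bl k n (l.map σ.symm))) := by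
  simp [cochainMap]

theorem cochainMap_bl_map (σ : A ≃ₐ[k] A) (n : ℕ) (f : Cochain k A n) (l : List A) :
    cochainMap σ n f (bl k n (l.map σ)) = σ (f (bl k n l)) := by
  simp [Function.comp_def]

theorem deltaA_cochainMap (σ : A ≃ₐ[k] A) {n n' : ℕ} (h : n + 1 = n') (f : Cochain k A n) :
    deltaA h (cochainMap σ n f) = cochainMap σ n' (deltaA h f) := by
  refine bl_hom_ext fun l hl => ?_
  obtain ⟨a, t, rfl⟩ := List.exists_cons_of_length_eq_add_one (hl.trans h.symm)
  obtain ⟨i, z, e, hi⟩ := exists_last a t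
  have e' : (a :: t).map σ.symm = i.map σ.symm ++ [σ.symm z] := by rw [e]; simp
  rw [cochainMap_bl, deltaA_bl h _ rfl e (by simp at hl; omega),
    deltaA_bl h f (List.map_cons ..) e' (by simp at hl ⊢; omega), mid_map σ.symm]
  simp only [cochainMap_bl, map_add, map_smul, map_mul, AlgEquiv.apply_symm_apply, map_mid]

variable [FiniteDimensional k A] (F : FrobeniusForm k A)

theorem FrobeniusForm.form_nakayama_nakayama (a b : A) :
    F.form (F.nakayama a) (F.nakayama b) = F.form a b := by
  rw [F.form_nakayama a b, F.form_nakayama b]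

/-- The pairing of cochains and chains. -/
noncomputable def FrobeniusForm.pair (p : ℕ) : Cochain k A p →ₗ[k] Chain k A p →ₗ[k] k :=
  LinearMap.flip (TensorProduct.lift
    (LinearMap.mk₂ k (fun a x => F.form.flip a ∘ₗ LinearMap.applyₗ x)
      (fun a a' x => by ext; simp) (fun c a x => by ext; simp)
      (fun a x x' => by ext; simp) (fun c a x => by ext; simp)))

omit [FiniteDimensional k A] in
theorem FrobeniusForm.pair_tmul {p : ℕ} (f : Cochain k A p) (a : A) (x : BarPow k A p) :
    F.pair p f (a ⊗ₜ x) = F.form (f x) a := by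
  simp [FrobeniusForm.pair]

omit [FiniteDimensional k A] in
theorem FrobeniusForm.pair_injective (p : ℕ) : Function.Injective (F.pair p) := by
  intro f g h
  refine LinearMap.ext fun x => ?_
  rw [← sub_eq_zero]
  refine F.nondegenerate.1 _ fun a => ?_
  have := LinearMap.congr_fun h (a ⊗ₜ x)
  rw [F.pair_tmul, F.pair_tmul] at this
  rw [map_sub, LinearMap.sub_apply, this, sub_self]

theorem FrobeniusForm.pair_surjective (p : ℕ) : Function.Surjective (F.pair p) := by
  intro φ
  refine ⟨(F.form.toDual F.nondegenerate).symm.toLinearMap ∘ₗ (TensorProduct.curry φ).flip,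
    TensorProduct.ext' fun a x => ?_⟩
  rw [F.pair_tmul, LinearMap.comp_apply]
  exact LinearMap.BilinForm.apply_toDual_symm_apply (hB := F.nondegenerate) _ a

/-- Since `⟨a f, m⟩ = ⟨f, m ν(a)⟩`, the coboundary is the transpose of the boundary twisted by `ν`,
not by `ν⁻¹`. Connes' operator is therefore used below for `ν⁻¹`. -/
theorem FrobeniusForm.pair_deltaA {p p' : ℕ} (h : p + 1 = p') (f : Cochain k A p)
    (α : Chain k A p') : F.pair p' (deltaA h f) α = F.pair p f (partA F.nakayama h α) := by
  suffices H : F.pair p' (deltaA h f) = F.pair p f ∘ₗ partA F.nakayama h from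
    LinearMap.congr_fun H α
  refine chain_hom_ext fun m l hl => ?_
  obtain ⟨a, t, rfl⟩ := List.exists_cons_of_length_eq_add_one (hl.trans h.symm)
  obtain ⟨i, z, e, hi⟩ := exists_last a t
  have ht : t.length = p := by simp at hl; omega
  rw [LinearMap.comp_apply, F.pair_tmul, deltaA_bl h f rfl e ht, partA_bl F.nakayama h m rfl e ht]
  have hm : mid (fun w => F.form (f (bl k p w))) (a :: t) m =
      mid (fun w => F.form (f (bl k p w)) m) (a :: t) := map_mid (LinearMap.applyₗ m) _ _
  simp only [map_add, map_smul, LinearMap.add_apply, LinearMap.smul_apply, map_mid, F.pair_tmul, hm]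
  rw [F.assoc a, F.form_nakayama a, F.assoc, F.assoc]

theorem FrobeniusForm.pair_cochainMap {p : ℕ} (f : Cochain k A p) (α : Chain k A p) :
    F.pair p (cochainMap F.nakayama p f) α = F.pair p f (chainMap F.nakayama.symm p α) := by
  suffices H : F.pair p (cochainMap F.nakayama p f) = F.pair p f ∘ₗ chainMap F.nakayama.symm p from
    LinearMap.congr_fun H α
  refine chain_hom_ext fun m l hl => ?_
  rw [LinearMap.comp_apply, F.pair_tmul, chainMap_bl, F.pair_tmul, cochainMap_bl,
    ← F.form_nakayama_nakayama (f _), AlgEquiv.apply_symm_apply]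

/-- In length `0` the term `B∂` is absent, so `1 - ν⁻¹` takes values in boundaries. A cocycle pairs
to zero with these, and the pairing is nondegenerate. -/
theorem FrobeniusForm.cochainMap_zero_of_cocycle {f : Cochain k A 0} (hf : deltaA rfl f = 0) :
    cochainMap F.nakayama 0 f = f := by
  refine F.pair_injective 0 (LinearMap.ext fun α => ?_)
  have := congrArg (F.pair 0 f) (partA_connes_zero F.nakayama.symm α)
  rw [AlgEquiv.symm_symm, ← F.pair_deltaA rfl, hf, map_zero, LinearMap.zero_apply, map_sub] at this
  rw [F.pair_cochainMap]
  exact (sub_eq_zero.1 this.symm).symm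

/-- The cochain `g` is the transpose of Connes' operator for `ν⁻¹` applied to `f`; the other half of
the homotopy formula pairs to zero because `f` is a cocycle. -/
theorem FrobeniusForm.exists_deltaA_eq_sub_cochainMap {p : ℕ} {f : Cochain k A (p + 1)}
    (hf : deltaA rfl f = 0) :
    ∃ g : Cochain k A p, deltaA rfl g = f - cochainMap F.nakayama (p + 1) f := by
  obtain ⟨g, hg⟩ := F.pair_surjective p (F.pair _ f ∘ₗ connes F.nakayama.symm p)
  refine ⟨g, F.pair_injective _ (LinearMap.ext fun α => ?_)⟩
  have := congrArg (F.pair _ f) (partA_connes F.nakayama.symm α)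
  rw [AlgEquiv.symm_symm, map_add, ← F.pair_deltaA rfl, hf, map_zero, LinearMap.zero_apply,
    zero_add, map_sub] at this
  rw [F.pair_deltaA, hg, LinearMap.comp_apply, this, map_sub, LinearMap.sub_apply,
    F.pair_cochainMap]

/-- The action of the Nakayama automorphism on the complete complex. -/
noncomputable def FrobeniusForm.tau : (r : ℤ) → D k A r →ₗ[k] D k A r
  | .ofNat n => (cochainMap F.nakayama n : Cochain k A n →ₗ[k] Cochain k A n)
  | .negSucc p => (chainMap F.nakayama p : Chain k A p →ₗ[k] Chain k A p)

theorem FrobeniusForm.tau_cohomologous {r : ℤ} {x : D k A r} (hx : F.d r x = 0) :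
    F.Cohomologous (F.tau r x) x := by
  match r, x, hx with
  | .negSucc p, x, hx => exact F.homologous_tw (.negSucc p) x hx
  | .ofNat 0, x, hx =>
    exact (congrArg (F.Homologous (toDN (.ofNat 0) (F.tau (.ofNat 0) x)))
      (F.cochainMap_zero_of_cocycle hx)).mp FrobeniusForm.Homologous.rfl
  | .ofNat (p + 1), x, hx =>
    obtain ⟨g, hg⟩ := F.exists_deltaA_eq_sub_cochainMap hx
    exact FrobeniusForm.Homologous.symm ((F.mem_bd (s := .ofNat p) (t := .ofNat (p + 1)) rfl).2
      ⟨g, hg⟩)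

/-- Two applications of the swap. This invariance is the reason why the formulas for `⋆` that
contain dual bases commute with `ν`. -/
theorem FrobeniusForm.casimir_nakayama {M : Type*} [AddCommGroup M] [Module k M]
    (β : A →ₗ[k] A →ₗ[k] M) :
    ∑ i, β (F.nakayama (F.u i)) (F.nakayama (F.v i)) = ∑ i, β (F.u i) (F.v i) := by
  have h := F.casimir_swap (β.flip.compl₂ F.nakayama.toLinearMap)
  simp only [LinearMap.compl₂_apply, LinearMap.flip_apply, AlgEquiv.toLinearMap_apply] at h
  rw [h, F.casimir_swap]

theorem FrobeniusForm.cochainMap_normA (α : Chain k A 0) :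
    cochainMap F.nakayama 0 (F.normA α) = F.normA α := by
  obtain ⟨a, rfl⟩ := chain_zero_exists α
  refine coch_zero_ext (N := Bimod.self k A) ?_
  rw [cochainMap_bl, F.normA_bl, F.normA_bl, map_sum]
  simp only [map_mul]
  refine (F.casimir_nakayama ((LinearMap.mul k A).compl₂
    (LinearMap.mulLeft k (F.nakayama a)))).trans ?_
  have := congrArg (fun f => f (bl k 0 [])) (F.normA_chainMap (a ⊗ₜ bl k 0 []))
  rw [chainMap_bl] at this
  rwa [F.normA_bl, F.normA_bl] at this

theorem FrobeniusForm.d_tau (r : ℤ) (x : D k A r) :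
    F.d r (F.tau r x) = F.tau (r + 1) (F.d r x) := by
  match r, x with
  | .ofNat n, f => exact deltaA_cochainMap F.nakayama rfl f
  | .negSucc 0, (α : Chain k A 0) =>
    change F.normMap (chainMap _ 0 α) = cochainMap _ 0 (F.normMap α)
    rw [F.normMap_eq_normA, F.normMap_eq_normA, F.normA_chainMap, F.cochainMap_normA]
  | .negSucc (p + 1), (α : Chain k A (p + 1)) =>
    change partialMap _ p (chainMap _ _ α) = chainMap _ p (partialMap _ p α)
    rw [partialMap_eq_partA, partialMap_eq_partA, partA_chainMap _ _ (by simp)]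

omit [FiniteDimensional k A] in
theorem cup_cochainMap (σ : A ≃ₐ[k] A) {m n t : ℕ} (h : m + n = t) (f : Cochain k A m)
    (g : Cochain k A n) :
    cup h (cochainMap σ m f) (cochainMap σ n g) = cochainMap σ t (cup h f g) := by
  refine bl_hom_ext fun l hl => ?_
  obtain ⟨l₁, l₂, rfl, h₁, h₂⟩ := exists_split (hl.trans h.symm)
  rw [cochainMap_bl, cup_eq_cupL, cup_eq_cupL, cupL_bl _ h _ _ rfl h₁,
    cupL_bl (Bimod.self k A) h f g List.map_append (by simpa using h₁)]
  simp

omit [FiniteDimensional k A] in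
theorem capLeft_cochainMap (σ : A ≃ₐ[k] A) {m p q : ℕ} (h : q + m = p) (f : Cochain k A m)
    (α : Chain k A p) :
    capLeft h (cochainMap σ m f) (chainMap σ p α) = chainMap σ q (capLeft h f α) := by
  suffices H : capLeft h (cochainMap σ m f) ∘ₗ chainMap σ p = chainMap σ q ∘ₗ capLeft h f from
    LinearMap.congr_fun H α
  refine chain_hom_ext fun a l hl => ?_
  obtain ⟨l₁, l₂, rfl, h₁, h₂⟩ := exists_split (hl.trans h.symm)
  simp only [LinearMap.comp_apply, chainMap_bl, capLeft_eq_capL]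
  rw [capL_bl _ h _ _ List.map_append (by simpa using h₁), capL_bl (Bimod.self k A) h f a rfl h₁, chainMap_bl,
    cochainMap_bl_map]
  simp

omit [FiniteDimensional k A] in
theorem capRight_cochainMap (σ : A ≃ₐ[k] A) {m p q : ℕ} (h : m + q = p) (f : Cochain k A m)
    (α : Chain k A p) :
    capRight σ.symm h (chainMap σ p α) (cochainMap σ m f) =
      chainMap σ q (capRight σ.symm h α f) := by
  suffices H : (capRight σ.symm h).flip (cochainMap σ m f) ∘ₗ chainMap σ p =
      chainMap σ q ∘ₗ (capRight σ.symm h).flip f from LinearMap.congr_fun H α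
  refine chain_hom_ext fun a l hl => ?_
  obtain ⟨l₁, l₂, rfl, h₁, h₂⟩ := exists_split (hl.trans h.symm)
  have h₁' : (l₁.map σ).length = m := by simpa using h₁
  simp [capRight, split_bl h h₁, split_bl h h₁', Function.comp_def]

theorem FrobeniusForm.evalLeft_cochainMap {n p m : ℕ} (h : n + (p + 1) = m) (f : Cochain k A m)
    (α : Chain k A p) :
    F.evalLeft h (cochainMap F.nakayama m f) (chainMap F.nakayama p α) =
      cochainMap F.nakayama n (F.evalLeft h f α) := by
  suffices H : F.evalLeft h (cochainMap F.nakayama m f) ∘ₗ chainMap F.nakayama p =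
      cochainMap F.nakayama n ∘ₗ F.evalLeft h f from LinearMap.congr_fun H α
  refine chain_hom_ext fun a l hl => bl_hom_ext fun b hb => ?_
  have hb' : (b.map F.nakayama.symm).length = n := by simpa using hb
  rw [LinearMap.comp_apply, LinearMap.comp_apply, cochainMap_bl, chainMap_bl, F.evalLeft_eq_evR,
    F.evalLeft_eq_evR, F.evR_bl _ h _ _ _ b hb, F.evR_bl _ h _ _ _ _ hb', map_sum]
  have c := F.casimir_nakayama ((LinearMap.mul k A) ∘ₗ F.nakayama.toLinearMap ∘ₗ f ∘ₗ
    slot k (b.map F.nakayama.symm) l (by omega) ∘ₗ LinearMap.mulRight k (F.nakayama a) ∘ₗ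
      F.nakayama.symm.toLinearMap)
  simp only [LinearMap.comp_apply, AlgEquiv.toLinearMap_apply, slot_apply, LinearMap.mulRight_apply,
    AlgEquiv.symm_apply_apply, LinearMap.mul_apply'] at c
  simp only [cochainMap_bl, LinearMap.flip_apply, LinearMap.mul_apply', map_mul]
  rw [c]
  simp [Function.comp_def]

theorem FrobeniusForm.evalRight_cochainMap {n p m : ℕ} (h : p + (n + 1) = m) (f : Cochain k A m)
    (α : Chain k A p) :
    F.evalRight h (chainMap F.nakayama p α) (cochainMap F.nakayama m f) =
      cochainMap F.nakayama n (F.evalRight h α f) := by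
  suffices H : (F.evalRight h).flip (cochainMap F.nakayama m f) ∘ₗ chainMap F.nakayama p =
      cochainMap F.nakayama n ∘ₗ (F.evalRight h).flip f from LinearMap.congr_fun H α
  refine chain_hom_ext fun a l hl => bl_hom_ext fun b hb => ?_
  simp only [LinearMap.comp_apply, LinearMap.flip_apply, cochainMap_bl, chainMap_bl,
    F.evalRight_eq_evA]
  rw [F.evA_bl _ h _ _ _ b (by simpa using hl), F.evA_bl _ h _ _ _ _ hl, map_sum]
  have c := F.casimir_nakayama ((LinearMap.mul k A).compl₂
    (LinearMap.mulLeft k (F.nakayama (F.nakayama a)) ∘ₗ F.nakayama.toLinearMap ∘ₗ f ∘ₗ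
      slot k l (b.map F.nakayama.symm) (by omega) ∘ₗ F.nakayama.symm.toLinearMap))
  simp only [LinearMap.comp_apply, AlgEquiv.toLinearMap_apply, slot_apply, LinearMap.mulLeft_apply,
    AlgEquiv.symm_apply_apply, LinearMap.compl₂_apply, LinearMap.mul_apply'] at c
  simp only [cochainMap_bl, LinearMap.mul_apply', map_mul, mul_assoc]
  rw [c]
  simp [Function.comp_def]

theorem FrobeniusForm.chainMul_chainMap {p q t : ℕ} (h : q + (p + 1) = t) (α : Chain k A p)
    (β : Chain k A q) :
    F.chainMul h (chainMap F.nakayama p α) (chainMap F.nakayama q β) =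
      chainMap F.nakayama t (F.chainMul h α β) := by
  suffices H : (F.chainMul h).compl₁₂ (chainMap F.nakayama p) (chainMap F.nakayama q) =
      (F.chainMul h).compr₂ (chainMap F.nakayama t) from
    LinearMap.congr_fun (LinearMap.congr_fun H α) β
  refine chain_hom_ext fun a l hl => chain_hom_ext fun b w hw => ?_
  simp only [LinearMap.compl₁₂_apply, LinearMap.compr₂_apply, chainMap_bl, F.chainMul_eq_mulA]
  rw [F.mulA_bl _ h _ _ _ _ (by simpa using hw), F.mulA_bl _ h _ _ _ _ hw, map_sum]
  have c := F.casimir_nakayama (((TensorProduct.mk k A (BarPow k A t)) ∘ₗ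
    LinearMap.mulRight k (F.nakayama b)).flip ∘ₗ
      slot k (w.map F.nakayama) (l.map F.nakayama) (by simp; omega) ∘ₗ
        LinearMap.mulRight k (F.nakayama (F.nakayama a)))
  simp only [LinearMap.comp_apply, LinearMap.flip_apply, slot_apply, LinearMap.mulRight_apply,
    TensorProduct.mk_apply] at c
  simp only [chainMap_bl, LinearMap.mul_apply', map_mul, List.map_append, List.map_cons]
  exact c.symm

theorem FrobeniusForm.star_tau (r s t : ℤ) (h : r + s = t) (x : D k A r) (y : D k A s) :
    F.star r s t h (F.tau r x) (F.tau s y) = F.tau t (F.star r s t h x y) := by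
  match r, s, t, h, x, y with
  | .ofNat m, .ofNat n, .ofNat l, h, f, g => exact cup_cochainMap F.nakayama _ f g
  | .ofNat m, .negSucc p, .negSucc q, h, f, α => exact capLeft_cochainMap F.nakayama _ f α
  | .ofNat m, .negSucc p, .ofNat n, h, f, α => exact F.evalLeft_cochainMap _ f α
  | .negSucc p, .ofNat m, .negSucc q, h, α, f => exact capRight_cochainMap F.nakayama _ f α
  | .negSucc p, .ofNat m, .ofNat n, h, α, f => exact F.evalRight_cochainMap _ f α
  | .negSucc p, .negSucc q, .negSucc l, h, α, β => exact F.chainMul_chainMap _ α β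
  | .ofNat m, .ofNat n, .negSucc l, h, _, _ =>
    exact absurd h (by simp only [Int.ofNat_eq_natCast]; omega)
  | .negSucc p, .negSucc q, .ofNat l, h, _, _ =>
    exact absurd h (by simp only [Int.ofNat_eq_natCast]; omega)

end Pairing

/-! ### Diagonalizable Nakayama automorphisms -/

section Diagonalizable

variable {k : Type u} {A : Type v} [Field k] [Ring A] [Algebra k A] 

theorem powMap_barTensor (σ : A ≃ₐ[k] A) {r : ℕ} (a : Fin r → A) :
    powMap σ r (barTensor k A a) = barTensor k A (fun i => σ (a i)) := by
  rw [barTensor_eq_bl, powMap_bl, barTensor_eq_bl, List.map_ofFn]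
  rfl

theorem barTensor_smul {r : ℕ} (e : Fin r → k) (a : Fin r → A) :
    barTensor k A (fun i => e i • a i) = (∏ i, e i) • barTensor k A a :=
  (barTensorMulti r).map_smul_univ e a

variable [FiniteDimensional k A] {F : FrobeniusForm k A}

theorem FrobeniusForm.NakayamaDiagonalizable.span_eq_top (hν : F.NakayamaDiagonalizable) :
    Submodule.span k {a : A | ∃ c, a ∈ F.eigen c} = ⊤ := by
  rw [eq_top_iff, ← hν, iSup_le_iff]
  exact fun c a ha => Submodule.subset_span ⟨c, ha⟩

variable {M : Type*} [AddCommGroup M] [Module k M]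

theorem FrobeniusForm.NakayamaDiagonalizable.barPow_hom_ext (hν : F.NakayamaDiagonalizable) {r : ℕ}
    {f g : BarPow k A r →ₗ[k] M} (h : ∀ (e : Fin r → k) (a : Fin r → A),
      (∀ i, a i ∈ F.eigen (e i)) → f (barTensor k A a) = g (barTensor k A a)) : f = g := by
  have key : f.compMultilinearMap (barTensorMulti r) = g.compMultilinearMap (barTensorMulti r) := by
    refine MultilinearMap.ext_of_span_eq_top (γ := fun _ => {a : A | ∃ c, a ∈ F.eigen c})
      (g := fun {_} a => (a : A)) (fun _ => ?_) fun a => ?_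
    · rw [Subtype.range_coe, hν.span_eq_top]
    · choose e he using fun i => (a i).2
      exact h e _ he
  exact FrobTate.barPow_hom_ext fun a => congrArg (fun m => m a) key

theorem FrobeniusForm.NakayamaDiagonalizable.chain_hom_ext (hν : F.NakayamaDiagonalizable) {p : ℕ}
    {f g : Chain k A p →ₗ[k] M} (h : ∀ (e₀ : k) (e : Fin p → k) (a₀ : A) (a : Fin p → A),
      a₀ ∈ F.eigen e₀ → (∀ i, a i ∈ F.eigen (e i)) →
        f (a₀ ⊗ₜ barTensor k A a) = g (a₀ ⊗ₜ barTensor k A a)) : f = g := by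
  refine TensorProduct.ext (LinearMap.ext_on hν.span_eq_top ?_)
  rintro a₀ ⟨e₀, h₀⟩
  exact hν.barPow_hom_ext fun e a ha => h e₀ e a₀ a h₀ ha

theorem FrobeniusForm.nakayama_of_mem_eigen {c : k} {a : A} (h : a ∈ F.eigen c) :
    F.nakayama a = c • a := Module.End.mem_eigenspace_iff.1 h

theorem FrobeniusForm.powMap_nakayama_barTensor {r : ℕ} {e : Fin r → k} {a : Fin r → A}
    (h : ∀ i, a i ∈ F.eigen (e i)) :
    powMap F.nakayama r (barTensor k A a) = (∏ i, e i) • barTensor k A a := by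
  rw [powMap_barTensor, ← barTensor_smul]
  congr 1
  ext i
  exact F.nakayama_of_mem_eigen (h i)

theorem FrobeniusForm.chainMap_nakayama_barTensor {p : ℕ} {e₀ : k} {e : Fin p → k} {a₀ : A}
    {a : Fin p → A} (h₀ : a₀ ∈ F.eigen e₀) (h : ∀ i, a i ∈ F.eigen (e i)) :
    chainMap F.nakayama p (a₀ ⊗ₜ barTensor k A a) = (e₀ * ∏ i, e i) • a₀ ⊗ₜ barTensor k A a := by
  rw [chainMap, TensorProduct.map_tmul, F.powMap_nakayama_barTensor h,
    AlgEquiv.toLinearMap_apply, F.nakayama_of_mem_eigen h₀, TensorProduct.smul_tmul_smul]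

theorem FrobeniusForm.tau_of_mem_eigenD_one {r : ℤ} {x : D k A r} (hν : F.NakayamaDiagonalizable)
    (h : x ∈ F.eigenD 1 r) : F.tau r x = x := by
  match r, x, h with
  | .ofNat n, (f : Cochain k A n), h =>
    have h : ∀ (e : Fin n → k) (a : Fin n → A), (∀ i, a i ∈ F.eigen (e i)) →
          f (barTensor k A a) ∈ F.eigen (1 * ∏ i, e i) := h
    have key : F.nakayama.toLinearMap ∘ₗ f = f ∘ₗ powMap F.nakayama n :=
      hν.barPow_hom_ext fun e a ha => by
        have := F.nakayama_of_mem_eigen (h e a ha)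
        rw [LinearMap.comp_apply, LinearMap.comp_apply, F.powMap_nakayama_barTensor ha, map_smul]
        rwa [one_mul] at this
    refine bl_hom_ext (M := A) fun l hl => ?_
    have := LinearMap.congr_fun key (bl k n (l.map F.nakayama.symm))
    rw [LinearMap.comp_apply, LinearMap.comp_apply, powMap_bl] at this
    refine (cochainMap_bl F.nakayama n f l).trans (this.trans ?_)
    simp [Function.comp_def]
  | .negSucc p, (α : Chain k A p), h =>
    change chainMap F.nakayama p α = α
    have h : α ∈ Submodule.span k {x | ∃ (e₀ : k) (e : Fin p → k) (a₀ : A) (a : Fin p → A),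
        e₀ * ∏ i, e i = 1 ∧ a₀ ∈ F.eigen e₀ ∧ (∀ i, a i ∈ F.eigen (e i)) ∧
        x = a₀ ⊗ₜ barTensor k A a} := h
    refine LinearMap.eqOn_span (g := LinearMap.id) ?_ h
    rintro _ ⟨e₀, e, a₀, a, he, h₀, ha, rfl⟩
    rw [F.chainMap_nakayama_barTensor h₀ ha, he, one_smul]
    rfl

theorem FrobeniusForm.mem_eigenD_one_cochain {n : ℕ} {f : Cochain k A n}
    (h : cochainMap F.nakayama n f = f) : (f : D k A (.ofNat n)) ∈ F.eigenD 1 (.ofNat n) := by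
  change ∀ (e : Fin n → k) (a : Fin n → A), (∀ i, a i ∈ F.eigen (e i)) →
          f (barTensor k A a) ∈ F.eigen (1 * ∏ i, e i)
  intro e a ha
  rw [one_mul, Module.End.mem_eigenspace_iff, ← map_smul, ← F.powMap_nakayama_barTensor ha,
    barTensor_eq_bl, powMap_bl]
  conv_rhs => rw [← h]
  exact (cochainMap_bl_map _ _ _ _).symm

/-- Tensors of eigenvectors span the chains. One of eigenvalue `c ≠ 1` is `ν - 1` applied to its
multiple by `(c - 1)⁻¹`; one of eigenvalue `1` lies in the subcomplex. The sum `P` of both subspaces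
is everything because its quotient map vanishes on such tensors. -/
theorem FrobeniusForm.exists_eigenD_add_chain (hν : F.NakayamaDiagonalizable) (p : ℕ)
    (α : Chain k A p) : ∃ y : Chain k A p, (y : D k A (.negSucc p)) ∈ F.eigenD 1 (.negSucc p) ∧
      ∃ z, α = y + (chainMap F.nakayama p z - z) := by
  set E : Submodule k (Chain k A p) := Submodule.span k
    {x | ∃ (e₀ : k) (e : Fin p → k) (a₀ : A) (a : Fin p → A),
        e₀ * ∏ i, e i = 1 ∧ a₀ ∈ F.eigen e₀ ∧ (∀ i, a i ∈ F.eigen (e i)) ∧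
        x = a₀ ⊗ₜ barTensor k A a}
  set P := E ⊔ LinearMap.range (chainMap F.nakayama p - LinearMap.id)
  have key : P.mkQ = 0 := hν.chain_hom_ext fun e₀ e a₀ a h₀ ha => by
    rw [Submodule.mkQ_apply, LinearMap.zero_apply, Submodule.Quotient.mk_eq_zero]
    by_cases he : e₀ * ∏ i, e i = 1
    · exact Submodule.mem_sup_left (Submodule.subset_span ⟨e₀, e, a₀, a, he, h₀, ha, rfl⟩)
    · refine Submodule.mem_sup_right ⟨(e₀ * ∏ i, e i - 1)⁻¹ • a₀ ⊗ₜ barTensor k A a, ?_⟩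
      rw [map_smul, LinearMap.sub_apply, F.chainMap_nakayama_barTensor h₀ ha, LinearMap.id_apply,
        ← one_smul k (_ ⊗ₜ _), smul_smul, mul_one, ← sub_smul, smul_smul, inv_mul_cancel₀ (sub_ne_zero.2 he), one_smul]
  have hα : α ∈ P := by rw [← P.ker_mkQ, key, LinearMap.ker_zero]; exact Submodule.mem_top
  obtain ⟨y, hy, _, ⟨z, rfl⟩, rfl⟩ := Submodule.mem_sup.1 hα
  exact ⟨y, hy, z, rfl⟩

/-- Rank and nullity add up to the dimension, so kernel and range span the space exactly when they
meet trivially. For chains spanning is the easy half, for cochains it is disjointness. -/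
theorem disjoint_ker_range_iff {V : Type*} [AddCommGroup V] [Module k V] [FiniteDimensional k V]
    (T : V →ₗ[k] V) :
    Disjoint (LinearMap.ker T) (LinearMap.range T) ↔
      Codisjoint (LinearMap.ker T) (LinearMap.range T) := by
  have h := T.finrank_range_add_finrank_ker
  have h' := Submodule.finrank_sup_add_finrank_inf_eq (LinearMap.ker T) (LinearMap.range T)
  rw [disjoint_iff, codisjoint_iff]
  constructor <;> intro e <;> rw [e] at h'
  · rw [finrank_bot] at h'
    exact Submodule.eq_top_of_finrank_eq (by omega)
  · rw [finrank_top] at h'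
    exact Submodule.finrank_eq_zero.1 (by omega)

theorem FrobeniusForm.chainMap_nakayama_of_range (hν : F.NakayamaDiagonalizable) {p : ℕ}
    {z : Chain k A p} (h : chainMap F.nakayama p (chainMap F.nakayama p z - z) =
      chainMap F.nakayama p z - z) : chainMap F.nakayama p z - z = 0 := by
  have hd := (disjoint_ker_range_iff (chainMap F.nakayama p - LinearMap.id)).2 <| by
    rw [codisjoint_iff, eq_top_iff]
    rintro α -
    obtain ⟨y, hy, z, rfl⟩ := F.exists_eigenD_add_chain hν p α
    refine Submodule.add_mem_sup (LinearMap.mem_ker.2 (sub_eq_zero.2 ?_)) ⟨z, rfl⟩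
    exact F.tau_of_mem_eigenD_one hν hy
  exact Submodule.disjoint_def.1 hd _ (sub_eq_zero.2 h) ⟨z, rfl⟩

/-- By duality with chains. The pairing is invariant under `ν`, so `ν(g) - g` pairs to zero with
fixed chains, and, being fixed itself, it pairs to zero with all `ν(z) - z`. These chains span. -/
theorem FrobeniusForm.cochainMap_nakayama_of_range (hν : F.NakayamaDiagonalizable) {n : ℕ}
    {g : Cochain k A n} (h : cochainMap F.nakayama n (cochainMap F.nakayama n g - g) =
      cochainMap F.nakayama n g - g) : cochainMap F.nakayama n g - g = 0 := by
  refine F.pair_injective n (LinearMap.ext fun α => ?_)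
  obtain ⟨y, hy, z, rfl⟩ := F.exists_eigenD_add_chain hν n α
  have hy : chainMap F.nakayama n y = y := F.tau_of_mem_eigenD_one hν hy
  have hy' : chainMap F.nakayama.symm n y = y := by
    exact chainMap_injective F.nakayama n ((chainMap_chainMap_symm F.nakayama n y).trans hy.symm)
  have e (f : Cochain k A n) (z : Chain k A n) : F.pair n (cochainMap F.nakayama n f)
      (chainMap F.nakayama n z) = F.pair n f z := by
    rw [F.pair_cochainMap]
    exact congrArg _ (chainMap_chainMap_symm F.nakayama.symm n z)
  rw [map_add, map_sub (F.pair n _)]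
  conv_lhs => enter [2, 1]; rw [← h]
  rw [e, sub_self, map_sub, LinearMap.sub_apply, F.pair_cochainMap, hy']
  simp

theorem FrobeniusForm.exists_eigenD_add (hν : F.NakayamaDiagonalizable) (r : ℤ) (x : D k A r) :
    ∃ y ∈ F.eigenD 1 r, ∃ z, x = y + (F.tau r z - z) := by
  match r, x with
  | .negSucc p, α => exact F.exists_eigenD_add_chain hν p α
  | .ofNat n, (f : Cochain k A n) =>
    have := FiniteDimensional.of_injective (F.pair n) (F.pair_injective n)
    have hd := (disjoint_ker_range_iff (cochainMap F.nakayama n - LinearMap.id)).1 <| by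
      rw [Submodule.disjoint_def]
      rintro _ hx ⟨g, rfl⟩
      exact F.cochainMap_nakayama_of_range hν (sub_eq_zero.1 hx)
    obtain ⟨y, _, hy, ⟨z, rfl⟩, h⟩ := Submodule.codisjoint_iff_exists_add_eq.1 hd f
    exact ⟨y, F.mem_eigenD_one_cochain (sub_eq_zero.1 (LinearMap.mem_ker.1 hy)), z, h.symm⟩

theorem FrobeniusForm.tau_sub_eq_zero (hν : F.NakayamaDiagonalizable) {r : ℤ} {z : D k A r}
    (h : F.tau r (F.tau r z - z) = F.tau r z - z) : F.tau r z - z = 0 := by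
  match r, z, h with
  | .negSucc p, α, h => exact F.chainMap_nakayama_of_range hν h
  | .ofNat n, f, h => exact F.cochainMap_nakayama_of_range hν h

/-- If a fixed `x` is written as `y + (τ z - z)` with `y` in the subcomplex, then `τ z - z` is fixed
too, hence zero. So the subcomplex is the fixed part of `τ`, and closure under `⋆` follows from
`star_tau`. -/
theorem FrobeniusForm.mem_eigenD_one_iff (hν : F.NakayamaDiagonalizable) {r : ℤ} {x : D k A r} :
    x ∈ F.eigenD 1 r ↔ F.tau r x = x := by
  refine ⟨F.tau_of_mem_eigenD_one hν, fun h => ?_⟩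
  obtain ⟨y, hy, z, rfl⟩ := F.exists_eigenD_add hν r x
  rw [map_add, F.tau_of_mem_eigenD_one hν hy, add_right_inj] at h
  rwa [F.tau_sub_eq_zero hν h, add_zero]

theorem FrobeniusForm.starRestricts_eigenD (hν : F.NakayamaDiagonalizable) :
    F.StarRestricts (F.eigenD 1) := by
  intro r s t h x hx y hy
  rw [F.mem_eigenD_one_iff hν] at hx hy ⊢
  rw [← F.star_tau, hx, hy]

theorem FrobeniusForm.unitD_mem_eigenD : unitD k A ∈ F.eigenD 1 0 := by
  refine F.mem_eigenD_one_cochain (n := 0) (coch_zero_ext (N := Bimod.self k A) ?_)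
  change cochainMap F.nakayama 0 (constN (Bimod.self k A) (1 : A)) _ = constN (Bimod.self k A) (1 : A) _
  rw [cochainMap_bl, constN_bl, constN_bl, map_one]

theorem FrobeniusForm.mem_coboundaries_succ {W : (r : ℤ) → Submodule k (D k A r)} {r : ℤ}
    {x : D k A (r + 1)} : x ∈ F.coboundaries W (r + 1) ↔ ∃ y ∈ W r, F.d r y = x := by
  match r, x with
  | .ofNat n, x => exact Submodule.mem_map
  | .negSucc 0, x => exact Submodule.mem_map
  | .negSucc (p + 1), x => exact Submodule.mem_map

/-- Split a primitive as `y + (τ z - z)` with `y` fixed. If its differential is fixed, then `d(τ z -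
z)` is fixed and lies in the image of `τ - 1`, so it vanishes, and `y` is a primitive inside the
subcomplex. -/
theorem FrobeniusForm.isPure_eigenD (hν : F.NakayamaDiagonalizable) : F.IsPure (F.eigenD 1) := by
  intro r x hx hx'
  obtain ⟨r, rfl⟩ : ∃ s : ℤ, r = s + 1 := ⟨r - 1, by omega⟩
  rw [F.mem_coboundaries_succ] at hx' ⊢
  obtain ⟨y, -, rfl⟩ := hx'
  obtain ⟨y, hy, z, rfl⟩ := F.exists_eigenD_add hν r y
  refine ⟨y, hy, ?_⟩
  rw [F.mem_eigenD_one_iff hν, ← F.d_tau, map_add, F.tau_of_mem_eigenD_one hν hy, map_add, map_add,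
    add_right_inj, map_sub (F.d r), map_sub, map_sub (F.d r)] at hx
  simp only [F.d_tau] at hx
  rw [← map_sub] at hx
  rw [map_add, map_sub, F.d_tau, F.tau_sub_eq_zero hν hx, add_zero]

/-- The component of a cocycle in the image of `τ - 1` is `τ z - z` for a cocycle `z`, and this is a
boundary because `τ` acts trivially on cohomology. The fixed component is the representative sought.
-/
theorem FrobeniusForm.exists_cocycle_eigenD (hν : F.NakayamaDiagonalizable) (r : ℤ) (x : D k A r)
    (hx : F.d r x = 0) : ∃ y ∈ F.cocycles (F.eigenD 1) r, F.Cohomologous y x := by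
  obtain ⟨y, hy, z, rfl⟩ := F.exists_eigenD_add hν r x
  -- A second decomposition replaces `z` by its component in the image of `τ - 1`, without changing
  -- `τ z - z`. On that image `τ - 1` is injective, which is what forces `d z = 0`.
  obtain ⟨y', hy', w, rfl⟩ := F.exists_eigenD_add hν r z
  set z := F.tau r w - w with hz
  have e : F.tau r (y' + z) - (y' + z) = F.tau r z - z := by
    rw [map_add, F.tau_of_mem_eigenD_one hν hy', add_sub_add_left_eq_sub]
  rw [e, map_add, map_sub, F.d_tau] at hx
  rw [e]
  have hdy : F.tau (r + 1) (F.d r y) = F.d r y := by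
    rw [← F.d_tau, F.tau_of_mem_eigenD_one hν hy]
  have hdz : F.tau (r + 1) (F.d r z) - F.d r z = 0 := F.tau_sub_eq_zero hν <| by
    rw [eq_neg_of_add_eq_zero_right hx, map_neg, hdy]
  have hdz' : F.d r z = 0 := by
    rw [hz, map_sub, F.d_tau] at hdz ⊢
    exact F.tau_sub_eq_zero hν (sub_eq_zero.1 hdz)
  rw [hdz, add_zero] at hx
  refine ⟨y, ⟨hx, hy⟩, ?_⟩
  have h := F.tau_cohomologous hdz'
  rw [F.cohomologous_iff] at h ⊢
  rw [sub_add_cancel_left]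
  exact neg_mem h

end Diagonalizable

/-! ### A restricted product forces diagonalizability. -/

section RestrictedProduct

variable {k : Type u} {A : Type v} [Field k] [Ring A] [Algebra k A] [FiniteDimensional k A]
  {F : FrobeniusForm k A}

theorem FrobeniusForm.one_mem_eigen : (1 : A) ∈ F.eigen 1 := by
  rw [Module.End.mem_eigenspace_iff]
  simp

/-- Contraction of the first tensor factor of a `1`-chain, modulo a subspace that contains `1`. -/
noncomputable def FrobeniusForm.contractFirst (F : FrobeniusForm k A) {L : Submodule k A}
    (hL : (1 : A) ∈ L) (y : A) : Chain k A 1 →ₗ[k] A ⧸ L :=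
  TensorProduct.lift <| LinearMap.lsmul k (A ⧸ L) ∘ₗ F.form.flip y |>.compl₂
    (Submodule.mapQ _ L LinearMap.id ((Submodule.span_singleton_le_iff_mem _ _).2 hL) ∘ₗ
      (PiTensorProduct.subsingletonEquiv (R := k) (s := fun _ : Fin 1 => Bar k A) 0).toLinearMap)

omit [FiniteDimensional k A] in
theorem FrobeniusForm.contractFirst_tmul {L : Submodule k A} (hL : (1 : A) ∈ L) (y a : A)
    (b : Fin 1 → A) : F.contractFirst hL y (a ⊗ₜ barTensor k A b) =
      F.form a y • Submodule.Quotient.mk (b 0) := by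
  simp [FrobeniusForm.contractFirst, barTensor]

/-- If `1 ⋆ 1 = ∑ vᵢ ⊗ ūᵢ` lies in the subcomplex, its second factors come from the sum `L` of the
eigenspaces. Contracting the first factor with `y` gives `∑ ⟨vᵢ, y⟩ uᵢ = y`, which is therefore zero
modulo `L`. -/
theorem FrobeniusForm.nakayamaDiagonalizable_of_starRestricts (h : F.StarRestricts (F.eigenD 1)) :
    F.NakayamaDiagonalizable := by
  let L : Submodule k A := ⨆ c : k, F.eigen c
  -- Since `1` is an eigenvector, the map `A → A / L` factors through `Ā`.
  have h1 : (1 : A) ∈ L := Submodule.mem_iSup_of_mem 1 F.one_mem_eigen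
  refine eq_top_iff.2 fun y _ => (Submodule.Quotient.mk_eq_zero L).1 ?_
  let x : Chain k A 0 := (1 : A) ⊗ₜ bl k 0 []
  have hx : (x : D k A (.negSucc 0)) ∈ F.eigenD 1 (.negSucc 0) :=
    Submodule.subset_span (M := Chain k A 0) ⟨1, fun _ => 1, 1, fun i => ([] : List A).getD i 0, by simp,
      F.one_mem_eigen, fun i => i.elim0, rfl⟩
  have hxx : F.chainMul (t := 1) rfl x x ∈ Submodule.span k
      {x | ∃ (e₀ : k) (e : Fin 1 → k) (a₀ : A) (a : Fin 1 → A),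
        e₀ * ∏ i, e i = 1 ∧ a₀ ∈ F.eigen e₀ ∧ (∀ i, a i ∈ F.eigen (e i)) ∧
        x = a₀ ⊗ₜ barTensor k A a} :=
    h (.negSucc 0) (.negSucc 0) (.negSucc 1) rfl x hx x hx
  have h₀ : F.contractFirst h1 y (F.chainMul (t := 1) rfl x x) = 0 := by
    refine LinearMap.eqOn_span (g := 0) ?_ hxx
    rintro _ ⟨e₀, e, a₀, a, -, -, ha, rfl⟩
    have : a 0 ∈ L := Submodule.mem_iSup_of_mem _ (ha 0)
    rw [F.contractFirst_tmul, (Submodule.Quotient.mk_eq_zero L).2 this, smul_zero]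
    rfl
  rw [F.chainMul_eq_mulA, F.mulA_bl (Bimod.self k A) rfl (q := 0) 1 (1 : A) [] [] rfl, map_sum] at h₀
  have e (i) : F.contractFirst h1 y ((F.v i * 1) ⊗ₜ bl k 1 ([] ++ (F.u i * F.nakayama 1) :: [])) =
      Submodule.Quotient.mk (F.form (F.v i) y • F.u i) := by
    rw [bl, F.contractFirst_tmul]
    simp
  have h₁ := (Finset.sum_congr rfl fun i _ => (e i).symm).trans h₀
  rw [← Submodule.mkQ_apply, ← F.sum_form_v_smul_u y, map_sum]
  exact h₁

end RestrictedProduct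
end FrobTate

theorem mainTheorem4 {k : Type*} {A : Type*} [Field k] [Ring A] [Algebra k A]
    [FiniteDimensional k A] (F : FrobTate.FrobeniusForm k A) :
    (F.StarRestricts (F.eigenD 1) →
      ∃ S₁ : FrobTate.GradedCommAlgebra k (F.HH (F.eigenD 1)),
        F.IsStarAlgebra (F.eigenD 1) S₁) ∧
    (F.NakayamaDiagonalizable →
      F.StarRestricts (F.eigenD 1) ∧
      ∃ (S₁ : FrobTate.GradedCommAlgebra k (F.HH (F.eigenD 1)))
        (S : FrobTate.GradedCommAlgebra k (F.HH fun _ => ⊤)),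
        F.IsStarAlgebra (F.eigenD 1) S₁ ∧ F.IsStarAlgebra (fun _ => ⊤) S ∧
        Nonempty (S₁.Iso S)) := by
  have key (hν : F.NakayamaDiagonalizable) := F.isStarAlgebra_starAlgebra (F.isPure_eigenD hν)
    (F.starRestricts_eigenD hν) F.unitD_mem_eigenD
  -- The hypothesis of the first part makes `ν` diagonalizable, so the same algebra structure serves
  -- both parts.
  refine ⟨fun h => ⟨_, key (F.nakayamaDiagonalizable_of_starRestricts h)⟩, fun hν => ?_⟩
  have htop := F.isStarAlgebra_starAlgebra F.isPure_top (fun _ _ _ _ _ _ _ _ => Submodule.mem_top)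
    Submodule.mem_top
  exact ⟨F.starRestricts_eigenD hν, _, _, key hν, htop,
    F.nonempty_iso (F.isPure_eigenD hν) (F.exists_cocycle_eigenD hν) (key hν) htop⟩
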